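/- **Theorem B.** For $n\ge 0$ let $\mathscr C(\mathbb R^n)$ be the Chabauty space of $\mathbb R^n$: the set of closed subgroups, where the neighbourhoods of $\Gamma$ are given by the sets $\{\Gamma' : \Gamma'\cap K\subset\Gamma+U,\ \Gamma\cap K\subset\Gamma'+U\}$ with $K$ compact and $U$ a neighbourhood of $0$. Say that $\Gamma$ has type $(p,q)$ if $\Gamma\cong\mathbb R^p\times\mathbb Z^q$ as a topological group, and let $\mathscr C^{(p,q)}$, $p+q\le n$, be the set of subgroups of type $(p,q)$. *Definitions.* A stratification of a metrizable separable space is a locally finite partition into non-empty locally closed sets (strata) such that a stratum which meets the closure of another one is contained in it; it is a TOP stratification if every stratum is a topological manifold of some dimension and the strata contained in the closure of a stratum $S$, other than $S$, have dimension $<\dim S$. Its dimension is the supremum of the dimensions of the strata ($-\infty$ for the empty space), and its singular codimension is the difference of the largest and the second largest dimension of strata. The open cone $cL=L\times[0,1)/L\times\{0\}$ of a compact stratified space $L$ ($c\varnothing$ is a point) has as strata the apex and the sets $S\times(0,1)$, $S$ a stratum of $L$. Such an $L$ is a link of a point $x\in X$ if, for some open neighbourhood $U$ of $x$ in its stratum,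 there is a homeomorphism of $U\times cL$ onto an open neighbourhood of $x$ in $X$ that matches strata and is the identity on $U\times\{\text{apex}\}=U$. A Goresky–MacPherson stratified space is, recursively, a finite-dimensional TOP stratified space each point of which has a link that is a Goresky–MacPherson stratified space of smaller dimension. It is a pseudo-manifold if, moreover, the union of the strata of maximal dimension is dense and the singular codimension is at least $2$. The join $X\star Y$ is $X\times Y\times[0,1]$ with $(x,y,1)$ identified to $x$ and $(x,y,0)$ to $y$ (and $X\star\varnothing=X$, $\varnothing\star Y=Y$); its strata are $S\times\{1\}$, $T\times\{0\}$, $S\times T\times(0,1)$ for strata $S$ of $X$ and $T$ of $Y$. Let $L^k(0)\subset\mathscr C(\mathbb R^k)$ be the space of closed subgroups whose shortest non-zero vectors exist and have length $1$, stratified by type (the types are $(0,1),\dots,(0,k)$; $L^0(0)=\varnothing$). *Statement.* For all $n$: 1. The partition $(\mathscr C^{(p,q)})_{p+q\le n}$ is a Goresky–MacPherson stratification of $\mathscr C(\mathbb R^n)$, and $\dim\mathscr C^{(p,q)}=(p+q)(n-p)$. 2. The strata $\mathscr C^{(p,q)}$ are the orbits of $\mathrm{GL}(n,\mathbb R)$.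 3. Every $\Gamma$ of type $(p,q)$ has an open neighbourhood isomorphic, as a stratified space, to $\mathbb R^{(n-p)(p+q)}\times cL$, with $(0,\text{apex})$ corresponding to $\Gamma$, where $L$ is a compact Goresky–MacPherson stratified space with a continuous surjection $\pi:L\to L^p(0)\star L^{n-p-q}(0)$ such that the strata of $L$ are the preimages of the strata of the join. Let a stratum of the join be given by the rank $j$ of its first component and the rank $m$ of its second component ($0\le j\le p$, $0\le m\le n-p-q$, $(j,m)\ne(0,0)$, rank $0$ meaning that the component is collapsed). Then its preimage is the stratum of $L$ that corresponds to the type $(r,s)=(p-j,\,q+j+m)$, and over it $\pi$ is a locally trivial bundle whose fibre is the total space of a locally trivial bundle over the torus of dimension $qj=q(p-r)$ with fibre the torus of dimension $m(q+j)=(r+s-p-q)(p+q-r)$. 4. If $n\ge 1$, the singular codimension is $n$; if $n\ge 2$, $\mathscr C(\mathbb R^n)$ with this stratification is a pseudo-manifold. -/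

import Mathlib

open Set Topology
open scoped Pointwise

universe u

/-! ### The Chabauty space of an additive topological group -/

/-- The set of closed subgroups of `G`. -/
def Chabauty (G : Type u) [AddGroup G] [TopologicalSpace G] : Type u := ClosedAddSubgroup G

/-- The underlying subgroup of a point of the Chabauty space. -/
def Chabauty.toSubgroup {G : Type u} [AddGroup G] [TopologicalSpace G] (Γ : Chabauty G) :
    AddSubgroup G := ClosedAddSubgroup.toAddSubgroup Γ

/-- The basic neighbourhood `{Γ' | Γ' ∩ K ⊆ Γ + U and Γ ∩ K ⊆ Γ' + U}` of `Γ`. -/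
def chabautyNhd {G : Type u} [AddGroup G] [TopologicalSpace G] (K U : Set G) (Γ : Chabauty G) :
    Set (Chabauty G) :=
  {Γ' | (Γ'.toSubgroup : Set G) ∩ K ⊆ (Γ.toSubgroup : Set G) + U ∧
    (Γ.toSubgroup : Set G) ∩ K ⊆ (Γ'.toSubgroup : Set G) + U}

theorem chabautyNhd_mono {G : Type u} [AddGroup G] [TopologicalSpace G] {K K' U U' : Set G}
    (hK : K ⊆ K') (hU : U' ⊆ U) (Γ : Chabauty G) : chabautyNhd K' U' Γ ⊆ chabautyNhd K U Γ :=
  fun _ h => ⟨fun _ hx => Set.add_subset_add_left hU (h.1 ⟨hx.1, hK hx.2⟩),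
    fun _ hx => Set.add_subset_add_left hU (h.2 ⟨hx.1, hK hx.2⟩)⟩

/-- The Chabauty topology: a set is open if with each of its points `Γ` it contains some
`chabautyNhd K U Γ` with `K` compact and `U` a neighbourhood of `0`. -/
instance {G : Type u} [AddGroup G] [TopologicalSpace G] : TopologicalSpace (Chabauty G) where
  IsOpen O := ∀ Γ ∈ O, ∃ K : Set G, IsCompact K ∧ ∃ U ∈ 𝓝 (0 : G), chabautyNhd K U Γ ⊆ O
  isOpen_univ := fun _ _ => ⟨∅, isCompact_empty, Set.univ, Filter.univ_mem, Set.subset_univ _⟩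
  isOpen_inter := by
    rintro O₁ O₂ h₁ h₂ Γ ⟨hΓ₁, hΓ₂⟩
    obtain ⟨K₁, hK₁, U₁, hU₁, hs₁⟩ := h₁ Γ hΓ₁
    obtain ⟨K₂, hK₂, U₂, hU₂, hs₂⟩ := h₂ Γ hΓ₂
    exact ⟨K₁ ∪ K₂, hK₁.union hK₂, U₁ ∩ U₂, Filter.inter_mem hU₁ hU₂, Set.subset_inter
      ((chabautyNhd_mono Set.subset_union_left Set.inter_subset_left Γ).trans hs₁)
      ((chabautyNhd_mono Set.subset_union_right Set.inter_subset_right Γ).trans hs₂)⟩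
  isOpen_sUnion := by
    rintro s h Γ ⟨O, hO, hΓ⟩
    obtain ⟨K, hK, U, hU, hs⟩ := h O hO Γ hΓ
    exact ⟨K, hK, U, hU, hs.trans (Set.subset_sUnion_of_mem hO)⟩

/-- The Chabauty space of Euclidean space `ℝⁿ`. -/
abbrev ChabautyR (n : ℕ) : Type := Chabauty (EuclideanSpace ℝ (Fin n))

/-- The set of closed subgroups of `ℝⁿ` of type `(p, q)`: those isomorphic, as topological groups,
to `ℝ^p × ℤ^q`. -/
def typeStratum (n p q : ℕ) : Set (ChabautyR n) :=
  {Γ | Nonempty (Γ.toSubgroup ≃ₜ+ ((Fin p → ℝ) × (Fin q → ℤ)))}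

/-- The possible types `(p, q)` of closed subgroups of `ℝⁿ`. -/
abbrev TypeIndex (n : ℕ) : Type := {t : ℕ × ℕ // t.1 + t.2 ≤ n}

/-- The partition of the Chabauty space of `ℝⁿ` by type. -/
def typeStrata (n : ℕ) (t : TypeIndex n) : Set (ChabautyR n) := typeStratum n t.1.1 t.1.2

/-- The dimension `(p + q)(n - p)` attached to the type `(p, q)`; here `p ≤ n`. -/
def typeDim (n : ℕ) (t : TypeIndex n) : ℕ := (t.1.1 + t.1.2) * (n - t.1.1)

/-! ### Stratifications -/

/-- A stratification: a locally finite partition of a metrizable separable space into (non-empty)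
locally closed subsets that satisfies the frontier condition. -/
structure IsStratification {X : Type*} [TopologicalSpace X] {ι : Type*} (A : ι → Set X) :
    Prop where
  metrizable : TopologicalSpace.MetrizableSpace X
  separable : TopologicalSpace.SeparableSpace X
  nonempty : ∀ s, (A s).Nonempty
  disjoint : Pairwise fun s t => Disjoint (A s) (A t)
  cover : ⋃ s, A s = Set.univ
  locallyFinite : LocallyFinite A
  locallyClosed : ∀ s, IsLocallyClosed (A s)
  frontier : ∀ s t, (A t ∩ closure (A s)).Nonempty → A t ⊆ closure (A s)

/-- A TOP stratification with dimension function `dim`: the stratum `A s` is a topological manifold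
of dimension `dim s`, and a stratum in the closure of another one has smaller dimension. -/
structure IsTopStratification {X : Type*} [TopologicalSpace X] {ι : Type*} (A : ι → Set X)
    (dim : ι → ℕ) : Prop extends IsStratification A where
  manifold : ∀ s, Nonempty (ChartedSpace (EuclideanSpace ℝ (Fin (dim s))) (A s))
  dim_lt : ∀ s t, s ≠ t → A t ⊆ closure (A s) → dim t < dim s

/-- The dimension of a stratification: the supremum of the dimensions of its strata
(`⊥` for the empty space). -/
noncomputable def stratDim {ι : Type*} (dim : ι → ℕ) : WithBot ℕ∞ :=
  ⨆ s, ((dim s : ℕ∞) : WithBot ℕ∞)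

/-- The singular codimension is `c`: the difference of the largest and of the second largest
dimension of the strata is `c`. -/
def HasSingularCodim {ι : Type*} (dim : ι → ℕ) (c : ℕ) : Prop :=
  ∃ d d' : ℕ, IsGreatest (Set.range dim) d ∧ IsGreatest {k | k ∈ Set.range dim ∧ k < d} d' ∧
    d = d' + c

/-! ### Open cones -/

/-- Gluing relation of the open cone: `(l, 0)` is identified with the apex. -/
inductive ConeRel (L : Type u) : Unit ⊕ (L × Set.Ico (0 : ℝ) 1) → Unit ⊕ (L × Set.Ico (0 : ℝ) 1) →
    Prop
  | glue (l : L) : ConeRel L (Sum.inr (l, ⟨0, by norm_num⟩)) (Sum.inl ())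

/-- The open cone `cL = L × [0, 1) / L × {0}`; the cone on the empty space is a point. -/
def OpenCone (L : Type u) : Type u := Quot (ConeRel L)

instance {L : Type u} [TopologicalSpace L] : TopologicalSpace (OpenCone L) :=
  inferInstanceAs (TopologicalSpace (Quot (ConeRel L)))

/-- The apex of the open cone. -/
def OpenCone.apex {L : Type u} : OpenCone L := Quot.mk _ (Sum.inl ())

/-- The point of the open cone with coordinates `(l, t)`. -/
def OpenCone.mk {L : Type u} (l : L) (t : Set.Ico (0 : ℝ) 1) : OpenCone L :=
  Quot.mk _ (Sum.inr (l, t))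

/-- The strata of the open cone: the apex and the products `B j × (0, 1)`. -/
def coneStrata {L : Type*} {κ : Type*} (B : κ → Set L) : Option κ → Set (OpenCone L)
  | none => {OpenCone.apex}
  | some j => {z | ∃ l ∈ B j, ∃ t : Set.Ico (0 : ℝ) 1, 0 < t.1 ∧ z = OpenCone.mk l t}

/-! ### Goresky–MacPherson stratifications and pseudo-manifolds -/

/-- The compact space `L` with stratification `B` is a link of the point `x` of the stratified
space `(X, A)`: for some open neighbourhood `U` of `x` in its stratum there is an isomorphism `f`
of `U × cL` onto an open neighbourhood of `x` in `X` that is the identity on `U × {apex}`. -/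
def IsLink {X : Type*} [TopologicalSpace X] {ι : Type*} (A : ι → Set X) (x : X)
    {L : Type*} [TopologicalSpace L] {κ : Type*} (B : κ → Set L) : Prop :=
  CompactSpace L ∧ IsStratification B ∧
  ∃ (s : ι) (U : Set X), x ∈ U ∧ (∃ O : Set X, IsOpen O ∧ U = O ∩ A s) ∧
    ∃ f : U × OpenCone L → X, IsOpenEmbedding f ∧ (∀ u : U, f (u, OpenCone.apex) = u) ∧
      ∀ t, (f ⁻¹' A t).Nonempty → ∃ j, f ⁻¹' A t = Set.univ ×ˢ coneStrata B j

/-- Goresky–MacPherson stratified spaces (with dimension function `dim` on the strata), defined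
recursively: finite-dimensional, locally cone-like TOP stratified spaces all of whose points admit
links that are Goresky–MacPherson stratified spaces of smaller dimension. -/
inductive IsGoreskyMacPherson : ∀ {X : Type u} [TopologicalSpace X] {ι : Type u},
    (ι → Set X) → (ι → ℕ) → Prop
  | intro {X : Type u} [TopologicalSpace X] {ι : Type u} {A : ι → Set X} {dim : ι → ℕ}
      (top : IsTopStratification A dim) (finite : stratDim dim < ⊤)
      (L : X → Type u) [∀ x, TopologicalSpace (L x)] (κ : X → Type u)
      (B : ∀ x, κ x → Set (L x)) (dimB : ∀ x, κ x → ℕ)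
      (link : ∀ x, IsLink A x (B x))
      (lt : ∀ x, stratDim (dimB x) < stratDim dim)
      (gm : ∀ x, IsGoreskyMacPherson (B x) (dimB x)) :
      IsGoreskyMacPherson A dim

/-- Pseudo-manifolds: Goresky–MacPherson stratified spaces whose strata of maximal dimension have
dense union and whose singular codimension is at least two (a requirement that is void if all
strata have the same dimension). -/
structure IsPseudoManifold {X : Type u} [TopologicalSpace X] {ι : Type u} (A : ι → Set X)
    (dim : ι → ℕ) : Prop where
  gm : IsGoreskyMacPherson A dim
  dense : Dense (⋃ s ∈ {s | ∀ t, dim t ≤ dim s}, A s)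
  codim : ∀ c, HasSingularCodim dim c → 2 ≤ c

/-! ### Joins -/

/-- Gluing relation of the join: `(x, y, 1)` is identified with `x`, and `(x, y, 0)` with `y`. -/
inductive JoinRel (X Y : Type u) :
    (X ⊕ Y) ⊕ (X × Y × unitInterval) → (X ⊕ Y) ⊕ (X × Y × unitInterval) → Prop
  | left (x : X) (y : Y) : JoinRel X Y (Sum.inr (x, y, 1)) (Sum.inl (Sum.inl x))
  | right (x : X) (y : Y) : JoinRel X Y (Sum.inr (x, y, 0)) (Sum.inl (Sum.inr y))

/-- The join `X ⋆ Y`; the join with the empty space is the other space. -/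
def TopJoin (X Y : Type u) : Type u := Quot (JoinRel X Y)

instance {X Y : Type u} [TopologicalSpace X] [TopologicalSpace Y] :
    TopologicalSpace (TopJoin X Y) :=
  inferInstanceAs (TopologicalSpace (Quot (JoinRel X Y)))

/-- The strata of the join: `A s × {1}`, `B t × {0}` and `A s × B t × (0, 1)`. -/
def joinStrata {X Y : Type u} {ι κ : Type*} (A : ι → Set X) (B : κ → Set Y) :
    ι ⊕ κ ⊕ (ι × κ) → Set (TopJoin X Y)
  | Sum.inl s => {z | ∃ x ∈ A s, z = Quot.mk _ (Sum.inl (Sum.inl x))}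
  | Sum.inr (Sum.inl t) => {z | ∃ y ∈ B t, z = Quot.mk _ (Sum.inl (Sum.inr y))}
  | Sum.inr (Sum.inr (s, t)) => {z | ∃ x ∈ A s, ∃ y ∈ B t, ∃ m : unitInterval,
      0 < m ∧ m < 1 ∧ z = Quot.mk _ (Sum.inr (x, y, m))}

/-! ### Links of the trivial subgroup, and torus fibrations -/

/-- The link `L^k(0)` of the trivial subgroup of `ℝᵏ`: the space of closed subgroups of first norm
one, that is, whose shortest non-zero vectors exist and have length one. -/
abbrev ZeroLink (k : ℕ) : Type :=
  {Γ : ChabautyR k // IsLeast {r : ℝ | ∃ v ∈ Γ.toSubgroup, v ≠ 0 ∧ r = ‖v‖} 1}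

/-- The stratification of `L^k(0)` by type; the types that occur are `(0, 1), …, (0, k)`. -/
def zeroLinkStrata (k : ℕ) (i : Fin k) : Set (ZeroLink k) :=
  {Γ | Γ.1 ∈ typeStratum k 0 (i + 1)}

/-- The index set of the strata of `L^a(0) ⋆ L^b(0)`. -/
abbrev JoinIndex (a b : ℕ) : Type := Fin a ⊕ Fin b ⊕ (Fin a × Fin b)

/-- Rank of the first component over a stratum of `L^a(0) ⋆ L^b(0)`
(zero where that component is collapsed). -/
def JoinIndex.fstRank {a b : ℕ} : JoinIndex a b → ℕ
  | Sum.inl i => i + 1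
  | Sum.inr (Sum.inl _) => 0
  | Sum.inr (Sum.inr (i, _)) => i + 1

/-- Rank of the second component over a stratum of `L^a(0) ⋆ L^b(0)`
(zero where that component is collapsed). -/
def JoinIndex.sndRank {a b : ℕ} : JoinIndex a b → ℕ
  | Sum.inl _ => 0
  | Sum.inr (Sum.inl i) => i + 1
  | Sum.inr (Sum.inr (_, i)) => i + 1

/-- The torus `(ℝ/ℤ)^d`. -/
abbrev Torus (d : ℕ) : Type := Fin d → UnitAddCircle

/-- `proj` is a locally trivial fibre bundle with fibre `F`. -/
def IsLocallyTrivialBundle (F : Type*) [TopologicalSpace F] {E B : Type*} [TopologicalSpace E]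
    [TopologicalSpace B] (proj : E → B) : Prop :=
  ∀ b : B, ∃ e : Bundle.Trivialization F proj, b ∈ e.baseSet

/-- `F` is the total space of a locally trivial bundle over the torus of dimension `a` with fibre
the torus of dimension `b`. -/
def IsTorusBundleOverTorus (F : Type*) [TopologicalSpace F] (a b : ℕ) : Prop :=
  ∃ ρ : F → Torus a, IsLocallyTrivialBundle (Torus b) ρ

open Filter

/-! ### Closed subgroups: membership and the basic neighbourhoods -/

/-- Euclidean space of dimension `n`. -/
abbrev Euc (n : ℕ) : Type := EuclideanSpace ℝ (Fin n)

namespace Chabauty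

instance {G : Type u} [AddGroup G] [TopologicalSpace G] : SetLike (Chabauty G) G where
  coe Γ := Γ.toSubgroup
  coe_injective := by
    rintro ⟨Γ, h⟩ ⟨Γ', h'⟩ hh
    have : Γ = Γ' := SetLike.coe_injective hh
    subst this
    rfl

instance {G : Type u} [AddGroup G] [TopologicalSpace G] : AddSubgroupClass (Chabauty G) G where
  add_mem {Γ} _ _ h h' := Γ.toSubgroup.add_mem h h'
  zero_mem Γ := Γ.toSubgroup.zero_mem
  neg_mem {Γ} _ h := Γ.toSubgroup.neg_mem h

section
variable {G : Type u} [AddGroup G] [TopologicalSpace G]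

@[ext] theorem ext {Γ Γ' : Chabauty G} (h : ∀ x, x ∈ Γ ↔ x ∈ Γ') : Γ = Γ' := SetLike.ext h

theorem isClosed (Γ : Chabauty G) : IsClosed (Γ : Set G) := ClosedAddSubgroup.isClosed' Γ

/-- A closed subgroup as a point of the Chabauty space. -/
def ofClosed (S : AddSubgroup G) (h : IsClosed (S : Set G)) : Chabauty G := ⟨S, h⟩

end

variable {n : ℕ}

theorem mem_chabautyNhd {K U : Set (Euc n)} {Γ Γ' : ChabautyR n} :
    Γ' ∈ chabautyNhd K U Γ ↔ (∀ x ∈ Γ', x ∈ K → ∃ y ∈ Γ, x - y ∈ U) ∧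
      (∀ x ∈ Γ, x ∈ K → ∃ y ∈ Γ', x - y ∈ U) := by
  have key : ∀ A B : ChabautyR n, ((A : Set (Euc n)) ∩ K ⊆ (B : Set (Euc n)) + U ↔
      ∀ x ∈ A, x ∈ K → ∃ y ∈ B, x - y ∈ U) := by
    intro A B
    constructor
    · intro h x hx hK
      obtain ⟨y, hy, u, hu, rfl⟩ := h ⟨hx, hK⟩
      exact ⟨y, hy, by simpa using hu⟩
    · rintro h x ⟨hx, hK⟩
      obtain ⟨y, hy, hu⟩ := h x hx hK
      exact ⟨y, hy, _, hu, by simp⟩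
  exact and_congr (key _ _) (key _ _)

/-- The neighbourhood of `Γ` attached to the closed ball of radius `R` and the `ε`-ball. -/
theorem mem_chabautyNhd_ball {R ε : ℝ} {Γ Γ' : ChabautyR n} :
    Γ' ∈ chabautyNhd (Metric.closedBall 0 R) (Metric.ball 0 ε) Γ ↔
      (∀ x ∈ Γ', ‖x‖ ≤ R → ∃ y ∈ Γ, ‖x - y‖ < ε) ∧
      (∀ x ∈ Γ, ‖x‖ ≤ R → ∃ y ∈ Γ', ‖x - y‖ < ε) := by
  simp [mem_chabautyNhd]

theorem chabautyNhd_mem_nhds (Γ : ChabautyR n) (R : ℝ) {ε : ℝ} (hε : 0 < ε) :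
    chabautyNhd (Metric.closedBall 0 R) (Metric.ball 0 ε) Γ ∈ 𝓝 Γ := by
  classical
  rw [mem_nhds_iff]
  refine ⟨{Γ' | ∃ R' : ℝ, ∃ ε' > 0,
    chabautyNhd (Metric.closedBall 0 R') (Metric.ball 0 ε') Γ' ⊆
      chabautyNhd (Metric.closedBall 0 R) (Metric.ball 0 ε) Γ}, ?_, ?_, R, ε, hε, subset_rfl⟩
  · rintro Γ' ⟨R', ε', hε', h⟩
    apply h
    rw [mem_chabautyNhd_ball]
    exact ⟨fun x hx _ => ⟨x, hx, by simpa⟩, fun x hx _ => ⟨x, hx, by simpa⟩⟩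
  · rintro Γ₁ ⟨R', ε', hε', h⟩
    have hm : 0 < min (ε' / 2) 1 := by positivity
    refine ⟨Metric.closedBall 0 (R' + 1), isCompact_closedBall _ _, Metric.ball 0 (min (ε' / 2) 1),
      Metric.ball_mem_nhds _ hm, ?_⟩
    intro Γ₂ h₂
    refine ⟨R' + 1, min (ε' / 2) 1, hm, fun Γ₃ h₃ => h ?_⟩
    rw [mem_chabautyNhd_ball] at h₂ h₃ ⊢
    constructor
    · intro x hx hxR
      obtain ⟨y, hy, hxy⟩ := h₃.1 x hx (by linarith)
      have hy' : ‖y‖ ≤ R' + 1 := by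
        have := norm_sub_norm_le y x
        rw [norm_sub_rev] at this
        linarith [min_le_right (ε' / 2) 1]
      obtain ⟨z, hz, hyz⟩ := h₂.1 y hy hy'
      refine ⟨z, hz, ?_⟩
      have := norm_sub_le_norm_sub_add_norm_sub x y z
      linarith [min_le_left (ε' / 2) 1]
    · intro x hx hxR
      obtain ⟨y, hy, hxy⟩ := h₂.2 x hx (by linarith)
      have hy' : ‖y‖ ≤ R' + 1 := by
        have := norm_sub_norm_le y x
        rw [norm_sub_rev] at this
        linarith [min_le_right (ε' / 2) 1]
      obtain ⟨z, hz, hyz⟩ := h₃.2 y hy hy'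
      refine ⟨z, hz, ?_⟩
      have := norm_sub_le_norm_sub_add_norm_sub x y z
      linarith [min_le_left (ε' / 2) 1]

/-- Convergence in the Chabauty space: points of the limit are approximated, and points outside
of the limit are eventually avoided. -/
theorem tendsto_iff {ι : Type*} {l : Filter ι} {f : ι → ChabautyR n} {Γ : ChabautyR n} :
    Tendsto f l (𝓝 Γ) ↔ (∀ x ∈ Γ, ∀ ε > 0, ∀ᶠ i in l, ∃ y ∈ f i, ‖y - x‖ < ε) ∧
      (∀ x ∉ Γ, ∃ ε > 0, ∀ᶠ i in l, ∀ y ∈ f i, ε ≤ ‖y - x‖) := by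
  constructor
  · intro h
    constructor
    · intro x hx ε hε
      filter_upwards [h (chabautyNhd_mem_nhds Γ ‖x‖ hε)] with i hi
      obtain ⟨y, hy, hxy⟩ := (mem_chabautyNhd_ball.1 hi).2 x hx le_rfl
      exact ⟨y, hy, by rwa [norm_sub_rev]⟩
    · intro x hx
      obtain ⟨ε, hε, hb⟩ := Metric.isOpen_iff.1 Γ.isClosed.isOpen_compl x hx
      refine ⟨ε / 2, by positivity, ?_⟩
      filter_upwards [h (chabautyNhd_mem_nhds Γ (‖x‖ + ε) (half_pos hε))] with i hi y hy
      by_contra! hlt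
      have hyn : ‖y‖ ≤ ‖x‖ + ε := by
        have := norm_sub_norm_le y x
        linarith
      obtain ⟨z, hz, hyz⟩ := (mem_chabautyNhd_ball.1 hi).1 y hy hyn
      refine hb (a := z) ?_ hz
      rw [Metric.mem_ball, dist_eq_norm]
      have := norm_sub_le_norm_sub_add_norm_sub z y x
      rw [norm_sub_rev z y] at this
      linarith
  · rintro ⟨ha, hb⟩
    rw [tendsto_nhds]
    intro O hO hΓ
    obtain ⟨K, hK, U, hU, hs⟩ := hO Γ hΓ
    obtain ⟨ε, hε, hεU⟩ := Metric.mem_nhds_iff.1 hU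
    have h₁ : ∀ᶠ i in l, ∀ x ∈ f i, x ∈ K → ∃ y ∈ Γ, x - y ∈ U := by
      refine hK.induction_on (p := fun S => ∀ᶠ i in l, ∀ x ∈ f i, x ∈ S → ∃ y ∈ Γ, x - y ∈ U)
        (by simp) (fun s t hst ht => ?_) (fun s t hs ht => ?_) (fun x _ => ?_)
      · filter_upwards [ht] with i hi x hx hxs using hi x hx (hst hxs)
      · filter_upwards [hs, ht] with i hi hi' x hx hxs
        exact hxs.elim (hi x hx) (hi' x hx)
      · by_cases hx : x ∈ Γ
        · refine ⟨Metric.ball x ε, mem_nhdsWithin_of_mem_nhds (Metric.ball_mem_nhds _ hε),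
            .of_forall fun i y _ hyx => ⟨x, hx, hεU ?_⟩⟩
          simpa [dist_eq_norm] using hyx
        · obtain ⟨δ, hδ, h⟩ := hb x hx
          refine ⟨Metric.ball x δ, mem_nhdsWithin_of_mem_nhds (Metric.ball_mem_nhds _ hδ), ?_⟩
          filter_upwards [h] with i hi y hy hyx
          rw [Metric.mem_ball, dist_eq_norm] at hyx
          exact absurd (hi y hy) (not_le.2 hyx)
    have h₂ : ∀ᶠ i in l, ∀ x ∈ Γ, x ∈ K → ∃ y ∈ f i, x - y ∈ U := by
      refine hK.induction_on (p := fun S => ∀ᶠ i in l, ∀ x ∈ Γ, x ∈ S → ∃ y ∈ f i, x - y ∈ U)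
        (by simp) (fun s t hst ht => ?_) (fun s t hs ht => ?_) (fun x _ => ?_)
      · filter_upwards [ht] with i hi x hx hxs using hi x hx (hst hxs)
      · filter_upwards [hs, ht] with i hi hi' x hx hxs
        exact hxs.elim (hi x hx) (hi' x hx)
      · by_cases hx : x ∈ Γ
        · refine ⟨Metric.ball x (ε / 2),
            mem_nhdsWithin_of_mem_nhds (Metric.ball_mem_nhds _ (half_pos hε)), ?_⟩
          filter_upwards [ha x hx (ε / 2) (half_pos hε)] with i hi y hy hyx
          obtain ⟨z, hz, hzx⟩ := hi
          refine ⟨z, hz, hεU ?_⟩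
          rw [Metric.mem_ball, dist_eq_norm] at hyx
          rw [mem_ball_zero_iff]
          have := norm_sub_le_norm_sub_add_norm_sub y x z
          rw [norm_sub_rev x z] at this
          linarith
        · exact ⟨(Γ : Set (Euc n))ᶜ, mem_nhdsWithin_of_mem_nhds (Γ.isClosed.isOpen_compl.mem_nhds hx),
            .of_forall fun i y hy hyx => absurd hy hyx⟩
    filter_upwards [h₁, h₂] with i hi hi'
    exact hs (mem_chabautyNhd.2 ⟨hi, hi'⟩)

/-- A nearest point of a closed subgroup. -/
theorem exists_nearest (Γ : ChabautyR n) (x : Euc n) :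
    ∃ y ∈ Γ, ∀ z ∈ Γ, ‖y - x‖ ≤ ‖z - x‖ := by
  obtain ⟨y, hy, h⟩ := Γ.isClosed.exists_infDist_eq_dist ⟨0, zero_mem Γ⟩ x
  refine ⟨y, hy, fun z hz => ?_⟩
  rw [← dist_eq_norm, ← dist_eq_norm, dist_comm, ← h, dist_comm]
  exact Metric.infDist_le_dist_of_mem hz

theorem exists_tendsto {ι : Type*} {l : Filter ι} {f : ι → ChabautyR n} {Γ : ChabautyR n}
    (h : Tendsto f l (𝓝 Γ)) {x : Euc n} (hx : x ∈ Γ) :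
    ∃ y : ι → Euc n, (∀ i, y i ∈ f i) ∧ Tendsto y l (𝓝 x) := by
  choose y hy hyx using fun i => exists_nearest (f i) x
  refine ⟨y, hy, Metric.tendsto_nhds.2 fun ε hε => ?_⟩
  filter_upwards [(tendsto_iff.1 h).1 x hx ε hε] with i ⟨z, hz, hzx⟩
  rw [dist_eq_norm]
  exact (hyx i z hz).trans_lt hzx

theorem mem_of_tendsto {ι : Type*} {l : Filter ι} [l.NeBot] {f : ι → ChabautyR n}
    {Γ : ChabautyR n} (h : Tendsto f l (𝓝 Γ)) {y : ι → Euc n} {x : Euc n}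
    (hy : ∀ᶠ i in l, y i ∈ f i) (hyx : Tendsto y l (𝓝 x)) : x ∈ Γ := by
  by_contra hx
  obtain ⟨ε, hε, hm⟩ := (tendsto_iff.1 h).2 x hx
  obtain ⟨i, h₁, h₂, h₃⟩ := (hy.and (hm.and (Metric.tendsto_nhds.1 hyx ε hε))).exists
  rw [dist_eq_norm] at h₃
  exact absurd (h₂ _ h₁) (not_le.2 h₃)

theorem exists_tendsto_of_forall_frequently {ι : Type*} {u : Ultrafilter ι} {f : ι → ChabautyR n}
    {x : Euc n} (h : ∀ ε > 0, ∀ᶠ i in (u : Filter ι), ∃ y ∈ f i, ‖y - x‖ < ε) :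
    ∃ y : ι → Euc n, (∀ i, y i ∈ f i) ∧ Tendsto y u (𝓝 x) := by
  choose y hy hyx using fun i => exists_nearest (f i) x
  refine ⟨y, hy, Metric.tendsto_nhds.2 fun ε hε => ?_⟩
  filter_upwards [h ε hε] with i ⟨z, hz, hzx⟩
  rw [dist_eq_norm]
  exact (hyx i z hz).trans_lt hzx

theorem tendsto_of_ultrafilter {ι : Type*} {u : Ultrafilter ι} {f : ι → ChabautyR n}
    {Γ : ChabautyR n}
    (ha : ∀ x ∈ Γ, ∃ y : ι → Euc n, (∀ᶠ i in (u : Filter ι), y i ∈ f i) ∧ Tendsto y u (𝓝 x))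
    (hb : ∀ (y : ι → Euc n) x, (∀ i, y i ∈ f i) → Tendsto y u (𝓝 x) → x ∈ Γ) :
    Tendsto f u (𝓝 Γ) := by
  refine tendsto_iff.2 ⟨fun x hx ε hε => ?_, fun x hx => ?_⟩
  · obtain ⟨y, hy, hyx⟩ := ha x hx
    filter_upwards [hy, Metric.tendsto_nhds.1 hyx ε hε] with i hi hi'
    exact ⟨y i, hi, by rwa [← dist_eq_norm]⟩
  · by_contra! hcon
    apply hx
    obtain ⟨y, hy, hyx⟩ := exists_tendsto_of_forall_frequently (u := u) (f := f) (x := x) hcon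
    exact hb y x hy hyx

theorem exists_ultrafilter_limit {ι : Type*} (u : Ultrafilter ι) (f : ι → ChabautyR n) :
    ∃ Γ, Tendsto f u (𝓝 Γ) := by
  let S : AddSubgroup (Euc n) :=
    { carrier := {x | ∃ y : ι → Euc n, (∀ i, y i ∈ f i) ∧ Tendsto y u (𝓝 x)}
      add_mem' := by
        rintro a b ⟨y, hy, hya⟩ ⟨z, hz, hzb⟩
        exact ⟨y + z, fun i => add_mem (hy i) (hz i), hya.add hzb⟩
      zero_mem' := ⟨0, fun i => zero_mem _, tendsto_const_nhds⟩
      neg_mem' := by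
        rintro a ⟨y, hy, hya⟩
        exact ⟨-y, fun i => neg_mem (hy i), hya.neg⟩ }
  have hS : IsClosed (S : Set (Euc n)) := by
    rw [← closure_subset_iff_isClosed]
    intro x hx
    refine exists_tendsto_of_forall_frequently fun ε hε => ?_
    obtain ⟨z, ⟨y, hy, hyz⟩, hzx⟩ := Metric.mem_closure_iff.1 hx (ε / 2) (half_pos hε)
    filter_upwards [Metric.tendsto_nhds.1 hyz (ε / 2) (half_pos hε)] with i hi
    refine ⟨y i, hy i, ?_⟩
    rw [← dist_eq_norm]
    have := dist_triangle (y i) z x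
    rw [dist_comm z x] at this
    linarith
  exact ⟨ofClosed S hS, tendsto_of_ultrafilter
    (fun x ⟨y, hy, hyx⟩ => ⟨y, .of_forall hy, hyx⟩) (fun y x hy hyx => ⟨y, hy, hyx⟩)⟩

instance : CompactSpace (ChabautyR n) := by
  rw [← isCompact_univ_iff, isCompact_iff_ultrafilter_le_nhds]
  intro u _
  obtain ⟨Γ, hΓ⟩ := exists_ultrafilter_limit u id
  exact ⟨Γ, mem_univ _, hΓ⟩

instance : T2Space (ChabautyR n) := by
  rw [t2_iff_ultrafilter]
  intro Γ Γ' u h h'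
  have key : ∀ {A B : ChabautyR n}, (u : Filter _) ≤ 𝓝 A → (u : Filter _) ≤ 𝓝 B → ∀ x ∈ A, x ∈ B := by
    intro A B hA hB x hx
    obtain ⟨y, hy, hyx⟩ := exists_tendsto (f := id) hA hx
    exact mem_of_tendsto (f := id) hB (.of_forall hy) hyx
  exact ext fun x => ⟨key h h' x, key h' h x⟩

/-- The sets of closed subgroups that meet the ball of centre `x` and radius `ε`. -/
theorem isOpen_hit (x : Euc n) (ε : ℝ) : IsOpen {Γ : ChabautyR n | ∃ y ∈ Γ, ‖y - x‖ < ε} := by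
  rw [isOpen_iff_ultrafilter]
  rintro Γ ⟨y, hy, hyx⟩ u hu
  obtain ⟨z, hz, hzy⟩ := exists_tendsto (f := id) hu hy
  have : ∀ᶠ i in (u : Filter _), ‖z i - x‖ < ε :=
    (hzy.sub_const x).norm.eventually (gt_mem_nhds hyx)
  filter_upwards [this] with i hi using ⟨z i, hz i, hi⟩

/-- The sets of closed subgroups that avoid the closed ball of centre `x` and radius `ε`. -/
theorem isOpen_miss (x : Euc n) (ε : ℝ) : IsOpen {Γ : ChabautyR n | ∀ y ∈ Γ, ε < ‖y - x‖} := by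
  rw [isOpen_iff_ultrafilter]
  rintro Γ hΓ u hu
  by_contra hcon
  have hcon : ∀ᶠ Γ' : ChabautyR n in (u : Filter _), ¬ ∀ y ∈ Γ', ε < ‖y - x‖ :=
    Ultrafilter.eventually_not.2 hcon
  choose z hz hzx using fun Γ' : ChabautyR n => exists_nearest Γ' x
  have hb : ∀ᶠ Γ' : ChabautyR n in (u : Filter _), z Γ' ∈ Metric.closedBall x ε := by
    filter_upwards [hcon] with Γ' h
    push Not at h
    obtain ⟨y, hy, hyx⟩ := h
    rw [Metric.mem_closedBall, dist_eq_norm]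
    exact (hzx Γ' y hy).trans hyx
  obtain ⟨a, ha, hza⟩ := (isCompact_closedBall x ε).ultrafilter_le_nhds (u.map z)
    (le_principal_iff.2 hb)
  have := mem_of_tendsto (f := id) hu (.of_forall hz) hza
  have h2 := hΓ a this
  rw [Metric.mem_closedBall, dist_eq_norm] at ha
  linarith

instance : SecondCountableTopology (ChabautyR n) := by
  obtain ⟨D, hDc, hD⟩ := TopologicalSpace.exists_countable_dense (Euc n)
  let B : Set (Set (ChabautyR n)) :=
    (fun t : Euc n × ℚ => {Γ : ChabautyR n | ∃ y ∈ Γ, ‖y - t.1‖ < t.2}) '' (D ×ˢ univ) ∪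
    (fun t : Euc n × ℚ => {Γ : ChabautyR n | ∀ y ∈ Γ, t.2 < ‖y - t.1‖}) '' (D ×ˢ univ)
  have hB : B.Countable :=
    ((hDc.prod countable_univ).image _).union ((hDc.prod countable_univ).image _)
  refine ⟨B, hB, le_antisymm ?_ ?_⟩
  · refine le_generateFrom ?_
    rintro _ (⟨t, -, rfl⟩ | ⟨t, -, rfl⟩)
    · exact isOpen_hit _ _
    · exact isOpen_miss _ _
  · rw [← continuous_id_iff_le]
    rw [@continuous_iff_continuousAt _ _ (TopologicalSpace.generateFrom B)]
    intro Γ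
    let T := TopologicalSpace.generateFrom B
    refine tendsto_iff.2 ⟨fun x hx ε hε => ?_, fun x hx => ?_⟩
    · obtain ⟨r, hr0, hr⟩ := exists_rat_btwn (half_pos hε)
      obtain ⟨d, hd, hxd⟩ := Metric.mem_closure_iff.1 (hD x) r hr0
      have hO : IsOpen[T] {Γ : ChabautyR n | ∃ y ∈ Γ, ‖y - d‖ < (r : ℝ)} :=
        TopologicalSpace.isOpen_generateFrom_of_mem (.inl ⟨(d, r), ⟨hd, mem_univ _⟩, rfl⟩)
      have := hO.mem_nhds (x := Γ) ⟨x, hx, by rwa [← dist_eq_norm]⟩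
      filter_upwards [this] with Γ' ⟨y, hy, hyd⟩
      refine ⟨y, hy, ?_⟩
      rw [dist_eq_norm, norm_sub_rev] at hxd
      have := norm_sub_le_norm_sub_add_norm_sub y d x
      linarith
    · obtain ⟨ε, hε, hb⟩ := Metric.isOpen_iff.1 Γ.isClosed.isOpen_compl x hx
      obtain ⟨r, hr0, hr⟩ := exists_rat_btwn (half_pos hε)
      obtain ⟨d, hd, hxd⟩ := Metric.mem_closure_iff.1 (hD x) (r / 2) (by positivity)
      rw [dist_eq_norm, norm_sub_rev] at hxd
      have hO : IsOpen[T] {Γ : ChabautyR n | ∀ y ∈ Γ, (r : ℝ) < ‖y - d‖} :=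
        TopologicalSpace.isOpen_generateFrom_of_mem (.inr ⟨(d, r), ⟨hd, mem_univ _⟩, rfl⟩)
      have := hO.mem_nhds (x := Γ) (by
        intro y hy
        by_contra! hle
        refine hb (a := y) ?_ hy
        rw [Metric.mem_ball, dist_eq_norm]
        have := norm_sub_le_norm_sub_add_norm_sub y d x
        linarith)
      refine ⟨r / 2, by positivity, ?_⟩
      filter_upwards [this] with Γ' h y hy
      have h1 := h y hy
      have := norm_sub_le_norm_sub_add_norm_sub y x d
      rw [norm_sub_rev x d] at this
      linarith

instance : TopologicalSpace.MetrizableSpace (ChabautyR n) :=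
  TopologicalSpace.metrizableSpace_of_t3_secondCountable _

/-- A bounded family of vectors converges along an ultrafilter. -/
theorem _root_.exists_tendsto_of_norm_le {ι : Type*} {u : Ultrafilter ι} {y : ι → Euc n} {R : ℝ}
    (h : ∀ᶠ i in (u : Filter ι), ‖y i‖ ≤ R) : ∃ x, Tendsto y u (𝓝 x) := by
  obtain ⟨a, -, ha⟩ := (isCompact_closedBall (0 : Euc n) R).ultrafilter_le_nhds (u.map y)
    (le_principal_iff.2 (by
      change ∀ᶠ i in (u : Filter ι), y i ∈ Metric.closedBall 0 R
      simpa using h))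
  exact ⟨a, ha⟩

end Chabauty

/-! ### The action of the general linear group -/

/-- The general linear group, as the group of invertible continuous endomorphisms. -/
abbrev GLn (n : ℕ) : Type := (Euc n →L[ℝ] Euc n)ˣ

theorem tendsto_clm_apply {ι : Type*} {l : Filter ι} {m n : ℕ} {T : ι → Euc m →L[ℝ] Euc n}
    {y : ι → Euc m} {S : Euc m →L[ℝ] Euc n} {x : Euc m} (hT : Tendsto T l (𝓝 S))
    (hy : Tendsto y l (𝓝 x)) : Tendsto (fun i => T i (y i)) l (𝓝 (S x)) :=
  (isBoundedBilinearMap_apply.continuous.tendsto (S, x)).comp (hT.prodMk_nhds hy)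

namespace GLn

variable {n : ℕ}

@[simp] theorem inv_apply_self (g : GLn n) (x : Euc n) : (↑g⁻¹ : Euc n →L[ℝ] Euc n) (g.val x) = x := by
  rw [← mul_apply_eq_comp, Units.inv_mul, one_apply_eq_self]

@[simp] theorem apply_inv_self (g : GLn n) (x : Euc n) : g.val ((↑g⁻¹ : Euc n →L[ℝ] Euc n) x) = x := by
  rw [← mul_apply_eq_comp, Units.mul_inv, one_apply_eq_self]

instance : MulAction (GLn n) (ChabautyR n) where
  smul g Γ := Chabauty.ofClosed (Γ.toSubgroup.comap
    ((↑g⁻¹ : Euc n →L[ℝ] Euc n) : Euc n →+ Euc n))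
    (Γ.isClosed.preimage (↑g⁻¹ : Euc n →L[ℝ] Euc n).continuous)
  one_smul Γ := by
    refine Chabauty.ext fun x => ?_
    change (↑(1 : GLn n)⁻¹ : Euc n →L[ℝ] Euc n) x ∈ Γ ↔ x ∈ Γ
    simp
  mul_smul g h Γ := by
    refine Chabauty.ext fun x => ?_
    change (↑(g * h)⁻¹ : Euc n →L[ℝ] Euc n) x ∈ Γ ↔
      (↑h⁻¹ : Euc n →L[ℝ] Euc n) ((↑g⁻¹ : Euc n →L[ℝ] Euc n) x) ∈ Γ
    simp

theorem mem_smul {g : GLn n} {Γ : ChabautyR n} {x : Euc n} :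
    x ∈ g • Γ ↔ (↑g⁻¹ : Euc n →L[ℝ] Euc n) x ∈ Γ := Iff.rfl

@[simp] theorem apply_mem_smul {g : GLn n} {Γ : ChabautyR n} {x : Euc n} :
    g.val x ∈ g • Γ ↔ x ∈ Γ := by simp [mem_smul]

theorem exists_of_mem_smul {g : GLn n} {Γ : ChabautyR n} {x : Euc n} (h : x ∈ g • Γ) :
    ∃ y ∈ Γ, g.val y = x := ⟨_, h, by simp⟩

theorem tendsto_smul {ι : Type*} {l : Filter ι} {g : ι → GLn n} {f : ι → ChabautyR n} {a : GLn n}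
    {Γ : ChabautyR n} (hg : Tendsto g l (𝓝 a)) (hf : Tendsto f l (𝓝 Γ)) :
    Tendsto (fun i => g i • f i) l (𝓝 (a • Γ)) := by
  rw [tendsto_iff_ultrafilter]
  intro u hu
  have hg := hg.mono_left hu
  have hf := hf.mono_left hu
  have hgv : Tendsto (fun i => (g i).val) u (𝓝 a.val) := (Units.continuous_val.tendsto a).comp hg
  have hgi : Tendsto (fun i => (↑(g i)⁻¹ : Euc n →L[ℝ] Euc n)) u (𝓝 (↑a⁻¹ : Euc n →L[ℝ] Euc n)) :=
    (Units.continuous_val.tendsto a⁻¹).comp hg.inv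
  refine Chabauty.tendsto_of_ultrafilter (fun x hx => ?_) (fun y x hy hyx => ?_)
  · obtain ⟨y, hy, hyx⟩ := Chabauty.exists_tendsto hf (mem_smul.1 hx)
    refine ⟨fun i => (g i).val (y i), .of_forall fun i => apply_mem_smul.2 (hy i), ?_⟩
    have := tendsto_clm_apply hgv hyx
    simpa using this
  · exact Chabauty.mem_of_tendsto hf (.of_forall hy) (tendsto_clm_apply hgi hyx)

instance : ContinuousSMul (GLn n) (ChabautyR n) :=
  ⟨continuous_iff_continuousAt.2 fun ⟨g, Γ⟩ =>
    tendsto_smul (continuous_fst.tendsto (g, Γ)) (continuous_snd.tendsto (g, Γ))⟩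

/-- Continuity of a map into the general linear group can be tested on endomorphisms. -/
theorem tendsto_iff {ι : Type*} {l : Filter ι} {g : ι → GLn n} {a : GLn n} :
    Tendsto g l (𝓝 a) ↔ Tendsto (fun i => (g i).val) l (𝓝 a.val) :=
  Units.isOpenEmbedding_val.isInducing.tendsto_nhds_iff

theorem continuous_iff {Y : Type*} [TopologicalSpace Y] {g : Y → GLn n} :
    Continuous g ↔ Continuous (fun y => (g y).val) :=
  Units.isOpenEmbedding_val.isInducing.continuous_iff

theorem exists_of_injective {T : Euc n →L[ℝ] Euc n} (h : Function.Injective T) :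
    ∃ g : GLn n, g.val = T :=
  ⟨ContinuousLinearEquiv.toUnit
    (LinearEquiv.ofInjectiveEndo T.toLinearMap h).toContinuousLinearEquiv, by ext x; rfl⟩

end GLn

/-! ### Coordinates -/

section Coordinates

variable {m n : ℕ}

/-- The standard basis vector. -/
noncomputable def bv (b : Fin n) : Euc n := EuclideanSpace.single b 1

theorem bv_apply (b a : Fin n) : bv b a = if a = b then 1 else 0 := by
  simp [bv]

@[simp] theorem bv_self (b : Fin n) : bv b b = 1 := by simp [bv_apply]

theorem bv_ne {a b : Fin n} (h : a ≠ b) : bv b a = 0 := by simp [bv_apply, h]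

@[simp] theorem norm_bv (b : Fin n) : ‖bv b‖ = 1 := by simp [bv]

/-- The linear map with given columns. -/
noncomputable def ofCols (v : Fin n → Euc m) : Euc n →L[ℝ] Euc m :=
  ∑ b, (EuclideanSpace.proj b : Euc n →L[ℝ] ℝ).smulRight (v b)

theorem ofCols_apply (v : Fin n → Euc m) (x : Euc n) : ofCols v x = ∑ b, x b • v b := by
  simp [ofCols]

theorem ofCols_apply_coord (v : Fin n → Euc m) (x : Euc n) (a : Fin m) :
    ofCols v x a = ∑ b, x b * v b a := by
  simp [ofCols_apply]

@[simp] theorem ofCols_bv (v : Fin n → Euc m) (b : Fin n) : ofCols v (bv b) = v b := by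
  rw [ofCols_apply, Finset.sum_eq_single b]
  · simp
  · intro c _ hc
    simp [bv_ne hc]
  · simp

theorem sum_smul_bv (x : Euc n) : ∑ b, x b • bv b = x := by
  ext a
  simp [bv_apply]

theorem clm_apply_eq_sum (T : Euc n →L[ℝ] Euc m) (x : Euc n) : T x = ∑ b, x b • T (bv b) := by
  conv_lhs => rw [← sum_smul_bv x]
  simp

theorem clm_ext_bv {T S : Euc n →L[ℝ] Euc m} (h : ∀ b, T (bv b) = S (bv b)) : T = S := by
  ext1 x
  rw [clm_apply_eq_sum T, clm_apply_eq_sum S]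
  simp [h]

theorem ofCols_bv_eq_one : ofCols (fun b : Fin n => bv b) = 1 :=
  clm_ext_bv fun b => by simp

theorem tendsto_ofCols {ι : Type*} {l : Filter ι} {v : ι → Fin n → Euc m} {w : Fin n → Euc m}
    (h : ∀ b, Tendsto (fun i => v i b) l (𝓝 (w b))) :
    Tendsto (fun i => ofCols (v i)) l (𝓝 (ofCols w)) := by
  refine tendsto_finsetSum _ fun b _ => ?_
  exact (((ContinuousLinearMap.smulRightL ℝ (Euc n) (Euc m)
    (EuclideanSpace.proj b)).continuous.tendsto (w b)).comp (h b))

theorem norm_coord_le (x : Euc n) (a : Fin n) : |x a| ≤ ‖x‖ := by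
  simpa using PiLp.norm_apply_le x a

theorem norm_le_sum (x : Euc n) : ‖x‖ ≤ ∑ a, |x a| := by
  calc ‖x‖ = ‖∑ b, x b • bv b‖ := by rw [sum_smul_bv]
    _ ≤ ∑ b, ‖x b • bv b‖ := norm_sum_le _ _
    _ = ∑ a, |x a| := by simp [norm_smul]

theorem norm_le_card_mul {x : Euc n} {c : ℝ} (h : ∀ a, |x a| ≤ c) : ‖x‖ ≤ n * c :=
  (norm_le_sum x).trans ((Finset.sum_le_sum fun a _ => h a).trans (by simp))

/-- The subspace of the vectors with vanishing coordinates of index at least `m`. -/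
def low (n m : ℕ) : Submodule ℝ (Euc n) where
  carrier := {x | ∀ a : Fin n, m ≤ a → x a = 0}
  add_mem' := by
    intro x y hx hy a ha
    simp [hx a ha, hy a ha]
  zero_mem' := by intro a _; rfl
  smul_mem' := by
    intro c x hx a ha
    simp [hx a ha]

theorem mem_low {x : Euc n} : x ∈ low n m ↔ ∀ a : Fin n, m ≤ a → x a = 0 := Iff.rfl

theorem low_mono {m m' : ℕ} (h : m ≤ m') : low n m ≤ low n m' :=
  fun _ hx a ha => hx a (h.trans ha)

theorem bv_mem_low {b : Fin n} (h : (b : ℕ) < m) : bv b ∈ low n m := by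
  intro a ha
  refine bv_ne ?_
  rintro rfl
  omega

theorem low_eq_top (h : n ≤ m) : low n m = ⊤ := by
  refine eq_top_iff.2 fun x _ a ha => ?_
  have := a.2
  omega

theorem clm_mem_of_mem_low {T : Euc n →L[ℝ] Euc n} {V : Submodule ℝ (Euc n)}
    (h : ∀ b : Fin n, (b : ℕ) < m → T (bv b) ∈ V) {x : Euc n} (hx : x ∈ low n m) : T x ∈ V := by
  rw [clm_apply_eq_sum]
  refine Submodule.sum_mem _ fun b _ => ?_
  by_cases hb : (b : ℕ) < m
  · exact V.smul_mem _ (h b hb)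
  · rw [hx b (not_lt.1 hb), zero_smul]
    exact V.zero_mem

theorem isClosed_low : IsClosed (low n m : Set (Euc n)) := Submodule.closed_of_finiteDimensional _

/-- The standard subgroup `ℝ^p × ℤ^q × 0` of type `(p, q)`. -/
def Std (n p q : ℕ) : ChabautyR n :=
  Chabauty.ofClosed
    { carrier := {x | (∀ a : Fin n, p ≤ a → ∃ z : ℤ, x a = z) ∧ x ∈ low n (p + q)}
      add_mem' := by
        rintro x y ⟨hx, hx'⟩ ⟨hy, hy'⟩
        refine ⟨fun a ha => ?_, add_mem hx' hy'⟩
        obtain ⟨z, hz⟩ := hx a ha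
        obtain ⟨w, hw⟩ := hy a ha
        exact ⟨z + w, by simp [hz, hw]⟩
      zero_mem' := ⟨fun a _ => ⟨0, by simp⟩, zero_mem _⟩
      neg_mem' := by
        rintro x ⟨hx, hx'⟩
        refine ⟨fun a ha => ?_, neg_mem hx'⟩
        obtain ⟨z, hz⟩ := hx a ha
        exact ⟨-z, by simp [hz]⟩ }
    (by
      have : {x : Euc n | (∀ a : Fin n, p ≤ a → ∃ z : ℤ, x a = z) ∧ x ∈ low n (p + q)} =
          (⋂ a : Fin n, ⋂ _ : p ≤ a, (fun x : Euc n => x a) ⁻¹' range ((↑) : ℤ → ℝ)) ∩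
            (low n (p + q) : Set (Euc n)) := by
        ext x
        simp [eq_comm]
      change IsClosed {x : Euc n | (∀ a : Fin n, p ≤ a → ∃ z : ℤ, x a = z) ∧ x ∈ low n (p + q)}
      rw [this]
      refine IsClosed.inter (isClosed_iInter fun a => isClosed_iInter fun _ => ?_) isClosed_low
      exact Int.isClosedEmbedding_coe_real.isClosed_range.preimage (by fun_prop))

theorem mem_Std {p q : ℕ} {x : Euc n} :
    x ∈ Std n p q ↔ (∀ a : Fin n, p ≤ a → ∃ z : ℤ, x a = z) ∧ x ∈ low n (p + q) := Iff.rfl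

end Coordinates

/-! ### Types of closed subgroups -/

section Types

variable {n : ℕ}

/-- The standard embedding of `ℝ^p × ℤ^q` into Euclidean space. -/
noncomputable def stdVec (n p q : ℕ) (v : (Fin p → ℝ) × (Fin q → ℤ)) : Euc n :=
  WithLp.toLp 2 fun a => if h : (a : ℕ) < p then v.1 ⟨a, h⟩
    else if h' : (a : ℕ) - p < q then (v.2 ⟨a - p, h'⟩ : ℝ) else 0

theorem Std_mem_typeStratum {p q : ℕ} (h : p + q ≤ n) : Std n p q ∈ typeStratum n p q := by
  have hmem : ∀ v, stdVec n p q v ∈ (Std n p q).toSubgroup := by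
    intro v
    refine mem_Std.2 ⟨fun a ha => ?_, fun a ha => ?_⟩
    · simp only [stdVec]
      rw [dif_neg (by omega)]
      split_ifs with h'
      · exact ⟨_, rfl⟩
      · exact ⟨0, by simp⟩
    · simp only [stdVec]
      rw [dif_neg (by omega), dif_neg (by omega)]
  have hcont : Continuous (stdVec n p q) := by
    refine (PiLp.continuous_toLp 2 _).comp (continuous_pi fun a => ?_)
    split_ifs
    · fun_prop
    · exact continuous_of_discreteTopology.comp ((continuous_apply _).comp continuous_snd)
    · fun_prop
  let inv : (Std n p q).toSubgroup → (Fin p → ℝ) × (Fin q → ℤ) := fun x =>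
    (fun i => x.1 ⟨i, by omega⟩, fun i => round (x.1 ⟨p + i, by omega⟩))
  have hinv : Continuous inv := by
    refine Continuous.prodMk (by fun_prop) (continuous_pi fun i => ?_)
    rw [Int.isClosedEmbedding_coe_real.isInducing.continuous_iff]
    have : (fun x : (Std n p q).toSubgroup => ((round (x.1 ⟨p + i, by omega⟩) : ℤ) : ℝ)) =
        fun x => x.1 ⟨p + i, by omega⟩ := by
      funext x
      obtain ⟨z, hz⟩ := (mem_Std.1 x.2).1 ⟨p + i, by omega⟩ (by simp)
      simp only
      rw [hz, round_intCast]
    change Continuous (fun x : (Std n p q).toSubgroup => ((round (x.1 ⟨p + i, by omega⟩) : ℤ) : ℝ))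
    rw [this]
    fun_prop
  refine ⟨ContinuousAddEquiv.symm
    { toFun := fun v => ⟨stdVec n p q v, hmem v⟩
      invFun := inv
      left_inv := ?_
      right_inv := ?_
      map_add' := ?_
      continuous_toFun := hcont.subtype_mk _
      continuous_invFun := hinv }⟩
  · rintro ⟨v, w⟩
    simp [inv, stdVec]
  · rintro ⟨x, hx⟩
    have hx := mem_Std.1 hx
    refine Subtype.ext ?_
    ext a
    simp only [stdVec, inv]
    split_ifs with h₁ h₂
    · rfl
    · obtain ⟨z, hz⟩ := hx.1 a (by omega)
      have : (⟨p + (a - p), by omega⟩ : Fin n) = a := Fin.ext (by simp; omega)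
      rw [this, hz, round_intCast]
    · exact (hx.2 a (by omega)).symm
  · rintro ⟨v, w⟩ ⟨v', w'⟩
    refine Subtype.ext ?_
    ext a
    simp only [stdVec, AddMemClass.mk_add_mk, PiLp.add_apply, Prod.mk_add_mk, Pi.add_apply]
    split_ifs <;> simp

theorem smul_mem_typeStratum {p q : ℕ} {Γ : ChabautyR n} (g : GLn n)
    (h : Γ ∈ typeStratum n p q) : g • Γ ∈ typeStratum n p q := by
  obtain ⟨φ⟩ := h
  let e : (g • Γ).toSubgroup ≃ₜ+ Γ.toSubgroup :=
    { toFun := fun x => ⟨(↑g⁻¹ : Euc n →L[ℝ] Euc n) x.1, x.2⟩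
      invFun := fun x => ⟨g.val x.1, GLn.apply_mem_smul.2 x.2⟩
      left_inv := fun x => by simp
      right_inv := fun x => by simp
      map_add' := fun x y => Subtype.ext (map_add _ _ _)
      continuous_toFun := by
        exact ((↑g⁻¹ : Euc n →L[ℝ] Euc n).continuous.comp continuous_subtype_val).subtype_mk _
      continuous_invFun := by
        exact (g.val.continuous.comp continuous_subtype_val).subtype_mk _ }
  exact ⟨e.trans φ⟩

theorem smul_mem_typeStratum_iff {p q : ℕ} {Γ : ChabautyR n} {g : GLn n} :
    g • Γ ∈ typeStratum n p q ↔ Γ ∈ typeStratum n p q :=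
  ⟨fun h => by simpa using smul_mem_typeStratum g⁻¹ h, smul_mem_typeStratum g⟩

/-- A topological isomorphism `ℝ^p × ℤ^q ≅ ℝ^p' × ℤ^q'` extends to linear maps. -/
theorem exists_linear_extension {p q p' q' : ℕ}
    (φ : ((Fin p → ℝ) × (Fin q → ℤ)) ≃ₜ+ ((Fin p' → ℝ) × (Fin q' → ℤ))) :
    ∃ T : ((Fin p → ℝ) × (Fin q → ℝ)) →ₗ[ℝ] ((Fin p' → ℝ) × (Fin q' → ℝ)),
      ∀ v, T (v.1, fun i => (v.2 i : ℝ)) = ((φ v).1, fun i => ((φ v).2 i : ℝ)) := by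
  let ι : ((Fin p' → ℝ) × (Fin q' → ℤ)) →+ ((Fin p' → ℝ) × (Fin q' → ℝ)) :=
    { toFun := fun v => (v.1, fun i => (v.2 i : ℝ))
      map_zero' := by ext <;> simp
      map_add' := fun v w => by ext <;> simp }
  have hι : Continuous ι := by
    refine Continuous.prodMk continuous_fst (continuous_pi fun i => ?_)
    exact continuous_of_discreteTopology.comp ((continuous_apply i).comp continuous_snd)
  let F : (Fin p → ℝ) →L[ℝ] ((Fin p' → ℝ) × (Fin q' → ℝ)) :=
    AddMonoidHom.toRealLinearMap ((ι.comp φ.toAddMonoidHom).comp (AddMonoidHom.inl _ _))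
      ((hι.comp φ.continuous).comp (by
        change Continuous fun x : Fin p → ℝ => (x, (0 : Fin q → ℤ))
        fun_prop))
  let H : (Fin q → ℝ) →ₗ[ℝ] ((Fin p' → ℝ) × (Fin q' → ℝ)) :=
    Fintype.linearCombination ℝ fun i => ι (φ (0, Pi.single i 1))
  refine ⟨F.toLinearMap.coprod H, fun v => ?_⟩
  have h₁ : F v.1 = ι (φ (v.1, 0)) := rfl
  have h₂ : H (fun i => (v.2 i : ℝ)) = ι (φ (0, v.2)) := by
    have : ((0 : Fin p → ℝ), v.2) = ∑ i, v.2 i • ((0 : Fin p → ℝ), (Pi.single i 1 : Fin q → ℤ)) := by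
      refine Prod.ext ?_ ?_
      · simp [Prod.fst_sum]
      · ext j
        simp [Prod.snd_sum, Finset.sum_apply, Pi.single_apply]
    rw [this, map_sum, map_sum]
    simp only [H, Fintype.linearCombination_apply, map_zsmul]
    refine Finset.sum_congr rfl fun i _ => ?_
    rw [Int.cast_smul_eq_zsmul]
  change F v.1 + H (fun i => (v.2 i : ℝ)) = ι (φ v)
  rw [h₁, h₂, ← map_add, ← map_add]
  simp

theorem type_le_of_equiv {p q p' q' : ℕ}
    (φ : ((Fin p → ℝ) × (Fin q → ℤ)) ≃ₜ+ ((Fin p' → ℝ) × (Fin q' → ℤ))) :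
    p ≤ p' ∧ p + q ≤ p' + q' := by
  constructor
  · let F : (Fin p → ℝ) →L[ℝ] (Fin p' → ℝ) :=
      AddMonoidHom.toRealLinearMap (((AddMonoidHom.fst _ _).comp φ.toAddMonoidHom).comp
        (AddMonoidHom.inl _ _))
        ((continuous_fst.comp φ.continuous).comp (by
          change Continuous fun x : Fin p → ℝ => (x, (0 : Fin q → ℤ))
          fun_prop))
    have hF : Function.Injective F.toLinearMap := by
      rw [← LinearMap.ker_eq_bot, LinearMap.ker_eq_bot']
      intro x hx
      have h₁ : (φ (x, 0)).1 = 0 := hx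
      have h₂ : (φ (x, 0)).2 = (φ (0, 0)).2 :=
        PreconnectedSpace.constant (α := Fin p → ℝ) (f := fun x => (φ (x, 0)).2) inferInstance
          (by
            refine (continuous_snd.comp φ.continuous).comp ?_
            fun_prop)
      have h₃ : φ (x, 0) = φ (0, 0) := Prod.ext (by
        rw [h₁, ← Prod.zero_eq_mk, map_zero]
        rfl) h₂
      simpa using φ.injective h₃
    simpa using LinearMap.finrank_le_finrank_of_injective hF
  · obtain ⟨T, hT⟩ := exists_linear_extension φ
    obtain ⟨S, hS⟩ := exists_linear_extension φ.symm
    have hST : ∀ v : (Fin p → ℝ) × (Fin q → ℤ), S (T (v.1, fun i => (v.2 i : ℝ))) =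
        (v.1, fun i => (v.2 i : ℝ)) := by
      intro v
      rw [hT, hS]
      simp
    have : S ∘ₗ T = LinearMap.id := by
      refine LinearMap.prod_ext (LinearMap.ext fun x => ?_) (LinearMap.pi_ext' fun i => ?_)
      · have := hST (x, 0)
        have hc : (fun j => (((0 : Fin q → ℤ) j : ℤ) : ℝ)) = 0 := by
          funext j
          simp
        simp only [hc] at this
        simpa using this
      · ext1
        have := hST (0, Pi.single i 1)
        have hc : (fun j => (((Pi.single i 1 : Fin q → ℤ) j : ℤ) : ℝ)) = Pi.single i 1 := by
          funext j
          by_cases h : j = i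
          · subst h; simp
          · simp [h]
        simp only [hc] at this
        simpa using this
    have hinj : Function.Injective T := by
      refine Function.LeftInverse.injective (g := S) fun x => ?_
      exact LinearMap.congr_fun this x
    simpa using LinearMap.finrank_le_finrank_of_injective hinj

theorem type_unique {p q p' q' : ℕ} {Γ : ChabautyR n} (h : Γ ∈ typeStratum n p q)
    (h' : Γ ∈ typeStratum n p' q') : p = p' ∧ q = q' := by
  obtain ⟨φ⟩ := h
  obtain ⟨ψ⟩ := h'
  have h₁ := type_le_of_equiv (φ.symm.trans ψ)
  have h₂ := type_le_of_equiv (ψ.symm.trans φ)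
  omega

end Types

/-! ### The structure of closed subgroups -/

section Structure

variable {n : ℕ}

/-- The largest linear subspace contained in a closed subgroup. -/
def Chabauty.core (Γ : ChabautyR n) : Submodule ℝ (Euc n) where
  carrier := {x | ∀ t : ℝ, t • x ∈ Γ}
  add_mem' := by
    intro x y hx hy t
    rw [smul_add]
    exact add_mem (hx t) (hy t)
  zero_mem' := by
    intro t
    rw [smul_zero]
    exact zero_mem Γ
  smul_mem' := by
    intro c x hx t
    rw [smul_smul]
    exact hx _

theorem Chabauty.core_le {Γ : ChabautyR n} {x : Euc n} (hx : x ∈ Γ.core) : x ∈ Γ := by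
  simpa using hx 1

/-- A closed subgroup with arbitrarily short vectors in a closed set of directions contains
a line. -/
theorem exists_gap (Γ : ChabautyR n) (V : Submodule ℝ (Euc n))
    (hV : ∀ x ∈ V, x ∈ Γ.core → x = 0) :
    ∃ ε > 0, ∀ x ∈ Γ, x ∈ V → x ≠ 0 → ε ≤ ‖x‖ := by
  by_contra! hcon
  choose x hxΓ hxV hx0 hx using fun i : ℕ => hcon (1 / ((i : ℝ) + 1)) (by positivity)
  let w : Ultrafilter ℕ := Filter.hyperfilter ℕ
  have hw : (w : Filter ℕ) ≤ atTop := by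
    rw [← Nat.cofinite_eq_atTop]
    exact Filter.hyperfilter_le_cofinite
  have hxlim : Tendsto (fun i => ‖x i‖) w (𝓝 0) := by
    refine squeeze_zero (fun i => norm_nonneg _) (fun i => (hx i).le) ?_
    exact tendsto_one_div_add_atTop_nhds_zero_nat.mono_left hw
  have hxpos : ∀ i, 0 < ‖x i‖ := fun i => norm_pos_iff.2 (hx0 i)
  let y : ℕ → Euc n := fun i => (‖x i‖)⁻¹ • x i
  have hy1 : ∀ i, ‖y i‖ = 1 := fun i => by
    simp [y, norm_smul, (hxpos i).ne']
  obtain ⟨v, hv⟩ := exists_tendsto_of_norm_le (u := w) (y := y) (R := 1)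
    (.of_forall fun i => (hy1 i).le)
  have hv1 : ‖v‖ = 1 := by
    refine tendsto_nhds_unique hv.norm ?_
    simp [hy1]
  have hvV : v ∈ V := (Submodule.closed_of_finiteDimensional V).mem_of_tendsto hv
    (.of_forall fun i => V.smul_mem _ (hxV i))
  have hvc : v ∈ Γ.core := by
    intro t
    have hlim : Tendsto (fun i => (⌊t / ‖x i‖⌋ : ℤ) • x i) w (𝓝 (t • v)) := by
      have h1 : Tendsto (fun i => t • y i) w (𝓝 (t • v)) := hv.const_smul t
      refine (tendsto_iff_of_dist ?_).1 h1
      refine squeeze_zero (fun i => dist_nonneg) (fun i => ?_) hxlim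
      have : t • y i - (⌊t / ‖x i‖⌋ : ℤ) • x i = (Int.fract (t / ‖x i‖)) • x i := by
        rw [← Int.cast_smul_eq_zsmul ℝ, smul_smul, ← sub_smul, ← div_eq_mul_inv,
          Int.self_sub_floor]
      rw [dist_eq_norm, this, norm_smul, Real.norm_of_nonneg (Int.fract_nonneg _)]
      exact mul_le_of_le_one_left (norm_nonneg _) (Int.fract_lt_one _).le
    exact Γ.isClosed.mem_of_tendsto hlim (.of_forall fun i => zsmul_mem (hxΓ i) _)
  have := hV v hvV hvc
  rw [this] at hv1
  simp at hv1

/-- Every closed subgroup is the image of a standard one under a linear automorphism. -/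
theorem exists_eq_smul_Std (Γ : ChabautyR n) :
    ∃ r s : ℕ, r + s ≤ n ∧ ∃ g : GLn n, Γ = g • Std n r s := by
  classical
  set V := Γ.core with hVdef
  obtain ⟨ε, hε, hgap⟩ := exists_gap Γ Vᗮ fun x hx hx' => by
    have : x ∈ V ⊓ Vᗮ := ⟨hx', hx⟩
    rwa [Submodule.inf_orthogonal_eq_bot, Submodule.mem_bot] at this
  let Λ : Submodule ℤ (Euc n) := AddSubgroup.toIntSubmodule (Γ.toSubgroup ⊓ Vᗮ.toAddSubgroup)
  have hΛ : ∀ {x}, x ∈ Λ ↔ x ∈ Γ ∧ x ∈ Vᗮ := Iff.rfl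
  have : DiscreteTopology Λ := by
    refine DiscreteTopology.of_forall_le_norm hε fun x hx => ?_
    exact hgap x.1 (hΛ.1 x.2).1 (hΛ.1 x.2).2 (by simpa using hx)
  let s := Module.finrank ℤ Λ
  let b : Module.Basis (Fin s) ℤ Λ := Module.finBasis ℤ Λ
  let bb : Fin s → Euc n := fun i => (b i : Euc n)
  have hbspan : Submodule.span ℤ (range bb) = Λ := by
    have : range bb = Λ.subtype '' range b := by
      rw [← range_comp]
      rfl
    rw [this, Submodule.span_image, b.span_eq, Submodule.map_top, Submodule.range_subtype]
  have hbli : LinearIndependent ℝ bb := by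
    rw [linearIndependent_iff_card_eq_finrank_span, Real.finrank_eq_int_finrank_of_discrete]
    · rw [Set.finrank, hbspan]
      simp [s]
    · rwa [hbspan]
  let r := Module.finrank ℝ V
  let v : Module.Basis (Fin r) ℝ V := Module.finBasis ℝ V
  let vv : Fin r → Euc n := fun i => (v i : Euc n)
  have hvli : LinearIndependent ℝ vv :=
    v.linearIndependent.map' V.subtype (by simp)
  have hvspan : Submodule.span ℝ (range vv) ≤ V := by
    rw [Submodule.span_le]
    rintro _ ⟨i, rfl⟩
    exact (v i).2
  have hbspan' : Submodule.span ℝ (range bb) ≤ Vᗮ := by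
    rw [Submodule.span_le]
    rintro _ ⟨i, rfl⟩
    exact (hΛ.1 (b i).2).2
  have hli₁ : LinearIndependent ℝ (Sum.elim vv bb) :=
    hvli.sum_type hbli (Submodule.orthogonal_disjoint V |>.mono hvspan hbspan')
  set U := Submodule.span ℝ (range (Sum.elim vv bb)) with hU
  have hUrank : Module.finrank ℝ U = r + s := by
    rw [hU, finrank_span_eq_card hli₁]
    simp
  have hsum := U.finrank_add_finrank_orthogonal
  rw [hUrank, finrank_euclideanSpace_fin] at hsum
  let t := Module.finrank ℝ Uᗮ
  let w : Module.Basis (Fin t) ℝ Uᗮ := Module.finBasis ℝ Uᗮ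
  let ww : Fin t → Euc n := fun i => (w i : Euc n)
  have hwli : LinearIndependent ℝ ww :=
    w.linearIndependent.map' Uᗮ.subtype (by simp)
  have hwspan : Submodule.span ℝ (range ww) ≤ Uᗮ := by
    rw [Submodule.span_le]
    rintro _ ⟨i, rfl⟩
    exact (w i).2
  have hli : LinearIndependent ℝ (Sum.elim (Sum.elim vv bb) ww) :=
    hli₁.sum_type hwli (Submodule.orthogonal_disjoint U |>.mono le_rfl hwspan)
  let e : (Fin r ⊕ Fin s) ⊕ Fin t ≃ Fin n :=
    ((Equiv.sumCongr finSumFinEquiv (Equiv.refl _)).trans finSumFinEquiv).trans (finCongr hsum)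
  have he₁ : ∀ i, ((e (.inl (.inl i))) : ℕ) = i := fun i => by simp [e]
  have he₂ : ∀ i, ((e (.inl (.inr i))) : ℕ) = r + i := fun i => by simp [e]
  have he₃ : ∀ i, ((e (.inr i)) : ℕ) = r + s + i := fun i => by simp [e]
  let T : Euc n →L[ℝ] Euc n := ofCols fun a => Sum.elim (Sum.elim vv bb) ww (e.symm a)
  have hT : ∀ x, T x = (∑ i, x (e (.inl (.inl i))) • vv i + ∑ i, x (e (.inl (.inr i))) • bb i) +
      ∑ i, x (e (.inr i)) • ww i := by
    intro x
    simp only [T, ofCols_apply]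
    rw [← e.sum_comp]
    simp [Fintype.sum_sum_type]
  have hTinj : Function.Injective T := by
    rw [injective_iff_map_eq_zero]
    intro x hx
    rw [Fintype.linearIndependent_iff] at hli
    have := hli (fun i => x (e i)) (by
      rw [← hx, hT]
      simp [Fintype.sum_sum_type])
    ext a
    simpa using this (e.symm a)
  obtain ⟨g, hg⟩ := GLn.exists_of_injective hTinj
  refine ⟨r, s, by omega, g, ?_⟩
  refine Chabauty.ext fun x => ⟨fun hx => ?_, fun hx => ?_⟩
  · obtain ⟨y, hy, z, hz, rfl⟩ := V.exists_add_mem_mem_orthogonal x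
    have hzΓ : z ∈ Λ := by
      refine hΛ.2 ⟨?_, hz⟩
      have := sub_mem hx (Chabauty.core_le hy)
      simpa using this
    let c : (Fin r ⊕ Fin s) ⊕ Fin t → ℝ :=
      Sum.elim (Sum.elim (fun i => v.repr ⟨y, hy⟩ i) (fun i => (b.repr ⟨z, hzΓ⟩ i : ℝ))) 0
    let X : Euc n := WithLp.toLp 2 fun a => c (e.symm a)
    have hX : g.val X = y + z := by
      rw [hg, hT]
      have h₁ : ∑ i, v.repr ⟨y, hy⟩ i • vv i = y := by
        have := congrArg V.subtype (v.sum_repr ⟨y, hy⟩)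
        rw [map_sum] at this
        exact this
      have h₂ : ∑ i, (b.repr ⟨z, hzΓ⟩ i : ℝ) • bb i = z := by
        have := congrArg Λ.subtype (b.sum_repr ⟨z, hzΓ⟩)
        rw [map_sum] at this
        simp only [Int.cast_smul_eq_zsmul]
        exact this
      simp only [X, Equiv.symm_apply_apply, c, Sum.elim_inl, Sum.elim_inr]
      rw [h₁, h₂]
      simp
    rw [← hX, GLn.apply_mem_smul, mem_Std]
    refine ⟨fun a ha => ?_, fun a ha => ?_⟩
    · obtain ⟨i, rfl⟩ := e.surjective a
      simp only [X, Equiv.symm_apply_apply]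
      rcases i with (i | i) | i
      · rw [he₁] at ha
        omega
      · exact ⟨_, rfl⟩
      · exact ⟨0, by simp [c]⟩
    · obtain ⟨i, rfl⟩ := e.surjective a
      simp only [X, Equiv.symm_apply_apply]
      rcases i with (i | i) | i
      · rw [he₁] at ha
        omega
      · rw [he₂] at ha
        omega
      · simp [c]
  · obtain ⟨y, hy, rfl⟩ := GLn.exists_of_mem_smul hx
    rw [mem_Std] at hy
    rw [hg, hT]
    refine add_mem (add_mem (sum_mem fun i _ => ?_) (sum_mem fun i _ => ?_)) ?_
    · exact (v i).2 _
    · obtain ⟨z, hz⟩ := hy.1 (e (.inl (.inr i))) (by rw [he₂]; omega)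
      rw [hz, Int.cast_smul_eq_zsmul]
      exact zsmul_mem (hΛ.1 (b i).2).1 _
    · have : ∑ i, y (e (.inr i)) • ww i = 0 := by
        refine Finset.sum_eq_zero fun i _ => ?_
        rw [hy.2 _ (by rw [he₃]; omega), zero_smul]
      rw [this]
      exact zero_mem _

theorem exists_type (Γ : ChabautyR n) : ∃ r s : ℕ, r + s ≤ n ∧ Γ ∈ typeStratum n r s := by
  obtain ⟨r, s, h, g, rfl⟩ := exists_eq_smul_Std Γ
  exact ⟨r, s, h, smul_mem_typeStratum g (Std_mem_typeStratum h)⟩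

theorem mem_typeStratum_iff {p q : ℕ} (h : p + q ≤ n) {Γ : ChabautyR n} :
    Γ ∈ typeStratum n p q ↔ ∃ g : GLn n, Γ = g • Std n p q := by
  refine ⟨fun hΓ => ?_, ?_⟩
  · obtain ⟨r, s, h', g, rfl⟩ := exists_eq_smul_Std Γ
    obtain ⟨rfl, rfl⟩ := type_unique hΓ (smul_mem_typeStratum g (Std_mem_typeStratum h'))
    exact ⟨g, rfl⟩
  · rintro ⟨g, rfl⟩
    exact smul_mem_typeStratum g (Std_mem_typeStratum h)

theorem mem_typeStratum_iff_image {p q : ℕ} (h : p + q ≤ n) {Γ Γ' : ChabautyR n}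
    (hΓ : Γ ∈ typeStratum n p q) : Γ' ∈ typeStratum n p q ↔
      ∃ g : Euc n ≃ₗ[ℝ] Euc n, (Γ'.toSubgroup : Set (Euc n)) = g '' Γ.toSubgroup := by
  have key : ∀ (g : GLn n) (Γ : ChabautyR n), ((g • Γ : ChabautyR n) : Set (Euc n)) = g.val '' Γ := by
    intro g Γ
    ext x
    constructor
    · intro hx
      exact GLn.exists_of_mem_smul hx
    · rintro ⟨y, hy, rfl⟩
      exact GLn.apply_mem_smul.2 hy
  constructor
  · intro hΓ'
    obtain ⟨a, rfl⟩ := (mem_typeStratum_iff h).1 hΓ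
    obtain ⟨b, rfl⟩ := (mem_typeStratum_iff h).1 hΓ'
    refine ⟨(ContinuousLinearEquiv.unitsEquiv ℝ (Euc n) (b * a⁻¹)).toLinearEquiv, ?_⟩
    have := key (b * a⁻¹) (a • Std n p q)
    rw [smul_smul, inv_mul_cancel_right] at this
    exact this
  · rintro ⟨g, hg⟩
    have : Γ' = ContinuousLinearEquiv.toUnit g.toContinuousLinearEquiv • Γ := by
      apply SetLike.coe_injective
      rw [key]
      exact hg
    rw [this]
    exact smul_mem_typeStratum _ hΓ

/-! ### Duality -/

/-- The dual of a closed subgroup: the vectors that have integral inner products with it. -/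
noncomputable def Chabauty.dual (Γ : ChabautyR n) : ChabautyR n :=
  Chabauty.ofClosed
    { carrier := {y | ∀ x ∈ Γ, ∃ z : ℤ, inner ℝ x y = z}
      add_mem' := by
        intro y y' hy hy' x hx
        obtain ⟨z, hz⟩ := hy x hx
        obtain ⟨z', hz'⟩ := hy' x hx
        exact ⟨z + z', by rw [inner_add_right, hz, hz']; simp⟩
      zero_mem' := fun x _ => ⟨0, by simp⟩
      neg_mem' := by
        intro y hy x hx
        obtain ⟨z, hz⟩ := hy x hx
        exact ⟨-z, by rw [inner_neg_right, hz]; simp⟩ }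
    (by
      change IsClosed {y | ∀ x ∈ Γ, ∃ z : ℤ, inner ℝ x y = (z : ℝ)}
      have : {y : Euc n | ∀ x ∈ Γ, ∃ z : ℤ, inner ℝ x y = (z : ℝ)} =
          ⋂ x ∈ Γ, (fun y => inner ℝ x y) ⁻¹' range ((↑) : ℤ → ℝ) := by
        ext y
        simp [eq_comm]
      rw [this]
      refine isClosed_biInter fun x _ => ?_
      exact Int.isClosedEmbedding_coe_real.isClosed_range.preimage (by fun_prop))

theorem mem_dual {Γ : ChabautyR n} {y : Euc n} :
    y ∈ Γ.dual ↔ ∀ x ∈ Γ, ∃ z : ℤ, inner ℝ x y = z := Iff.rfl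

theorem inner_bv_left (a : Fin n) (t : ℝ) (y : Euc n) : inner ℝ (t • bv a) y = t * y a := by
  simp [bv, inner_smul_left, EuclideanSpace.inner_single_left]

theorem inner_eq_sum (x y : Euc n) : inner ℝ x y = ∑ a, x a * y a := by
  simp [PiLp.inner_apply, mul_comm]

theorem dual_smul (g : GLn n) (Γ : ChabautyR n) : (g • Γ).dual = (star g)⁻¹ • Γ.dual := by
  refine Chabauty.ext fun y => ?_
  rw [GLn.mem_smul, inv_inv, Units.coe_star, ContinuousLinearMap.star_eq_adjoint, mem_dual,
    mem_dual]
  constructor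
  · intro h x hx
    rw [ContinuousLinearMap.adjoint_inner_right]
    exact h _ (GLn.apply_mem_smul.2 hx)
  · intro h x hx
    obtain ⟨x, hx', rfl⟩ := GLn.exists_of_mem_smul hx
    rw [← ContinuousLinearMap.adjoint_inner_right]
    exact h _ hx'

theorem mem_dual_Std {p q : ℕ} {y : Euc n} : y ∈ (Std n p q).dual ↔
    (∀ a : Fin n, (a : ℕ) < p → y a = 0) ∧ ∀ a : Fin n, (a : ℕ) < p + q → ∃ z : ℤ, y a = z := by
  constructor
  · intro hy
    constructor
    · intro a ha
      by_contra h0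
      obtain ⟨z, hz⟩ := hy ((2 * y a)⁻¹ • bv a) (mem_Std.2 ⟨fun c hc => ⟨0, by
        rw [PiLp.smul_apply, bv_ne (by rintro rfl; omega)]
        simp⟩, Submodule.smul_mem _ _ (bv_mem_low (by omega))⟩)
      rw [inner_bv_left, mul_inv, mul_assoc, inv_mul_cancel₀ h0] at hz
      have h2 : (1 : ℝ) = ((2 * z : ℤ) : ℝ) := by
        push_cast
        linarith
      have h3 : (1 : ℤ) = 2 * z := by exact_mod_cast h2
      omega
    · intro a ha
      obtain ⟨z, hz⟩ := hy ((1 : ℝ) • bv a) (mem_Std.2 ⟨fun c hc => by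
        rw [one_smul, bv_apply]
        split_ifs
        · exact ⟨1, by simp⟩
        · exact ⟨0, by simp⟩, Submodule.smul_mem _ _ (bv_mem_low ha)⟩)
      rw [inner_bv_left, one_mul] at hz
      exact ⟨z, hz⟩
  · rintro ⟨h₁, h₂⟩ x hx
    rw [mem_Std] at hx
    rw [inner_eq_sum]
    have : ∀ a : Fin n, ∃ z : ℤ, x a * y a = z := by
      intro a
      rcases lt_or_ge (a : ℕ) p with h | h
      · exact ⟨0, by simp [h₁ a h]⟩
      · rcases lt_or_ge (a : ℕ) (p + q) with h' | h'
        · obtain ⟨z, hz⟩ := hx.1 a h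
          obtain ⟨w, hw⟩ := h₂ a h'
          exact ⟨z * w, by simp [hz, hw]⟩
        · exact ⟨0, by simp [hx.2 a h']⟩
    choose z hz using this
    exact ⟨∑ a, z a, by simp [hz]⟩

theorem dual_dual (Γ : ChabautyR n) : Γ.dual.dual = Γ := by
  obtain ⟨r, s, -, g, rfl⟩ := exists_eq_smul_Std Γ
  rw [dual_smul, dual_smul, star_inv, inv_inv, star_star]
  congr 1
  refine Chabauty.ext fun y => ⟨fun hy => ?_, fun hy x hx => ?_⟩
  · refine mem_Std.2 ⟨fun a ha => ?_, fun a ha => ?_⟩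
    · obtain ⟨z, hz⟩ := hy ((1 : ℝ) • bv a) (by
        rw [one_smul, mem_dual_Std]
        refine ⟨fun c hc => bv_ne (by rintro rfl; omega), fun c _ => ?_⟩
        rw [bv_apply]
        split_ifs
        · exact ⟨1, by simp⟩
        · exact ⟨0, by simp⟩)
      rw [inner_bv_left, one_mul] at hz
      exact ⟨z, hz⟩
    · by_contra h0
      obtain ⟨z, hz⟩ := hy ((2 * y a)⁻¹ • bv a) (by
        rw [mem_dual_Std]
        have : ∀ c : Fin n, (c : ℕ) < r + s → ((2 * y a)⁻¹ • bv a : Euc n) c = 0 := fun c hc => by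
          rw [PiLp.smul_apply, bv_ne (by rintro rfl; omega)]
          simp
        exact ⟨fun c hc => this c (by omega), fun c hc => ⟨0, by rw [this c hc]; simp⟩⟩)
      rw [inner_bv_left, mul_inv, mul_assoc, inv_mul_cancel₀ h0] at hz
      have h2 : (1 : ℝ) = ((2 * z : ℤ) : ℝ) := by
        push_cast
        linarith
      have h3 : (1 : ℤ) = 2 * z := by exact_mod_cast h2
      omega
  · obtain ⟨z, hz⟩ := hx y hy
    exact ⟨z, by rw [real_inner_comm, hz]⟩

end Structure

/-! ### Truncations and dilations -/

section Dilations

variable {n : ℕ}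

/-- Truncation to the coordinates of index at least `m`. -/
noncomputable def tl (n m : ℕ) : Euc n →L[ℝ] Euc n :=
  ofCols fun b => if m ≤ (b : ℕ) then bv b else 0

theorem tl_apply (m : ℕ) (x : Euc n) (a : Fin n) : tl n m x a = if m ≤ (a : ℕ) then x a else 0 := by
  rw [tl, ofCols_apply_coord, Finset.sum_eq_single a]
  · split_ifs <;> simp
  · intro b _ hb
    split_ifs
    · simp [bv_ne hb.symm]
    · simp
  · simp

theorem tl_eq_zero_iff {m : ℕ} {x : Euc n} : tl n m x = 0 ↔ x ∈ low n m := by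
  constructor
  · intro h a ha
    have := tl_apply m x a
    rw [h, if_pos ha] at this
    simpa using this.symm
  · intro h
    ext a
    rw [tl_apply]
    split_ifs with ha
    · simp [h a ha]
    · rfl

theorem sub_tl_mem_low (m : ℕ) (x : Euc n) : x - tl n m x ∈ low n m := by
  intro a ha
  simp [tl_apply, ha]

theorem norm_tl_le (m : ℕ) (x : Euc n) : ‖tl n m x‖ ≤ ‖x‖ := by
  rw [EuclideanSpace.norm_eq, EuclideanSpace.norm_eq]
  refine Real.sqrt_le_sqrt (Finset.sum_le_sum fun a _ => ?_)
  rw [tl_apply]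
  split_ifs
  · exact le_rfl
  · rw [norm_zero, zero_pow two_ne_zero]
    exact sq_nonneg _

theorem tl_eq_of_sub_mem {m : ℕ} {x y : Euc n} (h : x - y ∈ low n m) : tl n m x = tl n m y := by
  rw [← sub_eq_zero, ← map_sub, tl_eq_zero_iff]
  exact h

/-- The diagonal automorphism with given non-zero entries. -/
noncomputable def diagGL (d : Fin n → ℝˣ) : GLn n where
  val := ofCols fun b => (d b : ℝ) • bv b
  inv := ofCols fun b => ((d b)⁻¹ : ℝˣ).val • bv b
  val_inv := clm_ext_bv fun b => by simp [smul_smul]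
  inv_val := clm_ext_bv fun b => by simp [smul_smul]

theorem diagGL_apply (d : Fin n → ℝˣ) (x : Euc n) (a : Fin n) :
    (diagGL d).val x a = d a * x a := by
  change ofCols (fun b => (d b : ℝ) • bv b) x a = _
  rw [ofCols_apply_coord, Finset.sum_eq_single a]
  · simp [mul_comm]
  · intro b _ hb
    simp [bv_ne hb.symm]
  · simp

theorem diagGL_mul (d d' : Fin n → ℝˣ) : diagGL (d * d') = diagGL d * diagGL d' := by
  refine Units.ext (ContinuousLinearMap.ext fun x => ?_)
  ext a
  rw [Units.val_mul, mul_apply_eq_comp]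
  simp [diagGL_apply, mul_assoc]

theorem continuous_diagGL : Continuous (diagGL (n := n)) := by
  rw [GLn.continuous_iff]
  refine continuous_iff_continuousAt.2 fun d => tendsto_ofCols fun b => ?_
  have h : Continuous fun d : Fin n → ℝˣ => (d b : ℝ) :=
    Units.continuous_val.comp (continuous_apply b)
  have : Continuous fun d : Fin n → ℝˣ => (d b : ℝ) • bv b := h.smul continuous_const
  exact this.tendsto d

/-- The dilation `(t, 1, t⁻¹)` of `ℝ^p × ℝ^q × ℝ^(n-p-q)`. -/
noncomputable def dil (n p q : ℕ) (t : ℝˣ) : GLn n :=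
  diagGL fun a => if (a : ℕ) < p then t else if (a : ℕ) < p + q then 1 else t⁻¹

variable {p q : ℕ}

theorem dil_apply (t : ℝˣ) (x : Euc n) (a : Fin n) : (dil n p q t).val x a =
    (if (a : ℕ) < p then (t : ℝ) else if (a : ℕ) < p + q then 1 else (t : ℝ)⁻¹) * x a := by
  rw [dil, diagGL_apply]
  split_ifs <;> simp

theorem dil_mul (s t : ℝˣ) : dil n p q (s * t) = dil n p q s * dil n p q t := by
  rw [dil, dil, dil, ← diagGL_mul]
  congr 1
  funext a
  simp only [Pi.mul_apply]
  split_ifs <;> simp [mul_comm]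

@[simp] theorem dil_one : dil n p q 1 = 1 := by
  have := dil_mul (n := n) (p := p) (q := q) 1 1
  simpa using this

theorem dil_inv (t : ℝˣ) : dil n p q t⁻¹ = (dil n p q t)⁻¹ := by
  rw [eq_inv_iff_mul_eq_one, ← dil_mul, inv_mul_cancel, dil_one]

theorem continuous_dil : Continuous (dil n p q) := by
  refine continuous_diagGL.comp (continuous_pi fun a => ?_)
  split_ifs
  · exact continuous_id
  · exact continuous_const
  · exact continuous_inv

theorem dil_apply_low {x : Euc n} (hx : x ∈ low n p) (t : ℝˣ) : (dil n p q t).val x = (t : ℝ) • x := by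
  ext a
  rw [dil_apply]
  split_ifs with h
  · simp
  · simp [hx a (not_lt.1 h)]
  · simp [hx a (not_lt.1 h)]

theorem tl_dil (x : Euc n) (t : ℝˣ) :
    tl n (p + q) ((dil n p q t).val x) = (t : ℝ)⁻¹ • tl n (p + q) x := by
  ext a
  rw [tl_apply, dil_apply, PiLp.smul_apply, tl_apply]
  split_ifs with h h₁ h₂
  · omega
  · omega
  · simp
  · simp

theorem dil_mem_low {m : ℕ} {x : Euc n} (t : ℝˣ) :
    (dil n p q t).val x ∈ low n m ↔ x ∈ low n m := by
  refine forall_congr' fun a => forall_congr' fun _ => ?_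
  rw [dil_apply]
  split_ifs <;> simp

theorem dil_sub_bv_mem_low {b : Fin n} (hb : p ≤ (b : ℕ)) (hb' : (b : ℕ) < p + q) (t : ℝˣ) :
    (dil n p q t).val (bv b) = bv b := by
  ext a
  rw [dil_apply]
  by_cases h : a = b
  · subst h
    rw [if_neg (by omega), if_pos hb', one_mul]
  · simp [bv_ne h]

end Dilations

/-! ### Slices -/

section Slices

variable {n p q : ℕ} {a b c : ℝ} {Γ : ChabautyR n}

/-- The part of `Γ` in `ℝ^p` has covering radius at most `c`. -/
def Cov (p : ℕ) (c : ℝ) (Γ : ChabautyR n) : Prop :=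
  ∀ x ∈ low n p, ∃ γ ∈ Γ, γ ∈ low n p ∧ ‖x - γ‖ ≤ c

/-- The non-zero vectors of the projection of `Γ` to the coordinates of index at least `m` have
norm at least `c⁻¹`. -/
def Gap (m : ℕ) (c : ℝ) (Γ : ChabautyR n) : Prop :=
  ∀ γ ∈ Γ, γ ∉ low n m → 1 ≤ c * ‖tl n m γ‖

/-- The standard basis vectors `e_p, …, e_(p+q-1)` lift to `Γ` modulo `ℝ^p`. -/
def Lifts (p q : ℕ) (Γ : ChabautyR n) : Prop :=
  ∀ i : Fin n, p ≤ (i : ℕ) → (i : ℕ) < p + q → ∃ γ ∈ Γ, γ - bv i ∈ low n p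

/-- The slices: closed subgroups close to `ℝ^p × ℤ^q × 0`, up to the action of automorphisms close
to the identity. -/
structure IsSlice (p q : ℕ) (a b : ℝ) (Γ : ChabautyR n) : Prop where
  cov : Cov p a Γ
  lift : Lifts p q Γ
  int : ∀ γ ∈ Γ, γ ∈ low n (p + q) → ∀ i : Fin n, p ≤ (i : ℕ) → ∃ z : ℤ, γ i = z
  gap : Gap (p + q) b Γ

theorem Cov.mono {a' : ℝ} (h : Cov p a Γ) (ha : a ≤ a') : Cov p a' Γ := fun x hx => by
  obtain ⟨γ, h₁, h₂, h₃⟩ := h x hx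
  exact ⟨γ, h₁, h₂, h₃.trans ha⟩

theorem Gap.mono {a' : ℝ} {m : ℕ} (h : Gap m a Γ) (ha : a ≤ a') : Gap m a' Γ := fun γ hγ hl =>
  (h γ hγ hl).trans (mul_le_mul_of_nonneg_right ha (norm_nonneg _))

theorem Cov.nonneg (h : Cov p a Γ) : 0 ≤ a := by
  obtain ⟨γ, -, -, h⟩ := h 0 (zero_mem _)
  exact (norm_nonneg _).trans h

theorem IsSlice.mono {a' b' : ℝ} (h : IsSlice p q a b Γ) (ha : a ≤ a') (hb : b ≤ b') :
    IsSlice p q a' b' Γ :=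
  ⟨h.cov.mono ha, h.lift, h.int, h.gap.mono hb⟩

theorem Cov.exists_reduce (h : Cov p a Γ) {γ : Euc n} (hγ : γ ∈ Γ) :
    ∃ γ' ∈ Γ, γ - γ' ∈ low n p ∧ ‖γ'‖ ≤ a + ‖tl n p γ‖ := by
  obtain ⟨δ, h₁, h₂, h₃⟩ := h _ (sub_tl_mem_low p γ)
  refine ⟨γ - δ, sub_mem hγ h₁, by simpa using h₂, ?_⟩
  calc ‖γ - δ‖ = ‖(γ - tl n p γ - δ) + tl n p γ‖ := by congr 1; abel
    _ ≤ _ := (norm_add_le _ _).trans (by gcongr)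

/-- Vectors of `Γ ∩ ℝ^(p+q)` with prescribed integral coordinates. -/
theorem Lifts.exists_int (h : Lifts p q Γ) (z : Fin n → ℤ) :
    ∃ γ ∈ Γ, γ ∈ low n (p + q) ∧
      ∀ i : Fin n, p ≤ (i : ℕ) → (i : ℕ) < p + q → γ i = z i := by
  classical
  choose! l hl hl' using h
  refine ⟨∑ i : Fin n, if p ≤ (i : ℕ) ∧ (i : ℕ) < p + q then z i • l i else 0,
    sum_mem fun i _ => ?_, Submodule.sum_mem _ fun i _ => ?_, fun j hj hj' => ?_⟩
  · split_ifs with hi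
    · exact zsmul_mem (hl i hi.1 hi.2) _
    · exact zero_mem _
  · split_ifs with hi
    · refine zsmul_mem ?_ _
      have := add_mem (low_mono (by omega) (hl' i hi.1 hi.2)) (bv_mem_low (n := n) (b := i) hi.2)
      simpa using this
    · exact zero_mem _
  · have : ∀ i : Fin n, (if p ≤ (i : ℕ) ∧ (i : ℕ) < p + q then z i • l i else 0 : Euc n) j =
        if j = i then (z i : ℝ) else 0 := by
      intro i
      split_ifs with h₁ h₂ h₂
      · have := hl' i h₁.1 h₁.2 j hj
        subst h₂
        simp only [PiLp.sub_apply, bv_self] at this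
        simp [sub_eq_zero.1 this]
      · have := hl' i h₁.1 h₁.2 j hj
        simp only [PiLp.sub_apply, bv_ne h₂, sub_zero] at this
        simp [this]
      · subst h₂
        exact absurd ⟨hj, hj'⟩ h₁
      · rfl
    rw [WithLp.ofLp_sum, Finset.sum_apply]
    simp only [this]
    simp

theorem Lifts.exists_round (h : Lifts p q Γ) (γ : Euc n) :
    ∃ δ ∈ Γ, δ ∈ low n (p + q) ∧ (∀ i : Fin n, p ≤ (i : ℕ) → ∃ z : ℤ, δ i = z) ∧
      ‖tl n p (γ - δ)‖ ≤ n + ‖tl n (p + q) γ‖ := by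
  obtain ⟨δ, h₁, h₂, h₃⟩ := h.exists_int fun i => round (γ i)
  refine ⟨δ, h₁, h₂, fun i hi => ?_, ?_⟩
  · rcases lt_or_ge (i : ℕ) (p + q) with h' | h'
    · exact ⟨_, h₃ i hi h'⟩
    · exact ⟨0, by simp [h₂ i h']⟩
  · have hsplit : tl n p (γ - δ) = (tl n p (γ - δ) - tl n (p + q) γ) + tl n (p + q) γ := by abel
    have hbound : ‖tl n p (γ - δ) - tl n (p + q) γ‖ ≤ n * 1 := by
      refine norm_le_card_mul fun i => ?_
      rw [PiLp.sub_apply, tl_apply, tl_apply]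
      split_ifs with hi hi'
      · simp [h₂ i hi']
      · rw [PiLp.sub_apply, h₃ i hi (by omega), sub_zero]
        exact (abs_sub_round _).trans (by norm_num)
      · omega
      · simp
    rw [hsplit]
    have := norm_add_le (tl n p (γ - δ) - tl n (p + q) γ) (tl n (p + q) γ)
    linarith

theorem IsSlice.exists_reduce (h : IsSlice p q a b Γ) {γ : Euc n} (hγ : γ ∈ Γ) :
    ∃ γ' ∈ Γ, γ - γ' ∈ low n (p + q) ∧ ‖γ'‖ ≤ a + n + ‖tl n (p + q) γ‖ := by
  obtain ⟨δ, h₁, h₂, -, h₄⟩ := h.lift.exists_round γ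
  obtain ⟨γ', hγ', hl, hn⟩ := h.cov.exists_reduce (sub_mem hγ h₁)
  refine ⟨γ', hγ', ?_, hn.trans (by linarith)⟩
  have := add_mem (low_mono (n := n) (show p ≤ p + q by omega) hl) h₂
  convert this using 1
  abel

/-- Vectors of `Γ` close to an integral vector of `ℝ^(p+q)` agree with it up to `ℝ^p`. -/
theorem IsSlice.sub_mem_low (h : IsSlice p q a b Γ) {γ v : Euc n} (hγ : γ ∈ Γ)
    (hv : v ∈ low n (p + q)) (hvz : ∀ i : Fin n, p ≤ (i : ℕ) → ∃ z : ℤ, v i = z)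
    (h₁ : ‖γ - v‖ < 1) (h₂ : b * ‖γ - v‖ < 1) : γ - v ∈ low n p := by
  have htl : tl n (p + q) γ = tl n (p + q) (γ - v) := by
    rw [map_sub, tl_eq_zero_iff.2 hv, sub_zero]
  have hγl : γ ∈ low n (p + q) := by
    by_contra hcon
    have h3 := h.gap γ hγ hcon
    rw [htl] at h3
    have h4 := norm_tl_le (p + q) (γ - v)
    rcases le_or_gt 0 b with hb | hb
    · nlinarith
    · nlinarith [norm_nonneg (tl n (p + q) (γ - v))]
  intro i hi
  obtain ⟨z, hz⟩ := h.int γ hγ hγl i hi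
  obtain ⟨w, hw⟩ := hvz i hi
  have h5 := (norm_coord_le (γ - v) i).trans_lt h₁
  rw [PiLp.sub_apply, hz, hw] at h5 ⊢
  have h6 : |z - w| < 1 := by
    have : ((|z - w| : ℤ) : ℝ) < 1 := by
      push_cast
      exact h5
    exact_mod_cast this
  have h7 : z - w = 0 := Int.abs_lt_one_iff.1 h6
  exact_mod_cast h7

theorem isSlice_zero_iff : IsSlice p q 0 0 Γ ↔ Γ = Std n p q := by
  have hint : ∀ i : Fin n, ∃ z : ℤ, (bv i : Euc n) i = z := fun i => ⟨1, by simp⟩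
  constructor
  · intro h
    have hlow : ∀ x ∈ low n p, x ∈ Γ := by
      intro x hx
      obtain ⟨γ, h₁, -, h₃⟩ := h.cov x hx
      rw [norm_le_zero_iff, sub_eq_zero] at h₃
      rwa [h₃]
    refine Chabauty.ext fun x => ⟨fun hx => ?_, fun hx => ?_⟩
    · have hl : x ∈ low n (p + q) := by
        by_contra hcon
        have := h.gap x hx hcon
        norm_num at this
      exact mem_Std.2 ⟨h.int x hx hl, hl⟩
    · obtain ⟨hz, hl⟩ := mem_Std.1 hx
      choose! z hz using hz
      obtain ⟨γ, h₁, h₂, h₃⟩ := h.lift.exists_int z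
      have : x - γ ∈ low n p := by
        intro i hi
        rcases lt_or_ge (i : ℕ) (p + q) with h' | h'
        · simp [hz i hi, h₃ i hi h']
        · simp [hl i h', h₂ i h']
      simpa using add_mem (hlow _ this) h₁
  · rintro rfl
    refine ⟨fun x hx => ⟨x, ?_, hx, by simp⟩, fun i hi hi' => ⟨bv i, ?_, by simp⟩, ?_, ?_⟩
    · exact mem_Std.2 ⟨fun i hi => ⟨0, by simp [hx i hi]⟩, low_mono (by omega) hx⟩
    · refine mem_Std.2 ⟨fun j _ => ?_, bv_mem_low hi'⟩
      rw [bv_apply]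
      split_ifs
      · exact ⟨1, by simp⟩
      · exact ⟨0, by simp⟩
    · intro γ hγ _
      exact (mem_Std.1 hγ).1
    · intro γ hγ hl
      exact absurd (mem_Std.1 hγ).2 hl

theorem isSlice_Std (ha : 0 ≤ a) (hb : 0 ≤ b) : IsSlice p q a b (Std n p q) :=
  (isSlice_zero_iff.2 rfl).mono ha hb

theorem IsSlice.dilate (h : IsSlice p q a b Γ) {t : ℝˣ} (ht : 0 < (t : ℝ)) :
    IsSlice p q (t * a) (t * b) (dil n p q t • Γ) := by
  have hne := ht.ne'
  refine ⟨fun x hx => ?_, fun i hi hi' => ?_, fun γ hγ hl => ?_, fun γ hγ hl => ?_⟩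
  · obtain ⟨γ, h₁, h₂, h₃⟩ := h.cov ((t : ℝ)⁻¹ • x) (Submodule.smul_mem _ _ hx)
    refine ⟨_, GLn.apply_mem_smul.2 h₁, (dil_mem_low t).2 h₂, ?_⟩
    rw [dil_apply_low h₂]
    have : x - (t : ℝ) • γ = (t : ℝ) • ((t : ℝ)⁻¹ • x - γ) := by
      rw [smul_sub, smul_smul, mul_inv_cancel₀ hne, one_smul]
    rw [this, norm_smul, Real.norm_of_nonneg ht.le]
    gcongr
  · obtain ⟨γ, h₁, h₂⟩ := h.lift i hi hi'
    refine ⟨_, GLn.apply_mem_smul.2 h₁, ?_⟩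
    rw [← dil_sub_bv_mem_low hi hi' t, ← map_sub]
    exact (dil_mem_low t).2 h₂
  · obtain ⟨γ, hγ', rfl⟩ := GLn.exists_of_mem_smul hγ
    intro i hi
    rw [dil_mem_low] at hl
    rw [dil_apply, if_neg (by omega)]
    split_ifs with h'
    · simpa using h.int γ hγ' hl i hi
    · exact ⟨0, by simp [hl i (by omega)]⟩
  · obtain ⟨γ, hγ', rfl⟩ := GLn.exists_of_mem_smul hγ
    rw [dil_mem_low] at hl
    have := h.gap γ hγ' hl
    rw [tl_dil, norm_smul, norm_inv, Real.norm_of_nonneg ht.le]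
    calc 1 ≤ b * ‖tl n (p + q) γ‖ := this
      _ = _ := by field_simp

/-! #### Limits of slices -/

variable {ι : Type*} {w : Ultrafilter ι} {f : ι → ChabautyR n}

/-- Vectors of slices that converge to a vector of `ℝ^p` eventually lie in `ℝ^p`. -/
theorem eventually_mem_low (hs : ∀ᶠ i in (w : Filter ι), IsSlice p q a b (f i)) {y : ι → Euc n}
    {x : Euc n} (hy : ∀ᶠ i in (w : Filter ι), y i ∈ f i) (hyx : Tendsto y w (𝓝 x))
    (hx : x ∈ low n (p + q)) : ∀ᶠ i in (w : Filter ι), y i ∈ low n (p + q) := by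
  have h₁ : Tendsto (fun i => b * ‖tl n (p + q) (y i)‖) w (𝓝 0) := by
    have := (((tl n (p + q)).continuous.tendsto x).comp hyx).norm.const_mul b
    simpa [tl_eq_zero_iff.2 hx] using this
  filter_upwards [hs, hy, h₁.eventually (gt_mem_nhds one_pos)] with i hi hyi h
  by_contra hcon
  exact absurd (hi.gap _ hyi hcon) (not_le.2 h)

theorem eventually_mem_low' (hs : ∀ᶠ i in (w : Filter ι), IsSlice p q a b (f i)) {y : ι → Euc n}
    {x : Euc n} (hy : ∀ᶠ i in (w : Filter ι), y i ∈ f i) (hyx : Tendsto y w (𝓝 x))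
    (hx : x ∈ low n p) : ∀ᶠ i in (w : Filter ι), y i ∈ low n p := by
  have h₁ : Tendsto (fun i => ‖tl n p (y i)‖) w (𝓝 0) := by
    have := (((tl n p).continuous.tendsto x).comp hyx).norm
    simpa [tl_eq_zero_iff.2 hx] using this
  filter_upwards [hs, hy, h₁.eventually (gt_mem_nhds one_pos),
    eventually_mem_low hs hy hyx (low_mono (by omega) hx)] with i hi hyi h hl
  intro j hj
  obtain ⟨z, hz⟩ := hi.int _ hyi hl j hj
  have h2 := (norm_coord_le (tl n p (y i)) j).trans_lt h
  rw [tl_apply, if_pos hj, hz] at h2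
  have h3 : |z| < 1 := by
    have : ((|z| : ℤ) : ℝ) < 1 := by
      push_cast
      exact h2
    exact_mod_cast this
  rw [hz, Int.abs_lt_one_iff.1 h3, Int.cast_zero]

theorem tendsto_coord {l : Filter ι} {y : ι → Euc n} {x : Euc n} (h : Tendsto y l (𝓝 x))
    (j : Fin n) : Tendsto (fun i => y i j) l (𝓝 (x j)) :=
  ((EuclideanSpace.proj j : Euc n →L[ℝ] ℝ).continuous.tendsto x).comp h

theorem IsSlice.of_tendsto (hs : ∀ᶠ i in (w : Filter ι), IsSlice p q a b (f i))
    (h : Tendsto f w (𝓝 Γ)) : IsSlice p q a b Γ := by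
  refine ⟨fun x hx => ?_, fun i hi hi' => ?_, fun γ hγ hl j hj => ?_, fun γ hγ hl => ?_⟩
  · obtain ⟨y, hy⟩ := (hs.mono fun i hi => hi.cov x hx).choice
    obtain ⟨γ, hγ⟩ := exists_tendsto_of_norm_le (u := w) (y := y) (R := ‖x‖ + a) (by
      filter_upwards [hy] with i hi
      have := norm_sub_norm_le (y i) x
      rw [norm_sub_rev] at this
      linarith [hi.2.2])
    refine ⟨γ, Chabauty.mem_of_tendsto h (hy.mono fun i hi => hi.1) hγ,
      isClosed_low.mem_of_tendsto hγ (hy.mono fun i hi => hi.2.1), ?_⟩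
    exact le_of_tendsto (hγ.const_sub x).norm (hy.mono fun i hi => hi.2.2)
  · have : ∀ᶠ k in (w : Filter ι), ∃ γ, γ ∈ f k ∧ γ - bv i ∈ low n p ∧ ‖γ - bv i‖ ≤ a := by
      filter_upwards [hs] with k hk
      obtain ⟨γ, h₁, h₂⟩ := hk.lift i hi hi'
      obtain ⟨δ, h₃, h₄, h₅⟩ := hk.cov _ h₂
      refine ⟨γ - δ, sub_mem h₁ h₃, ?_, ?_⟩
      · rw [sub_right_comm]
        exact sub_mem h₂ h₄
      · rwa [sub_right_comm]
    obtain ⟨y, hy⟩ := this.choice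
    obtain ⟨γ, hγ⟩ := exists_tendsto_of_norm_le (u := w) (y := y) (R := ‖bv i‖ + a) (by
      filter_upwards [hy] with k hk
      have := norm_sub_norm_le (y k) (bv i)
      linarith [hk.2.2])
    exact ⟨γ, Chabauty.mem_of_tendsto h (hy.mono fun i hi => hi.1) hγ,
      isClosed_low.mem_of_tendsto (hγ.sub_const _) (hy.mono fun i hi => hi.2.1)⟩
  · obtain ⟨y, hy, hyx⟩ := Chabauty.exists_tendsto h hγ
    have hlow := eventually_mem_low hs (.of_forall hy) hyx hl
    have : γ j ∈ range ((↑) : ℤ → ℝ) := by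
      refine Int.isClosedEmbedding_coe_real.isClosed_range.mem_of_tendsto (tendsto_coord hyx j) ?_
      filter_upwards [hs, hlow] with i hi hl
      obtain ⟨z, hz⟩ := hi.int _ (hy i) hl j hj
      exact ⟨z, hz.symm⟩
    obtain ⟨z, hz⟩ := this
    exact ⟨z, hz.symm⟩
  · obtain ⟨y, hy, hyx⟩ := Chabauty.exists_tendsto h hγ
    have hev : ∀ᶠ i in (w : Filter ι), y i ∉ low n (p + q) :=
      hyx.eventually (isClosed_low.isOpen_compl.mem_nhds hl)
    refine ge_of_tendsto ((((tl n (p + q)).continuous.tendsto γ).comp hyx).norm.const_mul b) ?_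
    filter_upwards [hs, hev] with i hi hl
    exact hi.gap _ (hy i) hl

theorem isClosed_isSlice : IsClosed {Γ : ChabautyR n | IsSlice p q a b Γ} := by
  rw [isClosed_iff_ultrafilter]
  intro Γ w hw hs
  exact IsSlice.of_tendsto (f := id) hs hw

/-! #### Sizes -/

/-- The covering radius of `Γ ∩ ℝ^p` in `ℝ^p`. -/
noncomputable def covSz (p : ℕ) (Γ : ChabautyR n) : ℝ := sInf {c | Cov p c Γ}

/-- The inverse of the first norm of the projection of `Γ` to the coordinates of index at
least `m`. -/
noncomputable def gapSz (m : ℕ) (Γ : ChabautyR n) : ℝ := sInf {c | 0 ≤ c ∧ Gap m c Γ}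

theorem covSz_nonneg : 0 ≤ covSz p Γ := Real.sInf_nonneg fun _ hc => hc.nonneg

theorem gapSz_nonneg {m : ℕ} : 0 ≤ gapSz m Γ := Real.sInf_nonneg fun _ hc => hc.1

theorem Cov.covSz_le (h : Cov p c Γ) : covSz p Γ ≤ c := csInf_le ⟨0, fun _ hc' => Cov.nonneg hc'⟩ h

theorem Gap.gapSz_le {m : ℕ} (h : Gap m c Γ) (hc : 0 ≤ c) : gapSz m Γ ≤ c :=
  csInf_le (s := {c | 0 ≤ c ∧ Gap m c Γ}) ⟨0, fun _ hc' => hc'.1⟩ ⟨hc, h⟩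

theorem Cov.cov_covSz (h : Cov p c Γ) : Cov p (covSz p Γ) Γ := by
  intro x hx
  have hcl : IsClosed ((Γ : Set (Euc n)) ∩ low n p) := Γ.isClosed.inter isClosed_low
  have hne : ((Γ : Set (Euc n)) ∩ low n p).Nonempty := ⟨0, zero_mem Γ, zero_mem (low n p)⟩
  obtain ⟨y, hy, hyx⟩ := hcl.exists_infDist_eq_dist hne x
  refine ⟨y, hy.1, hy.2, ?_⟩
  refine le_csInf ⟨c, h⟩ fun c' hc' => ?_
  obtain ⟨γ, h₁, h₂, h₃⟩ := hc' x hx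
  rw [← dist_eq_norm, ← hyx]
  rw [← dist_eq_norm] at h₃
  have hγ : γ ∈ (Γ : Set (Euc n)) ∩ low n p := ⟨h₁, h₂⟩
  exact (Metric.infDist_le_dist_of_mem hγ).trans h₃

theorem Gap.gap_gapSz {m : ℕ} (h : Gap m c Γ) (hc : 0 ≤ c) : Gap m (gapSz m Γ) Γ := by
  intro γ hγ hl
  have hpos : 0 < ‖tl n m γ‖ := norm_pos_iff.2 fun h0 => hl (tl_eq_zero_iff.1 h0)
  rw [← div_le_iff₀ hpos]
  refine le_csInf ⟨c, hc, h⟩ fun c' hc' => ?_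
  rw [div_le_iff₀ hpos]
  exact hc'.2 γ hγ hl

theorem IsSlice.isSlice_sz (h : IsSlice p q a b Γ) (hb : 0 ≤ b) :
    IsSlice p q (covSz p Γ) (gapSz (p + q) Γ) Γ :=
  ⟨h.cov.cov_covSz, h.lift, h.int, h.gap.gap_gapSz hb⟩

theorem tendsto_covSz (hs : ∀ᶠ i in (w : Filter ι), IsSlice p q a b (f i))
    (h : Tendsto f w (𝓝 Γ)) : Tendsto (fun i => covSz p (f i)) w (𝓝 (covSz p Γ)) := by
  have hΓ := IsSlice.of_tendsto hs h
  rw [tendsto_order]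
  constructor
  · intro c hc
    by_contra hcon
    have hcon : ∀ᶠ i in (w : Filter ι), ¬ c < covSz p (f i) := Ultrafilter.eventually_not.2 hcon
    have : IsSlice p q c b Γ := by
      refine IsSlice.of_tendsto (f := f) (w := w) ?_ h
      filter_upwards [hs, hcon] with i hi hi'
      exact ⟨hi.cov.cov_covSz.mono (not_lt.1 hi'), hi.lift, hi.int, hi.gap⟩
    exact absurd this.cov.covSz_le (not_le.2 hc)
  · intro c hc
    by_contra hcon
    have hcon : ∀ᶠ i in (w : Filter ι), ¬ covSz p (f i) < c := Ultrafilter.eventually_not.2 hcon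
    obtain ⟨c', hc₁, hc₂⟩ := exists_between hc
    have : ∀ᶠ i in (w : Filter ι), ∃ x, x ∈ low n p ∧ ‖x‖ ≤ a ∧
        ∀ γ ∈ f i, γ ∈ low n p → c' < ‖x - γ‖ := by
      filter_upwards [hs, hcon] with i hi hi'
      have hn : ¬ Cov p c' (f i) := fun h' => hi' (h'.covSz_le.trans_lt hc₂)
      unfold Cov at hn
      push Not at hn
      obtain ⟨x, hx, hx'⟩ := hn
      obtain ⟨δ, h₁, h₂, h₃⟩ := hi.cov x hx
      refine ⟨x - δ, sub_mem hx h₂, h₃, fun γ hγ hl => ?_⟩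
      have := hx' (δ + γ) (add_mem h₁ hγ) (add_mem h₂ hl)
      rwa [sub_sub]
    obtain ⟨x, hx⟩ := this.choice
    obtain ⟨y, hy⟩ := exists_tendsto_of_norm_le (u := w) (y := x) (hx.mono fun i hi => hi.2.1)
    have hyl : y ∈ low n p := isClosed_low.mem_of_tendsto hy (hx.mono fun i hi => hi.1)
    obtain ⟨γ, h₁, h₂, h₃⟩ := hΓ.cov.cov_covSz y hyl
    obtain ⟨z, hz, hzγ⟩ := Chabauty.exists_tendsto h h₁
    have hzl := eventually_mem_low' hs (.of_forall hz) hzγ h₂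
    have := ge_of_tendsto (hy.sub hzγ).norm (b := c') (by
      filter_upwards [hx, hzl] with i hi hi'
      exact (hi.2.2 _ (hz i) hi').le)
    linarith

theorem tendsto_gapSz (hb : 0 ≤ b) (hs : ∀ᶠ i in (w : Filter ι), IsSlice p q a b (f i))
    (h : Tendsto f w (𝓝 Γ)) : Tendsto (fun i => gapSz (p + q) (f i)) w (𝓝 (gapSz (p + q) Γ)) := by
  have hΓ := IsSlice.of_tendsto hs h
  rw [tendsto_order]
  constructor
  · intro c hc
    by_contra hcon
    have hcon : ∀ᶠ i in (w : Filter ι), ¬ c < gapSz (p + q) (f i) :=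
      Ultrafilter.eventually_not.2 hcon
    have : IsSlice p q a c Γ := by
      refine IsSlice.of_tendsto (f := f) (w := w) ?_ h
      filter_upwards [hs, hcon] with i hi hi'
      exact ⟨hi.cov, hi.lift, hi.int, (hi.gap.gap_gapSz hb).mono (not_lt.1 hi')⟩
    have hc0 : 0 ≤ c := by
      obtain ⟨i, hi⟩ := hcon.exists
      exact gapSz_nonneg.trans (not_lt.1 hi)
    exact absurd (this.gap.gapSz_le hc0) (not_le.2 hc)
  · intro c hc
    by_contra hcon
    have hcon : ∀ᶠ i in (w : Filter ι), ¬ gapSz (p + q) (f i) < c :=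
      Ultrafilter.eventually_not.2 hcon
    obtain ⟨c', hc₁, hc₂⟩ := exists_between hc
    have hc0 : 0 < c' := gapSz_nonneg.trans_lt hc₁
    have : ∀ᶠ i in (w : Filter ι), ∃ γ, γ ∈ f i ∧ ‖γ‖ ≤ a + n + 1 / c' ∧
        1 ≤ b * ‖tl n (p + q) γ‖ ∧ c' * ‖tl n (p + q) γ‖ ≤ 1 := by
      filter_upwards [hs, hcon] with i hi hi'
      have hn : ¬ Gap (p + q) c' (f i) := fun h' => hi' ((h'.gapSz_le hc0.le).trans_lt hc₂)
      unfold Gap at hn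
      push Not at hn
      obtain ⟨γ, hγ, hl, hlt⟩ := hn
      obtain ⟨γ', h₁, h₂, h₃⟩ := hi.exists_reduce hγ
      have htl := tl_eq_of_sub_mem h₂
      refine ⟨γ', h₁, h₃.trans ?_, ?_, ?_⟩
      · have : ‖tl n (p + q) γ‖ ≤ 1 / c' := by
          rw [le_div_iff₀ hc0]
          linarith
        linarith
      · rw [← htl]
        exact hi.gap γ hγ hl
      · rw [← htl]
        exact hlt.le
    obtain ⟨y, hy⟩ := this.choice
    obtain ⟨γ, hγ⟩ := exists_tendsto_of_norm_le (u := w) (y := y) (hy.mono fun i hi => hi.2.1)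
    have htl := (((tl n (p + q)).continuous.tendsto γ).comp hγ).norm
    have hγΓ := Chabauty.mem_of_tendsto h (hy.mono fun i hi => hi.1) hγ
    have h₁ := ge_of_tendsto (htl.const_mul b) (hy.mono fun i hi => hi.2.2.1)
    have h₂ := le_of_tendsto (htl.const_mul c') (hy.mono fun i hi => hi.2.2.2)
    have hpos : 0 < ‖tl n (p + q) γ‖ := by
      rcases (norm_nonneg (tl n (p + q) γ)).eq_or_lt with h0 | h0
      · rw [← h0] at h₁
        norm_num at h₁
      · exact h0
    have hγl : γ ∉ low n (p + q) := fun h0 => by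
      rw [tl_eq_zero_iff.2 h0] at hpos
      simp at hpos
    have := hΓ.gap.gap_gapSz hb γ hγΓ hγl
    nlinarith

/-- The size of a point of a slice. -/
noncomputable def sz (p q : ℕ) (Γ : ChabautyR n) : ℝ := max (covSz p Γ) (gapSz (p + q) Γ)

theorem sz_nonneg : 0 ≤ sz p q Γ := le_max_of_le_left covSz_nonneg

theorem tendsto_sz (hb : 0 ≤ b) (hs : ∀ᶠ i in (w : Filter ι), IsSlice p q a b (f i))
    (h : Tendsto f w (𝓝 Γ)) : Tendsto (fun i => sz p q (f i)) w (𝓝 (sz p q Γ)) :=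
  (tendsto_covSz hs h).max (tendsto_gapSz hb hs h)

theorem IsSlice.sz_le (h : IsSlice p q c c Γ) : sz p q Γ ≤ c :=
  max_le h.cov.covSz_le (h.gap.gapSz_le h.cov.nonneg)

theorem IsSlice.self_sz (h : IsSlice p q a b Γ) (hb : 0 ≤ b) :
    IsSlice p q (sz p q Γ) (sz p q Γ) Γ :=
  (h.isSlice_sz hb).mono (le_max_left _ _) (le_max_right _ _)

theorem IsSlice.covSz_dil (h : IsSlice p q a b Γ) {t : ℝˣ} (ht : 0 < (t : ℝ)) :
    covSz p (dil n p q t • Γ) = t * covSz p Γ := by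
  have key : ∀ {Γ : ChabautyR n} {a b : ℝ}, IsSlice p q a b Γ → ∀ {t : ℝˣ}, 0 < (t : ℝ) →
      covSz p (dil n p q t • Γ) ≤ t * covSz p Γ := by
    intro Γ a b h t ht
    exact ((⟨h.cov.cov_covSz, h.lift, h.int, h.gap⟩ : IsSlice p q (covSz p Γ) b Γ).dilate ht).cov.covSz_le
  refine le_antisymm (key h ht) ?_
  have ht' : 0 < ((t⁻¹ : ℝˣ) : ℝ) := by simpa using ht
  have := key (h.dilate ht) ht'
  rw [smul_smul, ← dil_mul, inv_mul_cancel, dil_one, one_smul] at this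
  rw [Units.val_inv_eq_inv_val] at this
  calc (t : ℝ) * covSz p Γ ≤ t * ((t : ℝ)⁻¹ * covSz p (dil n p q t • Γ)) := by gcongr
    _ = _ := by rw [mul_inv_cancel_left₀ ht.ne']

theorem IsSlice.gapSz_dil (h : IsSlice p q a b Γ) (hb : 0 ≤ b) {t : ℝˣ} (ht : 0 < (t : ℝ)) :
    gapSz (p + q) (dil n p q t • Γ) = t * gapSz (p + q) Γ := by
  have key : ∀ {Γ : ChabautyR n} {a b : ℝ}, 0 ≤ b → IsSlice p q a b Γ → ∀ {t : ℝˣ}, 0 < (t : ℝ) →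
      gapSz (p + q) (dil n p q t • Γ) ≤ t * gapSz (p + q) Γ := by
    intro Γ a b hb h t ht
    exact ((h.isSlice_sz hb).dilate ht).gap.gapSz_le (mul_nonneg ht.le gapSz_nonneg)
  refine le_antisymm (key hb h ht) ?_
  have ht' : 0 < ((t⁻¹ : ℝˣ) : ℝ) := by simpa using ht
  have := key (mul_nonneg ht.le hb) (h.dilate ht) ht'
  rw [smul_smul, ← dil_mul, inv_mul_cancel, dil_one, one_smul] at this
  rw [Units.val_inv_eq_inv_val] at this
  calc (t : ℝ) * gapSz (p + q) Γ ≤ t * ((t : ℝ)⁻¹ * gapSz (p + q) (dil n p q t • Γ)) := by gcongr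
    _ = _ := by rw [mul_inv_cancel_left₀ ht.ne']

theorem IsSlice.sz_dil (h : IsSlice p q a b Γ) (hb : 0 ≤ b) {t : ℝˣ} (ht : 0 < (t : ℝ)) :
    sz p q (dil n p q t • Γ) = t * sz p q Γ := by
  rw [sz, sz, h.covSz_dil ht, h.gapSz_dil hb ht, mul_max_of_nonneg _ _ ht.le]

theorem IsSlice.sz_eq_zero_iff (h : IsSlice p q a b Γ) (hb : 0 ≤ b) :
    sz p q Γ = 0 ↔ Γ = Std n p q := by
  constructor
  · intro h0
    rw [← isSlice_zero_iff]
    have := h.self_sz hb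
    rwa [h0] at this
  · rintro rfl
    exact le_antisymm (isSlice_zero_iff.2 rfl).sz_le sz_nonneg

/-- Small slices are close to the standard subgroup. -/
theorem exists_isSlice_subset {W : Set (ChabautyR n)} (hW : W ∈ 𝓝 (Std n p q)) :
    ∃ ε > 0, ∀ Γ : ChabautyR n, IsSlice p q ε ε Γ → Γ ∈ W := by
  by_contra! hcon
  choose Γ hΓ hΓW using fun i : ℕ => hcon (1 / ((i : ℝ) + 1)) (by positivity)
  let w : Ultrafilter ℕ := Filter.hyperfilter ℕ
  have hw : (w : Filter ℕ) ≤ atTop := by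
    rw [← Nat.cofinite_eq_atTop]
    exact Filter.hyperfilter_le_cofinite
  obtain ⟨Δ, hΔ⟩ := Chabauty.exists_ultrafilter_limit w Γ
  have h₁ : Tendsto (fun i => sz p q (Γ i)) w (𝓝 (sz p q Δ)) :=
    tendsto_sz (a := 1) (b := 1) zero_le_one (.of_forall fun i => (hΓ i).mono
      (by rw [div_le_one (by positivity)]; simp) (by rw [div_le_one (by positivity)]; simp)) hΔ
  have h₂ : Tendsto (fun i => sz p q (Γ i)) w (𝓝 0) :=
    squeeze_zero (fun i => sz_nonneg) (fun i => (hΓ i).sz_le)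
      (tendsto_one_div_add_atTop_nhds_zero_nat.mono_left hw)
  have h₃ : IsSlice p q 1 1 Δ := IsSlice.of_tendsto (.of_forall fun i => (hΓ i).mono
      (by rw [div_le_one (by positivity)]; simp) (by rw [div_le_one (by positivity)]; simp)) hΔ
  have := (h₃.sz_eq_zero_iff zero_le_one).1 (tendsto_nhds_unique h₁ h₂)
  rw [this] at hΔ
  have hev : ∀ᶠ i in (w : Filter ℕ), Γ i ∈ W := hΔ hW
  obtain ⟨i, hi⟩ := hev.exists
  exact hΓW i hi

end Slices

/-! ### Links and their open cones -/

section Cones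

variable {n p q : ℕ} {a b c : ℝ} {Γ : ChabautyR n}

/-- The real unit attached to a non-zero real number (and `1` to zero). -/
noncomputable def ru (t : ℝ) : ℝˣ := if h : t = 0 then 1 else Units.mk0 t h

theorem ru_val {t : ℝ} (h : t ≠ 0) : (ru t : ℝ) = t := by simp [ru, h]

@[simp] theorem ru_one : ru 1 = 1 := Units.ext (by rw [ru_val one_ne_zero, Units.val_one])

theorem ru_mul {s t : ℝ} (hs : s ≠ 0) (ht : t ≠ 0) : ru (s * t) = ru s * ru t :=
  Units.ext (by rw [Units.val_mul, ru_val hs, ru_val ht, ru_val (mul_ne_zero hs ht)])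

theorem ru_inv {t : ℝ} (ht : t ≠ 0) : ru t⁻¹ = (ru t)⁻¹ :=
  Units.ext (by rw [Units.val_inv_eq_inv_val, ru_val ht, ru_val (inv_ne_zero ht)])

theorem ru_val_self (t : ℝˣ) : ru (t : ℝ) = t := Units.ext (ru_val t.ne_zero)

theorem ru_pos {t : ℝ} (h : 0 < t) : 0 < (ru t : ℝ) := by rwa [ru_val h.ne']

theorem continuousOn_ru : ContinuousOn ru {t | t ≠ 0} := by
  rw [continuousOn_iff_continuous_domRestrict, Units.isEmbedding_val₀.continuous_iff]
  have : (fun t : {t : ℝ | t ≠ 0} => ((ru t : ℝˣ) : ℝ)) = fun t => t.1 := by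
    funext t
    exact ru_val t.2
  change Continuous (fun t : {t : ℝ | t ≠ 0} => ((ru t : ℝˣ) : ℝ))
  rw [this]
  fun_prop

theorem continuousOn_sz (hb : 0 ≤ b) :
    ContinuousOn (sz (n := n) p q) {Γ | IsSlice p q a b Γ} := by
  rw [continuousOn_iff_continuous_domRestrict, continuous_iff_ultrafilter]
  intro Γ w hw
  have h : Tendsto (Subtype.val : {Γ : ChabautyR n | IsSlice p q a b Γ} → _) w (𝓝 Γ.1) :=
    (continuous_subtype_val.tendsto Γ).mono_left hw
  exact tendsto_sz hb (.of_forall fun i => i.2) h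

/-- Rescaling of a point of a slice to size one. -/
noncomputable def nz (p q : ℕ) (Γ : ChabautyR n) : ChabautyR n := dil n p q (ru (sz p q Γ)⁻¹) • Γ

theorem IsSlice.nz_isSlice (h : IsSlice p q a b Γ) (hb : 0 ≤ b) (h0 : sz p q Γ ≠ 0) :
    IsSlice p q 1 1 (nz p q Γ) ∧ sz p q (nz p q Γ) = 1 := by
  have hpos : 0 < sz p q Γ := lt_of_le_of_ne sz_nonneg h0.symm
  have hru : (ru (sz p q Γ)⁻¹ : ℝ) = (sz p q Γ)⁻¹ := ru_val (inv_ne_zero h0)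
  have ht : 0 < (ru (sz p q Γ)⁻¹ : ℝ) := ru_pos (inv_pos.2 hpos)
  constructor
  · have := (h.self_sz hb).dilate ht
    rwa [hru, inv_mul_cancel₀ h0] at this
  · rw [nz, h.sz_dil hb ht, hru, inv_mul_cancel₀ h0]

theorem dil_smul_nz (h0 : sz p q Γ ≠ 0) : dil n p q (ru (sz p q Γ)) • nz p q Γ = Γ := by
  rw [nz, smul_smul, ← dil_mul, ← ru_mul h0 (inv_ne_zero h0), mul_inv_cancel₀ h0, ru_one, dil_one,
    one_smul]

theorem nz_eq_self (h : sz p q Γ = 1) : nz p q Γ = Γ := by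
  simp [nz, h]

theorem IsSlice.nz_dil (h : IsSlice p q a b Γ) (hb : 0 ≤ b) {t : ℝˣ} (ht : 0 < (t : ℝ))
    (h0 : sz p q Γ ≠ 0) : nz p q (dil n p q t • Γ) = nz p q Γ := by
  rw [nz, nz, h.sz_dil hb ht, smul_smul, ← dil_mul]
  congr 2
  refine Units.ext ?_
  rw [Units.val_mul, ru_val (inv_ne_zero (mul_ne_zero ht.ne' h0)), ru_val (inv_ne_zero h0)]
  field_simp

theorem continuousOn_nz (hb : 0 ≤ b) :
    ContinuousOn (nz (n := n) p q) {Γ | IsSlice p q a b Γ ∧ sz p q Γ ≠ 0} := by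
  have h₁ : ContinuousOn (sz (n := n) p q) {Γ | IsSlice p q a b Γ ∧ sz p q Γ ≠ 0} :=
    (continuousOn_sz hb).mono fun Γ h => h.1
  have h₂ : ContinuousOn (fun Γ : ChabautyR n => dil n p q (ru (sz p q Γ)⁻¹))
      {Γ | IsSlice p q a b Γ ∧ sz p q Γ ≠ 0} :=
    continuous_dil.comp_continuousOn (continuousOn_ru.comp (h₁.inv₀ fun Γ h => h.2)
      fun Γ h => inv_ne_zero h.2)
  exact h₂.smul continuousOn_id

/-- The link of the standard subgroup: the points of size one of the slice. -/
abbrev Lk (n p q : ℕ) : Type := {Γ : ChabautyR n // IsSlice p q 1 1 Γ ∧ sz p q Γ = 1}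

instance : CompactSpace (Lk n p q) := by
  refine isCompact_iff_compactSpace (s := {Γ : ChabautyR n | IsSlice p q 1 1 Γ ∧ sz p q Γ = 1}).1 ?_
  refine IsClosed.isCompact ?_
  exact (continuousOn_sz zero_le_one).preimage_isClosed_of_isClosed isClosed_isSlice
    (isClosed_singleton (x := (1 : ℝ)))

/-- The parametrization of the slice by the cone over the link. -/
noncomputable def coneFun (n p q : ℕ) (ε : ℝ) : OpenCone (Lk n p q) → ChabautyR n :=
  Quot.lift (fun s => Sum.elim (fun _ => Std n p q)
    (fun lt : Lk n p q × Set.Ico (0 : ℝ) 1 => if lt.2.1 = 0 then Std n p q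
      else dil n p q (ru (ε * lt.2.1)) • lt.1.1) s) (by
    rintro _ _ ⟨l⟩
    simp)

@[simp] theorem coneFun_apex (ε : ℝ) : coneFun n p q ε OpenCone.apex = Std n p q := rfl

theorem coneFun_mk (ε : ℝ) (l : Lk n p q) {t : Set.Ico (0 : ℝ) 1} (ht : t.1 ≠ 0) :
    coneFun n p q ε (OpenCone.mk l t) = dil n p q (ru (ε * t.1)) • l.1 := by
  change (if t.1 = 0 then Std n p q else dil n p q (ru (ε * t.1)) • l.1) = _
  rw [if_neg ht]

theorem OpenCone.mk_eq_apex {L : Type u} (l : L) {t : Set.Ico (0 : ℝ) 1} (ht : t.1 = 0) :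
    OpenCone.mk l t = OpenCone.apex := by
  obtain ⟨t, ht'⟩ := t
  obtain rfl : t = 0 := ht
  exact Quot.sound (ConeRel.glue l)

theorem OpenCone.cases {L : Type u} (z : OpenCone L) :
    z = OpenCone.apex ∨ ∃ (l : L) (t : Set.Ico (0 : ℝ) 1), 0 < t.1 ∧ z = OpenCone.mk l t := by
  obtain ⟨(_ | ⟨l, t⟩), rfl⟩ := Quot.exists_rep z
  · exact .inl rfl
  · rcases t.2.1.eq_or_lt with h | h
    · exact .inl (OpenCone.mk_eq_apex l h.symm)
    · exact .inr ⟨l, t, h, rfl⟩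

theorem OpenCone.continuous_mk {L : Type u} [TopologicalSpace L] :
    Continuous fun lt : L × Set.Ico (0 : ℝ) 1 => OpenCone.mk lt.1 lt.2 :=
  continuous_quot_mk.comp continuous_inr

theorem coneFun_mk_spec {ε : ℝ} (hε : 0 < ε) (l : Lk n p q) (t : Set.Ico (0 : ℝ) 1) :
    IsSlice p q (ε * t.1) (ε * t.1) (coneFun n p q ε (OpenCone.mk l t)) ∧
      sz p q (coneFun n p q ε (OpenCone.mk l t)) = ε * t.1 := by
  rcases t.2.1.eq_or_lt with h | h
  · rw [OpenCone.mk_eq_apex l h.symm, coneFun_apex, ← h, mul_zero]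
    exact ⟨isSlice_zero_iff.2 rfl, ((isSlice_zero_iff.2 rfl).sz_eq_zero_iff le_rfl).2 rfl⟩
  · rw [coneFun_mk _ _ h.ne']
    have hpos : 0 < ε * t.1 := mul_pos hε h
    have h1 := l.2.1.dilate (ru_pos hpos)
    have h2 := l.2.1.sz_dil zero_le_one (ru_pos hpos)
    rw [l.2.2] at h2
    simp only [ru_val hpos.ne', mul_one] at h1 h2
    exact ⟨h1, h2⟩

theorem coneFun_spec {ε : ℝ} (hε : 0 < ε) (z : OpenCone (Lk n p q)) :
    ∃ c < ε, IsSlice p q c c (coneFun n p q ε z) := by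
  rcases OpenCone.cases z with rfl | ⟨l, t, ht, rfl⟩
  · exact ⟨0, hε, isSlice_zero_iff.2 rfl⟩
  · exact ⟨ε * t.1, mul_lt_of_lt_one_right hε t.2.2, (coneFun_mk_spec hε l t).1⟩

theorem continuous_coneFun {ε : ℝ} (hε : 0 < ε) : Continuous (coneFun n p q ε) := by
  refine continuous_quot_lift _ (continuous_sumElim.2 ⟨continuous_const, ?_⟩)
  rw [continuous_iff_continuousAt]
  rintro ⟨l, t⟩
  rcases t.2.1.eq_or_lt with h | h
  · have h0 : (if t.1 = 0 then Std n p q else dil n p q (ru (ε * t.1)) • l.1) = Std n p q :=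
      if_pos h.symm
    rw [ContinuousAt]
    simp only
    rw [h0]
    intro W hW
    obtain ⟨δ, hδ, hs⟩ := exists_isSlice_subset hW
    have hev : ∀ᶠ lt : Lk n p q × Set.Ico (0 : ℝ) 1 in 𝓝 (l, t), ε * lt.2.1 < δ := by
      have : Continuous fun lt : Lk n p q × Set.Ico (0 : ℝ) 1 => ε * lt.2.1 := by fun_prop
      refine this.continuousAt.eventually (gt_mem_nhds ?_)
      simpa [← h] using hδ
    refine Filter.mem_map.2 ?_
    filter_upwards [hev] with lt hlt
    have := (coneFun_mk_spec hε lt.1 lt.2).1.mono hlt.le hlt.le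
    exact hs _ this
  · have hc : ContinuousAt (fun lt : Lk n p q × Set.Ico (0 : ℝ) 1 =>
        dil n p q (ru (ε * lt.2.1)) • lt.1.1) (l, t) := by
      have h₁ : ContinuousAt (fun lt : Lk n p q × Set.Ico (0 : ℝ) 1 => ru (ε * lt.2.1)) (l, t) := by
        refine ContinuousAt.comp (g := ru) ?_ (by fun_prop)
        exact continuousOn_ru.continuousAt (isOpen_ne.mem_nhds (mul_pos hε h).ne')
      have h₂ : ContinuousAt (fun lt : Lk n p q × Set.Ico (0 : ℝ) 1 =>
          dil n p q (ru (ε * lt.2.1))) (l, t) :=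
        continuous_dil.continuousAt.comp (f := fun lt : Lk n p q × Set.Ico (0 : ℝ) 1 =>
          ru (ε * lt.2.1)) h₁
      exact h₂.smul (by fun_prop)
    refine hc.congr ?_
    have hev : ∀ᶠ lt : Lk n p q × Set.Ico (0 : ℝ) 1 in 𝓝 (l, t), lt.2.1 ≠ 0 := by
      have : Continuous fun lt : Lk n p q × Set.Ico (0 : ℝ) 1 => lt.2.1 := by fun_prop
      exact this.continuousAt.eventually_ne h.ne'
    filter_upwards [hev] with lt hlt
    rw [if_neg hlt]

/-- The small points of the slice. -/
abbrev Nb (n p q : ℕ) (ε : ℝ) : Type := {Γ : ChabautyR n // ∃ c < ε, IsSlice p q c c Γ}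

theorem Nb.isSlice {ε : ℝ} (Γ : Nb n p q ε) : IsSlice p q ε ε Γ.1 := by
  obtain ⟨c, hc, h⟩ := Γ.2
  exact h.mono hc.le hc.le

theorem Nb.sz_lt {ε : ℝ} (Γ : Nb n p q ε) : sz p q Γ.1 < ε := by
  obtain ⟨c, hc, h⟩ := Γ.2
  exact h.sz_le.trans_lt hc

theorem IsSlice.mem_Nb {ε : ℝ} (h : IsSlice p q a b Γ) (hb : 0 ≤ b) (hlt : sz p q Γ < ε) :
    ∃ c < ε, IsSlice p q c c Γ := ⟨_, hlt, h.self_sz hb⟩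

theorem Nb.continuous_sz {ε : ℝ} (hε : 0 < ε) : Continuous fun Γ : Nb n p q ε => sz p q Γ.1 :=
  (continuousOn_sz hε.le).comp_continuous continuous_subtype_val fun Γ => Γ.isSlice

/-- Inverse of the parametrization of the slice by the cone over the link. -/
noncomputable def coneInv (n p q : ℕ) {ε : ℝ} (hε : 0 < ε) (Γ : Nb n p q ε) :
    OpenCone (Lk n p q) :=
  if h : sz p q Γ.1 = 0 then OpenCone.apex
  else OpenCone.mk ⟨nz p q Γ.1, Γ.isSlice.nz_isSlice hε.le h⟩
    ⟨sz p q Γ.1 / ε, div_nonneg sz_nonneg hε.le, (div_lt_one hε).2 Γ.sz_lt⟩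

theorem coneInv_of_ne {ε : ℝ} (hε : 0 < ε) (Γ : Nb n p q ε) (h : sz p q Γ.1 ≠ 0) :
    coneInv n p q hε Γ = OpenCone.mk ⟨nz p q Γ.1, Γ.isSlice.nz_isSlice hε.le h⟩
    ⟨sz p q Γ.1 / ε, div_nonneg sz_nonneg hε.le, (div_lt_one hε).2 Γ.sz_lt⟩ := dif_neg h

/-- An open neighbourhood of the apex of the cone over a compact space contains a small cone. -/
theorem OpenCone.exists_subset {L : Type u} [TopologicalSpace L] [CompactSpace L]
    {V : Set (OpenCone L)} (hV : IsOpen V) (ha : OpenCone.apex ∈ V) :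
    ∃ δ > 0, ∀ (l : L) (t : Set.Ico (0 : ℝ) 1), t.1 < δ → OpenCone.mk l t ∈ V := by
  have hpre : IsOpen {lt : L × Set.Ico (0 : ℝ) 1 | OpenCone.mk lt.1 lt.2 ∈ V} :=
    hV.preimage OpenCone.continuous_mk
  obtain ⟨u, v, -, hv, hu', hv', huv⟩ := generalized_tube_lemma (s := (univ : Set L))
    isCompact_univ (t := {(⟨0, by norm_num⟩ : Set.Ico (0 : ℝ) 1)}) isCompact_singleton hpre (by
      rintro ⟨l, t⟩ ⟨-, ht⟩
      obtain rfl : t = _ := ht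
      change OpenCone.mk l _ ∈ V
      rwa [OpenCone.mk_eq_apex l rfl])
  obtain ⟨δ, hδ, hb⟩ := Metric.isOpen_iff.1 hv _ (hv' rfl)
  refine ⟨δ, hδ, fun l t ht => huv (⟨hu' (mem_univ l), hb ?_⟩ : (l, t) ∈ u ×ˢ v)⟩
  rw [Metric.mem_ball, Subtype.dist_eq, Real.dist_eq, sub_zero, abs_of_nonneg t.2.1]
  exact ht

theorem continuous_coneInv {ε : ℝ} (hε : 0 < ε) : Continuous (coneInv n p q hε) := by
  rw [continuous_iff_continuousAt]
  intro Γ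
  by_cases h : sz p q Γ.1 = 0
  · have h0 : coneInv n p q hε Γ = OpenCone.apex := dif_pos h
    rw [ContinuousAt, h0, tendsto_nhds]
    intro V hV ha
    obtain ⟨δ, hδ, hs⟩ := OpenCone.exists_subset hV ha
    have hev : ∀ᶠ Γ' : Nb n p q ε in 𝓝 Γ, sz p q Γ'.1 / ε < δ := by
      refine ((Nb.continuous_sz hε).div_const ε).continuousAt.eventually (gt_mem_nhds ?_)
      simpa [h] using hδ
    filter_upwards [hev] with Γ' hΓ'
    by_cases h' : sz p q Γ'.1 = 0
    · have h0 : coneInv n p q hε Γ' = OpenCone.apex := dif_pos h'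
      change coneInv n p q hε Γ' ∈ V
      rwa [h0]
    · change coneInv n p q hε Γ' ∈ V
      rw [coneInv_of_ne hε Γ' h']
      exact hs _ _ hΓ'
  · have hopen : IsOpen {Γ : Nb n p q ε | sz p q Γ.1 ≠ 0} :=
      isOpen_ne.preimage (Nb.continuous_sz hε)
    refine ContinuousOn.continuousAt (s := {Γ : Nb n p q ε | sz p q Γ.1 ≠ 0}) ?_
      (hopen.mem_nhds h)
    rw [continuousOn_iff_continuous_domRestrict]
    have hc : Continuous fun Γ : {Γ : Nb n p q ε | sz p q Γ.1 ≠ 0} =>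
        OpenCone.mk (⟨nz p q Γ.1.1, Γ.1.isSlice.nz_isSlice hε.le Γ.2⟩ : Lk n p q)
        ⟨sz p q Γ.1.1 / ε, div_nonneg sz_nonneg hε.le, (div_lt_one hε).2 Γ.1.sz_lt⟩ := by
      refine OpenCone.continuous_mk.comp (Continuous.prodMk ?_ ?_)
      · refine Continuous.subtype_mk ?_ _
        exact (continuousOn_nz hε.le).comp_continuous
          (continuous_subtype_val.comp continuous_subtype_val) fun Γ => ⟨Γ.1.isSlice, Γ.2⟩
      · refine Continuous.subtype_mk ?_ _
        exact ((Nb.continuous_sz hε).comp continuous_subtype_val).div_const ε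
    refine hc.congr fun Γ => ?_
    exact (coneInv_of_ne hε Γ.1 Γ.2).symm

/-- The small points of the slice form an open cone over the link. -/
noncomputable def coneHomeo (n p q : ℕ) {ε : ℝ} (hε : 0 < ε) :
    OpenCone (Lk n p q) ≃ₜ Nb n p q ε where
  toFun z := ⟨coneFun n p q ε z, coneFun_spec hε z⟩
  invFun := coneInv n p q hε
  left_inv z := by
    rcases OpenCone.cases z with rfl | ⟨l, t, ht, rfl⟩
    · exact dif_pos (((isSlice_zero_iff.2 rfl).sz_eq_zero_iff le_rfl).2 rfl)
    · have hs := coneFun_mk_spec hε l t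
      have hpos : 0 < ε * t.1 := mul_pos hε ht
      rw [coneInv_of_ne hε _ (by simp only [hs.2]; exact hpos.ne')]
      have h₁ : nz p q (coneFun n p q ε (OpenCone.mk l t)) = l.1 := by
        rw [coneFun_mk ε l ht.ne', l.2.1.nz_dil zero_le_one (ru_pos hpos) (by rw [l.2.2]; norm_num),
          nz_eq_self l.2.2]
      congr 1
      · exact Subtype.ext h₁
      · refine Subtype.ext ?_
        simp only [hs.2]
        exact mul_div_cancel_left₀ _ hε.ne'
  right_inv Γ := by
    refine Subtype.ext ?_
    by_cases h : sz p q Γ.1 = 0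
    · have h0 : coneInv n p q hε Γ = OpenCone.apex := dif_pos h
      simp only [h0, coneFun_apex]
      exact ((Γ.isSlice.sz_eq_zero_iff hε.le).1 h).symm
    · simp only [coneInv_of_ne hε Γ h]
      rw [coneFun_mk _ _ (div_ne_zero h hε.ne')]
      simp only
      rw [mul_div_cancel₀ _ hε.ne', dil_smul_nz h]
  continuous_toFun := (continuous_coneFun hε).subtype_mk _
  continuous_invFun := continuous_coneInv hε

end Cones

/-! ### Automorphisms that preserve the slices -/

section Parabolic

variable {n p q r s : ℕ} {a b c : ℝ} {Γ : ChabautyR n}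

theorem GLn.inv_mem_of_forall_mem {V : Submodule ℝ (Euc n)} (g : GLn n)
    (h : ∀ x ∈ V, g.val x ∈ V) : ∀ x ∈ V, (↑g⁻¹ : Euc n →L[ℝ] Euc n) x ∈ V := by
  have hinj : Function.Injective g.val.toLinearMap :=
    Function.LeftInverse.injective (g := (↑g⁻¹ : Euc n →L[ℝ] Euc n)) fun x => by
      simp
  have hle : V.map g.val.toLinearMap ≤ V := by
    rintro _ ⟨x, hx, rfl⟩
    exact h x hx
  have heq : V.map g.val.toLinearMap = V := by
    refine Submodule.eq_of_le_of_finrank_eq hle ?_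
    exact LinearEquiv.finrank_eq (Submodule.equivMapOfInjective _ hinj V).symm
  intro x hx
  rw [← heq] at hx
  obtain ⟨y, hy, rfl⟩ := hx
  have : (↑g⁻¹ : Euc n →L[ℝ] Euc n) (g.val y) = y := by simp
  exact this.symm ▸ hy

/-- The endomorphisms that preserve `ℝ^p` and `ℝ^(p+q)` and act trivially on their quotient. -/
def Qc (p q : ℕ) (g : Euc n →L[ℝ] Euc n) : Prop := ∀ x ∈ low n (p + q), g x - x ∈ low n p

theorem Qc.map_low {g : Euc n →L[ℝ] Euc n} (h : Qc p q g) {x : Euc n} (hx : x ∈ low n p) :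
    g x ∈ low n p := by
  simpa using add_mem (h x (low_mono (by omega) hx)) hx

theorem Qc.map_low' {g : Euc n →L[ℝ] Euc n} (h : Qc p q g) {x : Euc n} (hx : x ∈ low n (p + q)) :
    g x ∈ low n (p + q) := by
  simpa using add_mem (low_mono (n := n) (show p ≤ p + q by omega) (h x hx)) hx

theorem Qc.apply_coord {g : Euc n →L[ℝ] Euc n} (h : Qc p q g) {x : Euc n}
    (hx : x ∈ low n (p + q)) {i : Fin n} (hi : p ≤ (i : ℕ)) : g x i = x i := by
  have := h x hx i hi
  rw [PiLp.sub_apply] at this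
  linarith

theorem Qc.of_bv {g : Euc n →L[ℝ] Euc n}
    (h : ∀ i : Fin n, (i : ℕ) < p + q → g (bv i) - bv i ∈ low n p) : Qc p q g := by
  intro x hx
  have := clm_mem_of_mem_low (T := g - 1) (V := low n p) (m := p + q) (by simpa using h) hx
  simpa using this

theorem Qc.mul {g h : Euc n →L[ℝ] Euc n} (hg : Qc p q g) (hh : Qc p q h) : Qc p q (g * h) := by
  intro x hx
  have := add_mem (hg _ (hh.map_low' hx)) (hh x hx)
  rw [mul_apply_eq_comp]
  simpa using this

theorem Qc.inv {g : GLn n} (h : Qc p q g.val) : Qc p q (↑g⁻¹ : Euc n →L[ℝ] Euc n) := by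
  intro x hx
  have hy := GLn.inv_mem_of_forall_mem g (fun y hy => h.map_low' hy) x hx
  have := neg_mem (h _ hy)
  simpa using this

/-- The stabilizer of the slices. -/
def Qgrp (n p q : ℕ) : Subgroup (GLn n) where
  carrier := {g | Qc p q g.val}
  mul_mem' := fun hg hh => Qc.mul hg hh
  one_mem' := fun x _ => by simp
  inv_mem' := fun hg => Qc.inv hg

theorem mem_Qgrp {g : GLn n} : g ∈ Qgrp n p q ↔ Qc p q g.val := Iff.rfl

theorem IsSlice.smul (h : IsSlice p q a b Γ) {g : GLn n} (hg : g ∈ Qgrp n p q) (hb : 0 ≤ b) :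
    IsSlice p q (‖g.val‖ * a) (‖(↑g⁻¹ : Euc n →L[ℝ] Euc n)‖ * b) (g • Γ) := by
  have hgi : Qc p q (↑g⁻¹ : Euc n →L[ℝ] Euc n) := (Qgrp n p q).inv_mem hg
  rw [mem_Qgrp] at hg
  refine ⟨fun x hx => ?_, fun i hi hi' => ?_, fun γ hγ hl i hi => ?_, fun γ hγ hl => ?_⟩
  · obtain ⟨γ, h₁, h₂, h₃⟩ := h.cov _ (hgi.map_low hx)
    refine ⟨_, GLn.apply_mem_smul.2 h₁, hg.map_low h₂, ?_⟩
    have : x - g.val γ = g.val ((↑g⁻¹ : Euc n →L[ℝ] Euc n) x - γ) := by simp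
    rw [this]
    exact (g.val.le_opNorm _).trans (by gcongr)
  · obtain ⟨γ, h₁, h₂⟩ := h.lift i hi hi'
    refine ⟨_, GLn.apply_mem_smul.2 h₁, ?_⟩
    have := add_mem (hg.map_low h₂) (hg _ (bv_mem_low hi'))
    simpa using this
  · obtain ⟨γ, hγ', rfl⟩ := GLn.exists_of_mem_smul hγ
    have hl' : γ ∈ low n (p + q) := by simpa using hgi.map_low' hl
    rw [hg.apply_coord hl' hi]
    exact h.int γ hγ' hl' i hi
  · obtain ⟨γ, hγ', rfl⟩ := GLn.exists_of_mem_smul hγ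
    have hl' : γ ∉ low n (p + q) := fun h0 => hl (hg.map_low' h0)
    refine (h.gap γ hγ' hl').trans ?_
    have htl : tl n (p + q) γ =
        tl n (p + q) ((↑g⁻¹ : Euc n →L[ℝ] Euc n) (tl n (p + q) (g.val γ))) := by
      refine tl_eq_of_sub_mem ?_
      have := hgi.map_low' (sub_tl_mem_low (p + q) (g.val γ))
      simpa using this
    have : ‖tl n (p + q) γ‖ ≤ ‖(↑g⁻¹ : Euc n →L[ℝ] Euc n)‖ * ‖tl n (p + q) (g.val γ)‖ := by
      rw [htl]
      exact (norm_tl_le _ _).trans (ContinuousLinearMap.le_opNorm _ _)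
    calc b * ‖tl n (p + q) γ‖ ≤
        b * (‖(↑g⁻¹ : Euc n →L[ℝ] Euc n)‖ * ‖tl n (p + q) (g.val γ)‖) := by gcongr
      _ = _ := by ring

/-! #### Rigidity -/

theorem le_of_forall_exists_near {V W : Submodule ℝ (Euc n)} {δ : ℝ} (hδ : 0 < δ)
    (h : ∀ x ∈ V, ‖x‖ ≤ 2 * δ → ∃ w ∈ W, w ∈ V ∧ ‖x - w‖ ≤ δ) : V ≤ W := by
  intro x hx
  obtain ⟨w, hw, y, hy, rfl⟩ := (V ⊓ W).exists_add_mem_mem_orthogonal x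
  have hyV : y ∈ V := by simpa using V.sub_mem hx hw.1
  suffices y = 0 by
    subst this
    simpa using hw.2
  by_contra hy0
  have hpos : 0 < ‖y‖ := norm_pos_iff.2 hy0
  have hnorm : ‖(2 * δ / ‖y‖) • y‖ = 2 * δ := by
    rw [norm_smul, Real.norm_of_nonneg (by positivity)]
    field_simp
  obtain ⟨w', h₁, h₂, h₃⟩ := h ((2 * δ / ‖y‖) • y) (V.smul_mem _ hyV) hnorm.le
  have hinner : inner ℝ ((2 * δ / ‖y‖) • y) w' = 0 :=
    Submodule.inner_left_of_mem_orthogonal (K := V ⊓ W) ⟨h₂, h₁⟩ (Submodule.smul_mem _ _ hy)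
  have := norm_sub_sq_real ((2 * δ / ‖y‖) • y) w'
  rw [hinner, hnorm] at this
  nlinarith [norm_nonneg (((2 * δ / ‖y‖) • y : Euc n) - w'), norm_nonneg w']

/-- Automorphisms close to the identity that map a point of a small slice to a point of a slice
preserve the latter. -/
theorem IsSlice.rigid {δ δ' c' : ℝ} (hr : r ≤ p) (hs : p + q ≤ r + s) {g : GLn n}
    (h : IsSlice r s δ δ' Γ) (h' : IsSlice p q c c' (g • Γ)) (hδ : 0 < δ) (hc' : 0 ≤ c')
    (hg : ‖g.val - 1‖ ≤ δ) (hsmall : (c' + 1) * (6 * δ) < 1) : g ∈ Qgrp n p q := by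
  have h6 : 6 * δ < 1 := by nlinarith
  have h6' : c' * (6 * δ) < 1 := by nlinarith
  have hgn : ‖g.val‖ ≤ 2 := by
    calc ‖g.val‖ = ‖(g.val - 1) + 1‖ := by rw [sub_add_cancel]
      _ ≤ ‖g.val - 1‖ + ‖(1 : Euc n →L[ℝ] Euc n)‖ := norm_add_le _ _
      _ ≤ 1 + 1 := add_le_add (by linarith) ContinuousLinearMap.norm_id_le
      _ = 2 := by norm_num
  have hclose : ∀ {γ v : Euc n}, γ ∈ Γ → v ∈ low n (p + q) →
      (∀ i : Fin n, p ≤ (i : ℕ) → ∃ z : ℤ, v i = z) → ‖g.val γ - v‖ ≤ 6 * δ →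
      g.val γ - v ∈ low n p := by
    intro γ v hγ hv hvz hn
    refine h'.sub_mem_low (GLn.apply_mem_smul.2 hγ) hv hvz (hn.trans_lt h6) ?_
    exact (mul_le_mul_of_nonneg_left hn hc').trans_lt h6'
  have hlow : ∀ x ∈ low n r, g.val x ∈ low n p := by
    have : low n r ≤ (low n p).comap g.val.toLinearMap := by
      refine le_of_forall_exists_near hδ fun x hx hxn => ?_
      obtain ⟨γ, h₁, h₂, h₃⟩ := h.cov x hx
      refine ⟨γ, ?_, h₂, h₃⟩
      have hγn : ‖γ‖ ≤ 3 * δ := by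
        have := norm_sub_norm_le γ x
        rw [norm_sub_rev] at this
        linarith
      have := hclose h₁ (v := 0) (zero_mem _) (fun i _ => ⟨0, by simp⟩) (by
        rw [sub_zero]
        refine (g.val.le_opNorm γ).trans ?_
        nlinarith [norm_nonneg γ, norm_nonneg g.val])
      simpa using this
    exact fun x hx => this hx
  refine mem_Qgrp.2 (Qc.of_bv fun i hi => ?_)
  rcases lt_or_ge (i : ℕ) r with hir | hir
  · exact sub_mem (hlow _ (bv_mem_low hir)) (bv_mem_low (by omega))
  · obtain ⟨γ, h₁, h₂⟩ := h.lift i hir (by omega)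
    obtain ⟨η, h₃, h₄, h₅⟩ := h.cov _ h₂
    have hl : (γ - η) - bv i ∈ low n r := by
      rw [sub_right_comm]
      exact sub_mem h₂ h₄
    have hn : ‖(γ - η) - bv i‖ ≤ δ := by rwa [sub_right_comm]
    have key := hclose (sub_mem h₁ h₃) (v := bv i) (bv_mem_low hi) (fun j _ => by
        rw [bv_apply]
        split_ifs
        · exact ⟨1, by simp⟩
        · exact ⟨0, by simp⟩) (by
        have h1 : g.val (γ - η) - bv i = g.val ((γ - η) - bv i) + (g.val - 1) (bv i) := by
          rw [map_sub g.val (γ - η)]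
          simp
        rw [h1]
        refine (norm_add_le _ _).trans ?_
        have h2 := g.val.le_opNorm ((γ - η) - bv i)
        have h3 := (g.val - 1).le_opNorm (bv i)
        rw [norm_bv, mul_one] at h3
        nlinarith [norm_nonneg ((γ - η) - bv i), norm_nonneg g.val])
    have := sub_mem key (hlow _ hl)
    simpa using this

end Parabolic

/-! ### Spaces of matrices and automorphisms close to the identity -/

section Matrices

variable {n : ℕ}

/-- The endomorphisms with matrix entries supported in `S`. -/
def matSub (S : Finset (Fin n × Fin n)) : Submodule ℝ (Euc n →L[ℝ] Euc n) where
  carrier := {X | ∀ i j, (i, j) ∉ S → X (bv j) i = 0}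
  add_mem' := by
    intro X Y hX hY i j h
    simp [hX i j h, hY i j h]
  zero_mem' := by
    intro i j _
    simp
  smul_mem' := by
    intro c X hX i j h
    simp [hX i j h]

theorem finrank_matSub (S : Finset (Fin n × Fin n)) : Module.finrank ℝ (matSub S) = S.card := by
  classical
  let e : matSub S ≃ₗ[ℝ] (S → ℝ) :=
    { toFun := fun X s => X.1 (bv s.1.2) s.1.1
      map_add' := fun X Y => by ext; simp
      map_smul' := fun c X => by ext; simp
      invFun := fun v => ⟨ofCols fun j => WithLp.toLp 2 fun i =>
        if h : (i, j) ∈ S then v ⟨(i, j), h⟩ else 0, fun i j h => by simp [h]⟩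
      left_inv := fun X => by
        refine Subtype.ext (clm_ext_bv fun j => ?_)
        ext i
        simp only [ofCols_bv]
        split_ifs with h
        · rfl
        · exact (X.2 i j h).symm
      right_inv := fun v => by
        ext s
        simp }
  rw [e.finrank_eq, Module.finrank_fintype_fun_eq_card, Fintype.card_coe]

/-- The automorphism `1 + X`, for `X` of norm less than one. -/
noncomputable def oneAdd (X : Euc n →L[ℝ] Euc n) : GLn n :=
  if h : ‖X‖ < 1 then Units.oneSub (-X) (by rwa [norm_neg]) else 1

theorem oneAdd_val {X : Euc n →L[ℝ] Euc n} (h : ‖X‖ < 1) : (oneAdd X).val = 1 + X := by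
  simp [oneAdd, h]

theorem oneAdd_eq {X : Euc n →L[ℝ] Euc n} (h : ‖X‖ < 1) {g : GLn n} (hg : g.val = 1 + X) :
    oneAdd X = g := Units.ext ((oneAdd_val h).trans hg.symm)

@[simp] theorem oneAdd_zero : oneAdd (0 : Euc n →L[ℝ] Euc n) = 1 :=
  oneAdd_eq (by simp) (by simp)

theorem continuousOn_oneAdd : ContinuousOn (oneAdd (n := n)) {X | ‖X‖ < 1} := by
  rw [continuousOn_iff_continuous_domRestrict, GLn.continuous_iff]
  have : (fun X : {X : Euc n →L[ℝ] Euc n | ‖X‖ < 1} => (oneAdd X.1).val) = fun X => 1 + X.1 := by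
    funext X
    exact oneAdd_val X.2
  change Continuous fun X : {X : Euc n →L[ℝ] Euc n | ‖X‖ < 1} => (oneAdd X.1).val
  rw [this]
  fun_prop

theorem norm_oneAdd_inv_le {X : Euc n →L[ℝ] Euc n} (h : ‖X‖ ≤ 1 / 2) :
    ‖(↑(oneAdd X)⁻¹ : Euc n →L[ℝ] Euc n)‖ ≤ 2 := by
  refine ContinuousLinearMap.opNorm_le_bound _ (by norm_num) fun x => ?_
  set y := (↑(oneAdd X)⁻¹ : Euc n →L[ℝ] Euc n) x with hy
  have hx : x = y + X y := by
    have : (oneAdd X).val y = x := by simp [hy]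
    rw [← this, oneAdd_val (by linarith)]
    simp
  have h1 := norm_sub_le x (X y)
  have h2 : x - X y = y := by
    rw [hx]
    simp
  rw [h2] at h1
  have h3 := X.le_opNorm y
  nlinarith [norm_nonneg y]

theorem norm_oneAdd_le {X : Euc n →L[ℝ] Euc n} (h : ‖X‖ ≤ 1 / 2) : ‖(oneAdd X).val‖ ≤ 2 := by
  rw [oneAdd_val (by linarith)]
  have := norm_add_le 1 X
  have h1 : ‖(1 : Euc n →L[ℝ] Euc n)‖ ≤ 1 := ContinuousLinearMap.norm_id_le
  linarith

theorem oneAdd_inv_mul_sub_one_le {X Y : Euc n →L[ℝ] Euc n} (hX : ‖X‖ ≤ 1 / 2) (hY : ‖Y‖ ≤ 1 / 2) :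
    ‖((oneAdd Y)⁻¹ * oneAdd X).val - 1‖ ≤ 2 * (‖X‖ + ‖Y‖) := by
  have : ((oneAdd Y)⁻¹ * oneAdd X).val - 1 = (↑(oneAdd Y)⁻¹ : Euc n →L[ℝ] Euc n) * (X - Y) := by
    have h1 : (↑(oneAdd Y)⁻¹ : Euc n →L[ℝ] Euc n) * (oneAdd Y).val = 1 := Units.inv_mul _
    rw [Units.val_mul, oneAdd_val (X := X) (by linarith)]
    rw [oneAdd_val (X := Y) (by linarith)] at h1
    calc _ = (↑(oneAdd Y)⁻¹ : Euc n →L[ℝ] Euc n) * (1 + X) -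
          (↑(oneAdd Y)⁻¹ : Euc n →L[ℝ] Euc n) * (1 + Y) := by rw [h1]
      _ = _ := by rw [← mul_sub, add_sub_add_left_eq_sub]
  rw [this]
  refine (norm_mul_le _ _).trans ?_
  have := norm_oneAdd_inv_le hY
  have h2 := norm_sub_le X Y
  exact mul_le_mul this h2 (norm_nonneg _) (by norm_num)

end Matrices

/-- A criterion for open embeddings of products of subspaces. -/
theorem isOpenEmbedding_of_forall_eventually {A B Y : Type*} [TopologicalSpace A]
    [TopologicalSpace B] [TopologicalSpace Y] {P : A → Prop} {Q : B → Prop}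
    {F : {a // P a} × {b // Q b} → Y} (hc : Continuous F) (hi : Function.Injective F)
    (h : ∀ x, ∀ V ∈ 𝓝 (x.1.1, x.2.1), ∀ᶠ y in 𝓝 (F x), ∃ x', (x'.1.1, x'.2.1) ∈ V ∧ F x' = y) :
    IsOpenEmbedding F := by
  refine .of_continuous_injective_isOpenMap hc hi ?_
  rw [isOpenMap_iff_nhds_le]
  intro x U hU
  have hind : IsInducing (fun x : {a // P a} × {b // Q b} => (x.1.1, x.2.1)) :=
    IsInducing.subtypeVal.prodMap IsInducing.subtypeVal
  have hU' := Filter.mem_map.1 hU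
  rw [hind.nhds_eq_comap] at hU'
  obtain ⟨V, hV, hVU⟩ := hU'
  filter_upwards [h x V hV] with y ⟨x', hx', hy⟩
  rw [← hy]
  exact hVU hx'

/-! ### Charts transverse to the slices -/

section Transversal

variable {n p q : ℕ} {a b c : ℝ} {Γ : ChabautyR n}

/-- The matrix positions in the rows of index at least `p` and the columns of index less
than `p + q`. -/
def blockS (n p q : ℕ) : Finset (Fin n × Fin n) :=
  Finset.univ.filter fun ij => p ≤ (ij.1 : ℕ) ∧ (ij.2 : ℕ) < p + q

theorem mem_blockS {i j : Fin n} : (i, j) ∈ blockS n p q ↔ p ≤ (i : ℕ) ∧ (j : ℕ) < p + q := by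
  simp [blockS]

theorem mem_matSub_blockS {X : Euc n →L[ℝ] Euc n} : X ∈ matSub (blockS n p q) ↔
    (∀ x, ∀ i : Fin n, (i : ℕ) < p → X x i = 0) ∧ ∀ j : Fin n, p + q ≤ (j : ℕ) → X (bv j) = 0 := by
  constructor
  · intro h
    refine ⟨fun x i hi => ?_, fun j hj => ?_⟩
    · rw [clm_apply_eq_sum, WithLp.ofLp_sum, Finset.sum_apply]
      refine Finset.sum_eq_zero fun b _ => ?_
      rw [PiLp.smul_apply, h i b (by rw [mem_blockS]; omega), smul_zero]
    · ext i
      rw [h i j (by rw [mem_blockS]; omega)]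
      rfl
  · rintro ⟨h₁, h₂⟩ i j hij
    rw [mem_blockS, not_and_or, not_le, not_lt] at hij
    rcases hij with h | h
    · exact h₁ _ i h
    · rw [h₂ j h]
      rfl

theorem matSub_blockS_mul {X Y : Euc n →L[ℝ] Euc n} (hX : X ∈ matSub (blockS n p q))
    (hY : Y ∈ matSub (blockS n p q)) : X * Y ∈ matSub (blockS n p q) := by
  rw [mem_matSub_blockS] at *
  refine ⟨fun x i hi => hX.1 _ i hi, fun j hj => ?_⟩
  rw [mul_apply_eq_comp, hY.2 j hj, map_zero]

theorem tendsto_oneAdd {ι : Type*} {l : Filter ι} {Y : ι → Euc n →L[ℝ] Euc n}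
    {X : Euc n →L[ℝ] Euc n} (hX : ‖X‖ < 1) (h : Tendsto Y l (𝓝 X)) :
    Tendsto (fun i => oneAdd (Y i)) l (𝓝 (oneAdd X)) :=
  ((continuousOn_oneAdd.continuousAt
    ((isOpen_lt continuous_norm continuous_const).mem_nhds hX)).tendsto).comp h

theorem tendsto_oneAdd_sub_one {ι : Type*} {l : Filter ι} {T : ι → Euc n →L[ℝ] Euc n}
    (h : Tendsto T l (𝓝 1)) : Tendsto (fun i => oneAdd (T i - 1)) l (𝓝 1) := by
  have := tendsto_oneAdd (X := 0) (by simp) (Y := fun i => T i - 1) (by simpa using h.sub_const 1)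
  simpa using this

theorem eventually_oneAdd_sub_one {ι : Type*} {l : Filter ι} {T : ι → Euc n →L[ℝ] Euc n}
    (h : Tendsto T l (𝓝 1)) : ∀ᶠ i in l, (oneAdd (T i - 1)).val = T i := by
  have h0 : Tendsto (fun i => ‖T i - 1‖) l (𝓝 0) := by simpa using (h.sub_const 1).norm
  filter_upwards [h0.eventually (gt_mem_nhds one_pos)] with i hi
  rw [oneAdd_val hi, add_sub_cancel]

/-- Automorphisms close to the identity factor through the transversal and the stabilizer of the
slices. -/
theorem eventually_factor (p q : ℕ) {ε : ℝ} (hε : 0 < ε) {W : Set (GLn n)} (hW : W ∈ 𝓝 1) :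
    ∀ᶠ T in 𝓝 (1 : GLn n), ∃ X ∈ matSub (blockS n p q), ‖X‖ < ε ∧
      ∃ g ∈ Qgrp n p q, g ∈ W ∧ T = oneAdd X * g := by
  classical
  let A : GLn n → Euc n →L[ℝ] Euc n := fun T =>
    ofCols fun b => if (b : ℕ) < p + q then T.val (bv b) else bv b
  let K : GLn n → Euc n →L[ℝ] Euc n := fun T =>
    ofCols fun b => if (b : ℕ) < p + q then
      T.val (bv b) - tl n p (T.val (bv b)) + tl n p (bv b) else bv b
  have hval : Tendsto (fun T : GLn n => T.val) (𝓝 1) (𝓝 1) := Units.continuous_val.tendsto 1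
  have happ : ∀ b : Fin n, Tendsto (fun T : GLn n => T.val (bv b)) (𝓝 1) (𝓝 (bv b)) := fun b => by
    have := tendsto_clm_apply hval (tendsto_const_nhds (x := (bv b : Euc n)))
    simpa using this
  have hA : Tendsto A (𝓝 1) (𝓝 1) := by
    rw [← ofCols_bv_eq_one]
    refine tendsto_ofCols fun b => ?_
    split_ifs
    · exact happ b
    · exact tendsto_const_nhds
  have hK : Tendsto K (𝓝 1) (𝓝 1) := by
    rw [← ofCols_bv_eq_one]
    refine tendsto_ofCols fun b => ?_
    split_ifs
    · have := ((happ b).sub (((tl n p).continuous.tendsto _).comp (happ b))).add_const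
        (tl n p (bv b))
      simpa using this
    · exact tendsto_const_nhds
  let t : GLn n → GLn n := fun T => oneAdd (A T - 1)
  let k : GLn n → GLn n := fun T => oneAdd (K T - 1)
  have ht : Tendsto t (𝓝 1) (𝓝 1) := tendsto_oneAdd_sub_one hA
  have hk : Tendsto k (𝓝 1) (𝓝 1) := tendsto_oneAdd_sub_one hK
  have hh : Tendsto (fun T => t T * (k T)⁻¹) (𝓝 1) (𝓝 1) := by simpa using ht.mul hk.inv
  have hg : Tendsto (fun T => k T * (t T)⁻¹ * T) (𝓝 1) (𝓝 1) := by
    simpa using (hk.mul ht.inv).mul tendsto_id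
  have hX : Tendsto (fun T => ‖(t T * (k T)⁻¹).val - 1‖) (𝓝 1) (𝓝 0) := by
    simpa using (((Units.continuous_val.tendsto 1).comp hh).sub_const 1).norm
  filter_upwards [eventually_oneAdd_sub_one hA, eventually_oneAdd_sub_one hK, hg hW,
    hX.eventually (gt_mem_nhds hε), hX.eventually (gt_mem_nhds one_pos)] with T h₁ h₂ h₃ h₄ h₅
  have h₁ : (t T).val = A T := h₁
  have h₂ : (k T).val = K T := h₂
  refine ⟨_, ?_, h₄, _, ?_, h₃, ?_⟩
  · rw [mem_matSub_blockS]
    constructor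
    · intro x i hi
      obtain ⟨y, rfl⟩ : ∃ y, (k T).val y = x := ⟨_, GLn.apply_inv_self _ _⟩
      have : ((t T * (k T)⁻¹).val - 1) ((k T).val y) = (A T - K T) y := by
        rw [← h₁, ← h₂, Units.val_mul]
        simp
      rw [this, clm_apply_eq_sum, WithLp.ofLp_sum, Finset.sum_apply]
      refine Finset.sum_eq_zero fun b _ => ?_
      simp only [A, K, PiLp.smul_apply, sub_apply, ofCols_bv]
      split_ifs
      · simp [tl_apply, not_le.2 hi]
      · simp
    · intro j hj
      have e₁ : (t T).val (bv j) = bv j := by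
        rw [h₁]
        simp [A, not_lt.2 hj]
      have e₂ : (k T).val (bv j) = bv j := by
        rw [h₂]
        simp [K, not_lt.2 hj]
      have e₃ : (↑(k T)⁻¹ : Euc n →L[ℝ] Euc n) (bv j) = bv j := by
        conv_lhs => rw [← e₂]
        simp
      rw [Units.val_mul, sub_apply, mul_apply_eq_comp, e₃, e₁]
      simp
  · refine mem_Qgrp.2 (Qc.of_bv fun b hb => ?_)
    have e₁ : (t T).val (bv b) = T.val (bv b) := by
      rw [h₁]
      simp [A, hb]
    rw [Units.val_mul, Units.val_mul, mul_apply_eq_comp, mul_apply_eq_comp, ← e₁,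
      GLn.inv_apply_self, h₂]
    simp only [K, ofCols_bv, if_pos hb]
    have := sub_mem (sub_tl_mem_low p (T.val (bv b))) (sub_tl_mem_low p (bv b))
    convert this using 1
    abel
  · rw [oneAdd_eq h₅ (g := t T * (k T)⁻¹) (by rw [add_sub_cancel])]
    group

/-- A family of subgroups that converges to `ℝ^p × ℤ^q × 0` and contains a fine lattice of it
lies eventually in the slices. -/
theorem eventually_isSlice_of_tendsto {ι : Type*} {w : Ultrafilter ι} {f : ι → ChabautyR n}
    (h : Tendsto f w (𝓝 (Std n p q))) {η ε : ℝ} (hη : 0 < η) (hε : 0 < ε)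
    (h₁ : ∀ b : Fin n, (b : ℕ) < p → ∀ᶠ i in (w : Filter ι), η • bv b ∈ f i)
    (h₂ : ∀ b : Fin n, p ≤ (b : ℕ) → (b : ℕ) < p + q → ∀ᶠ i in (w : Filter ι), bv b ∈ f i) :
    ∀ᶠ i in (w : Filter ι), IsSlice p q (n * η) ε (f i) := by
  have h₁' : ∀ᶠ i in (w : Filter ι), ∀ b : Fin n, (b : ℕ) < p → η • bv b ∈ f i :=
    eventually_all.2 fun b => by
      by_cases hb : (b : ℕ) < p
      · filter_upwards [h₁ b hb] with i hi _ using hi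
      · exact .of_forall fun i hb' => absurd hb' hb
  have h₂' : ∀ᶠ i in (w : Filter ι), ∀ b : Fin n, p ≤ (b : ℕ) → (b : ℕ) < p + q → bv b ∈ f i :=
    eventually_all.2 fun b => by
      by_cases hb : p ≤ (b : ℕ) ∧ (b : ℕ) < p + q
      · filter_upwards [h₂ b hb.1 hb.2] with i hi _ _ using hi
      · exact .of_forall fun i hb' hb'' => absurd ⟨hb', hb''⟩ hb
  have hcov : ∀ᶠ i in (w : Filter ι), Cov p (n * η) (f i) := by
    filter_upwards [h₁'] with i hi x hx
    refine ⟨∑ b : Fin n, if (b : ℕ) < p then (round (x b / η)) • (η • bv b) else 0,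
      sum_mem fun b _ => ?_, Submodule.sum_mem _ fun b _ => ?_, ?_⟩
    · split_ifs with hb
      · exact zsmul_mem (hi b hb) _
      · exact zero_mem _
    · split_ifs with hb
      · exact zsmul_mem (Submodule.smul_mem _ _ (bv_mem_low hb)) _
      · exact zero_mem _
    · refine norm_le_card_mul fun a => ?_
      have : (∑ b : Fin n, if (b : ℕ) < p then (round (x b / η)) • (η • bv b) else 0 : Euc n) a =
          if (a : ℕ) < p then round (x a / η) * η else 0 := by
        rw [WithLp.ofLp_sum, Finset.sum_apply, Finset.sum_eq_single a]
        · split_ifs <;> simp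
        · intro b _ hb
          split_ifs <;> simp [bv_ne hb.symm]
        · simp
      rw [PiLp.sub_apply, this]
      split_ifs with ha
      · have e : x a - round (x a / η) * η = (x a / η - round (x a / η)) * η := by
          field_simp
        rw [e, abs_mul, abs_of_pos hη]
        have := abs_sub_round (x a / η)
        nlinarith
      · rw [hx a (by omega)]
        simpa using hη.le
  have hlift : ∀ᶠ i in (w : Filter ι), Lifts p q (f i) := by
    filter_upwards [h₂'] with i hi b hb hb'
    exact ⟨bv b, hi b hb hb', by simp⟩
  -- small vectors of the projection vanish
  have hsmall : ∀ᶠ i in (w : Filter ι), ∀ γ ∈ f i, ‖tl n p γ‖ < 1 / 4 → tl n p γ = 0 := by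
    by_contra hcon
    rw [← Ultrafilter.eventually_not] at hcon
    have hcon' : ∀ᶠ i in (w : Filter ι), ∃ γ, γ ∈ f i ∧ 1 / 4 ≤ ‖tl n p γ‖ ∧ ‖tl n p γ‖ ≤ 1 / 2 := by
      filter_upwards [hcon] with i hi
      push Not at hi
      obtain ⟨γ, hγ, hlt, hne⟩ := hi
      have hpos : 0 < ‖tl n p γ‖ := norm_pos_iff.2 hne
      obtain ⟨k, hk₁, hk₂⟩ : ∃ k : ℕ, 1 / 4 ≤ k * ‖tl n p γ‖ ∧ k * ‖tl n p γ‖ ≤ 1 / 2 := by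
        refine ⟨⌈1 / 4 / ‖tl n p γ‖⌉₊, ?_, ?_⟩
        · rw [← div_le_iff₀ hpos]
          exact Nat.le_ceil _
        · have := Nat.ceil_lt_add_one (show 0 ≤ 1 / 4 / ‖tl n p γ‖ by positivity)
          have h' := mul_lt_mul_of_pos_right this hpos
          rw [add_mul, div_mul_cancel₀ _ hpos.ne'] at h'
          linarith
      refine ⟨k • γ, nsmul_mem hγ k, ?_, ?_⟩
      all_goals rw [map_nsmul, ← Nat.cast_smul_eq_nsmul ℝ, norm_smul, Real.norm_natCast]; assumption
    obtain ⟨g, hg⟩ := hcon'.choice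
    have hred : ∀ᶠ i in (w : Filter ι), ∃ γ, γ ∈ f i ∧ g i - γ ∈ low n p ∧
        ‖γ‖ ≤ n * η + ‖tl n p (g i)‖ := by
      filter_upwards [hcov, hg] with i hi hgi
      exact hi.exists_reduce hgi.1
    obtain ⟨y, hy⟩ := hred.choice
    obtain ⟨x, hx⟩ := exists_tendsto_of_norm_le (u := w) (y := y) (R := n * η + 1 / 2) (by
      filter_upwards [hy, hg] with i hi hgi
      linarith [hi.2.2, hgi.2.2])
    have hxS := Chabauty.mem_of_tendsto h (hy.mono fun i hi => hi.1) hx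
    have htl : Tendsto (fun i => ‖tl n p (y i)‖) w (𝓝 ‖tl n p x‖) :=
      (((tl n p).continuous.tendsto x).comp hx).norm
    have hb : ∀ᶠ i in (w : Filter ι), 1 / 4 ≤ ‖tl n p (y i)‖ ∧ ‖tl n p (y i)‖ ≤ 1 / 2 := by
      filter_upwards [hy, hg] with i hi hgi
      rw [← tl_eq_of_sub_mem hi.2.1]
      exact hgi.2
    have hlow := ge_of_tendsto htl (hb.mono fun i hi => hi.1)
    have hup := le_of_tendsto htl (hb.mono fun i hi => hi.2)
    have : tl n p x = 0 := by
      rw [tl_eq_zero_iff]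
      intro a ha
      obtain ⟨z, hz⟩ := hxS.1 a ha
      have h1 := (norm_coord_le (tl n p x) a).trans hup
      rw [tl_apply, if_pos ha, hz] at h1
      have : ((|z| : ℤ) : ℝ) < 1 := by
        push_cast
        linarith
      have : |z| < 1 := by exact_mod_cast this
      rw [hz, Int.abs_lt_one_iff.1 this, Int.cast_zero]
    rw [this, norm_zero] at hlow
    linarith
  -- bounded vectors of the projection
  have hmain : ∀ᶠ i in (w : Filter ι), ∀ γ ∈ f i, ε * ‖tl n (p + q) γ‖ < 1 →
      γ ∈ low n (p + q) ∧ ∀ a : Fin n, p ≤ (a : ℕ) → ∃ z : ℤ, γ a = z := by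
    by_contra hcon
    rw [← Ultrafilter.eventually_not] at hcon
    have hcon' : ∀ᶠ i in (w : Filter ι), ∃ γ, γ ∈ f i ∧ ε * ‖tl n (p + q) γ‖ < 1 ∧
        ¬ (γ ∈ low n (p + q) ∧ ∀ a : Fin n, p ≤ (a : ℕ) → ∃ z : ℤ, γ a = z) := by
      filter_upwards [hcon] with i hi
      rw [not_forall] at hi
      obtain ⟨γ, hi⟩ := hi
      rw [Classical.not_imp, Classical.not_imp] at hi
      exact ⟨γ, hi⟩
    obtain ⟨g, hg⟩ := hcon'.choice
    have hred : ∀ᶠ i in (w : Filter ι), ∃ γ, γ ∈ f i ∧ ‖γ‖ ≤ n * η + (n + ε⁻¹) ∧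
        ¬ (γ ∈ low n (p + q) ∧ ∀ a : Fin n, p ≤ (a : ℕ) → ∃ z : ℤ, γ a = z) := by
      filter_upwards [hcov, hlift, hg] with i hi hl ⟨hgi, hgb, hgn⟩
      obtain ⟨δ, hδ, hδl, hδz, hδn⟩ := hl.exists_round (g i)
      obtain ⟨γ, hγ, hγl, hγn⟩ := hi.exists_reduce (sub_mem hgi hδ)
      refine ⟨γ, hγ, ?_, fun hbad => hgn ⟨?_, fun a ha => ?_⟩⟩
      · have : ‖tl n (p + q) (g i)‖ ≤ ε⁻¹ := by
          rw [← one_div, le_div_iff₀ hε]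
          linarith
        linarith
      · have := add_mem (add_mem (low_mono (n := n) (show p ≤ p + q by omega) hγl) hbad.1) hδl
        simpa using this
      · obtain ⟨z, hz⟩ := hbad.2 a ha
        obtain ⟨z', hz'⟩ := hδz a ha
        have := hγl a ha
        simp only [PiLp.sub_apply] at this
        exact ⟨z + z', by push_cast; linarith⟩
    obtain ⟨y, hy⟩ := hred.choice
    obtain ⟨x, hx⟩ := exists_tendsto_of_norm_le (u := w) (y := y) (R := n * η + (n + ε⁻¹))
      (hy.mono fun i hi => hi.2.1)
    have hxS := Chabauty.mem_of_tendsto h (hy.mono fun i hi => hi.1) hx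
    choose! z hz using hxS.1
    have hfar : ∀ᶠ i in (w : Filter ι), ‖tl n p (y i - x)‖ < 1 / 4 := by
      have : Tendsto (fun i => ‖tl n p (y i - x)‖) w (𝓝 0) := by
        have := (((tl n p).continuous.tendsto _).comp (hx.sub_const x)).norm
        simpa using this
      exact this.eventually (gt_mem_nhds (by norm_num))
    obtain ⟨i, hyi, hsi, hli, hfi⟩ := (hy.and (hsmall.and (h₂'.and hfar))).exists
    -- the integral part of the limit
    set v : Euc n := ∑ b : Fin n, if p ≤ (b : ℕ) ∧ (b : ℕ) < p + q then z b • bv b else 0 with hv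
    have hvf : v ∈ f i := sum_mem fun b _ => by
      split_ifs with hb
      · exact zsmul_mem (hli b hb.1 hb.2) _
      · exact zero_mem _
    have hva : ∀ a : Fin n, v a = if p ≤ (a : ℕ) ∧ (a : ℕ) < p + q then (z a : ℝ) else 0 := by
      intro a
      rw [hv, WithLp.ofLp_sum, Finset.sum_apply, Finset.sum_eq_single a]
      · split_ifs <;> simp
      · intro b _ hb
        split_ifs <;> simp [bv_ne hb.symm]
      · simp
    have hxv : x - v ∈ low n p := by
      intro a ha
      rw [PiLp.sub_apply, hva]
      split_ifs with h'
      · rw [hz a ha, sub_self]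
      · rw [hxS.2 a (by omega), sub_self]
    have e : tl n p (y i - v) = tl n p (y i - x) := tl_eq_of_sub_mem (by simpa using hxv)
    have h0 := hsi _ (sub_mem hyi.1 hvf) (by rwa [e])
    rw [tl_eq_zero_iff] at h0
    have hval : ∀ a : Fin n, p ≤ (a : ℕ) → y i a = v a := fun a ha => by
      have := h0 a ha
      rw [PiLp.sub_apply] at this
      linarith
    refine hyi.2.2 ⟨fun a ha => ?_, fun a ha => ?_⟩
    · rw [hval a (by omega), hva, if_neg (by omega)]
    · rw [hval a ha, hva]
      split_ifs
      · exact ⟨_, rfl⟩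
      · exact ⟨0, by simp⟩
  filter_upwards [hcov, hlift, hmain] with i hc hl hm
  refine ⟨hc, hl, fun γ hγ hγl => (hm γ hγ ?_).2, fun γ hγ hγl => ?_⟩
  · rw [tl_eq_zero_iff.2 hγl]
    simp
  · by_contra hlt
    exact hγl (hm γ hγ (not_le.1 hlt)).1

/-- Every subgroup close to `ℝ^p × ℤ^q × 0` is the image of a point of a small slice under an
element of the transversal. -/
theorem eventually_exists_slice (n p q : ℕ) {δ ε : ℝ} (hδ : 0 < δ) (hε : 0 < ε) :
    ∀ᶠ Γ in 𝓝 (Std n p q), ∃ X ∈ matSub (blockS n p q), ‖X‖ < δ ∧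
      ∃ ν, IsSlice p q ε ε ν ∧ oneAdd X • ν = Γ := by
  rw [Filter.Eventually, mem_iff_ultrafilter]
  intro w hw
  change ∀ᶠ Γ in (w : Filter (ChabautyR n)), _
  have hid : Tendsto (fun Γ : ChabautyR n => Γ) w (𝓝 (Std n p q)) := hw
  set η : ℝ := ε / (2 * (n + 1)) with hηdef
  have hη : 0 < η := by positivity
  have hc : ∀ b : Fin n, ∃ y : ChabautyR n → Euc n, Tendsto y w (𝓝 (bv b)) ∧
      ((b : ℕ) < p → ∀ Γ, η • y Γ ∈ Γ) ∧
      (p ≤ (b : ℕ) → (b : ℕ) < p + q → ∀ Γ, y Γ ∈ Γ) := by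
    intro b
    rcases lt_or_ge (b : ℕ) p with hb | hb
    · obtain ⟨y, hy, hyt⟩ := Chabauty.exists_tendsto hid (x := η • bv b) (mem_Std.2
        ⟨fun a ha => ⟨0, by
          rw [PiLp.smul_apply, bv_ne (by rintro rfl; omega)]
          simp⟩, Submodule.smul_mem _ _ (bv_mem_low (by omega))⟩)
      refine ⟨fun Γ => η⁻¹ • y Γ, ?_, fun _ Γ => ?_, fun h => by omega⟩
      · have := hyt.const_smul η⁻¹
        rwa [smul_smul, inv_mul_cancel₀ hη.ne', one_smul] at this
      · rw [smul_smul, mul_inv_cancel₀ hη.ne', one_smul]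
        exact hy Γ
    · rcases lt_or_ge (b : ℕ) (p + q) with hb' | hb'
      · obtain ⟨y, hy, hyt⟩ := Chabauty.exists_tendsto hid (x := bv b) (mem_Std.2
          ⟨fun a ha => by
            rw [bv_apply]
            split_ifs
            · exact ⟨1, by simp⟩
            · exact ⟨0, by simp⟩, bv_mem_low hb'⟩)
        exact ⟨y, hyt, fun h => by omega, fun _ _ => hy⟩
      · exact ⟨fun _ => bv b, tendsto_const_nhds, fun h => by omega, fun _ h => by omega⟩
  choose y hy hy₁ hy₂ using hc
  have hT : Tendsto (fun Γ => ofCols fun b => y b Γ) w (𝓝 1) := by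
    rw [← ofCols_bv_eq_one]
    exact tendsto_ofCols hy
  set T : ChabautyR n → GLn n := fun Γ => oneAdd (ofCols (fun b => y b Γ) - 1) with hTdef
  have hT1 : Tendsto T w (𝓝 1) := tendsto_oneAdd_sub_one hT
  have hν : Tendsto (fun Γ => (T Γ)⁻¹ • Γ) w (𝓝 (Std n p q)) := by
    simpa using GLn.tendsto_smul hT1.inv hid
  have hTb : ∀ᶠ Γ in (w : Filter _), ∀ b, (T Γ).val (bv b) = y b Γ := by
    filter_upwards [eventually_oneAdd_sub_one hT] with Γ hΓ b
    have : (T Γ).val = ofCols fun b => y b Γ := hΓ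
    rw [this, ofCols_bv]
  have hs := eventually_isSlice_of_tendsto hν hη (half_pos hε)
    (fun b hb => by
      filter_upwards [hTb] with Γ hΓ
      rw [GLn.mem_smul, inv_inv, map_smul, hΓ]
      exact hy₁ b hb Γ)
    (fun b hb hb' => by
      filter_upwards [hTb] with Γ hΓ
      rw [GLn.mem_smul, inv_inv, hΓ]
      exact hy₂ b hb hb' Γ)
  have hWn : {g : GLn n | ‖g.val‖ < 2 ∧ ‖(↑g⁻¹ : Euc n →L[ℝ] Euc n)‖ < 2} ∈ 𝓝 (1 : GLn n) := by
    refine IsOpen.mem_nhds ((isOpen_lt Units.continuous_val.norm continuous_const).inter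
      (isOpen_lt (Units.continuous_val.comp continuous_inv).norm continuous_const)) ?_
    have : ‖(1 : Euc n →L[ℝ] Euc n)‖ < 2 := ContinuousLinearMap.norm_id_le.trans_lt one_lt_two
    exact ⟨this, by simpa using this⟩
  filter_upwards [hs, hT1 (eventually_factor p q hδ hWn)] with Γ hΓ ⟨X, hX, hXn, g, hg, hgW, hTX⟩
  have hm : (n : ℝ) * η ≤ ε / 2 := by
    rw [hηdef, mul_div_assoc', div_le_div_iff₀ (by positivity) two_pos]
    nlinarith
  refine ⟨X, hX, hXn, g • (T Γ)⁻¹ • Γ, (hΓ.smul hg (half_pos hε).le).mono ?_ ?_, ?_⟩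
  · have : (0 : ℝ) ≤ n * η := by positivity
    nlinarith [hgW.1]
  · nlinarith [hgW.2]
  · rw [smul_smul, smul_smul, ← hTX, mul_inv_cancel, one_smul]

end Transversal

section Chart

variable {n p q : ℕ} {a b c : ℝ} {Γ : ChabautyR n}

theorem eq_of_oneAdd_eq_mul {X Y : Euc n →L[ℝ] Euc n} (hX : X ∈ matSub (blockS n p q))
    (hY : Y ∈ matSub (blockS n p q)) (hXn : ‖X‖ < 1) (hYn : ‖Y‖ < 1) {g : GLn n}
    (hg : g ∈ Qgrp n p q) (h : oneAdd X = oneAdd Y * g) : X = Y := by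
  rw [mem_matSub_blockS] at hX hY
  rw [mem_Qgrp] at hg
  have hv : ∀ x, x + X x = g.val x + Y (g.val x) := by
    intro x
    have := congrArg (fun g : GLn n => g.val x) h
    simpa [oneAdd_val hXn, oneAdd_val hYn] using this
  refine clm_ext_bv fun j => ?_
  rcases lt_or_ge (j : ℕ) (p + q) with hj | hj
  · have hgj : g.val (bv j) = bv j := by
      rw [← sub_eq_zero]
      ext i
      rcases lt_or_ge (i : ℕ) p with hi | hi
      · have := congrArg (fun x : Euc n => x i) (hv (bv j))
        simp only [PiLp.add_apply, hX.1 _ i hi, hY.1 _ i hi] at this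
        simp only [PiLp.sub_apply, PiLp.zero_apply]
        linarith
      · exact hg (bv j) (bv_mem_low hj) i hi
    have := hv (bv j)
    rwa [hgj, add_right_inj] at this
  · rw [hX.2 j hj, hY.2 j hj]

theorem oneAdd_smul_injective {X Y : Euc n →L[ℝ] Euc n} (hX : X ∈ matSub (blockS n p q))
    (hY : Y ∈ matSub (blockS n p q)) (hXn : ‖X‖ ≤ 1 / 40) (hYn : ‖Y‖ ≤ 1 / 40)
    {ν ν' : ChabautyR n} (hν : IsSlice p q (1 / 40) (1 / 40) ν)
    (hν' : IsSlice p q (1 / 40) (1 / 40) ν') (h : oneAdd X • ν = oneAdd Y • ν') :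
    X = Y ∧ ν = ν' := by
  have hg : ((oneAdd Y)⁻¹ * oneAdd X) • ν = ν' := by
    rw [mul_smul, h, inv_smul_smul]
  have hn := oneAdd_inv_mul_sub_one_le (X := X) (Y := Y) (by linarith) (by linarith)
  have hQ : (oneAdd Y)⁻¹ * oneAdd X ∈ Qgrp n p q :=
    IsSlice.rigid (r := p) (s := q) (δ := 1 / 10) le_rfl le_rfl
      (hν.mono (by norm_num) le_rfl) (hg.symm ▸ hν') (by norm_num) (by norm_num) (by linarith)
      (by norm_num)
  have hXY := eq_of_oneAdd_eq_mul hX hY (by linarith) (by linarith) hQ (by group)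
  refine ⟨hXY, ?_⟩
  subst hXY
  simpa using h

theorem dil_bv (t : ℝˣ) (j : Fin n) : ∃ c : ℝ, (dil n p q t).val (bv j) = c • bv j := by
  refine ⟨if (j : ℕ) < p then (t : ℝ) else if (j : ℕ) < p + q then 1 else (t : ℝ)⁻¹, ?_⟩
  ext i
  rw [dil_apply, PiLp.smul_apply, smul_eq_mul, bv_apply]
  by_cases hij : i = j
  · subst hij
    rfl
  · simp [hij]

theorem dil_conj_mem_matSub {X : Euc n →L[ℝ] Euc n} (hX : X ∈ matSub (blockS n p q)) (t : ℝˣ) :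
    (↑(dil n p q t)⁻¹ : Euc n →L[ℝ] Euc n) * X * (dil n p q t).val ∈ matSub (blockS n p q) := by
  rw [mem_matSub_blockS] at hX ⊢
  refine ⟨fun x i hi => ?_, fun j hj => ?_⟩
  · rw [mul_apply_eq_comp, mul_apply_eq_comp, ← dil_inv, dil_apply, hX.1 _ i hi, mul_zero]
  · obtain ⟨c, hc⟩ := dil_bv (p := p) (q := q) t j
    rw [mul_apply_eq_comp, mul_apply_eq_comp, hc, map_smul, hX.2 j hj, smul_zero, map_zero]

theorem exists_pos_dil_mem (hν : IsSlice p q c c Γ) {W : Set (ChabautyR n)}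
    (hW : W ∈ 𝓝 (Std n p q)) {δ : ℝ} (hδ : 0 < δ) :
    ∃ t : ℝˣ, 0 < (t : ℝ) ∧ dil n p q t • Γ ∈ W ∧ IsSlice p q δ δ (dil n p q t • Γ) := by
  obtain ⟨ε, hε, hs⟩ := exists_isSlice_subset hW
  have hc : 0 ≤ c := hν.cov.nonneg
  have ht : 0 < min ε δ / (c + 1) := by positivity
  have hle : min ε δ / (c + 1) * c ≤ min ε δ := by
    rw [div_mul_eq_mul_div, div_le_iff₀ (by positivity)]
    nlinarith [lt_min hε hδ]
  have := hν.dilate (ru_pos ht)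
  rw [ru_val ht.ne'] at this
  have := this.mono hle hle
  exact ⟨ru (min ε δ / (c + 1)), ru_pos ht, hs _ (this.mono (min_le_left _ _) (min_le_left _ _)),
    this.mono (min_le_right _ _) (min_le_right _ _)⟩

/-- The parametrization by the transversal and the slice is open. -/
theorem eventually_exists_oneAdd_smul {X₀ : Euc n →L[ℝ] Euc n} (hX₀ : X₀ ∈ matSub (blockS n p q))
    (hX₀n : ‖X₀‖ < 1) {ν₀ : ChabautyR n} {ε : ℝ} (hν₀ : ∃ c < ε, IsSlice p q c c ν₀)
    {V : Set ((Euc n →L[ℝ] Euc n) × ChabautyR n)} (hV : V ∈ 𝓝 (X₀, ν₀)) :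
    ∀ᶠ y in 𝓝 (oneAdd X₀ • ν₀), ∃ X ∈ matSub (blockS n p q), ∃ ν, (∃ c < ε, IsSlice p q c c ν) ∧
      (X, ν) ∈ V ∧ oneAdd X • ν = y := by
  obtain ⟨c, hcε, hc⟩ := hν₀
  rw [Filter.Eventually, mem_iff_ultrafilter]
  intro w hw
  change ∀ᶠ y in (w : Filter (ChabautyR n)), _
  have hid : Tendsto (fun Γ : ChabautyR n => Γ) w (𝓝 (oneAdd X₀ • ν₀)) := hw
  have h40 : (0 : ℝ) < 1 / 40 := by norm_num
  obtain ⟨t, ht, htW, hts⟩ := exists_pos_dil_mem hc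
    ((eventually_exists_slice n p q h40 h40).eventually_nhds) h40
  have h₀ : Tendsto (fun y => dil n p q t • (oneAdd X₀)⁻¹ • y) w (𝓝 (dil n p q t • ν₀)) := by
    have := (hid.const_smul (oneAdd X₀)⁻¹).const_smul (dil n p q t)
    simpa using this
  obtain ⟨X, hX⟩ := (h₀.eventually htW).choice
  have hXm := hX.mono fun y hy => hy.1
  obtain ⟨ν, hν⟩ := (hX.mono fun y hy => hy.2.2).choice
  obtain ⟨X₁, hX₁⟩ : ∃ X₁, Tendsto X w (𝓝 X₁) := by
    have : ProperSpace (Euc n →L[ℝ] Euc n) := FiniteDimensional.proper ℝ _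
    obtain ⟨X₁, -, h₁⟩ := (isCompact_closedBall (0 : Euc n →L[ℝ] Euc n) (1 / 40)).ultrafilter_le_nhds
      (w.map X) (le_principal_iff.2 (by
        change ∀ᶠ i in (w : Filter (ChabautyR n)), X i ∈ Metric.closedBall 0 (1 / 40)
        filter_upwards [hX] with y hy
        simpa using hy.2.1.le))
    exact ⟨X₁, h₁⟩
  obtain ⟨ν₁, hν₁⟩ := Chabauty.exists_ultrafilter_limit w ν
  have hX₁m : X₁ ∈ matSub (blockS n p q) :=
    (Submodule.closed_of_finiteDimensional (matSub (blockS n p q))).mem_of_tendsto hX₁ hXm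
  have hX₁n : ‖X₁‖ ≤ 1 / 40 := le_of_tendsto hX₁.norm (hX.mono fun y hy => hy.2.1.le)
  have hν₁s : IsSlice p q (1 / 40) (1 / 40) ν₁ := IsSlice.of_tendsto (hν.mono fun y hy => hy.1) hν₁
  have heq : oneAdd X₁ • ν₁ = oneAdd (0 : Euc n →L[ℝ] Euc n) • dil n p q t • ν₀ := by
    rw [oneAdd_zero, one_smul]
    refine tendsto_nhds_unique (GLn.tendsto_smul (tendsto_oneAdd (by linarith) hX₁) hν₁) ?_
    exact h₀.congr' (hν.mono fun y hy => hy.2.symm)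
  obtain ⟨rfl, rfl⟩ := oneAdd_smul_injective hX₁m (zero_mem _) hX₁n (by simp) hν₁s hts heq
  set Y : ChabautyR n → Euc n →L[ℝ] Euc n := fun y =>
    (↑(dil n p q t)⁻¹ : Euc n →L[ℝ] Euc n) * X y * (dil n p q t).val with hYdef
  have hY : Tendsto Y w (𝓝 0) := by
    have := (hX₁.const_mul (↑(dil n p q t)⁻¹ : Euc n →L[ℝ] Euc n)).mul_const (dil n p q t).val
    simpa using this
  have hX' : Tendsto (fun y => X₀ + Y y + X₀ * Y y) w (𝓝 X₀) := by
    have := (hY.const_add X₀).add (hY.const_mul X₀)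
    simpa using this
  have hν' : Tendsto (fun y => (dil n p q t)⁻¹ • ν y) w (𝓝 ν₀) := by
    have := hν₁.const_smul (dil n p q t)⁻¹
    rwa [inv_smul_smul] at this
  have hti : 0 < ((t⁻¹ : ℝˣ) : ℝ) := by
    rw [Units.val_inv_eq_inv_val]
    positivity
  have hsl : ∀ᶠ y in (w : Filter (ChabautyR n)), IsSlice p q (((t⁻¹ : ℝˣ) : ℝ) * (1 / 40))
      (((t⁻¹ : ℝˣ) : ℝ) * (1 / 40)) ((dil n p q t)⁻¹ • ν y) := by
    filter_upwards [hν] with y hy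
    rw [← dil_inv]
    exact hy.1.dilate hti
  have hsz := tendsto_sz (by positivity) hsl hν'
  filter_upwards [hX, hν, hX'.norm.eventually (gt_mem_nhds hX₀n), hsl,
    hsz.eventually (gt_mem_nhds (hc.sz_le.trans_lt hcε)), (hX'.prodMk_nhds hν') hV]
    with y h₁ h₂ h₃ h₄ h₅ h₆
  have hYm : Y y ∈ matSub (blockS n p q) := dil_conj_mem_matSub h₁.1 t
  refine ⟨_, add_mem (add_mem hX₀ hYm) (matSub_blockS_mul hX₀ hYm), _,
    h₄.mem_Nb (by positivity) h₅, h₆, ?_⟩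
  rw [oneAdd_eq h₃ (g := oneAdd X₀ * ((dil n p q t)⁻¹ * oneAdd (X y) * dil n p q t))]
  · rw [smul_smul, mul_assoc, mul_assoc, mul_inv_cancel, mul_one, mul_smul, mul_smul, h₂.2,
      inv_smul_smul, smul_inv_smul]
  · simp only [Units.val_mul, oneAdd_val hX₀n, oneAdd_val (h₁.2.1.trans (by norm_num : (1/40:ℝ) < 1)),
      hYdef]
    have : (↑(dil n p q t)⁻¹ : Euc n →L[ℝ] Euc n) * (dil n p q t).val = 1 := Units.inv_mul _
    rw [mul_add (↑(dil n p q t)⁻¹ : Euc n →L[ℝ] Euc n), mul_one,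
      add_mul (↑(dil n p q t)⁻¹ : Euc n →L[ℝ] Euc n), this, add_mul, one_mul, mul_add, mul_one]
    abel

theorem continuous_oneAdd_smul {δ : ℝ} (hδ : δ ≤ 1) {P : (Euc n →L[ℝ] Euc n) → Prop}
    {Q : ChabautyR n → Prop} : Continuous fun x : {X : Euc n →L[ℝ] Euc n // P X ∧ ‖X‖ < δ} ×
      {ν : ChabautyR n // Q ν} => oneAdd x.1.1 • x.2.1 := by
  have h : Continuous fun X : {X : Euc n →L[ℝ] Euc n // P X ∧ ‖X‖ < δ} => oneAdd X.1 :=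
    continuousOn_oneAdd.comp_continuous continuous_subtype_val fun X => X.2.2.trans_le hδ
  exact (h.comp continuous_fst).smul (continuous_subtype_val.comp continuous_snd)

/-- The parametrization of a neighbourhood of `ℝ^p × ℤ^q × 0` by the transversal and the slice. -/
theorem isOpenEmbedding_chart (n p q : ℕ) {δ ε : ℝ} (hδ : δ ≤ 1 / 40) (hε : ε ≤ 1 / 40) :
    IsOpenEmbedding fun x : {X : Euc n →L[ℝ] Euc n // X ∈ matSub (blockS n p q) ∧ ‖X‖ < δ} ×
      Nb n p q ε => oneAdd x.1.1 • x.2.1 := by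
  refine isOpenEmbedding_of_forall_eventually (continuous_oneAdd_smul (by linarith)) ?_ ?_
  · rintro ⟨X, ν⟩ ⟨Y, ν'⟩ h
    obtain ⟨h₁, h₂⟩ := oneAdd_smul_injective X.2.1 Y.2.1 (X.2.2.le.trans hδ) (Y.2.2.le.trans hδ)
      ((Nb.isSlice ν).mono hε hε) ((Nb.isSlice ν').mono hε hε) h
    exact Prod.ext (Subtype.ext h₁) (Subtype.ext h₂)
  · rintro ⟨X, ν⟩ V hV
    have hV' : V ∩ {x | ‖x.1‖ < δ} ∈ 𝓝 (X.1, ν.1) := inter_mem hV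
      ((isOpen_lt continuous_fst.norm continuous_const).mem_nhds X.2.2)
    filter_upwards [eventually_exists_oneAdd_smul X.2.1 (X.2.2.trans_le (by linarith)) ν.2 hV']
      with y ⟨X', hX', ν', hν', hm, hy⟩
    exact ⟨(⟨X', hX', hm.2⟩, ⟨ν', hν'⟩), hm.1, hy⟩

/-- A ball of a subspace of a normed space, parametrized by a Euclidean space. -/
theorem Submodule.exists_homeomorph_ball {E : Type*} [NormedAddCommGroup E] [NormedSpace ℝ E]
    [FiniteDimensional ℝ E] (V : Submodule ℝ E) {d : ℕ} (hd : Module.finrank ℝ V = d) {δ : ℝ}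
    (hδ : 0 < δ) : ∃ e : Euc d ≃ₜ {X : E // X ∈ V ∧ ‖X‖ < δ}, (e 0).1 = 0 := by
  have hf : Module.finrank ℝ (Euc d) = Module.finrank ℝ (V) := by
    rw [hd, finrank_euclideanSpace_fin]
  let φ : Euc d ≃L[ℝ] V := (LinearEquiv.ofFinrankEq _ _ hf).toContinuousLinearEquiv
  have ht : (OpenPartialHomeomorph.univBall (E := V) (P := V) (0 : V) δ).target = Metric.ball 0 δ :=
    OpenPartialHomeomorph.univBall_target _ hδ
  have hs : (OpenPartialHomeomorph.univBall (E := V) (P := V) (0 : V) δ).source = univ :=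
    OpenPartialHomeomorph.univBall_source _ _
  have h0 : OpenPartialHomeomorph.univBall (E := V) (P := V) (0 : V) δ 0 = 0 :=
    OpenPartialHomeomorph.univBall_apply_zero _ _
  generalize OpenPartialHomeomorph.univBall (E := V) (P := V) (0 : V) δ = b at ht hs h0
  have hb : ∀ y, b y ∈ Metric.ball (0 : V) δ := fun y => ht ▸ b.map_source (hs ▸ mem_univ y)
  have hmem : ∀ X : {X : E // X ∈ V ∧ ‖X‖ < δ},
      (⟨X.1, X.2.1⟩ : V) ∈ b.target := fun X => by
    rw [ht, mem_ball_zero_iff]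
    exact X.2.2
  refine ⟨{ toFun := fun y => ⟨(b (φ y)).1, (b (φ y)).2, by simpa using hb (φ y)⟩
            invFun := fun X => φ.symm (b.symm ⟨X.1, X.2.1⟩)
            left_inv := fun y => by
              have := b.left_inv (x := φ y) (hs ▸ mem_univ _)
              simp [this]
            right_inv := fun X => by
              have := b.right_inv (hmem X)
              simp [this]
            continuous_toFun := ?_
            continuous_invFun := ?_ }, ?_⟩
  · have : Continuous b := continuousOn_univ.1 (hs ▸ b.continuousOn)
    exact (continuous_subtype_val.comp (this.comp φ.continuous)).subtype_mk _
  · refine φ.symm.continuous.comp ?_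
    exact b.continuousOn_symm.comp_continuous (continuous_subtype_val.subtype_mk _) hmem
  · change (b (φ 0)).1 = 0
    rw [map_zero, h0]
    rfl

theorem card_blockS (h : p + q ≤ n) : (blockS n p q).card = (n - p) * (p + q) := by
  have h₁ : (Finset.univ.filter fun i : Fin n => p ≤ (i : ℕ)).card = n - p := by
    rw [← Finset.card_map Fin.valEmbedding]
    have : (Finset.univ.filter fun i : Fin n => p ≤ (i : ℕ)).map Fin.valEmbedding =
        Finset.Ico p n := by
      ext i
      simp only [Finset.mem_map, Finset.mem_filter, Finset.mem_univ, true_and,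
        Fin.valEmbedding_apply, Finset.mem_Ico]
      constructor
      · rintro ⟨j, hj, rfl⟩
        exact ⟨hj, j.2⟩
      · rintro ⟨h₁, h₂⟩
        exact ⟨⟨i, h₂⟩, h₁, rfl⟩
    rw [this, Nat.card_Ico]
  have h₂ : (Finset.univ.filter fun i : Fin n => (i : ℕ) < p + q).card = p + q := by
    rw [← Finset.card_map Fin.valEmbedding]
    have : (Finset.univ.filter fun i : Fin n => (i : ℕ) < p + q).map Fin.valEmbedding =
        Finset.range (p + q) := by
      ext i
      simp only [Finset.mem_map, Finset.mem_filter, Finset.mem_univ, true_and,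
        Fin.valEmbedding_apply, Finset.mem_range]
      constructor
      · rintro ⟨j, hj, rfl⟩
        exact hj
      · intro h₁
        exact ⟨⟨i, h₁.trans_le h⟩, h₁, rfl⟩
    rw [this, Finset.card_range]
  have : blockS n p q = (Finset.univ.filter fun i : Fin n => p ≤ (i : ℕ)) ×ˢ
      (Finset.univ.filter fun i : Fin n => (i : ℕ) < p + q) := by
    ext ⟨i, j⟩
    simp [mem_blockS]
  rw [this, Finset.card_product, h₁, h₂]

end Chart

/-! ### The components of a point of a slice -/

section Components

/-- The linear map `x ↦ (x_d, x_(d+1), …)`, truncated or extended by zero. -/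
noncomputable def sh (d m n : ℕ) : Euc n →L[ℝ] Euc m :=
  LinearMap.toContinuousLinearMap
    { toFun := fun x => WithLp.toLp 2 fun a => if h : (a : ℕ) + d < n then x ⟨a + d, h⟩ else 0
      map_add' := fun x y => by
        ext a
        by_cases h : (a : ℕ) + d < n <;> simp [h]
      map_smul' := fun c x => by
        ext a
        by_cases h : (a : ℕ) + d < n <;> simp [h] }

theorem sh_apply (d m n : ℕ) (x : Euc n) (a : Fin m) :
    sh d m n x a = if h : (a : ℕ) + d < n then x ⟨a + d, h⟩ else 0 := rfl

theorem sh_zero_apply {m n : ℕ} (x : Euc n) {a : Fin m} (h : (a : ℕ) < n) :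
    sh 0 m n x a = x ⟨a, h⟩ := by
  rw [sh_apply, dif_pos (by simpa using h)]
  rfl

theorem sh_zero_apply' {m n : ℕ} (x : Euc n) {a : Fin m} (h : n ≤ (a : ℕ)) :
    sh 0 m n x a = 0 := by
  rw [sh_apply, dif_neg (by omega)]

variable {n p q k : ℕ} {a b c : ℝ} {Γ : ChabautyR n}

theorem sh_mem_low (x : Euc p) : sh 0 n p x ∈ low n p := fun _ h => sh_zero_apply' x h

theorem sh_sh (h : p ≤ n) (x : Euc p) : sh 0 p n (sh 0 n p x) = x := by
  ext i
  rw [sh_zero_apply _ (i.2.trans_le h), sh_zero_apply (a := (⟨i, i.2.trans_le h⟩ : Fin n)) _ i.2]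

theorem sh_sh_of_mem_low {x : Euc n} (h : x ∈ low n p) : sh 0 n p (sh 0 p n x) = x := by
  ext i
  rcases lt_or_ge (i : ℕ) p with hi | hi
  · rw [sh_zero_apply _ hi, sh_zero_apply (a := (⟨i, hi⟩ : Fin p)) _ i.2]
  · rw [sh_zero_apply' _ hi, h i hi]

theorem sum_fin_eq_of_shift {f : Fin n → ℝ} {g : Fin k → ℝ} {d : ℕ} (hd : d + k ≤ n)
    (h₁ : ∀ (i : Fin k), f ⟨i + d, by omega⟩ = g i)
    (h₂ : ∀ i : Fin n, (i : ℕ) < d ∨ d + k ≤ (i : ℕ) → f i = 0) : ∑ i, f i = ∑ i, g i := by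
  symm
  refine Finset.sum_of_injOn (fun i : Fin k => (⟨i + d, by omega⟩ : Fin n)) ?_ ?_ ?_ ?_
  · intro i _ j _ hij
    simp only [Fin.mk.injEq] at hij
    exact Fin.ext (by omega)
  · intro i _
    simp
  · intro i _ hi
    refine h₂ i ?_
    by_contra! hcon
    refine hi ⟨⟨i - d, by omega⟩, by simp, Fin.ext ?_⟩
    change (i : ℕ) - d + d = i
    omega
  · intro i _
    exact (h₁ i).symm

theorem norm_sh_zero (h : p ≤ n) (x : Euc p) : ‖sh 0 n p x‖ = ‖x‖ := by
  rw [EuclideanSpace.norm_eq, EuclideanSpace.norm_eq]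
  congr 1
  refine sum_fin_eq_of_shift (d := 0) (by omega) (fun i => ?_) (fun i hi => ?_)
  · rw [sh_zero_apply _ (by simp)]
    simp
  · rw [sh_zero_apply' _ (by omega)]
    simp

theorem norm_sh_eq_tl (hn : p + q + k = n) (x : Euc n) :
    ‖sh (p + q) k n x‖ = ‖tl n (p + q) x‖ := by
  rw [EuclideanSpace.norm_eq, EuclideanSpace.norm_eq]
  congr 1
  symm
  refine sum_fin_eq_of_shift (d := p + q) (by omega) (fun i => ?_) (fun i hi => ?_)
  · rw [tl_apply, if_pos (by simp), sh_apply, dif_pos]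
  · rw [tl_apply, if_neg (by omega)]
    simp

theorem sh_eq_zero_iff (hn : p + q + k = n) {x : Euc n} :
    sh (p + q) k n x = 0 ↔ x ∈ low n (p + q) := by
  rw [← norm_eq_zero, norm_sh_eq_tl hn, norm_eq_zero, tl_eq_zero_iff]

theorem sh_eq_of_sub_mem (hn : p + q + k = n) {x y : Euc n} (h : x - y ∈ low n (p + q)) :
    sh (p + q) k n x = sh (p + q) k n y := by
  rw [← sub_eq_zero, ← map_sub, sh_eq_zero_iff hn]
  exact h

/-- The intersection of `Γ` with `ℝ^p`. -/
noncomputable def fstPart (p : ℕ) (Γ : ChabautyR n) : ChabautyR p :=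
  Chabauty.ofClosed (Γ.toSubgroup.comap (sh 0 n p : Euc p →+ Euc n))
    (Γ.isClosed.preimage (sh 0 n p).continuous)

theorem mem_fstPart {y : Euc p} : y ∈ fstPart p Γ ↔ sh 0 n p y ∈ Γ := Iff.rfl

/-- The closure of the projection of `Γ` to the last `k` coordinates, where the first of them has
index `m`. -/
noncomputable def sndPart (m k : ℕ) (Γ : ChabautyR n) : ChabautyR k :=
  Chabauty.ofClosed (Γ.toSubgroup.map (sh m k n : Euc n →+ Euc k)).topologicalClosure
    (AddSubgroup.isClosed_topologicalClosure _)

theorem sh_mem_sndPart {m : ℕ} {γ : Euc n} (h : γ ∈ Γ) : sh m k n γ ∈ sndPart m k Γ :=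
  AddSubgroup.le_topologicalClosure _ ⟨γ, h, rfl⟩

theorem IsSlice.mem_sndPart (h : IsSlice p q a b Γ) (hb : 0 ≤ b) (hn : p + q + k = n) {e : Euc k} :
    e ∈ sndPart (p + q) k Γ ↔ ∃ γ ∈ Γ, sh (p + q) k n γ = e := by
  refine ⟨fun he => ?_, ?_⟩
  · have hcl : ∀ η > 0, ∃ γ ∈ Γ, ‖e - sh (p + q) k n γ‖ < η := by
      intro η hη
      have he' : e ∈ closure ((Γ.toSubgroup.map (sh (p + q) k n : Euc n →+ Euc k) :
          AddSubgroup (Euc k)) : Set (Euc k)) := he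
      obtain ⟨_, ⟨γ, hγ, rfl⟩, hd⟩ := Metric.mem_closure_iff.1 he' η hη
      exact ⟨γ, hγ, by simpa [dist_eq_norm] using hd⟩
    have hr : 0 < 1 / (b + 1) := by positivity
    obtain ⟨γ, hγ, hlt⟩ := hcl (1 / (b + 1) / 2) (half_pos hr)
    refine ⟨γ, hγ, ?_⟩
    by_contra hne
    have hpos : 0 < ‖e - sh (p + q) k n γ‖ := norm_pos_iff.2 fun h0 => hne (sub_eq_zero.1 h0).symm
    obtain ⟨γ', hγ', hlt'⟩ := hcl ‖e - sh (p + q) k n γ‖ hpos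
    have hlow : γ - γ' ∈ low n (p + q) := by
      by_contra hcon
      have h1 := h.gap _ (sub_mem hγ hγ') hcon
      rw [← norm_sh_eq_tl hn, map_sub] at h1
      have h2 : ‖sh (p + q) k n γ - sh (p + q) k n γ'‖ < 1 / (b + 1) := by
        calc _ = ‖(e - sh (p + q) k n γ') - (e - sh (p + q) k n γ)‖ := by congr 1; abel
          _ ≤ _ := norm_sub_le _ _
          _ < 1 / (b + 1) / 2 + 1 / (b + 1) / 2 := add_lt_add (hlt'.trans hlt) hlt
          _ = _ := add_halves _
      rw [lt_div_iff₀ (by positivity)] at h2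
      nlinarith [norm_nonneg (sh (p + q) k n γ - sh (p + q) k n γ')]
    rw [sh_eq_of_sub_mem hn hlow] at hlt'
    exact lt_irrefl _ hlt'
  · rintro ⟨γ, hγ, rfl⟩
    exact sh_mem_sndPart hγ

theorem Cov.fstPart (h : Cov p c Γ) (hp : p ≤ n) : Cov p c (fstPart p Γ) := by
  intro x _
  obtain ⟨γ, h₁, h₂, h₃⟩ := h (sh 0 n p x) (sh_mem_low x)
  refine ⟨sh 0 p n γ, ?_, fun i hi => by omega, ?_⟩
  · rw [mem_fstPart, sh_sh_of_mem_low h₂]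
    exact h₁
  · rwa [← norm_sh_zero hp, map_sub, sh_sh_of_mem_low h₂]

theorem Cov.of_fstPart (hp : p ≤ n) (h : Cov p c (_root_.fstPart p Γ)) : Cov p c Γ := by
  intro x hx
  obtain ⟨γ, h₁, h₂, h₃⟩ := h (sh 0 p n x) (fun i hi => by omega)
  refine ⟨_, mem_fstPart.1 h₁, sh_mem_low _, ?_⟩
  rw [← norm_sh_zero hp, map_sub, sh_sh_of_mem_low hx] at h₃
  exact h₃

theorem IsSlice.gap_sndPart (h : IsSlice p q a b Γ) (hb : 0 ≤ b) (hn : p + q + k = n) :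
    Gap 0 b (sndPart (p + q) k Γ) := by
  intro e he he0
  obtain ⟨γ, hγ, rfl⟩ := (h.mem_sndPart hb hn).1 he
  have hγl : γ ∉ low n (p + q) := fun h0 => he0 (by
    rw [(sh_eq_zero_iff hn).2 h0]
    exact zero_mem _)
  have := h.gap γ hγ hγl
  rw [← norm_sh_eq_tl hn] at this
  convert this using 3
  ext i
  simp [tl_apply]

theorem Gap.of_sndPart (hn : p + q + k = n) (h : Gap 0 c (sndPart (p + q) k Γ)) :
    Gap (p + q) c Γ := by
  intro γ hγ hl
  have := h _ (sh_mem_sndPart hγ) (fun h0 => hl ?_)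
  · rw [← norm_sh_eq_tl hn]
    convert this using 3
    ext i
    simp [tl_apply]
  · rw [← sh_eq_zero_iff hn]
    ext i
    exact h0 i (Nat.zero_le _)

section Limits

variable {ι : Type*} {w : Ultrafilter ι} {f : ι → ChabautyR n}

theorem tendsto_fstPart (hp : p ≤ n) (hs : ∀ᶠ i in (w : Filter ι), IsSlice p q a b (f i))
    (h : Tendsto f w (𝓝 Γ)) : Tendsto (fun i => fstPart p (f i)) w (𝓝 (fstPart p Γ)) := by
  refine Chabauty.tendsto_of_ultrafilter (fun x hx => ?_) fun y x hy hyx => ?_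
  · obtain ⟨y, hy, hyx⟩ := Chabauty.exists_tendsto h (mem_fstPart.1 hx)
    refine ⟨fun i => sh 0 p n (y i), ?_, ?_⟩
    · filter_upwards [eventually_mem_low' hs (.of_forall hy) hyx (sh_mem_low x)] with i hi
      rw [mem_fstPart, sh_sh_of_mem_low hi]
      exact hy i
    · have := ((sh 0 p n).continuous.tendsto _).comp hyx
      rwa [sh_sh hp] at this
  · exact Chabauty.mem_of_tendsto h (.of_forall hy) (((sh 0 n p).continuous.tendsto _).comp hyx)

theorem tendsto_sndPart (hb : 0 ≤ b) (hn : p + q + k = n)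
    (hs : ∀ᶠ i in (w : Filter ι), IsSlice p q a b (f i)) (h : Tendsto f w (𝓝 Γ)) :
    Tendsto (fun i => sndPart (p + q) k (f i)) w (𝓝 (sndPart (p + q) k Γ)) := by
  have hΓ := IsSlice.of_tendsto hs h
  refine Chabauty.tendsto_of_ultrafilter (fun x hx => ?_) fun y x hy hyx => ?_
  · obtain ⟨γ, hγ, rfl⟩ := (hΓ.mem_sndPart hb hn).1 hx
    obtain ⟨y, hy, hyx⟩ := Chabauty.exists_tendsto h hγ
    exact ⟨fun i => sh (p + q) k n (y i), .of_forall fun i => sh_mem_sndPart (hy i),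
      ((sh (p + q) k n).continuous.tendsto _).comp hyx⟩
  · have : ∀ᶠ i in (w : Filter ι), ∃ γ, γ ∈ f i ∧ sh (p + q) k n γ = y i ∧
        ‖γ‖ ≤ a + n + ‖y i‖ := by
      filter_upwards [hs] with i hi
      obtain ⟨γ, hγ, he⟩ := (hi.mem_sndPart hb hn).1 (hy i)
      obtain ⟨γ', h₁, h₂, h₃⟩ := hi.exists_reduce hγ
      rw [← norm_sh_eq_tl hn, he] at h₃
      exact ⟨γ', h₁, by rw [← sh_eq_of_sub_mem hn h₂, he], h₃⟩
    obtain ⟨g, hg⟩ := this.choice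
    obtain ⟨γ, hγ⟩ := exists_tendsto_of_norm_le (u := w) (y := g) (R := a + n + (‖x‖ + 1)) (by
      filter_upwards [hg, hyx.norm.eventually (gt_mem_nhds (lt_add_one ‖x‖))] with i h₁ h₂
      linarith [h₁.2.2])
    have hm := Chabauty.mem_of_tendsto h (hg.mono fun i hi => hi.1) hγ
    have he : sh (p + q) k n γ = x :=
      tendsto_nhds_unique (((sh (p + q) k n).continuous.tendsto _).comp hγ)
        (hyx.congr' (hg.mono fun i hi => hi.2.1.symm))
    exact he ▸ sh_mem_sndPart hm

end Limits

theorem fstPart_smul {g : GLn n} {α : GLn p}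
    (h : ∀ x, g.val (sh 0 n p x) = sh 0 n p (α.val x)) (Γ : ChabautyR n) :
    fstPart p (g • Γ) = α • fstPart p Γ := by
  refine Chabauty.ext fun y => ?_
  obtain ⟨x, rfl⟩ : ∃ x, α.val x = y := ⟨_, GLn.apply_inv_self α y⟩
  rw [mem_fstPart, ← h, GLn.apply_mem_smul, GLn.apply_mem_smul, mem_fstPart]

theorem IsSlice.sndPart_smul (hΓ : IsSlice p q a b Γ) (hb : 0 ≤ b) (hn : p + q + k = n) {g : GLn n}
    (hg : g ∈ Qgrp n p q) {β : GLn k}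
    (h : ∀ x, sh (p + q) k n (g.val x) = β.val (sh (p + q) k n x)) :
    sndPart (p + q) k (g • Γ) = β • sndPart (p + q) k Γ := by
  refine Chabauty.ext fun y => ?_
  obtain ⟨x, rfl⟩ : ∃ x, β.val x = y := ⟨_, GLn.apply_inv_self β y⟩
  rw [(hΓ.smul hg hb).mem_sndPart (by positivity) hn, GLn.apply_mem_smul, hΓ.mem_sndPart hb hn]
  constructor
  · rintro ⟨γ, hγ, he⟩
    obtain ⟨γ, hγ', rfl⟩ := GLn.exists_of_mem_smul hγ
    rw [h] at he
    refine ⟨γ, hγ', ?_⟩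
    have := congrArg (↑β⁻¹ : Euc k →L[ℝ] Euc k) he
    simpa using this
  · rintro ⟨γ, hγ, rfl⟩
    exact ⟨_, GLn.apply_mem_smul.2 hγ, h γ⟩

theorem dil_mem_Qgrp (t : ℝˣ) : dil n p q t ∈ Qgrp n p q := by
  refine mem_Qgrp.2 (Qc.of_bv fun i hi => ?_)
  rcases lt_or_ge (i : ℕ) p with h | h
  · exact sub_mem ((dil_mem_low t).2 (bv_mem_low h)) (bv_mem_low h)
  · rw [dil_sub_bv_mem_low h hi, sub_self]
    exact zero_mem _

theorem fstPart_dil (t : ℝˣ) (Γ : ChabautyR n) :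
    fstPart p (dil n p q t • Γ) = dil p p 0 t • fstPart p Γ := by
  refine fstPart_smul (fun x => ?_) Γ
  rw [dil_apply_low (sh_mem_low x), dil_apply_low (q := 0) (fun i hi => by omega), map_smul]

theorem IsSlice.sndPart_dil (h : IsSlice p q a b Γ) (hb : 0 ≤ b) (hn : p + q + k = n) (t : ℝˣ) :
    sndPart (p + q) k (dil n p q t • Γ) = dil k 0 0 t • sndPart (p + q) k Γ := by
  refine h.sndPart_smul hb hn (dil_mem_Qgrp t) fun x => ?_
  ext i
  rw [dil_apply, sh_apply, sh_apply]
  rw [dif_pos (by omega), dif_pos (by omega), dil_apply, if_neg (by simp only; omega),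
    if_neg (by simp only; omega), if_neg (by omega), if_neg (by omega)]

/-! #### Block matrices -/

/-- The endomorphism that acts by `α` on the first `p` and by `β` on the last `k` coordinates. -/
noncomputable def blkL (n p m k : ℕ) (α : Euc p →L[ℝ] Euc p) (β : Euc k →L[ℝ] Euc k) :
    Euc n →L[ℝ] Euc n :=
  LinearMap.toContinuousLinearMap
    { toFun := fun x => WithLp.toLp 2 fun a => if h : (a : ℕ) < p then α (sh 0 p n x) ⟨a, h⟩
        else if h' : m ≤ (a : ℕ) ∧ (a : ℕ) - m < k then β (sh m k n x) ⟨a - m, h'.2⟩ else x a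
      map_add' := fun x y => by
        ext a
        simp only [map_add, PiLp.add_apply]
        split_ifs <;> simp
      map_smul' := fun c x => by
        ext a
        simp only [map_smul, PiLp.smul_apply]
        split_ifs <;> simp }

theorem blkL_apply (n p m k : ℕ) (α : Euc p →L[ℝ] Euc p) (β : Euc k →L[ℝ] Euc k) (x : Euc n)
    (i : Fin n) : blkL n p m k α β x i = if h : (i : ℕ) < p then α (sh 0 p n x) ⟨i, h⟩
      else if h' : m ≤ (i : ℕ) ∧ (i : ℕ) - m < k then β (sh m k n x) ⟨i - m, h'.2⟩ else x i := rfl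

theorem sh_blkL (hp : p ≤ n) {m : ℕ} (α : Euc p →L[ℝ] Euc p) (β : Euc k →L[ℝ] Euc k) (x : Euc n) :
    sh 0 p n (blkL n p m k α β x) = α (sh 0 p n x) := by
  ext i
  rw [sh_zero_apply _ (i.2.trans_le hp), blkL_apply, dif_pos i.2]

theorem sh_blkL' (hn : p + q + k = n) (α : Euc p →L[ℝ] Euc p) (β : Euc k →L[ℝ] Euc k) (x : Euc n) :
    sh (p + q) k n (blkL n p (p + q) k α β x) = β (sh (p + q) k n x) := by
  ext i
  rw [sh_apply, dif_pos (by omega), blkL_apply, dif_neg (by simp only; omega), dif_pos (by simp only; omega)]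
  exact congrArg (fun j => β (sh (p + q) k n x) j)
    (Fin.ext (show (i : ℕ) + (p + q) - (p + q) = i by omega))

theorem blkL_mul (hn : p + q + k = n) (α α' : Euc p →L[ℝ] Euc p) (β β' : Euc k →L[ℝ] Euc k) :
    blkL n p (p + q) k α β * blkL n p (p + q) k α' β' = blkL n p (p + q) k (α * α') (β * β') := by
  ext1 x
  ext i
  rw [mul_apply_eq_comp, blkL_apply, sh_blkL (by omega), sh_blkL' hn, blkL_apply n p (p + q) k (α * α')]
  split_ifs with h h'
  · rfl
  · rfl
  · rw [blkL_apply, dif_neg h, dif_neg h']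

theorem blkL_one (hn : p + q + k = n) : blkL n p (p + q) k 1 1 = 1 := by
  ext1 x
  ext i
  rw [blkL_apply]
  split_ifs with h h'
  · rw [one_apply_eq_self, sh_zero_apply (a := (⟨i, h⟩ : Fin p)) _ i.2, one_apply_eq_self]
  · rw [one_apply_eq_self, sh_apply, dif_pos (by simp only; omega), one_apply_eq_self]
    exact congrArg (fun j => x j) (Fin.ext (show (i : ℕ) - (p + q) + (p + q) = i by omega))
  · rfl

/-- The automorphism that acts by `α` on the first `p` and by `β` on the last `k` coordinates. -/
noncomputable def blk (hn : p + q + k = n) (α : GLn p) (β : GLn k) : GLn n where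
  val := blkL n p (p + q) k α.val β.val
  inv := blkL n p (p + q) k (↑α⁻¹) (↑β⁻¹)
  val_inv := by rw [blkL_mul hn, Units.mul_inv, Units.mul_inv, blkL_one hn]
  inv_val := by rw [blkL_mul hn, Units.inv_mul, Units.inv_mul, blkL_one hn]

theorem blk_val (hn : p + q + k = n) (α : GLn p) (β : GLn k) :
    (blk hn α β).val = blkL n p (p + q) k α.val β.val := rfl

theorem blk_inv (hn : p + q + k = n) (α : GLn p) (β : GLn k) :
    (blk hn α β)⁻¹ = blk hn α⁻¹ β⁻¹ := Units.ext rfl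

theorem blk_mem_Qgrp (hn : p + q + k = n) (α : GLn p) (β : GLn k) : blk hn α β ∈ Qgrp n p q := by
  intro x hx i hi
  rw [PiLp.sub_apply, blk_val, blkL_apply, dif_neg (by omega)]
  split_ifs with h
  · rw [(sh_eq_zero_iff hn).2 hx, map_zero, hx i h.1]
    simp
  · rw [sub_self]

theorem blk_sh (hn : p + q + k = n) (α : GLn p) (β : GLn k) (x : Euc p) :
    (blk hn α β).val (sh 0 n p x) = sh 0 n p (α.val x) := by
  have h₁ : (blk hn α β).val (sh 0 n p x) ∈ low n p :=
    (mem_Qgrp.1 (blk_mem_Qgrp hn α β)).map_low (sh_mem_low x)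
  rw [← sh_sh_of_mem_low h₁, blk_val, sh_blkL (by omega), sh_sh (by omega)]

theorem fstPart_blk (hn : p + q + k = n) (α : GLn p) (β : GLn k) (Γ : ChabautyR n) :
    fstPart p (blk hn α β • Γ) = α • fstPart p Γ := fstPart_smul (blk_sh hn α β) Γ

theorem IsSlice.sndPart_blk (h : IsSlice p q a b Γ) (hb : 0 ≤ b) (hn : p + q + k = n) (α : GLn p)
    (β : GLn k) : sndPart (p + q) k (blk hn α β • Γ) = β • sndPart (p + q) k Γ :=
  h.sndPart_smul hb hn (blk_mem_Qgrp hn α β) fun x => sh_blkL' hn _ _ x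

theorem tendsto_blk (hn : p + q + k = n) {ι : Type*} {l : Filter ι} {α : ι → GLn p} {β : ι → GLn k}
    {α₀ : GLn p} {β₀ : GLn k} (hα : Tendsto α l (𝓝 α₀)) (hβ : Tendsto β l (𝓝 β₀)) :
    Tendsto (fun i => blk hn (α i) (β i)) l (𝓝 (blk hn α₀ β₀)) := by
  have key : ∀ (α : GLn p) (β : GLn k), (blk hn α β).val =
      ofCols fun j => blkL n p (p + q) k α.val β.val (bv j) := fun α β => clm_ext_bv fun j => by
    rw [ofCols_bv, blk_val]
  rw [GLn.tendsto_iff] at hα hβ ⊢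
  simp only [key]
  refine tendsto_ofCols fun j => ?_
  refine ((PiLp.continuous_toLp 2 _).tendsto _).comp (tendsto_pi_nhds.2 fun i => ?_)
  split_ifs with h h'
  · exact tendsto_coord (tendsto_clm_apply hα tendsto_const_nhds) _
  · exact tendsto_coord (tendsto_clm_apply hβ tendsto_const_nhds) _
  · exact tendsto_const_nhds

end Components

/-! ### Normal form of the points of a slice -/

section NormalForm

variable {n p q k j m r s : ℕ} {a b c : ℝ} {Γ : ChabautyR n}

theorem Cov.exists_eq_smul_Std {D : ChabautyR p} (h : Cov p c D) :
    ∃ j ≤ p, ∃ α : GLn p, D = α • Std p (p - j) j := by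
  obtain ⟨r, s, hrs, α, rfl⟩ := _root_.exists_eq_smul_Std D
  obtain rfl | hlt := hrs.eq_or_lt
  · exact ⟨s, by omega, α, by rw [Nat.add_sub_cancel]⟩
  · exfalso
    set t : ℝ := ‖(↑α⁻¹ : Euc p →L[ℝ] Euc p)‖ * c + 1 with ht
    obtain ⟨γ, hγ, -, hn⟩ := h (α.val (t • bv ⟨r + s, hlt⟩)) (fun i hi => by omega)
    obtain ⟨γ, hγ', rfl⟩ := GLn.exists_of_mem_smul hγ
    have h0 := (mem_Std.1 hγ').2 ⟨r + s, hlt⟩ le_rfl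
    have h1 : ‖t • bv ⟨r + s, hlt⟩ - γ‖ ≤ ‖(↑α⁻¹ : Euc p →L[ℝ] Euc p)‖ * c := by
      have := (↑α⁻¹ : Euc p →L[ℝ] Euc p).le_opNorm (α.val (t • bv ⟨r + s, hlt⟩) - α.val γ)
      rw [map_sub, GLn.inv_apply_self, GLn.inv_apply_self] at this
      exact this.trans (by gcongr)
    have h2 := (norm_coord_le _ ⟨r + s, hlt⟩).trans h1
    rw [PiLp.sub_apply, h0, PiLp.smul_apply, bv_self, sub_zero, smul_eq_mul, mul_one] at h2
    have := le_abs_self t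
    linarith

theorem Gap.exists_eq_smul_Std {E : ChabautyR k} (h : Gap 0 b E) (hb : 0 ≤ b) :
    ∃ m ≤ k, ∃ β : GLn k, E = β • Std k 0 m := by
  obtain ⟨r, s, hrs, β, rfl⟩ := _root_.exists_eq_smul_Std E
  obtain rfl | hpos := Nat.eq_zero_or_pos r
  · exact ⟨s, by omega, β, rfl⟩
  · exfalso
    have hk : 0 < k := by omega
    set t : ℝ := 1 / (2 * (b + 1) * (‖β.val‖ + 1)) with ht
    have htpos : 0 < t := by positivity
    have hm : t • bv (⟨0, hk⟩ : Fin k) ∈ Std k r s := by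
      refine mem_Std.2 ⟨fun i hi => ⟨0, ?_⟩, Submodule.smul_mem _ _ (bv_mem_low (by simp; omega))⟩
      rw [PiLp.smul_apply, bv_ne (by rintro rfl; simp at hi; omega)]
      simp
    have := h _ (GLn.apply_mem_smul.2 hm) (fun h0 => by
      have : β.val (t • bv (⟨0, hk⟩ : Fin k)) = 0 := by
        ext i
        exact h0 i (Nat.zero_le _)
      have h1 := congrArg (fun x => (↑β⁻¹ : Euc k →L[ℝ] Euc k) x ⟨0, hk⟩) this
      simp at h1
      exact htpos.ne' h1)
    have h2 : ‖tl k 0 (β.val (t • bv (⟨0, hk⟩ : Fin k)))‖ ≤ ‖β.val‖ * t := by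
      refine (norm_tl_le _ _).trans ((β.val.le_opNorm _).trans ?_)
      rw [norm_smul, norm_bv, mul_one, Real.norm_of_nonneg htpos.le]
    have h3 : b * (‖β.val‖ * t) < 1 := by
      rw [ht, mul_one_div, mul_div_assoc', div_lt_one (by positivity)]
      nlinarith [norm_nonneg β.val, mul_nonneg hb (norm_nonneg β.val)]
    nlinarith [mul_le_mul_of_nonneg_left h2 hb]

theorem Chabauty.exists_int_comb {M : ℕ}
    (h : ∀ i : Fin n, p ≤ (i : ℕ) → (i : ℕ) < M → bv i ∈ Γ) (z : Fin n → ℤ) :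
    ∃ v ∈ Γ, ∀ i : Fin n, v i = if p ≤ (i : ℕ) ∧ (i : ℕ) < M then (z i : ℝ) else 0 := by
  refine ⟨∑ b : Fin n, if p ≤ (b : ℕ) ∧ (b : ℕ) < M then z b • bv b else 0,
    sum_mem fun b _ => ?_, fun i => ?_⟩
  · split_ifs with hb
    · exact zsmul_mem (h b hb.1 hb.2) _
    · exact zero_mem _
  · rw [WithLp.ofLp_sum, Finset.sum_apply, Finset.sum_eq_single i]
    · split_ifs <;> simp
    · intro b _ hb
      split_ifs <;> simp [bv_ne hb.symm]
    · simp

theorem IsSlice.eq_Std_of_parts (h : IsSlice p q a b Γ) (hn : p + q + k = n) (hj : j ≤ p)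
    (h₁ : fstPart p Γ = Std p (p - j) j) (h₂ : sndPart (p + q) k Γ = Std k 0 m)
    (h₃ : ∀ i : Fin n, p ≤ (i : ℕ) → (i : ℕ) < p + q + m → bv i ∈ Γ) :
    Γ = Std n (p - j) (q + j + m) := by
  refine Chabauty.ext fun x => ⟨fun hx => ?_, fun hx => ?_⟩
  · have hhi : sh (p + q) k n x ∈ Std k 0 m := h₂ ▸ sh_mem_sndPart hx
    have hhi₁ : ∀ i : Fin n, p + q ≤ (i : ℕ) → ∃ z : ℤ, x i = z := fun i hi => by
      obtain ⟨z, hz⟩ := hhi.1 ⟨i - (p + q), by omega⟩ (Nat.zero_le _)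
      rw [sh_apply, dif_pos (by simp only; omega)] at hz
      exact ⟨z, hz ▸ congrArg (fun j => x j) (Fin.ext (show (i : ℕ) = i - (p + q) + (p + q) by omega))⟩
    have hhi₂ : ∀ i : Fin n, p + q + m ≤ (i : ℕ) → x i = 0 := fun i hi => by
      have hz := hhi.2 ⟨i - (p + q), by omega⟩ (by simp only; omega)
      rw [sh_apply, dif_pos (by simp only; omega)] at hz
      exact hz ▸ congrArg (fun j => x j) (Fin.ext (show (i : ℕ) = i - (p + q) + (p + q) by omega))
    choose! z hz using hhi₁
    obtain ⟨v, hv, hvi⟩ := Chabauty.exists_int_comb (p := p + q) (M := p + q + m) (Γ := Γ)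
      (fun i hi hi' => h₃ i (by omega) hi') z
    have hlow : x - v ∈ low n (p + q) := fun i hi => by
      rw [PiLp.sub_apply, hvi]
      split_ifs with hi'
      · rw [hz i hi, sub_self]
      · rw [hhi₂ i (by omega), sub_self]
    have hmid : ∀ i : Fin n, p ≤ (i : ℕ) → (i : ℕ) < p + q → ∃ z : ℤ, x i = z := fun i hi hi' => by
      obtain ⟨z, hz⟩ := h.int _ (sub_mem hx hv) hlow i hi
      rw [PiLp.sub_apply, hvi, if_neg (by omega), sub_zero] at hz
      exact ⟨z, hz⟩
    have hint : ∀ i : Fin n, p ≤ (i : ℕ) → ∃ z : ℤ, x i = z := fun i hi => by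
      rcases lt_or_ge (i : ℕ) (p + q) with hi' | hi'
      · exact hmid i hi hi'
      · exact ⟨_, hz i hi'⟩
    choose! z' hz' using hint
    obtain ⟨v', hv', hvi'⟩ := Chabauty.exists_int_comb (p := p) (M := p + q + m) (Γ := Γ) h₃ z'
    have hlow' : x - v' ∈ low n p := fun i hi => by
      rw [PiLp.sub_apply, hvi']
      split_ifs with hi'
      · rw [hz' i hi, sub_self]
      · rw [hhi₂ i (by omega), sub_self]
    have hD : sh 0 p n (x - v') ∈ Std p (p - j) j := by
      rw [← h₁, mem_fstPart, sh_sh_of_mem_low hlow']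
      exact sub_mem hx hv'
    refine mem_Std.2 ⟨fun i hi => ?_, fun i hi => hhi₂ i (by omega)⟩
    rcases lt_or_ge (i : ℕ) p with hip | hip
    · obtain ⟨z, hz⟩ := hD.1 ⟨i, hip⟩ hi
      rw [sh_zero_apply (a := (⟨i, hip⟩ : Fin p)) _ i.2, PiLp.sub_apply, hvi' ⟨i, _⟩,
        if_neg (by simp only; omega), sub_zero] at hz
      exact ⟨z, hz⟩
    · exact ⟨_, hz' i hip⟩
  · obtain ⟨hx₁, hx₂⟩ := mem_Std.1 hx
    choose! z hz using hx₁
    obtain ⟨v, hv, hvi⟩ := Chabauty.exists_int_comb (p := p) (M := p + q + m) (Γ := Γ) h₃ z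
    have hlow : x - v ∈ low n p := fun i hi => by
      rw [PiLp.sub_apply, hvi]
      split_ifs with hi'
      · rw [hz i (by omega), sub_self]
      · rw [hx₂ i (by omega), sub_self]
    have hD : sh 0 p n (x - v) ∈ Std p (p - j) j := by
      refine mem_Std.2 ⟨fun i hi => ⟨z ⟨i, by omega⟩, ?_⟩, fun i hi => by omega⟩
      rw [sh_zero_apply _ (show (i : ℕ) < n by omega), PiLp.sub_apply, hvi,
        if_neg (by simp only; omega), sub_zero, hz]
      exact hi
    rw [← h₁, mem_fstPart, sh_sh_of_mem_low hlow] at hD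
    simpa using add_mem hD hv

/-- A point of a slice with standard components is the image of a standard subgroup under any
unipotent automorphism whose columns lift the standard basis vectors. -/
theorem IsSlice.eq_smul_Std_of_parts (h : IsSlice p q a b Γ) (hb : 0 ≤ b) (hn : p + q + k = n)
    (hj : j ≤ p) (h₁ : fstPart p Γ = Std p (p - j) j) (h₂ : sndPart (p + q) k Γ = Std k 0 m)
    {T : GLn n} (hT : T ∈ Qgrp n p q) (hT₁ : ∀ x ∈ low n p, T.val x = x)
    (hT₂ : ∀ x, T.val x - x ∈ low n (p + q))
    (h₃ : ∀ i : Fin n, p ≤ (i : ℕ) → (i : ℕ) < p + q + m → T.val (bv i) ∈ Γ) :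
    Γ = T • Std n (p - j) (q + j + m) := by
  rw [eq_comm, ← eq_inv_smul_iff]
  have hTi := (Qgrp n p q).inv_mem hT
  refine ((h.smul hTi hb).eq_Std_of_parts hn hj ?_ ?_ fun i hi hi' => ?_).symm
  · rw [fstPart_smul (α := 1), one_smul, h₁]
    intro x
    have := hT₁ _ (sh_mem_low (n := n) x)
    conv_lhs => rw [← this]
    simp
  · rw [h.sndPart_smul hb hn hTi (β := 1), one_smul, h₂]
    intro x
    refine sh_eq_of_sub_mem hn ?_
    have := neg_mem (hT₂ ((↑T⁻¹ : Euc n →L[ℝ] Euc n) x))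
    simpa using this
  · rw [GLn.mem_smul, inv_inv]
    exact h₃ i hi hi'

theorem exists_unipotent {v : Fin n → Euc n}
    (h₁ : ∀ i : Fin n, (i : ℕ) < p → v i = bv i)
    (h₂ : ∀ i : Fin n, p ≤ (i : ℕ) → (i : ℕ) < p + q → v i - bv i ∈ low n p)
    (h₃ : ∀ i : Fin n, p + q ≤ (i : ℕ) → v i - bv i ∈ low n (p + q)) :
    ∃ T ∈ Qgrp n p q, (∀ x ∈ low n p, T.val x = x) ∧ (∀ x, T.val x - x ∈ low n (p + q)) ∧
      ∀ i, T.val (bv i) = v i := by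
  have hQ : Qc p q (ofCols v) := Qc.of_bv fun i hi => by
    rw [ofCols_bv]
    rcases lt_or_ge (i : ℕ) p with h | h
    · rw [h₁ i h, sub_self]
      exact zero_mem _
    · exact h₂ i h hi
  have hl : ∀ x ∈ low n p, ofCols v x = x := fun x hx => by
    have := clm_mem_of_mem_low (T := ofCols v - 1) (V := ⊥) (m := p) (fun i hi => by
      rw [sub_apply, ofCols_bv, h₁ i hi]
      simp) hx
    simpa [sub_eq_zero] using this
  have hh : ∀ x, ofCols v x - x ∈ low n (p + q) := fun x => by
    have := clm_mem_of_mem_low (T := ofCols v - 1) (V := low n (p + q)) (m := n) (fun i _ => by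
      rw [sub_apply, ofCols_bv]
      rcases lt_or_ge (i : ℕ) p with h | h
      · rw [h₁ i h]
        simp
      · rcases lt_or_ge (i : ℕ) (p + q) with h' | h'
        · exact low_mono (by omega) (h₂ i h h')
        · exact h₃ i h') (x := x) (by rw [low_eq_top le_rfl]; trivial)
    simpa using this
  obtain ⟨T, hT⟩ := GLn.exists_of_injective (T := ofCols v) (by
    rw [injective_iff_map_eq_zero]
    intro x hx
    have hx₁ : x ∈ low n (p + q) := by simpa [hx] using hh x
    have hx₂ : x ∈ low n p := by simpa [hx] using hQ x hx₁
    rw [← hl x hx₂, hx])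
  exact ⟨T, mem_Qgrp.2 (hT ▸ hQ), hT ▸ hl, hT ▸ hh, fun i => by rw [hT, ofCols_bv]⟩

theorem IsSlice.exists_unipotent_of_parts (h : IsSlice p q a b Γ) (hb : 0 ≤ b) (hn : p + q + k = n)
    (hj : j ≤ p) (hm : m ≤ k) (h₁ : fstPart p Γ = Std p (p - j) j)
    (h₂ : sndPart (p + q) k Γ = Std k 0 m) :
    ∃ T ∈ Qgrp n p q, Γ = T • Std n (p - j) (q + j + m) := by
  have hc : ∀ i : Fin n, ∃ v : Euc n, ((i : ℕ) < p → v = bv i) ∧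
      (p ≤ (i : ℕ) → (i : ℕ) < p + q → v - bv i ∈ low n p) ∧
      (p + q ≤ (i : ℕ) → v - bv i ∈ low n (p + q)) ∧
      (p ≤ (i : ℕ) → (i : ℕ) < p + q + m → v ∈ Γ) := by
    intro i
    rcases lt_or_ge (i : ℕ) p with hi | hi
    · exact ⟨bv i, fun _ => rfl, fun h => by omega, fun h => by omega, fun h => by omega⟩
    rcases lt_or_ge (i : ℕ) (p + q) with hi' | hi'
    · obtain ⟨v, hv, hvl⟩ := h.lift i hi hi'
      exact ⟨v, fun h => by omega, fun _ _ => hvl, fun h => by omega, fun _ _ => hv⟩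
    rcases lt_or_ge (i : ℕ) (p + q + m) with hi'' | hi''
    · have : bv (⟨i - (p + q), by omega⟩ : Fin k) ∈ sndPart (p + q) k Γ := by
        rw [h₂]
        refine mem_Std.2 ⟨fun a _ => ?_, bv_mem_low (by simp only; omega)⟩
        rw [bv_apply]
        split_ifs
        · exact ⟨1, by simp⟩
        · exact ⟨0, by simp⟩
      obtain ⟨v, hv, hve⟩ := (h.mem_sndPart hb hn).1 this
      refine ⟨v, fun h => by omega, fun _ h => by omega, fun _ => ?_, fun _ _ => hv⟩
      rw [← sh_eq_zero_iff hn, map_sub, hve, sub_eq_zero]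
      ext a
      rw [sh_apply, dif_pos (by omega), bv_apply, bv_apply]
      simp only [Fin.ext_iff]
      congr 1
      rw [eq_iff_iff]
      omega
    · exact ⟨bv i, fun h => by omega, fun _ h => by omega, fun _ => by simp, fun _ h => by omega⟩
  choose v hv₁ hv₂ hv₃ hv₄ using hc
  obtain ⟨T, hT, hT₁, hT₂, hT₃⟩ := exists_unipotent hv₁ hv₂ hv₃
  refine ⟨T, hT, h.eq_smul_Std_of_parts hb hn hj h₁ h₂ hT hT₁ hT₂ fun i hi hi' => ?_⟩
  rw [hT₃]
  exact hv₄ i hi hi'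

/-- The points of the slices are images of standard subgroups under automorphisms that preserve
the slices. -/
theorem IsSlice.exists_normal (h : IsSlice p q a b Γ) (hb : 0 ≤ b) (hn : p + q + k = n) :
    ∃ j ≤ p, ∃ m ≤ k, (∃ u ∈ Qgrp n p q, Γ = u • Std n (p - j) (q + j + m)) ∧
      fstPart p Γ ∈ typeStratum p (p - j) j ∧ sndPart (p + q) k Γ ∈ typeStratum k 0 m := by
  obtain ⟨j, hj, α, hα⟩ := (h.cov.fstPart (by omega)).exists_eq_smul_Std
  obtain ⟨m, hm, β, hβ⟩ := (h.gap_sndPart hb hn).exists_eq_smul_Std hb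
  refine ⟨j, hj, m, hm, ?_, ?_, ?_⟩
  · have hu := (Qgrp n p q).inv_mem (blk_mem_Qgrp hn α β)
    obtain ⟨T, hT, hTe⟩ := (h.smul hu hb).exists_unipotent_of_parts (by positivity) hn hj hm
      (by rw [blk_inv, fstPart_blk, hα, inv_smul_smul])
      (by rw [blk_inv, h.sndPart_blk hb, hβ, inv_smul_smul])
    exact ⟨_, (Qgrp n p q).mul_mem (blk_mem_Qgrp hn α β) hT, by
      rw [mul_smul, ← hTe, smul_inv_smul]⟩
  · rw [hα]
    exact smul_mem_typeStratum α (Std_mem_typeStratum (by omega))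
  · rw [hβ]
    exact smul_mem_typeStratum β (Std_mem_typeStratum (by omega))

/-- The slices at a stratum contain the small slices at the neighbouring strata. -/
theorem IsSlice.of_le (h : IsSlice r s a b Γ) (hr : r ≤ p) (hs : p + q ≤ r + s) :
    IsSlice p q (n + a) (max b 1) Γ := by
  refine ⟨fun x hx => ?_, fun i hi hi' => ?_, fun γ hγ hl i hi => ?_, fun γ hγ hl => ?_⟩
  · obtain ⟨δ, h₁, h₂, h₃⟩ := h.lift.exists_int fun i => if (i : ℕ) < p then round (x i) else 0
    obtain ⟨η, h₄, h₅, h₆⟩ := h.cov _ (sub_tl_mem_low r (x - δ))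
    have hδ : ∀ i : Fin n, r ≤ (i : ℕ) → δ i = if (i : ℕ) < p then (round (x i) : ℝ) else 0 := by
      intro i hi
      rcases lt_or_ge (i : ℕ) (r + s) with hi' | hi'
      · rw [h₃ i hi hi']
        split_ifs <;> simp
      · rw [h₂ i hi', if_neg (by omega)]
    refine ⟨δ + η, add_mem h₁ h₄, fun i hi => ?_, ?_⟩
    · rw [PiLp.add_apply, h₅ i (by omega), hδ i (by omega), if_neg (by omega), add_zero]
    · have e : x - (δ + η) = tl n r (x - δ) + (x - δ - tl n r (x - δ) - η) := by abel
      rw [e]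
      refine (norm_add_le _ _).trans (add_le_add ?_ h₆)
      refine (norm_le_card_mul (c := 1) fun i => ?_).trans (by simp)
      rw [tl_apply]
      split_ifs with hi
      · rw [PiLp.sub_apply, hδ i hi]
        split_ifs with hip
        · exact (abs_sub_round (x i)).trans (by norm_num)
        · simp [hx i (by omega)]
      · simp
  · obtain ⟨γ, hγ, hl⟩ := h.lift i (by omega) (by omega)
    exact ⟨γ, hγ, low_mono hr hl⟩
  · exact h.int γ hγ (low_mono hs hl) i (by omega)
  · by_cases hl' : γ ∈ low n (r + s)
    · have : ∃ i : Fin n, p + q ≤ (i : ℕ) ∧ γ i ≠ 0 := by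
        by_contra! hcon
        exact hl hcon
      obtain ⟨i, hi, hne⟩ := this
      obtain ⟨z, hz⟩ := h.int γ hγ hl' i (by omega)
      have h1 := norm_coord_le (tl n (p + q) γ) i
      rw [tl_apply, if_pos hi, hz] at h1
      have hz0 : z ≠ 0 := by
        rintro rfl
        simp [hz] at hne
      have : (1 : ℝ) ≤ |(z : ℝ)| := by exact_mod_cast Int.one_le_abs hz0
      nlinarith [le_max_right b 1, norm_nonneg (tl n (p + q) γ)]
    · have h1 := h.gap γ hγ hl'
      have h2 : ‖tl n (r + s) γ‖ ≤ ‖tl n (p + q) γ‖ := by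
        have : tl n (r + s) γ = tl n (r + s) (tl n (p + q) γ) := by
          refine tl_eq_of_sub_mem (low_mono hs (sub_tl_mem_low _ _))
        rw [this]
        exact norm_tl_le _ _
      have h3 : b * ‖tl n (r + s) γ‖ ≤ max b 1 * ‖tl n (p + q) γ‖ :=
        mul_le_mul (le_max_left _ _) h2 (norm_nonneg _) (by positivity)
      linarith

theorem Qgrp_smul_Std {g : GLn n} (hg : g ∈ Qgrp n p q) : g • Std n p q = Std n p q := by
  have := (isSlice_Std (n := n) (p := p) (q := q) le_rfl le_rfl).smul hg le_rfl
  rw [mul_zero, mul_zero] at this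
  exact isSlice_zero_iff.1 this

/-- Only the standard subgroup has the type of the slice. -/
theorem IsSlice.eq_Std (h : IsSlice p q a b Γ) (hb : 0 ≤ b) (hn : p + q ≤ n)
    (ht : Γ ∈ typeStratum n p q) : Γ = Std n p q := by
  obtain ⟨j, hj, m, hm, ⟨u, hu, rfl⟩, -⟩ := h.exists_normal hb (k := n - (p + q)) (by omega)
  have h₁ := type_unique ht (smul_mem_typeStratum u (Std_mem_typeStratum (by omega)))
  obtain rfl : j = 0 := by omega
  obtain rfl : m = 0 := by omega
  exact Qgrp_smul_Std hu

/-- Local sections of the action on a stratum. -/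
theorem exists_local_section (hn : p + q ≤ n) {Γ₀ : ChabautyR n} (h₀ : Γ₀ ∈ typeStratum n p q) :
    ∃ O ∈ 𝓝 Γ₀, IsOpen O ∧ ∃ σ : ChabautyR n → GLn n, ContinuousOn σ (O ∩ typeStratum n p q) ∧
      ∀ Γ ∈ O ∩ typeStratum n p q, σ Γ • Std n p q = Γ := by
  obtain ⟨g, rfl⟩ := (mem_typeStratum_iff hn).1 h₀
  have h40 : (0 : ℝ) < 1 / 40 := by norm_num
  have hf := isOpenEmbedding_chart n p q (δ := 1 / 40) (ε := 1 / 40) le_rfl le_rfl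
  set f := fun x : {X : Euc n →L[ℝ] Euc n // X ∈ matSub (blockS n p q) ∧ ‖X‖ < 1 / 40} ×
      Nb n p q (1 / 40) => oneAdd x.1.1 • x.2.1 with hfdef
  have hF : IsOpenEmbedding fun x => g • f x := (Homeomorph.smul g).isOpenEmbedding.comp hf
  let x₀ : {X : Euc n →L[ℝ] Euc n // X ∈ matSub (blockS n p q) ∧ ‖X‖ < 1 / 40} ×
      Nb n p q (1 / 40) := (⟨0, zero_mem _, by simp⟩, ⟨Std n p q, 0, h40, isSlice_Std le_rfl le_rfl⟩)
  have : Nonempty ({X : Euc n →L[ℝ] Euc n // X ∈ matSub (blockS n p q) ∧ ‖X‖ < 1 / 40} ×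
      Nb n p q (1 / 40)) := ⟨x₀⟩
  let e := hF.toOpenPartialHomeomorph
  have he : ∀ Γ ∈ range (fun x => g • f x), g • f (e.symm Γ) = Γ := fun Γ hΓ =>
    e.right_inv (by simpa [e] using hΓ)
  refine ⟨range fun x => g • f x, hF.isOpen_range.mem_nhds ⟨x₀, ?_⟩, hF.isOpen_range,
    fun Γ => g * oneAdd (e.symm Γ).1.1, ?_, ?_⟩
  · simp [f, x₀]
  · have h₁ : ContinuousOn (fun Γ => (e.symm Γ).1.1) (range fun x => g • f x) := by
      have : ContinuousOn e.symm (range fun x => g • f x) := by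
        simpa [e] using e.continuousOn_symm
      exact (continuous_subtype_val.comp continuous_fst).comp_continuousOn this
    have h₂ := continuousOn_oneAdd.comp h₁ fun Γ _ => (e.symm Γ).1.2.2.trans (by norm_num)
    exact (continuousOn_const.mul h₂).mono inter_subset_left
  · rintro Γ ⟨hΓ, ht⟩
    have h₁ := he Γ hΓ
    have h₂ : (e.symm Γ).2.1 ∈ typeStratum n p q := by
      rw [← h₁] at ht
      simpa [f, smul_mem_typeStratum_iff] using ht
    have h₃ := (Nb.isSlice (e.symm Γ).2).eq_Std h40.le hn h₂
    conv_rhs => rw [← h₁]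
    simp only [f]
    rw [h₃, mul_smul]

end NormalForm

/-! ### Charts of the links -/

section LinkCharts

variable {n p q r s : ℕ} {a b c : ℝ} {Γ : ChabautyR n}

/-- The diagonal position that is fixed by normalization. -/
def IsDiag (p q r s : ℕ) (i : Fin n) : Prop :=
  ((i : ℕ) = r ∧ r < p) ∨ ((i : ℕ) = p + q ∧ r = p ∧ p + q < r + s)

/-- The matrix positions that parametrize a stratum of the link. -/
def linkS (p q r s : ℕ) (i : Fin n) : Finset (Fin n × Fin n) :=
  (blockS n r s \ blockS n p q).erase (i, i)

theorem IsDiag.mem {i : Fin n} (hi : IsDiag p q r s i) (hs : p + q ≤ r + s) :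
    (i, i) ∈ blockS n r s \ blockS n p q := by
  rw [Finset.mem_sdiff, mem_blockS, mem_blockS]
  rcases hi with ⟨h₁, h₂⟩ | ⟨h₁, h₂, h₃⟩ <;> omega

theorem blockS_subset (hr : r ≤ p) (hs : p + q ≤ r + s) : blockS n p q ⊆ blockS n r s := by
  rintro ⟨i, j⟩ h
  rw [mem_blockS] at h ⊢
  omega

theorem card_linkS (hr : r ≤ p) (hs : p + q ≤ r + s) (hn : r + s ≤ n) {i : Fin n}
    (hi : IsDiag p q r s i) :
    (linkS p q r s i).card + (n - p) * (p + q) + 1 = (n - r) * (r + s) := by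
  have h := Finset.card_sdiff_add_card_eq_card (blockS_subset (n := n) hr hs)
  have h' := Finset.card_erase_add_one (hi.mem hs)
  rw [linkS, ← card_blockS hn, ← card_blockS (hs.trans hn)]
  omega

theorem mem_matSub_linkS {i : Fin n} {X : Euc n →L[ℝ] Euc n}
    (hX : ‖X‖ < 1) : X ∈ matSub (linkS p q r s i) ↔
      X ∈ matSub (blockS n r s) ∧ oneAdd X ∈ Qgrp n p q ∧ X (bv i) i = 0 := by
  constructor
  · intro h
    refine ⟨fun a b hab => h a b fun hm => hab ?_, ?_, h i i (by simp [linkS])⟩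
    · exact (Finset.mem_sdiff.1 (Finset.mem_of_mem_erase hm)).1
    · refine mem_Qgrp.2 (Qc.of_bv fun b hb a ha => ?_)
      have := h a b (fun hm => (Finset.mem_sdiff.1 (Finset.mem_of_mem_erase hm)).2
        (mem_blockS.2 ⟨ha, hb⟩))
      rw [oneAdd_val hX]
      simpa using this
  · rintro ⟨h₁, h₂, h₃⟩ a b hab
    by_cases hd : (a, b) = (i, i)
    · obtain ⟨rfl, rfl⟩ := Prod.mk.inj hd
      exact h₃
    by_cases hm : (a, b) ∈ blockS n r s
    · have hm' : (a, b) ∈ blockS n p q := by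
        by_contra hcon
        exact hab (Finset.mem_erase.2 ⟨hd, Finset.mem_sdiff.2 ⟨hm, hcon⟩⟩)
      rw [mem_blockS] at hm'
      have := mem_Qgrp.1 h₂ (bv b) (bv_mem_low hm'.2) a hm'.1
      rw [oneAdd_val hX] at this
      simpa using this
    · exact h₁ a b hm

theorem conj_dil_apply_low {u : GLn n} (hu : u ∈ Qgrp n p q) (t : ℝˣ) {x : Euc n}
    (hx : x ∈ low n p) : (u⁻¹ * dil n p q t * u).val x = (t : ℝ) • x := by
  have h := (mem_Qgrp.1 hu).map_low hx
  rw [Units.val_mul, Units.val_mul, mul_apply_eq_comp, mul_apply_eq_comp, dil_apply_low h, map_smul,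
    GLn.inv_apply_self]

theorem conj_dil_sub_mem_low {u : GLn n} (hu : u ∈ Qgrp n p q) (t : ℝˣ) (x : Euc n) :
    (u⁻¹ * dil n p q t * u).val x - (t : ℝ)⁻¹ • x ∈ low n (p + q) := by
  have h₁ : (dil n p q t).val (u.val x) - (t : ℝ)⁻¹ • u.val x ∈ low n (p + q) := by
    rw [← tl_eq_zero_iff, map_sub, tl_dil, map_smul, sub_self]
  have h₂ := (Qc.inv (mem_Qgrp.1 hu)).map_low' h₁
  rw [Units.val_mul, Units.val_mul, mul_apply_eq_comp, mul_apply_eq_comp]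
  simpa using h₂

/-- The effect of a dilatation on the normalized diagonal entry. -/
noncomputable def diagScale (p r : ℕ) (t : ℝ) : ℝ := if r < p then t else t⁻¹

theorem diag_of_factor {i : Fin n} (hs : p + q ≤ r + s) (hi : IsDiag p q r s i)
    {X Y : Euc n →L[ℝ] Euc n} (hX : X ∈ matSub (blockS n r s)) (hXn : ‖X‖ < 1)
    (hY : Y ∈ matSub (blockS n r s)) (hYn : ‖Y‖ < 1) (hXQ : oneAdd X ∈ Qgrp n p q)
    (hYQ : oneAdd Y ∈ Qgrp n p q) {g u : GLn n} (hg : g ∈ Qgrp n r s) (hu : u ∈ Qgrp n p q)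
    {t : ℝˣ} (h : oneAdd Y * g = u⁻¹ * dil n p q t * u * oneAdd X) :
    1 + Y (bv i) i = diagScale p r t * (1 + X (bv i) i) := by
  have hv : (oneAdd Y).val (g.val (bv i)) =
      (u⁻¹ * dil n p q t * u).val ((oneAdd X).val (bv i)) := by
    rw [← mul_apply_eq_comp, ← Units.val_mul, h, Units.val_mul, mul_apply_eq_comp]
  rw [mem_matSub_blockS] at hX hY
  rw [mem_Qgrp] at hXQ hYQ hg
  have hXv : (oneAdd X).val (bv i) = bv i + X (bv i) := by
    rw [oneAdd_val hXn]
    simp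
  have hYv : ∀ x, (oneAdd Y).val x = x + Y x := fun x => by
    rw [oneAdd_val hYn]
    simp
  have hgi := hg (bv i) (bv_mem_low (by rcases hi with h | h <;> omega))
  rcases hi with ⟨h₁, h₂⟩ | ⟨h₁, h₂, h₃⟩
  · have hlow : (oneAdd X).val (bv i) ∈ low n p := hXQ.map_low (bv_mem_low (by omega))
    rw [conj_dil_apply_low hu t hlow, hXv, hYv] at hv
    have hgb : g.val (bv i) = bv i := by
      rw [← sub_eq_zero]
      ext a
      rcases lt_or_ge (a : ℕ) r with ha | ha
      · have := congrArg (fun x : Euc n => x a) hv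
        simp only [PiLp.add_apply, PiLp.smul_apply, hX.1 _ a ha, hY.1 _ a ha] at this
        rw [bv_ne (by rintro rfl; omega)] at this
        rw [PiLp.sub_apply, bv_ne (by rintro rfl; omega)]
        simpa using this
      · exact hgi a ha
    have := congrArg (fun x : Euc n => x i) hv
    rw [hgb] at this
    simpa [diagScale, h₂, mul_add] using this
  · have hd : g.val (bv i) - bv i ∈ low n p := h₂ ▸ hgi
    have e₁ : ((oneAdd Y).val (g.val (bv i))) i = 1 + Y (bv i) i := by
      have := hYQ.map_low hd i (by omega)
      rw [map_sub, PiLp.sub_apply, hYv (bv i), PiLp.add_apply, bv_self] at this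
      linarith
    have e₂ := conj_dil_sub_mem_low hu t ((oneAdd X).val (bv i)) i h₁.ge
    rw [PiLp.sub_apply, PiLp.smul_apply, hXv, PiLp.add_apply, bv_self, ← hXv, ← hv, e₁] at e₂
    rw [diagScale, if_neg (by omega)]
    simpa [sub_eq_zero] using e₂

theorem tendsto_diag {i : Fin n} {X₀ : Euc n →L[ℝ] Euc n} :
    Tendsto (fun X : Euc n →L[ℝ] Euc n => 1 + X (bv i) i) (𝓝 X₀) (𝓝 (1 + X₀ (bv i) i)) := by
  have h : Tendsto (fun X : Euc n →L[ℝ] Euc n => X (bv i)) (𝓝 X₀) (𝓝 (X₀ (bv i))) :=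
    tendsto_clm_apply tendsto_id tendsto_const_nhds
  exact (tendsto_coord h i).const_add 1

theorem tendsto_ru {t : ℝ} (ht : t ≠ 0) : Tendsto ru (𝓝 t) (𝓝 (ru t)) :=
  (continuousOn_ru.continuousAt (isOpen_ne.mem_nhds ht)).tendsto

theorem IsSlice.smul_oneAdd_smul (hr : r ≤ p) (hs : p + q ≤ r + s) {u : GLn n} (hu : u ∈ Qgrp n p q) {i : Fin n}
    {X : Euc n →L[ℝ] Euc n} (hX : X ∈ matSub (linkS p q r s i))
    (hXn : ‖X‖ ≤ 1 / 2) (hΓ : IsSlice r s 1 1 Γ) :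
    IsSlice p q (2 * (n + 1) * (‖u.val‖ + ‖(↑u⁻¹ : Euc n →L[ℝ] Euc n)‖))
      (2 * (n + 1) * (‖u.val‖ + ‖(↑u⁻¹ : Euc n →L[ℝ] Euc n)‖)) (u • oneAdd X • Γ) := by
  have hQ := ((mem_matSub_linkS (by linarith)).1 hX).2.1
  have h := ((hΓ.of_le hr hs).smul hQ (by positivity)).smul hu (by positivity)
  rw [max_self, mul_one] at h
  have h₁ := norm_oneAdd_le hXn
  have h₂ := norm_oneAdd_inv_le hXn
  have h₃ := norm_nonneg u.val
  have h₄ := norm_nonneg (↑u⁻¹ : Euc n →L[ℝ] Euc n)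
  have hn0 : (0 : ℝ) ≤ n := Nat.cast_nonneg n
  refine h.mono ?_ ?_
  · calc ‖u.val‖ * (‖(oneAdd X).val‖ * (n + 1)) ≤ ‖u.val‖ * (2 * (n + 1)) := by gcongr
      _ ≤ _ := by nlinarith
  · calc _ ≤ ‖(↑u⁻¹ : Euc n →L[ℝ] Euc n)‖ * 2 := by gcongr
      _ ≤ _ := by nlinarith [mul_nonneg hn0 h₃, mul_nonneg hn0 h₄]

theorem IsSlice.ne_Std (hr : r ≤ p) (hs : p + q ≤ r + s) (hn : r + s ≤ n) (hne : (r, s) ≠ (p, q)) (hb : 0 ≤ b) (hΓ : IsSlice r s a b Γ) (g : GLn n) :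
    g • Γ ≠ Std n p q := by
  intro h
  obtain ⟨j, hj, m, hm, ⟨v, -, rfl⟩, -⟩ := hΓ.exists_normal hb (k := n - (r + s)) (by omega)
  have h₁ : g • v • Std n (r - j) (s + j + m) ∈ typeStratum n (r - j) (s + j + m) :=
    smul_mem_typeStratum g (smul_mem_typeStratum v (Std_mem_typeStratum (by omega)))
  rw [h] at h₁
  have := type_unique h₁ (Std_mem_typeStratum (hs.trans hn))
  refine hne (Prod.ext ?_ ?_) <;> simp only <;> omega

theorem exists_norm_conj_dil_lt (u : GLn n) : ∃ κ > 0, ∀ (t : ℝ) (X Y : Euc n →L[ℝ] Euc n),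
    |t - 1| < κ → ‖X‖ < κ → ‖Y‖ < κ →
      ‖((oneAdd Y)⁻¹ * (u⁻¹ * dil n p q (ru t) * u) * oneAdd X).val - 1‖ < 1 / 10 := by
  have h₁ : Tendsto (fun x : ℝ × (Euc n →L[ℝ] Euc n) × (Euc n →L[ℝ] Euc n) =>
      (oneAdd x.2.2)⁻¹ * (u⁻¹ * dil n p q (ru x.1) * u) * oneAdd x.2.1) (𝓝 (1, 0, 0)) (𝓝 1) := by
    have e₁ : Tendsto (fun x : ℝ × (Euc n →L[ℝ] Euc n) × (Euc n →L[ℝ] Euc n) => oneAdd x.2.2)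
        (𝓝 (1, 0, 0)) (𝓝 1) := by
      have := tendsto_oneAdd (X := (0 : Euc n →L[ℝ] Euc n)) (by simp)
        ((continuous_snd.comp continuous_snd).tendsto
          ((1, 0, 0) : ℝ × (Euc n →L[ℝ] Euc n) × (Euc n →L[ℝ] Euc n)))
      simpa using this
    have e₂ : Tendsto (fun x : ℝ × (Euc n →L[ℝ] Euc n) × (Euc n →L[ℝ] Euc n) => oneAdd x.2.1)
        (𝓝 (1, 0, 0)) (𝓝 1) := by
      have := tendsto_oneAdd (X := (0 : Euc n →L[ℝ] Euc n)) (by simp)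
        ((continuous_fst.comp continuous_snd).tendsto
          ((1, 0, 0) : ℝ × (Euc n →L[ℝ] Euc n) × (Euc n →L[ℝ] Euc n)))
      simpa using this
    have e₃ : Tendsto (fun x : ℝ × (Euc n →L[ℝ] Euc n) × (Euc n →L[ℝ] Euc n) =>
        dil n p q (ru x.1)) (𝓝 (1, 0, 0)) (𝓝 1) := by
      have := (continuous_dil (n := n) (p := p) (q := q)).continuousAt.tendsto.comp
        ((tendsto_ru one_ne_zero).comp (continuous_fst.tendsto
          ((1, 0, 0) : ℝ × (Euc n →L[ℝ] Euc n) × (Euc n →L[ℝ] Euc n))))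
      simpa [dil_one, Function.comp_def] using this
    have := (e₁.inv.mul ((e₃.const_mul u⁻¹).mul_const u)).mul e₂
    simpa using this
  have h₂ := (((Units.continuous_val.tendsto _).comp h₁).sub_const 1).norm
  rw [Units.val_one, sub_self, norm_zero] at h₂
  have h₃ := h₂.eventually (gt_mem_nhds (by norm_num : (0 : ℝ) < 1 / 10))
  obtain ⟨κ, hκ, hb⟩ := Metric.eventually_nhds_iff.1 h₃
  refine ⟨κ, hκ, fun t X Y ht hX hY => hb (y := (t, X, Y)) ?_⟩
  simp [Prod.dist_eq, Real.dist_eq, ht, hX, hY]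

theorem exists_abs_sz_sub_one_lt (hr : r ≤ p) (hs : p + q ≤ r + s) {u : GLn n}
    (hu : u ∈ Qgrp n p q) (hsz1 : sz p q (u • Std n r s) = 1) {i : Fin n} {η : ℝ} (hη : 0 < η) :
    ∃ δ > 0, ∀ X ∈ matSub (linkS p q r s i), ‖X‖ < δ → ‖X‖ < 1 / 2 → ∀ ν : ChabautyR n,
      IsSlice r s δ δ ν →
      IsSlice r s 1 1 ν → |sz p q (u • oneAdd X • ν) - 1| < η := by
  set C : ℝ := 2 * (n + 1) * (‖u.val‖ + ‖(↑u⁻¹ : Euc n →L[ℝ] Euc n)‖) with hC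
  have hC0 : 0 ≤ C := by positivity
  let f : {X : Euc n →L[ℝ] Euc n // X ∈ matSub (linkS p q r s i) ∧ ‖X‖ < 1 / 2} ×
      {ν : ChabautyR n // IsSlice r s 1 1 ν} → ℝ := fun x => sz p q (u • oneAdd x.1.1 • x.2.1)
  have hf : Continuous f := by
    refine (continuousOn_sz (a := C) hC0).comp_continuous
      ((continuous_oneAdd_smul (δ := 1 / 2) (by norm_num)).const_smul u) fun x => ?_
    exact x.2.2.smul_oneAdd_smul hr hs hu x.1.2.1 x.1.2.2.le
  let x₀ : {X : Euc n →L[ℝ] Euc n // X ∈ matSub (linkS p q r s i) ∧ ‖X‖ < 1 / 2} ×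
      {ν : ChabautyR n // IsSlice r s 1 1 ν} :=
    (⟨0, zero_mem _, by simp⟩, ⟨Std n r s, isSlice_Std zero_le_one zero_le_one⟩)
  have hx₀ : f x₀ = 1 := by simp [f, x₀, hsz1]
  have hU : {x | |f x - 1| < η} ∈ 𝓝 x₀ := by
    refine (isOpen_lt (hf.sub continuous_const).abs continuous_const).mem_nhds ?_
    change |f x₀ - 1| < η
    rwa [hx₀, sub_self, abs_zero]
  obtain ⟨U, hU, V, hV, hUV⟩ := mem_nhds_prod_iff.1 hU
  obtain ⟨U', hU', hUU⟩ := mem_nhds_subtype _ _ _ |>.1 hU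
  obtain ⟨V', hV', hVV⟩ := mem_nhds_subtype _ _ _ |>.1 hV
  obtain ⟨ε₁, hε₁, hb⟩ := Metric.mem_nhds_iff.1 hU'
  obtain ⟨ε₂, hε₂, hb'⟩ := exists_isSlice_subset hV'
  refine ⟨min ε₁ ε₂, lt_min hε₁ hε₂, fun X hX h₁ h₂ ν h₃ h₄ => ?_⟩
  exact hUV (a := (⟨X, hX, h₂⟩, ⟨ν, h₄⟩))
    ⟨hUU (a := ⟨X, hX, h₂⟩) (hb (by simpa [x₀] using h₁.trans_le (min_le_left _ _))),
      hVV (a := ⟨ν, h₄⟩) (hb' ν (h₃.mono (min_le_right _ _) (min_le_right _ _)))⟩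

set_option maxHeartbeats 1000000 in
/-- Charts of the link of a stratum along a neighbouring stratum. -/
theorem exists_link_chart (hr : r ≤ p) (hs : p + q ≤ r + s) (hn : r + s ≤ n) (hne : (r, s) ≠ (p, q)) {i : Fin n} (hi : IsDiag p q r s i)
    {u : GLn n} (hu : u ∈ Qgrp n p q) (z : Lk n p q) (hz : z.1 = u • Std n r s) :
    ∃ δ > 0, ∃ F : {X : Euc n →L[ℝ] Euc n // X ∈ matSub (linkS p q r s i) ∧ ‖X‖ < δ} ×
      Nb n r s δ → Lk n p q, IsOpenEmbedding F ∧ (∀ x, ∃ g : GLn n, (F x).1 = g • x.2.1) ∧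
      ∀ x, x.1.1 = 0 → x.2.1 = Std n r s → F x = z := by
  set C : ℝ := 2 * (n + 1) * (‖u.val‖ + ‖(↑u⁻¹ : Euc n →L[ℝ] Euc n)‖) with hC
  have hC0 : 0 ≤ C := by positivity
  obtain ⟨κ, hκ, hκg⟩ := exists_norm_conj_dil_lt (p := p) (q := q) u
  obtain ⟨δ₁, hδ₁, hδsz⟩ := exists_abs_sz_sub_one_lt hr hs hu (hz ▸ z.2.2)
    (show 0 < min (1 / 2) (κ / 5) by positivity) (i := i)
  set δ : ℝ := min (min δ₁ κ) (min (1 / 40) (1 / (12 * (4 * ‖u.val‖ + 1)))) with hδ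
  have hδpos : 0 < δ := by positivity
  have hδδ₁ : δ ≤ δ₁ := (min_le_left _ _).trans (min_le_left _ _)
  have hδκ : δ ≤ κ := (min_le_left _ _).trans (min_le_right _ _)
  have hδ40 : δ ≤ 1 / 40 := (min_le_right _ _).trans (min_le_left _ _)
  have hδu : (4 * ‖u.val‖ + 1) * (6 * δ) < 1 := by
    have : δ ≤ 1 / (12 * (4 * ‖u.val‖ + 1)) := (min_le_right _ _).trans (min_le_right _ _)
    rw [le_div_iff₀ (by positivity)] at this
    nlinarith
  have hslice : ∀ {X : Euc n →L[ℝ] Euc n} {ν : ChabautyR n}, X ∈ matSub (linkS p q r s i) → ‖X‖ < δ → IsSlice r s δ δ ν →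
      IsSlice p q C C (u • oneAdd X • ν) ∧ sz p q (u • oneAdd X • ν) ≠ 0 ∧
        |sz p q (u • oneAdd X • ν) - 1| < min (1 / 2) (κ / 5) := by
    intro X ν hX hXn hν
    have hν1 : IsSlice r s 1 1 ν := hν.mono (by linarith) (by linarith)
    have h₁ := hν1.smul_oneAdd_smul hr hs hu hX (by linarith)
    refine ⟨h₁, fun h0 => ?_, hδsz X hX (hXn.trans_le hδδ₁) (by linarith) ν
      (hν.mono hδδ₁ hδδ₁) hν1⟩
    rw [h₁.sz_eq_zero_iff hC0, smul_smul] at h0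
    exact hν1.ne_Std hr hs hn hne zero_le_one _ h0
  let G : {X : Euc n →L[ℝ] Euc n // X ∈ matSub (linkS p q r s i) ∧ ‖X‖ < δ} × Nb n r s δ →
      ChabautyR n := fun x => u • oneAdd x.1.1 • x.2.1
  have hG : ∀ x, IsSlice p q C C (G x) ∧ sz p q (G x) ≠ 0 ∧
      |sz p q (G x) - 1| < min (1 / 2) (κ / 5) := fun x => hslice x.1.2.1 x.1.2.2 (Nb.isSlice x.2)
  let F : {X : Euc n →L[ℝ] Euc n // X ∈ matSub (linkS p q r s i) ∧ ‖X‖ < δ} × Nb n r s δ →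
      Lk n p q := fun x => ⟨nz p q (G x), (hG x).1.nz_isSlice hC0 (hG x).2.1⟩
  have hGc : Continuous G := (continuous_oneAdd_smul (by linarith)).const_smul u
  refine ⟨δ, hδpos, F, isOpenEmbedding_of_forall_eventually ?_ ?_ ?_, fun x => ?_, fun x h₁ h₂ => ?_⟩
  · exact ((continuousOn_nz (a := C) hC0).comp_continuous hGc
      fun x => ⟨(hG x).1, (hG x).2.1⟩).subtype_mk _
  · intro x y hxy
    have hxy' : nz p q (G x) = nz p q (G y) := congrArg Subtype.val hxy
    obtain ⟨-, hx0, hx1⟩ := hG x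
    obtain ⟨-, hy0, hy1⟩ := hG y
    set t := sz p q (G y) * (sz p q (G x))⁻¹ with ht
    have ht0 : t ≠ 0 := mul_ne_zero hy0 (inv_ne_zero hx0)
    have hdil : dil n p q (ru t) • G x = G y := by
      have e := dil_smul_nz hy0
      rw [← hxy', nz, smul_smul, ← dil_mul, ← ru_mul hy0 (inv_ne_zero hx0)] at e
      exact e
    have ht1 : |t - 1| < κ := by
      have hm₁ := min_le_left (1 / 2) (κ / 5)
      have hm₂ := min_le_right (1 / 2) (κ / 5)
      rw [abs_lt] at hx1 hy1
      have hxpos : 0 < sz p q (G x) := by linarith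
      have e : t - 1 = (sz p q (G y) - sz p q (G x)) / sz p q (G x) := by
        rw [ht]
        field_simp
      rw [e, abs_div, abs_of_pos hxpos, div_lt_iff₀ hxpos, abs_lt]
      constructor <;> nlinarith
    set g := (oneAdd y.1.1)⁻¹ * (u⁻¹ * dil n p q (ru t) * u) * oneAdd x.1.1 with hg
    have hgν : g • x.2.1 = y.2.1 := by
      have : (u⁻¹ * dil n p q (ru t) * u) • oneAdd x.1.1 • x.2.1 = oneAdd y.1.1 • y.2.1 := by
        rw [mul_smul, mul_smul, inv_smul_eq_iff]
        exact hdil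
      rw [hg, mul_smul, mul_smul, this, inv_smul_smul]
    have hxs := (Nb.isSlice x.2).mono hδ40 hδ40
    have hys := (Nb.isSlice y.2).mono hδ40 hδ40
    have hgQ : g ∈ Qgrp n r s :=
      IsSlice.rigid (r := r) (s := s) (δ := 1 / 10) le_rfl le_rfl (hxs.mono (by norm_num) le_rfl)
        (hgν.symm ▸ hys) (by norm_num) (by norm_num)
        (hκg t _ _ ht1 (x.1.2.2.trans_le hδκ) (y.1.2.2.trans_le hδκ)).le (by norm_num)
    have hx1' : ‖x.1.1‖ < 1 := x.1.2.2.trans_le (by linarith)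
    have hy1' : ‖y.1.1‖ < 1 := y.1.2.2.trans_le (by linarith)
    obtain ⟨hX₁, hX₂, hX₃⟩ := (mem_matSub_linkS hx1').1 x.1.2.1
    obtain ⟨hY₁, hY₂, hY₃⟩ := (mem_matSub_linkS hy1').1 y.1.2.1
    have hdiag := diag_of_factor hs hi hX₁ hx1' hY₁ hy1' hX₂ hY₂ hgQ hu
      (t := ru t) (by rw [hg]; group)
    rw [hX₃, hY₃, add_zero, mul_one, diagScale, ru_val ht0] at hdiag
    have ht1 : t = 1 := by
      split_ifs at hdiag
      · exact hdiag.symm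
      · exact (inv_eq_one.1 hdiag.symm)
    rw [ht1, ru_one, dil_one, one_smul] at hdil
    have hinj : oneAdd x.1.1 • x.2.1 = oneAdd y.1.1 • y.2.1 := (MulAction.injective u) hdil
    obtain ⟨h₁, h₂⟩ := oneAdd_smul_injective hX₁ hY₁ (x.1.2.2.le.trans hδ40)
      (y.1.2.2.le.trans hδ40) hxs hys hinj
    exact Prod.ext (Subtype.ext h₁) (Subtype.ext h₂)
  · rintro ⟨⟨X₀, hX₀, hX₀n⟩, ⟨ν₀, c₀, hc₀, hν₀⟩⟩ V hV
    simp only at hV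
    set x₀ : {X : Euc n →L[ℝ] Euc n // X ∈ matSub (linkS p q r s i) ∧ ‖X‖ < δ} × Nb n r s δ :=
      (⟨X₀, hX₀, hX₀n⟩, ⟨ν₀, c₀, hc₀, hν₀⟩) with hx₀
    obtain ⟨hs₀, hs₀0, hs₀1⟩ := hG x₀
    set s₀ := sz p q (G x₀) with hs₀def
    have hs₀pos : 0 < s₀ := lt_of_le_of_ne sz_nonneg hs₀0.symm
    have hs₀2 : s₀ ≤ 2 := by
      have hm₁ := min_le_left (1 / 2) (κ / 5)
      rw [abs_lt] at hs₀1
      linarith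
    have hX₀1 : ‖X₀‖ < 1 := by linarith
    obtain ⟨hX₀₁, hX₀₂, hX₀₃⟩ := (mem_matSub_linkS hX₀1).1 hX₀
    obtain ⟨c₁, hc₀₁, hc₁⟩ := exists_between hc₀
    have hc₁0 : 0 ≤ c₁ := hν₀.cov.nonneg.trans hc₀₁.le
    -- neighbourhoods
    have hΦ : Tendsto (fun x : (Euc n →L[ℝ] Euc n) × GLn n × ChabautyR n =>
        (X₀ + x.1 + X₀ * x.1, x.2.1 • x.2.2)) (𝓝 (0, 1, ν₀)) (𝓝 (X₀, ν₀)) := by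
      have e₁ : Tendsto (fun x : (Euc n →L[ℝ] Euc n) × GLn n × ChabautyR n =>
          X₀ + x.1 + X₀ * x.1) (𝓝 (0, 1, ν₀)) (𝓝 X₀) := by
        have h := continuous_fst.tendsto ((0, 1, ν₀) : (Euc n →L[ℝ] Euc n) × GLn n × ChabautyR n)
        have := (h.const_add X₀).add (h.const_mul X₀)
        simpa using this
      have e₂ : Tendsto (fun x : (Euc n →L[ℝ] Euc n) × GLn n × ChabautyR n =>
          x.2.1 • x.2.2) (𝓝 (0, 1, ν₀)) (𝓝 ν₀) := by
        have h := continuous_snd.tendsto ((0, 1, ν₀) : (Euc n →L[ℝ] Euc n) × GLn n × ChabautyR n)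
        have := GLn.tendsto_smul ((continuous_fst.tendsto _).comp h)
          ((continuous_snd.tendsto _).comp h)
        simpa using this
      exact e₁.prodMk_nhds e₂
    have hV₂ : V ∩ {x | ‖x.1‖ < δ} ∈ 𝓝 (X₀, ν₀) := inter_mem hV
      ((isOpen_lt continuous_fst.norm continuous_const).mem_nhds hX₀n)
    obtain ⟨UY, hUY, Ug, hUg, hsub⟩ := mem_nhds_prod_iff.1 (hΦ hV₂)
    obtain ⟨Ug, hUg, Uν, hUν, hsub'⟩ := mem_nhds_prod_iff.1 hUg
    obtain ⟨ε₁, hε₁, hbY⟩ := Metric.mem_nhds_iff.1 hUY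
    have hWn : {g : GLn n | ‖g.val‖ * c₁ < δ ∧ ‖(↑g⁻¹ : Euc n →L[ℝ] Euc n)‖ * c₁ < δ} ∈
        𝓝 (1 : GLn n) := by
      refine IsOpen.mem_nhds ((isOpen_lt (Units.continuous_val.norm.mul continuous_const)
        continuous_const).inter (isOpen_lt ((Units.continuous_val.comp continuous_inv).norm.mul
          continuous_const) continuous_const)) ?_
      have h1 : ‖(1 : Euc n →L[ℝ] Euc n)‖ * c₁ < δ :=
        (mul_le_of_le_one_left hc₁0 ContinuousLinearMap.norm_id_le).trans_lt hc₁
      exact ⟨h1, by simpa using h1⟩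
    have hfac := eventually_factor (n := n) r s (lt_min hε₁ one_pos) (inter_mem hUg hWn)
    let τ : (Euc n →L[ℝ] Euc n) → ℝ := fun X => diagScale p r (1 + X (bv i) i)⁻¹
    have hτ : Tendsto τ (𝓝 X₀) (𝓝 1) := by
      have h := tendsto_diag (i := i) (X₀ := X₀)
      rw [hX₀₃, add_zero] at h
      have h' := h.inv₀ one_ne_zero
      simp only [τ, diagScale, inv_inv]
      split_ifs
      · simpa using h'
      · exact h
    have hR : Tendsto (fun X => (oneAdd X₀)⁻¹ * (u⁻¹ * dil n p q (ru (τ X)) * u * oneAdd X)) (𝓝 X₀)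
        (𝓝 1) := by
      have e₁ := (continuous_dil (n := n) (p := p) (q := q)).continuousAt.tendsto.comp
        ((tendsto_ru one_ne_zero).comp hτ)
      rw [ru_one, dil_one] at e₁
      have := ((((e₁.const_mul u⁻¹).mul_const u)).mul
        (tendsto_oneAdd hX₀1 tendsto_id)).const_mul (oneAdd X₀)⁻¹
      simpa using this
    have hV₁ : {X | (∃ Y ∈ matSub (blockS n r s), ‖Y‖ < min ε₁ 1 ∧ ∃ g ∈ Qgrp n r s,
        g ∈ Ug ∩ {g : GLn n | ‖g.val‖ * c₁ < δ ∧ ‖(↑g⁻¹ : Euc n →L[ℝ] Euc n)‖ * c₁ < δ} ∧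
        (oneAdd X₀)⁻¹ * (u⁻¹ * dil n p q (ru (τ X)) * u * oneAdd X) = oneAdd Y * g) ∧ ‖X‖ < δ} ×ˢ
        Uν ∈ 𝓝 (X₀, ν₀) :=
      prod_mem_nhds (inter_mem (hR hfac)
        ((isOpen_lt continuous_norm continuous_const).mem_nhds hX₀n)) hUν
    have hopen := eventually_exists_oneAdd_smul hX₀₁ hX₀1 ⟨c₀, hc₀₁, hν₀⟩ hV₁
    have hconv : Tendsto (fun y : Lk n p q => u⁻¹ • dil n p q (ru s₀) • y.1) (𝓝 (F x₀))
        (𝓝 (oneAdd X₀ • ν₀)) := by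
      have h := ((continuous_subtype_val.tendsto (F x₀)).const_smul (dil n p q (ru s₀))).const_smul u⁻¹
      have e : u⁻¹ • dil n p q (ru s₀) • (F x₀).1 = oneAdd X₀ • ν₀ := by
        rw [inv_smul_eq_iff]
        exact dil_smul_nz hs₀0
      rwa [e] at h
    filter_upwards [hconv.eventually hopen] with y ⟨X, hX, ν, ⟨c, hc, hν⟩, ⟨⟨hfac, hXn⟩, hνU⟩, hy⟩
    obtain ⟨Y, hY, hYn, g, hg, ⟨hgU, hg₁, hg₂⟩, hfeq⟩ := hfac
    have hX1 : ‖X‖ < 1 := by linarith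
    have hru : (ru s₀ : ℝ) = s₀ := ru_val hs₀0
    -- the automorphism preserves the slice
    have hys : IsSlice p q s₀ s₀ (dil n p q (ru s₀) • y.1) := by
      have := y.2.1.dilate (t := ru s₀) (ru_pos hs₀pos)
      rwa [hru, mul_one] at this
    have hXQ : oneAdd X ∈ Qgrp n p q := by
      have h' := hys.smul ((Qgrp n p q).inv_mem hu) hs₀pos.le
      rw [← hy, inv_inv] at h'
      refine IsSlice.rigid hr hs (hν.mono (hc.trans hc₁).le le_rfl) h' hδpos
        (by positivity) ?_ ?_
      · rw [oneAdd_val hX1, add_sub_cancel_left]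
        exact hXn.le
      · have : (‖u.val‖ * s₀ + 1) * (6 * δ) ≤ (4 * ‖u.val‖ + 1) * (6 * δ) :=
          mul_le_mul_of_nonneg_right (by nlinarith [norm_nonneg u.val]) (by positivity)
        linarith
    have hXii : |X (bv i) i| < 1 / 40 := by
      have h1 := (norm_coord_le (X (bv i)) i).trans (X.le_opNorm (bv i))
      rw [norm_bv, mul_one] at h1
      linarith
    rw [abs_lt] at hXii
    have hpos : 0 < 1 + X (bv i) i := by linarith
    have hτpos : 0 < τ X := by
      simp only [τ, diagScale]
      split_ifs <;> positivity
    have hτ2 : τ X ≤ 2 := by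
      simp only [τ, diagScale, inv_inv]
      split_ifs
      · rw [inv_le_comm₀ hpos two_pos]
        linarith
      · linarith
    set X' := X₀ + Y + X₀ * Y with hX'
    have hmem := hsub (a := (Y, g, ν)) ⟨hbY (by simpa using hYn.trans_le (min_le_left _ _)), hsub' ⟨hgU, hνU⟩⟩
    have hX'n : ‖X'‖ < δ := hmem.2
    have hX'1 : ‖X'‖ < 1 := by linarith
    have hX'm : X' ∈ matSub (blockS n r s) := add_mem (add_mem hX₀₁ hY) (matSub_blockS_mul hX₀₁ hY)
    have hgν : IsSlice r s (max (‖g.val‖ * c₁) (‖(↑g⁻¹ : Euc n →L[ℝ] Euc n)‖ * c₁))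
        (max (‖g.val‖ * c₁) (‖(↑g⁻¹ : Euc n →L[ℝ] Euc n)‖ * c₁)) (g • ν) :=
      ((hν.mono hc.le hc.le).smul hg hc₁0).mono (le_max_left _ _) (le_max_right _ _)
    have hmax : max (‖g.val‖ * c₁) (‖(↑g⁻¹ : Euc n →L[ℝ] Euc n)‖ * c₁) < δ := max_lt hg₁ hg₂
    have hY1 : (oneAdd X').val = (oneAdd X₀ * oneAdd Y).val := by
      have hYlt : ‖Y‖ < 1 := hYn.trans_le (min_le_right _ _)
      rw [Units.val_mul, oneAdd_val hX'1, oneAdd_val hX₀1, oneAdd_val hYlt, hX']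
      noncomm_ring
    have hX'eq : oneAdd X' * g = u⁻¹ * dil n p q (ru (τ X)) * u * oneAdd X := by
      rw [Units.ext hY1, mul_assoc, ← hfeq, mul_inv_cancel_left]
    have hact : oneAdd X' • g • ν = u⁻¹ • dil n p q (ru (τ X)) • dil n p q (ru s₀) • y.1 := by
      rw [smul_smul, hX'eq, mul_smul, hy, mul_smul, mul_smul, smul_inv_smul]
    have hX'Q : oneAdd X' ∈ Qgrp n p q := by
      have h' := ((hys.dilate (t := ru (τ X)) (ru_pos hτpos)).smul ((Qgrp n p q).inv_mem hu)
        (by rw [ru_val hτpos.ne']; positivity))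
      rw [← hact, inv_inv, ru_val hτpos.ne'] at h'
      refine IsSlice.rigid hr hs (hgν.mono hmax.le le_rfl) h' hδpos (by positivity) ?_ ?_
      · rw [oneAdd_val hX'1, add_sub_cancel_left]
        exact hX'n.le
      · have h4 : τ X * s₀ ≤ 4 := by nlinarith
        have : (‖u.val‖ * (τ X * s₀) + 1) * (6 * δ) ≤ (4 * ‖u.val‖ + 1) * (6 * δ) :=
          mul_le_mul_of_nonneg_right (by nlinarith [norm_nonneg u.val]) (by positivity)
        linarith
    have hdiag := diag_of_factor hs hi hX hX1 hX'm hX'1 hXQ hX'Q hg hu hX'eq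
    have hX'0 : X' (bv i) i = 0 := by
      have : diagScale p r (ru (τ X) : ℝ) * (1 + X (bv i) i) = 1 := by
        rw [ru_val hτpos.ne']
        simp only [τ, diagScale]
        split_ifs
        · field_simp
        · rw [inv_inv]
          field_simp
      rw [this] at hdiag
      linarith
    have hX'S : X' ∈ matSub (linkS p q r s i) :=
      (mem_matSub_linkS hX'1).2 ⟨hX'm, hX'Q, hX'0⟩
    refine ⟨(⟨X', hX'S, hX'n⟩, ⟨g • ν, _, hmax, hgν⟩), hmem.1, Subtype.ext ?_⟩
    change nz p q (u • oneAdd X' • g • ν) = y.1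
    rw [hact, smul_inv_smul, hys.nz_dil hs₀pos.le (ru_pos hτpos) ?_,
      y.2.1.nz_dil zero_le_one (ru_pos hs₀pos) (by rw [y.2.2]; norm_num), nz_eq_self y.2.2]
    rw [y.2.1.sz_dil zero_le_one (ru_pos hs₀pos), y.2.2, mul_one, hru]
    exact hs₀0
  · exact ⟨_, by
      change nz p q (u • oneAdd x.1.1 • x.2.1) = _
      rw [nz, smul_smul, smul_smul]⟩
  · refine Subtype.ext ?_
    change nz p q (u • oneAdd x.1.1 • x.2.1) = z.1
    rw [h₁, h₂, oneAdd_zero, one_smul, ← hz]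
    exact nz_eq_self z.2.2

end LinkCharts

/-! ### A criterion for Goresky–MacPherson stratifications -/

section Criterion

theorem IsGoreskyMacPherson.isTopStratification {X : Type u} [TopologicalSpace X] {ι : Type u}
    {A : ι → Set X} {dim : ι → ℕ} (h : IsGoreskyMacPherson A dim) : IsTopStratification A dim := by
  cases h
  assumption

theorem OpenCone.isClosed_apex {L : Type u} [TopologicalSpace L] :
    IsClosed ({OpenCone.apex} : Set (OpenCone L)) := by
  have hq : IsQuotientMap (Quot.mk (ConeRel L) : _ → OpenCone L) := isQuotientMap_quot_mk
  refine hq.isClosed_preimage.1 ?_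
  rw [isClosed_sum_iff]
  constructor
  · convert isClosed_univ
    ext
    simp only [mem_preimage, mem_univ, iff_true]
    rfl
  · have : Sum.inr ⁻¹' (Quot.mk (ConeRel L) ⁻¹' {OpenCone.apex}) =
        {x : L × Set.Ico (0 : ℝ) 1 | x.2.1 = 0} := by
      ext ⟨l, t⟩
      constructor
      · intro h
        let φ : OpenCone L → ℝ := Quot.lift (Sum.elim (fun _ => 0) fun x => x.2.1) (by
          rintro _ _ ⟨l⟩
          rfl)
        exact congrArg φ (show OpenCone.mk l t = OpenCone.apex from h)
      · intro h
        exact OpenCone.mk_eq_apex l h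
    refine Eq.mpr (congrArg IsClosed this) ?_
    exact isClosed_eq (continuous_subtype_val.comp continuous_snd) continuous_const

theorem stratDim_lt_top {ι : Type*} [Finite ι] (dim : ι → ℕ) : stratDim dim < ⊤ := by
  cases isEmpty_or_nonempty ι
  · rw [stratDim, iSup_of_empty]
    exact bot_lt_top
  · obtain ⟨s, hs⟩ := exists_eq_ciSup_of_finite (f := fun s => ((dim s : ℕ∞) : WithBot ℕ∞))
    rw [stratDim, ← hs]
    exact WithBot.coe_lt_coe.2 (ENat.natCast_lt_top _)

theorem stratDim_lt {ι κ : Type*} [Finite κ] {dim : ι → ℕ} {dim' : κ → ℕ} {τ : κ → ι}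
    (s : ι) (h : ∀ k, dim' k < dim (τ k)) : stratDim dim' < stratDim dim := by
  cases isEmpty_or_nonempty κ
  · rw [stratDim, iSup_of_empty]
    exact (WithBot.bot_lt_coe _).trans_le
      (le_iSup (fun s => ((dim s : ℕ∞) : WithBot ℕ∞)) s)
  · obtain ⟨k, hk⟩ := exists_eq_ciSup_of_finite (f := fun s => ((dim' s : ℕ∞) : WithBot ℕ∞))
    rw [stratDim, ← hk]
    refine lt_of_lt_of_le ?_ (le_iSup (fun s => ((dim s : ℕ∞) : WithBot ℕ∞)) (τ k))
    exact WithBot.coe_lt_coe.2 (by exact_mod_cast h k)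

variable {X : Type u} [TopologicalSpace X] {L : Type u} [TopologicalSpace L] {κ ι : Type u}
  {A : ι → Set X} {B : κ → Set L} {d : ℕ}

/-- A conical chart along the stratum `A s`. -/
structure IsConeChart (A : ι → Set X) (B : κ → Set L) (τ : κ → ι) (s : ι)
    (f : Euc d × OpenCone L → X) : Prop where
  emb : IsOpenEmbedding f
  self : f ⁻¹' A s = univ ×ˢ {OpenCone.apex}
  next : ∀ k, f ⁻¹' A (τ k) = univ ×ˢ coneStrata B (some k)

variable {τ : κ → ι} {s : ι} {f : Euc d × OpenCone L → X}

theorem IsConeChart.apex_mem (hf : IsConeChart A B τ s f) (v : Euc d) :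
    f (v, OpenCone.apex) ∈ A s := by
  have : (v, OpenCone.apex) ∈ f ⁻¹' A s := by
    rw [hf.self]
    exact ⟨mem_univ _, rfl⟩
  exact this

theorem IsConeChart.eq_or (hf : IsConeChart A B τ s f) (hA : Pairwise fun s t => Disjoint (A s) (A t))
    (hB : ⋃ k, B k = univ) {t : ι} (h : (f ⁻¹' A t).Nonempty) : t = s ∨ ∃ k, t = τ k := by
  have huniq : ∀ {t t' : ι} {x : X}, x ∈ A t → x ∈ A t' → t = t' := fun {t t' x} h h' => by
    by_contra hne
    exact Set.disjoint_left.1 (hA hne) h h'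
  obtain ⟨⟨v, z⟩, h⟩ := h
  rcases OpenCone.cases z with rfl | ⟨l, c, hc, rfl⟩
  · exact .inl (huniq h (hf.apex_mem v))
  · obtain ⟨k, hk⟩ := mem_iUnion.1 (hB.symm ▸ mem_univ l : l ∈ ⋃ k, B k)
    refine .inr ⟨k, huniq h ?_⟩
    have : (v, OpenCone.mk l c) ∈ f ⁻¹' A (τ k) := by
      rw [hf.next]
      exact ⟨mem_univ _, l, hk, c, hc, rfl⟩
    exact this

theorem IsConeChart.mem_closure [CompactSpace L] (hf : IsConeChart A B τ s f) {k : κ}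
    (hB : (B k).Nonempty) (v : Euc d) : f (v, OpenCone.apex) ∈ closure (A (τ k)) := by
  obtain ⟨l, hl⟩ := hB
  rw [mem_closure_iff]
  intro O hO hx
  have hV : IsOpen {z : OpenCone L | f (v, z) ∈ O} :=
    hO.preimage (hf.emb.continuous.comp (Continuous.prodMk_right v))
  obtain ⟨δ, hδ, h⟩ := OpenCone.exists_subset hV hx
  have h1 := min_le_left δ 1
  have h2 := min_le_right δ 1
  have h3 : 0 < min δ 1 := lt_min hδ one_pos
  let t : Set.Ico (0 : ℝ) 1 := ⟨min δ 1 / 2, by linarith, by linarith⟩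
  refine ⟨f (v, OpenCone.mk l t), h l t (by change min δ 1 / 2 < δ; linarith), ?_⟩
  have : (v, OpenCone.mk l t) ∈ f ⁻¹' A (τ k) := by
    rw [hf.next]
    exact ⟨mem_univ _, l, hl, t, half_pos h3, rfl⟩
  exact this

theorem IsConeChart.closure_inter_range (hf : IsConeChart A B τ s f) :
    closure (A s) ∩ range f ⊆ A s := by
  rintro _ ⟨hy, ⟨v, z⟩, rfl⟩
  by_cases hz : z = OpenCone.apex
  · subst hz
    exact hf.apex_mem v
  · exfalso
    have hO : IsOpen (f '' (univ ×ˢ {OpenCone.apex}ᶜ)) :=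
      hf.emb.isOpenMap _ (isOpen_univ.prod OpenCone.isClosed_apex.isOpen_compl)
    obtain ⟨_, ⟨⟨v', z'⟩, hm, rfl⟩, hA⟩ := mem_closure_iff.1 hy _ hO
      ⟨(v, z), ⟨mem_univ _, hz⟩, rfl⟩
    have : (v', z') ∈ f ⁻¹' A s := hA
    rw [hf.self] at this
    exact hm.2 this.2

theorem isOpenEmbedding_pair_apex :
    IsEmbedding fun v : Euc d => ((v, OpenCone.apex) : Euc d × OpenCone L) :=
  .of_leftInverse (f := Prod.fst) (fun _ => rfl) continuous_fst (Continuous.prodMk_left _)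

theorem IsConeChart.isEmbedding (hf : IsConeChart A B τ s f) :
    IsEmbedding fun v => f (v, OpenCone.apex) :=
  hf.emb.isEmbedding.comp isOpenEmbedding_pair_apex

theorem IsConeChart.range_eq (hf : IsConeChart A B τ s f) :
    range (fun v => f (v, OpenCone.apex)) = range f ∩ A s := by
  ext y
  constructor
  · rintro ⟨v, rfl⟩
    exact ⟨⟨_, rfl⟩, hf.apex_mem v⟩
  · rintro ⟨⟨⟨v, z⟩, rfl⟩, hy⟩
    have : (v, z) ∈ f ⁻¹' A s := hy
    rw [hf.self] at this
    obtain rfl : z = OpenCone.apex := this.2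
    exact ⟨v, rfl⟩

theorem IsConeChart.isOpenEmbedding (hf : IsConeChart A B τ s f) :
    IsOpenEmbedding fun v => (⟨f (v, OpenCone.apex), hf.apex_mem v⟩ : A s) := by
  refine ⟨hf.isEmbedding.codRestrict _ _, ?_⟩
  have : range (fun v => (⟨f (v, OpenCone.apex), hf.apex_mem v⟩ : A s)) =
      Subtype.val ⁻¹' range f := by
    ext y
    constructor
    · rintro ⟨v, rfl⟩
      exact ⟨_, rfl⟩
    · intro hy
      have : y.1 ∈ range f ∩ A s := ⟨hy, y.2⟩
      rw [← hf.range_eq] at this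
      obtain ⟨v, hv⟩ := this
      exact ⟨v, Subtype.ext hv⟩
  rw [this]
  exact hf.emb.isOpen_range.preimage continuous_subtype_val

theorem IsConeChart.isLink [CompactSpace L] (hf : IsConeChart A B τ s f) (hB : IsStratification B)
    (hA : Pairwise fun s t => Disjoint (A s) (A t)) : IsLink A (f (0, OpenCone.apex)) B := by
  refine ⟨inferInstance, hB, s, range fun v => f (v, OpenCone.apex), ⟨0, rfl⟩,
    ⟨range f, hf.emb.isOpen_range, hf.range_eq⟩, ?_⟩
  let e := hf.isEmbedding.toHomeomorph
  refine ⟨fun x => f (e.symm x.1, x.2), ?_, fun u => ?_, fun t ht => ?_⟩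
  · exact hf.emb.comp (e.symm.prodCongr (Homeomorph.refl _)).isOpenEmbedding
  · exact congrArg Subtype.val (e.apply_symm_apply u)
  · have hpre : ∀ C : Set (OpenCone L), f ⁻¹' A t = univ ×ˢ C →
        (fun x : range (fun v => f (v, OpenCone.apex)) × OpenCone L => f (e.symm x.1, x.2)) ⁻¹' A t =
          univ ×ˢ C := by
      intro C hC
      have : (fun x : range (fun v => f (v, OpenCone.apex)) × OpenCone L =>
          f (e.symm x.1, x.2)) ⁻¹' A t = (fun x => (e.symm x.1, x.2)) ⁻¹' (f ⁻¹' A t) := rfl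
      rw [this, hC]
      ext
      simp
    obtain ⟨x, hx⟩ := ht
    rcases hf.eq_or hA hB.cover (t := t) ⟨_, hx⟩ with rfl | ⟨k, rfl⟩
    · exact ⟨none, hpre _ hf.self⟩
    · exact ⟨some k, hpre _ (hf.next k)⟩

/-- A partition with conical charts is a Goresky–MacPherson stratification. -/
theorem isGoreskyMacPherson_of_charts [TopologicalSpace.MetrizableSpace X]
    [TopologicalSpace.SeparableSpace X] [Finite ι] {dim : ι → ℕ}
    (hne : ∀ s, (A s).Nonempty) (hA : Pairwise fun s t => Disjoint (A s) (A t))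
    (hcov : ⋃ s, A s = univ) (L : ι → Type u) [∀ s, TopologicalSpace (L s)]
    [∀ s, CompactSpace (L s)] (κ : ι → Type u) [∀ s, Finite (κ s)] (B : ∀ s, κ s → Set (L s))
    (dimB : ∀ s, κ s → ℕ) (hgm : ∀ s, IsGoreskyMacPherson (B s) (dimB s)) (τ : ∀ s, κ s → ι)
    (hdim : ∀ s k, dim s < dim (τ s k)) (hdimB : ∀ s k, dimB s k < dim (τ s k))
    (hchart : ∀ s, ∀ x ∈ A s, ∃ f : Euc (dim s) × OpenCone (L s) → X,
      IsConeChart A (B s) (τ s) s f ∧ f (0, OpenCone.apex) = x) :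
    IsGoreskyMacPherson A dim := by
  have hB := fun s => (hgm s).isTopStratification.toIsStratification
  have hcl : ∀ {s t : ι} {x : X}, x ∈ A s → x ∈ closure (A t) → t = s ∨ ∃ k, t = τ s k := by
    intro s t x hx hxt
    obtain ⟨f, hf, hfx⟩ := hchart s x hx
    obtain ⟨_, ⟨y, rfl⟩, hy⟩ := mem_closure_iff.1 hxt _ hf.emb.isOpen_range ⟨_, hfx⟩
    exact hf.eq_or hA (hB s).cover ⟨y, hy⟩
  have htop : IsTopStratification A dim :=
    { metrizable := inferInstance
      separable := inferInstance
      nonempty := hne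
      disjoint := hA
      cover := hcov
      locallyFinite := locallyFinite_of_finite A
      locallyClosed := fun s => by
        choose f hf hfx using hchart s
        refine ⟨⋃ (x) (hx : x ∈ A s), range (f x hx), closure (A s),
          isOpen_iUnion fun x => isOpen_iUnion fun hx => (hf x hx).emb.isOpen_range,
          isClosed_closure, ?_⟩
        ext y
        simp only [mem_inter_iff, mem_iUnion]
        constructor
        · intro hy
          exact ⟨⟨y, hy, _, hfx y hy⟩, subset_closure hy⟩
        · rintro ⟨⟨x, hx, hy⟩, hy'⟩
          exact (hf x hx).closure_inter_range ⟨hy', hy⟩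
      frontier := by
        rintro s t ⟨x, hxt, hxs⟩ y hy
        obtain ⟨f, hf, hfy⟩ := hchart t y hy
        rcases hcl hxt hxs with rfl | ⟨k, rfl⟩
        · exact subset_closure hy
        · exact hfy ▸ hf.mem_closure ((hB t).nonempty k) 0
      manifold := fun s => by
        choose f hf hfx using hchart s
        exact ⟨{ atlas := univ
                 chartAt := fun x => ((hf x.1 x.2).isOpenEmbedding.toOpenPartialHomeomorph).symm
                 mem_chart_source := fun x => by
                   simp only [OpenPartialHomeomorph.symm_source,
                     IsOpenEmbedding.toOpenPartialHomeomorph_target]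
                   exact ⟨0, Subtype.ext (hfx x.1 x.2)⟩
                 chart_mem_atlas := fun x => mem_univ _ }⟩
      dim_lt := by
        intro s t hst hsub
        obtain ⟨x, hx⟩ := hne t
        rcases hcl hx (hsub hx) with h | ⟨k, rfl⟩
        · exact absurd h hst
        · exact hdim t k }
  choose σ hσ using fun x => mem_iUnion.1 (hcov.symm ▸ mem_univ x : x ∈ ⋃ s, A s)
  refine .intro htop (stratDim_lt_top dim) (fun x => L (σ x)) (fun x => κ (σ x))
    (fun x => B (σ x)) (fun x => dimB (σ x)) (fun x => ?_)
    (fun x => stratDim_lt (σ x) (hdimB (σ x))) fun x => hgm (σ x)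
  obtain ⟨f, hf, hfx⟩ := hchart (σ x) x (hσ x)
  have := hf.isLink (hB (σ x)) hA
  rwa [hfx] at this

end Criterion

/-! ### The stratifications by type -/

section TypeStrata

namespace JoinIndex

variable {a b : ℕ}

theorem fstRank_le (k : JoinIndex a b) : k.fstRank ≤ a := by
  rcases k with i | i | ⟨i, j⟩
  · exact i.2
  · exact Nat.zero_le _
  · exact i.2

theorem sndRank_le (k : JoinIndex a b) : k.sndRank ≤ b := by
  rcases k with i | i | ⟨i, j⟩
  · exact Nat.zero_le _
  · exact i.2
  · exact j.2

theorem rank_pos (k : JoinIndex a b) : 0 < k.fstRank + k.sndRank := by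
  rcases k with i | i | ⟨i, j⟩ <;> simp [fstRank, sndRank]

theorem ext_rank {k k' : JoinIndex a b} (h : k.fstRank = k'.fstRank)
    (h' : k.sndRank = k'.sndRank) : k = k' := by
  rcases k with i | i | ⟨i, j⟩ <;> rcases k' with i' | i' | ⟨i', j'⟩ <;>
    simp [fstRank, sndRank, Fin.ext_iff] at h h' ⊢ <;> omega

theorem exists_rank {j m : ℕ} (hj : j ≤ a) (hm : m ≤ b) (h : 0 < j + m) :
    ∃ k : JoinIndex a b, k.fstRank = j ∧ k.sndRank = m := by
  rcases Nat.eq_zero_or_pos j with rfl | hj0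
  · exact ⟨Sum.inr (Sum.inl ⟨m - 1, by omega⟩), rfl, by simp [sndRank]; omega⟩
  · rcases Nat.eq_zero_or_pos m with rfl | hm0
    · exact ⟨Sum.inl ⟨j - 1, by omega⟩, by simp [fstRank]; omega, rfl⟩
    · exact ⟨Sum.inr (Sum.inr (⟨j - 1, by omega⟩, ⟨m - 1, by omega⟩)), by simp [fstRank]; omega,
        by simp [sndRank]; omega⟩

end JoinIndex

variable {n p q r s : ℕ} {a b c : ℝ} {Γ : ChabautyR n}

/-- The stratification of the link by type. -/
def lkStrata (n p q : ℕ) (k : JoinIndex p (n - (p + q))) : Set (Lk n p q) :=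
  {Γ | Γ.1 ∈ typeStratum n (p - k.fstRank) (q + k.fstRank + k.sndRank)}

/-- The dimension of the strata of the link. -/
def lkDim (n p q : ℕ) (k : JoinIndex p (n - (p + q))) : ℕ :=
  (n - (p - k.fstRank)) * (p - k.fstRank + (q + k.fstRank + k.sndRank)) - (n - p) * (p + q) - 1

theorem dim_lt_dim (hr : r ≤ p) (hs : p + q ≤ r + s) (hn : r + s ≤ n) (hne : (r, s) ≠ (p, q)) :
    (n - p) * (p + q) < (n - r) * (r + s) := by
  rcases hr.eq_or_lt with rfl | hlt
  · have : s ≠ q := by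
      rintro rfl
      exact hne rfl
    exact Nat.mul_lt_mul_of_pos_left (by omega) (by omega)
  · calc (n - p) * (p + q) < (n - r) * (p + q) := Nat.mul_lt_mul_of_pos_right (by omega) (by omega)
      _ ≤ _ := Nat.mul_le_mul_left _ hs

theorem IsSlice.exists_joinIndex (h : IsSlice p q a b Γ) (hb : 0 ≤ b) (hn : p + q ≤ n)
    (h0 : Γ ≠ Std n p q) : ∃ k : JoinIndex p (n - (p + q)),
      (∃ u ∈ Qgrp n p q, Γ = u • Std n (p - k.fstRank) (q + k.fstRank + k.sndRank)) ∧
      fstPart p Γ ∈ typeStratum p (p - k.fstRank) k.fstRank ∧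
      sndPart (p + q) (n - (p + q)) Γ ∈ typeStratum (n - (p + q)) 0 k.sndRank := by
  obtain ⟨j, hj, m, hm, ⟨u, hu, hΓ⟩, h₁, h₂⟩ := h.exists_normal hb (k := n - (p + q)) (by omega)
  obtain ⟨k, rfl, rfl⟩ := JoinIndex.exists_rank hj hm (by
    by_contra hcon
    obtain rfl : j = 0 := by omega
    obtain rfl : m = 0 := by omega
    exact h0 (hΓ.trans (Qgrp_smul_Std hu)))
  exact ⟨k, ⟨u, hu, hΓ⟩, h₁, h₂⟩

theorem Lk.ne_Std (Γ : Lk n p q) : Γ.1 ≠ Std n p q := by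
  intro h
  have h₁ := (Γ.2.1.sz_eq_zero_iff zero_le_one).2 h
  rw [Γ.2.2] at h₁
  exact one_ne_zero h₁

theorem coneFun_mem_typeStratum_self (hn : p + q ≤ n) {ε : ℝ} (hε : 0 < ε)
    (z : OpenCone (Lk n p q)) :
    coneFun n p q ε z ∈ typeStratum n p q ↔ z = OpenCone.apex := by
  constructor
  · intro h
    obtain ⟨c, -, hc⟩ := coneFun_spec hε z
    have := hc.eq_Std hc.cov.nonneg hn h
    exact (coneHomeo n p q hε).injective (Subtype.ext this)
  · rintro rfl
    exact Std_mem_typeStratum hn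

theorem coneFun_mem_typeStratum (hn : p + q ≤ n) (ε : ℝ) (z : OpenCone (Lk n p q))
    (k : JoinIndex p (n - (p + q))) :
    coneFun n p q ε z ∈ typeStratum n (p - k.fstRank) (q + k.fstRank + k.sndRank) ↔
      z ∈ coneStrata (lkStrata n p q) (some k) := by
  constructor
  · intro h
    rcases OpenCone.cases z with rfl | ⟨l, t, ht, rfl⟩
    · have := type_unique h (Std_mem_typeStratum hn)
      have := k.rank_pos
      omega
    · rw [coneFun_mk _ _ ht.ne', smul_mem_typeStratum_iff] at h
      exact ⟨l, h, t, ht, rfl⟩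
  · rintro ⟨l, hl, t, ht, rfl⟩
    rw [coneFun_mk _ _ ht.ne', smul_mem_typeStratum_iff]
    exact hl

/-- The index of the stratum of a link that corresponds to a stratum of a link of one of its
points. -/
theorem exists_joinIndex_add (hn : p + q ≤ n) (k : JoinIndex p (n - (p + q)))
    (l : JoinIndex (p - k.fstRank)
      (n - (p - k.fstRank + (q + k.fstRank + k.sndRank)))) :
    ∃ k' : JoinIndex p (n - (p + q)), p - k'.fstRank = p - k.fstRank - l.fstRank ∧
      q + k'.fstRank + k'.sndRank = q + k.fstRank + k.sndRank + l.fstRank + l.sndRank := by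
  have h₁ := k.fstRank_le
  have h₂ := k.sndRank_le
  have h₃ := l.fstRank_le
  have h₄ := l.sndRank_le
  have h₅ := k.rank_pos
  obtain ⟨k', h, h'⟩ := JoinIndex.exists_rank (a := p) (b := n - (p + q))
    (j := k.fstRank + l.fstRank) (m := k.sndRank + l.sndRank) (by omega) (by omega) (by omega)
  exact ⟨k', by omega, by omega⟩

theorem lkStrata_nonempty (hn : p + q ≤ n) (k : JoinIndex p (n - (p + q))) :
    (lkStrata n p q k).Nonempty := by
  have h₁ := k.fstRank_le
  have h₂ := k.sndRank_le
  have h₃ := k.rank_pos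
  have hs := (isSlice_Std (n := n) (p := p - k.fstRank) (q := q + k.fstRank + k.sndRank)
    le_rfl le_rfl).of_le (p := p) (q := q) (by omega) (by omega)
  have h0 : sz p q (Std n (p - k.fstRank) (q + k.fstRank + k.sndRank)) ≠ 0 := by
    rw [Ne, hs.sz_eq_zero_iff (by simp)]
    intro h
    have h' := Std_mem_typeStratum (n := n) (p := p - k.fstRank) (q := q + k.fstRank + k.sndRank)
      (by omega)
    rw [h] at h'
    have := type_unique h' (Std_mem_typeStratum hn)
    omega
  refine ⟨⟨nz p q _, hs.nz_isSlice (by simp) h0⟩, ?_⟩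
  exact smul_mem_typeStratum _ (Std_mem_typeStratum (by omega))

instance : TopologicalSpace.MetrizableSpace (Lk n p q) :=
  IsEmbedding.subtypeVal.metrizableSpace

theorem isGoreskyMacPherson_lkStrata (n p q : ℕ) (hn : p + q ≤ n) :
    IsGoreskyMacPherson (lkStrata n p q) (lkDim n p q) := by
  induction hN : n - q using Nat.strong_induction_on generalizing p q with
  | _ N ih =>
  have hle := fun k : JoinIndex p (n - (p + q)) => k.fstRank_le
  have hle' := fun k : JoinIndex p (n - (p + q)) => k.sndRank_le
  have hpos := fun k : JoinIndex p (n - (p + q)) => k.rank_pos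
  have hrs : ∀ k : JoinIndex p (n - (p + q)),
      p - k.fstRank + (q + k.fstRank + k.sndRank) ≤ n := fun k => by
    have := hle k
    have := hle' k
    omega
  choose τ hτ₁ hτ₂ using fun k => exists_joinIndex_add hn k
  have hD : ∀ k : JoinIndex p (n - (p + q)), (n - p) * (p + q) <
      (n - (p - k.fstRank)) * (p - k.fstRank + (q + k.fstRank + k.sndRank)) := fun k => by
    have := hle k
    have := hpos k
    refine dim_lt_dim (by omega) (by omega) (hrs k) fun h => ?_
    rw [Prod.mk.injEq] at h
    omega
  have hD' : ∀ k l, (n - (p - k.fstRank)) * (p - k.fstRank + (q + k.fstRank + k.sndRank)) <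
      (n - (p - (τ k l).fstRank)) *
        (p - (τ k l).fstRank + (q + (τ k l).fstRank + (τ k l).sndRank)) := fun k l => by
    have h₁ := l.fstRank_le
    have h₂ := l.sndRank_le
    have h₃ := l.rank_pos
    rw [hτ₁, hτ₂]
    have := hrs k
    refine dim_lt_dim (by omega) (by omega) (by omega) fun h => ?_
    rw [Prod.mk.injEq] at h
    omega
  refine isGoreskyMacPherson_of_charts (lkStrata_nonempty hn) ?_ ?_
    (fun k => Lk n (p - k.fstRank) (q + k.fstRank + k.sndRank))
    (fun k => JoinIndex (p - k.fstRank)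
      (n - (p - k.fstRank + (q + k.fstRank + k.sndRank))))
    (fun k => lkStrata n (p - k.fstRank) (q + k.fstRank + k.sndRank))
    (fun k => lkDim n (p - k.fstRank) (q + k.fstRank + k.sndRank))
    (fun k => ih (n - (q + k.fstRank + k.sndRank)) ?_ _ _ (hrs k) rfl) τ ?_ ?_ ?_
  · intro k k' hne
    rw [Set.disjoint_left]
    intro Γ h h'
    have := type_unique h h'
    have := hle k
    have := hle k'
    exact hne (JoinIndex.ext_rank (by omega) (by omega))
  · refine eq_univ_of_forall fun Γ => ?_
    obtain ⟨k, ⟨u, -, hu⟩, -⟩ := Γ.2.1.exists_joinIndex zero_le_one hn Γ.ne_Std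
    refine mem_iUnion.2 ⟨k, ?_⟩
    change Γ.1 ∈ typeStratum n (p - k.fstRank) (q + k.fstRank + k.sndRank)
    rw [hu]
    exact smul_mem_typeStratum u (Std_mem_typeStratum (hrs k))
  · have := hle k
    have := hle' k
    have := hpos k
    omega
  · intro k l
    have := hD k
    have := hD' k l
    simp only [lkDim]
    omega
  · intro k l
    have := hD k
    have := hD' k l
    rw [lkDim, lkDim, ← hτ₁ k l, ← hτ₂ k l]
    omega
  · intro k Γ hΓ
    have hk := hle k
    have hk' := hle' k
    have hk₀ := hpos k
    have hrk := hrs k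
    set r := p - k.fstRank with hr
    set s := q + k.fstRank + k.sndRank with hs
    obtain ⟨k', ⟨u, hu, hΓu⟩, -⟩ := Γ.2.1.exists_joinIndex zero_le_one hn Γ.ne_Std
    have ht : Γ.1 ∈ typeStratum n (p - k'.fstRank) (q + k'.fstRank + k'.sndRank) := by
      rw [hΓu]
      exact smul_mem_typeStratum u (Std_mem_typeStratum (hrs k'))
    obtain ⟨h₁, h₂⟩ := type_unique ht hΓ
    rw [h₁, h₂] at hΓu
    obtain ⟨i, hi⟩ : ∃ i : Fin n, IsDiag p q r s i := by
      rcases lt_or_ge r p with h | h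
      · exact ⟨⟨r, by omega⟩, .inl ⟨rfl, h⟩⟩
      · exact ⟨⟨p + q, by omega⟩, .inr ⟨rfl, by omega, by omega⟩⟩
    obtain ⟨δ, hδ, F, hF, hFg, hF0⟩ := exists_link_chart (r := r) (s := s) (by omega) (by omega) hrk
      (fun h => by rw [Prod.mk.injEq] at h; omega) hi hu Γ hΓu
    have hcard : (linkS p q r s i).card = lkDim n p q k := by
      have := card_linkS (by omega) (by omega) hrk hi
      simp only [lkDim, ← hr, ← hs]
      omega
    obtain ⟨e, he⟩ := Submodule.exists_homeomorph_ball (matSub (linkS p q r s i))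
      ((finrank_matSub _).trans hcard) hδ
    have htype : ∀ {r' s'} (x : Euc (lkDim n p q k) × OpenCone (Lk n r s)),
        (F (e x.1, coneHomeo n r s hδ x.2)).1 ∈ typeStratum n r' s' ↔
          coneFun n r s δ x.2 ∈ typeStratum n r' s' := by
      intro r' s' x
      obtain ⟨g, hg⟩ := hFg (e x.1, coneHomeo n r s hδ x.2)
      rw [hg, smul_mem_typeStratum_iff]
      rfl
    refine ⟨fun x => F (e x.1, coneHomeo n r s hδ x.2), ⟨?_, ?_, fun l => ?_⟩, ?_⟩
    · exact hF.comp (e.prodCongr (coneHomeo n r s hδ)).isOpenEmbedding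
    · ext x
      have := (htype (r' := r) (s' := s) x).trans (coneFun_mem_typeStratum_self hrk hδ x.2)
      simp only [mem_preimage, mem_prod, mem_univ, true_and, mem_singleton_iff]
      exact this
    · ext x
      have h := (htype (r' := r - l.fstRank) (s' := s + l.fstRank + l.sndRank) x).trans
        (coneFun_mem_typeStratum hrk δ x.2 l)
      rw [← hτ₁ k l, ← hτ₂ k l] at h
      simp only [mem_preimage, mem_prod, mem_univ, true_and]
      exact h
    · exact hF0 _ he rfl

/-- Conical charts of the Chabauty space. -/
theorem exists_cone_chart (hn : p + q ≤ n) (hΓ : Γ ∈ typeStratum n p q) {d : ℕ}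
    (hd : (n - p) * (p + q) = d) : ∃ f : Euc d × OpenCone (Lk n p q) → ChabautyR n,
      IsOpenEmbedding f ∧ f (0, OpenCone.apex) = Γ ∧
      f ⁻¹' typeStratum n p q = univ ×ˢ {OpenCone.apex} ∧
      ∀ k : JoinIndex p (n - (p + q)),
        f ⁻¹' typeStratum n (p - k.fstRank) (q + k.fstRank + k.sndRank) =
          univ ×ˢ coneStrata (lkStrata n p q) (some k) := by
  obtain ⟨g, rfl⟩ := (mem_typeStratum_iff hn).1 hΓ
  have h40 : (0 : ℝ) < 1 / 40 := by norm_num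
  obtain ⟨e, he⟩ := Submodule.exists_homeomorph_ball (matSub (blockS n p q))
    ((finrank_matSub _).trans ((card_blockS hn).trans hd)) h40
  have htype : ∀ {r' s'} (x : Euc d × OpenCone (Lk n p q)),
      g • oneAdd (e x.1).1 • (coneHomeo n p q h40 x.2).1 ∈ typeStratum n r' s' ↔
        coneFun n p q (1 / 40) x.2 ∈ typeStratum n r' s' := by
    intro r' s' x
    rw [smul_mem_typeStratum_iff, smul_mem_typeStratum_iff]
    rfl
  refine ⟨fun x => g • oneAdd (e x.1).1 • (coneHomeo n p q h40 x.2).1, ?_, ?_, ?_, fun k => ?_⟩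
  · have h₁ := isOpenEmbedding_chart n p q (δ := 1 / 40) (ε := 1 / 40) le_rfl le_rfl
    have h₂ := h₁.comp (e.prodCongr (coneHomeo n p q h40)).isOpenEmbedding
    exact (Homeomorph.smul g).isOpenEmbedding.comp h₂
  · simp only
    rw [he, oneAdd_zero, one_smul]
    rfl
  · ext x
    have := (htype (r' := p) (s' := q) x).trans (coneFun_mem_typeStratum_self hn h40 x.2)
    simpa using this
  · ext x
    have h := (htype (r' := p - k.fstRank) (s' := q + k.fstRank + k.sndRank) x).trans
      (coneFun_mem_typeStratum hn (1 / 40) x.2 k)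
    simpa using h

instance (n : ℕ) : Finite (TypeIndex n) := by
  refine Set.Finite.subset (s := Iic n ×ˢ Iic n) ((Set.finite_Iic n).prod (Set.finite_Iic n)) ?_
  rintro ⟨p, q⟩ h
  have h : p + q ≤ n := h
  exact ⟨show p ≤ n by omega, show q ≤ n by omega⟩

theorem isGoreskyMacPherson_typeStrata (n : ℕ) :
    IsGoreskyMacPherson (typeStrata n) (typeDim n) := by
  have hτ : ∀ (t : TypeIndex n) (k : JoinIndex t.1.1 (n - (t.1.1 + t.1.2))), ∃ t' : TypeIndex n,
      t'.1.1 = t.1.1 - k.fstRank ∧ t'.1.2 = t.1.2 + k.fstRank + k.sndRank := by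
    intro t k
    have := k.fstRank_le
    have := k.sndRank_le
    have := t.2
    exact ⟨⟨(t.1.1 - k.fstRank, t.1.2 + k.fstRank + k.sndRank), by simp only; omega⟩, rfl, rfl⟩
  choose τ hτ₁ hτ₂ using hτ
  have hD : ∀ t k, typeDim n t < typeDim n (τ t k) := by
    intro t k
    have h₁ := k.fstRank_le
    have h₂ := k.sndRank_le
    have h₃ := k.rank_pos
    have h₄ := t.2
    rw [typeDim, typeDim, mul_comm, mul_comm (_ + _), hτ₁, hτ₂]
    refine dim_lt_dim (by omega) (by omega) (by omega) fun h => ?_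
    rw [Prod.mk.injEq] at h
    omega
  refine isGoreskyMacPherson_of_charts (fun t => ⟨_, Std_mem_typeStratum t.2⟩) ?_ ?_
    (fun t => Lk n t.1.1 t.1.2) (fun t => JoinIndex t.1.1 (n - (t.1.1 + t.1.2)))
    (fun t => lkStrata n t.1.1 t.1.2) (fun t => lkDim n t.1.1 t.1.2)
    (fun t => isGoreskyMacPherson_lkStrata n _ _ t.2) τ hD ?_ ?_
  · intro t t' hne
    rw [Set.disjoint_left]
    intro Γ h h'
    have := type_unique h h'
    exact hne (Subtype.ext (Prod.ext this.1 this.2))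
  · refine eq_univ_of_forall fun Γ => ?_
    obtain ⟨r, s, h, hΓ⟩ := exists_type Γ
    exact mem_iUnion.2 ⟨⟨(r, s), h⟩, hΓ⟩
  · intro t k
    have := hD t k
    rw [typeDim, typeDim, mul_comm, mul_comm (_ + _), hτ₁, hτ₂] at this
    rw [typeDim, mul_comm, hτ₁, hτ₂, lkDim]
    omega
  · intro t Γ hΓ
    obtain ⟨f, h₁, h₂, h₃, h₄⟩ := exists_cone_chart t.2 hΓ (d := typeDim n t) (mul_comm _ _)
    refine ⟨f, ⟨h₁, h₃, fun k => ?_⟩, h₂⟩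
    rw [← h₄ k, typeStrata, hτ₁, hτ₂]

end TypeStrata

/-! ### Continuity of duality -/

section Duality

variable {n p : ℕ} {c : ℝ}

theorem exists_nat_mul_far {θ : ℝ} (h : ∀ z : ℤ, θ ≠ z) : ∃ k : ℕ, ∀ z : ℤ, 1 / 4 ≤ |k * θ - z| := by
  set δ := |θ - round θ| with hδ
  have h₀ : 0 < δ := abs_pos.2 (sub_ne_zero.2 (h _))
  have h₁ : δ ≤ 1 / 2 := abs_sub_round θ
  set k := ⌈1 / (4 * δ)⌉₊ with hk
  have h₂ : 1 / 4 ≤ k * δ := by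
    have := Nat.le_ceil (1 / (4 * δ))
    rw [← hk, div_le_iff₀ (by positivity)] at this
    linarith
  have h₃ : k * δ < 3 / 4 := by
    have := Nat.ceil_lt_add_one (a := 1 / (4 * δ)) (by positivity)
    rw [← hk] at this
    have h' : 1 / (4 * δ) * δ = 1 / 4 := by field_simp
    have := mul_lt_mul_of_pos_right this h₀
    linarith
  have key : ∀ x : ℝ, |x| = k * δ → ∀ z : ℤ, 1 / 4 ≤ |x - z| := by
    intro x hx z
    rcases eq_or_ne z 0 with rfl | hz
    · simpa [hx] using h₂
    · have : (1 : ℝ) ≤ |(z : ℝ)| := by exact_mod_cast Int.one_le_abs hz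
      have := abs_sub_abs_le_abs_sub (z : ℝ) x
      rw [abs_sub_comm] at this
      linarith
  refine ⟨k, fun z => ?_⟩
  have := key (k * (θ - round θ)) (by rw [abs_mul, Nat.abs_cast]) (z - k * round θ)
  push_cast at this
  convert this using 2
  ring

variable {ι : Type*} {w : Ultrafilter ι} {f : ι → ChabautyR n} {Γ : ChabautyR n}

theorem tendsto_dual_of_bv (hf : ∀ᶠ i in (w : Filter ι), ∀ b, bv b ∈ f i)
    (h : Tendsto f w (𝓝 Γ)) : Tendsto (fun i => (f i).dual) w (𝓝 Γ.dual) := by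
  refine Chabauty.tendsto_of_ultrafilter (fun y hy => ⟨fun _ => y, ?_, tendsto_const_nhds⟩) ?_
  · by_contra hcon
    rw [← Ultrafilter.eventually_not] at hcon
    have hfar : ∀ᶠ i in (w : Filter ι), ∃ x : Euc n, x ∈ f i ∧ ‖x‖ ≤ n * 1 ∧
        ∀ z : ℤ, 1 / 4 ≤ |inner ℝ x y - z| := by
      filter_upwards [hcon, hf] with i hi hb
      rw [mem_dual] at hi
      push Not at hi
      obtain ⟨x, hx, hxy⟩ := hi
      obtain ⟨k, hk⟩ := exists_nat_mul_far hxy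
      obtain ⟨v, hv, hvc⟩ := Chabauty.exists_int_comb (p := 0) (M := n) (fun b _ _ => hb b)
        fun a => ⌊(k • x) a⌋
      have hvy : ∃ z : ℤ, inner ℝ v y = z := by
        rw [inner_eq_sum]
        have hz : ∀ a, ∃ z : ℤ, v a * y a = z := by
          intro a
          obtain ⟨e, he⟩ := mem_dual.1 hy (bv a)
            (Chabauty.mem_of_tendsto h (y := fun _ => bv a) (hf.mono fun i hi => hi a)
              tendsto_const_nhds)
          have := inner_bv_left a 1 y
          rw [one_smul, one_mul] at this
          rw [hvc a, if_pos ⟨Nat.zero_le _, a.2⟩, ← this, he]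
          exact ⟨⌊(k • x) a⌋ * e, by push_cast; rfl⟩
        choose z hz using hz
        exact ⟨∑ a, z a, by push_cast; exact Finset.sum_congr rfl fun a _ => hz a⟩
      obtain ⟨e, he⟩ := hvy
      refine ⟨k • x - v, sub_mem (nsmul_mem hx k) hv, norm_le_card_mul fun a => ?_, fun z => ?_⟩
      · rw [PiLp.sub_apply, hvc a, if_pos ⟨Nat.zero_le _, a.2⟩, Int.self_sub_floor,
          Int.abs_fract]
        exact (Int.fract_lt_one _).le
      · have := hk (e + z)
        push_cast at this
        rw [inner_sub_left, he, ← Nat.cast_smul_eq_nsmul ℝ, inner_smul_left]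
        convert this using 2
        simp only [conj_trivial]
        ring
    obtain ⟨x, hx⟩ := hfar.choice
    obtain ⟨x₀, hx₀⟩ := exists_tendsto_of_norm_le (hx.mono fun i hi => hi.2.1)
    obtain ⟨z, hz⟩ := mem_dual.1 hy x₀ (Chabauty.mem_of_tendsto h (hx.mono fun i hi => hi.1) hx₀)
    have h₁ : Tendsto (fun i => |inner ℝ (x i) y - z|) w (𝓝 |inner ℝ x₀ y - z|) :=
      ((hx₀.inner tendsto_const_nhds).sub tendsto_const_nhds).abs
    have := ge_of_tendsto h₁ (hx.mono fun i hi => hi.2.2 z)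
    rw [hz, sub_self, abs_zero] at this
    norm_num at this
  · intro y y₀ hy hy₀
    rw [mem_dual]
    intro x hx
    obtain ⟨x', hx', hx'x⟩ := Chabauty.exists_tendsto h hx
    have := Int.isClosedEmbedding_coe_real.isClosed_range.mem_of_tendsto
      (hx'x.inner hy₀) (.of_forall fun i => by
        obtain ⟨z, hz⟩ := mem_dual.1 (hy i) _ (hx' i)
        exact ⟨z, hz.symm⟩)
    obtain ⟨z, hz⟩ := this
    exact ⟨z, hz.symm⟩

theorem GLn.tendsto_star {l : Filter ι} {g : ι → GLn n} {a : GLn n} (h : Tendsto g l (𝓝 a)) :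
    Tendsto (fun i => star (g i)) l (𝓝 (star a)) :=
  GLn.tendsto_iff.2 (((ContinuousLinearMap.adjoint (𝕜 := ℝ) (E := Euc n)
    (F := Euc n)).continuous.tendsto a.val).comp (GLn.tendsto_iff.1 h))

theorem tendsto_dual {T : GLn n} (hT : ∀ b, T.val (bv b) ∈ Γ) (h : Tendsto f w (𝓝 Γ)) :
    Tendsto (fun i => (f i).dual) w (𝓝 Γ.dual) := by
  choose v hv hvT using fun b => Chabauty.exists_tendsto h (hT b)
  have hlim : Tendsto (fun i => ofCols fun b => v b i) w (𝓝 T.val) := by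
    have := tendsto_ofCols (v := fun i b => v b i) hvT
    rwa [show (ofCols fun b => T.val (bv b)) = T.val from clm_ext_bv fun b => by simp] at this
  have hu : ∀ᶠ i in (w : Filter ι), ∃ g : GLn n, g.val = ofCols fun b => v b i :=
    hlim.eventually (Units.isOpen.mem_nhds ⟨T, rfl⟩)
  obtain ⟨g, hg⟩ := hu.choice
  have hgT : Tendsto g w (𝓝 T) :=
    GLn.tendsto_iff.2 (hlim.congr' (hg.mono fun i hi => hi.symm))
  have h₁ := tendsto_dual_of_bv (f := fun i => (g i)⁻¹ • f i) (hg.mono fun i hi b => by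
    rw [GLn.mem_smul, inv_inv, hi, ofCols_bv]
    exact hv b i) (GLn.tendsto_smul hgT.inv h)
  have h₂ := GLn.tendsto_smul (GLn.tendsto_star hgT).inv h₁
  simpa only [← dual_smul, smul_inv_smul] using h₂

theorem Cov.tendsto_dual {f : ι → ChabautyR p} {D : ChabautyR p} (hD : Cov p c D)
    (h : Tendsto f w (𝓝 D)) : Tendsto (fun i => (f i).dual) w (𝓝 D.dual) := by
  obtain ⟨j, hj, α, rfl⟩ := hD.exists_eq_smul_Std
  refine _root_.tendsto_dual (T := α) (fun b => ?_) h
  rw [GLn.apply_mem_smul, mem_Std]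
  refine ⟨fun a _ => ?_, bv_mem_low (by omega)⟩
  rw [bv_apply]
  split_ifs
  · exact ⟨1, by simp⟩
  · exact ⟨0, by simp⟩

/-- The symmetry of `ℝⁿ` that reverses the order of the coordinates. -/
noncomputable def revGL (n : ℕ) : GLn n where
  val := ofCols fun b => bv b.rev
  inv := ofCols fun b => bv b.rev
  val_inv := clm_ext_bv fun b => by simp
  inv_val := clm_ext_bv fun b => by simp

theorem revGL_inv_apply (x : Euc n) (a : Fin n) :
    (↑(revGL n)⁻¹ : Euc n →L[ℝ] Euc n) x a = x a.rev := by
  change ofCols (fun b => bv b.rev) x a = _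
  rw [ofCols_apply_coord, Finset.sum_eq_single a.rev]
  · simp
  · intro b _ hb
    rw [bv_ne, mul_zero]
    rintro rfl
    exact hb (by simp)
  · simp

theorem dual_Std {j : ℕ} (hj : j ≤ p) : (Std p (p - j) j).dual = revGL p • Std p 0 j := by
  ext y
  rw [mem_dual_Std, GLn.mem_smul, mem_Std, mem_low]
  simp only [revGL_inv_apply]
  constructor
  · rintro ⟨h₁, h₂⟩
    refine ⟨fun a _ => h₂ _ (by have := a.rev.2; omega), fun a ha => h₁ _ ?_⟩
    rw [Fin.val_rev]
    have := a.2
    omega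
  · rintro ⟨h₁, h₂⟩
    refine ⟨fun a ha => ?_, fun a _ => ?_⟩
    · have := h₂ a.rev (by rw [Fin.val_rev]; omega)
      rwa [Fin.rev_rev] at this
    · have := h₁ a.rev (Nat.zero_le _)
      rwa [Fin.rev_rev] at this

theorem dual_mem_typeStratum {j : ℕ} (hj : j ≤ p) {D : ChabautyR p}
    (h : D ∈ typeStratum p (p - j) j) : D.dual ∈ typeStratum p 0 j := by
  obtain ⟨g, rfl⟩ := (mem_typeStratum_iff (by omega)).1 h
  rw [dual_smul, dual_Std hj]
  exact smul_mem_typeStratum _ (smul_mem_typeStratum _ (Std_mem_typeStratum (by omega)))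

theorem Cov.gap_dual {D : ChabautyR p} (h : Cov p c D) : Gap 0 (2 * c) D.dual := by
  intro y hy hy0
  have hne : y ≠ 0 := fun h0 => hy0 (h0 ▸ zero_mem _)
  have hpos := norm_pos_iff.2 hne
  rw [show tl p 0 y = y from by ext a; simp [tl_apply]]
  obtain ⟨γ, hγ, -, hd⟩ := h ((2 * ‖y‖ ^ 2)⁻¹ • y) (by rw [low_eq_top le_rfl]; trivial)
  obtain ⟨z, hz⟩ := mem_dual.1 hy γ hγ
  have h₁ : inner ℝ ((2 * ‖y‖ ^ 2)⁻¹ • y - γ) y = 1 / 2 - z := by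
    rw [inner_sub_left, inner_smul_left, hz, real_inner_self_eq_norm_sq]
    simp only [conj_trivial]
    field_simp
  have h₂ := abs_real_inner_le_norm ((2 * ‖y‖ ^ 2)⁻¹ • y - γ) y
  rw [h₁] at h₂
  have h₃ : (1 / 2 : ℝ) ≤ |1 / 2 - (z : ℝ)| := by
    rcases le_or_gt z 0 with hz0 | hz0
    · have : (z : ℝ) ≤ 0 := by exact_mod_cast hz0
      exact le_abs.2 (.inl (by linarith))
    · have : (1 : ℝ) ≤ z := by exact_mod_cast hz0
      exact le_abs.2 (.inr (by linarith))
  have := mul_le_mul_of_nonneg_right hd hpos.le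
  linarith

end Duality

/-! ### The link of the trivial subgroup -/

section ZeroLinks

variable {k : ℕ} {a b c : ℝ} {D : ChabautyR k}

@[simp] theorem tl_zero (x : Euc k) : tl k 0 x = x := by
  ext a
  simp [tl_apply]

theorem mem_low_zero {x : Euc k} : x ∈ low k 0 ↔ x = 0 := by
  rw [← tl_eq_zero_iff, tl_zero]

theorem Gap.isSlice (h : Gap 0 b D) (ha : 0 ≤ a) : IsSlice 0 0 a b D where
  cov := fun x hx => ⟨0, zero_mem D, zero_mem _, by simpa [mem_low_zero.1 hx] using ha⟩
  lift := fun i _ hi => by omega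
  int := fun γ _ h i _ => ⟨0, by rw [mem_low_zero.1 h]; simp⟩
  gap := h

theorem sz_zero_zero : sz 0 0 D = gapSz 0 D := by
  refine max_eq_right (le_trans (Cov.covSz_le (c := 0) fun x hx => ?_) gapSz_nonneg)
  exact ⟨0, zero_mem D, zero_mem _, by simp [mem_low_zero.1 hx]⟩

theorem Gap.isSlice_sz (h : Gap 0 b D) (hb : 0 ≤ b) : IsSlice 0 0 (sz 0 0 D) (sz 0 0 D) D := by
  rw [sz_zero_zero]
  exact (h.gap_gapSz hb).isSlice gapSz_nonneg

theorem isLeast_iff_isSlice : IsLeast {r : ℝ | ∃ v ∈ D.toSubgroup, v ≠ 0 ∧ r = ‖v‖} 1 ↔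
    IsSlice 0 0 1 1 D ∧ sz 0 0 D = 1 := by
  rw [sz_zero_zero]
  constructor
  · rintro ⟨⟨v, hv, hv0, h1⟩, hlb⟩
    have hg : Gap 0 1 D := by
      intro γ hγ h0
      rw [mem_low_zero] at h0
      simpa using hlb ⟨γ, hγ, h0, rfl⟩
    refine ⟨hg.isSlice zero_le_one, le_antisymm (hg.gapSz_le zero_le_one) ?_⟩
    have := hg.gap_gapSz zero_le_one v hv (by rwa [mem_low_zero])
    simpa [← h1] using this
  · rintro ⟨hs, h1⟩
    have hlb : ∀ γ ∈ D, γ ≠ 0 → 1 ≤ ‖γ‖ := fun γ hγ h0 => by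
      simpa using hs.gap γ hγ (by rwa [mem_low_zero])
    have hK : IsCompact ((D : Set (Euc k)) ∩ {x | 1 ≤ ‖x‖} ∩ Metric.closedBall 0 2) :=
      (isCompact_closedBall _ _).inter_left
        (D.isClosed.inter (isClosed_le continuous_const continuous_norm))
    obtain ⟨v, hv, hmin⟩ := hK.exists_isMinOn (by
      by_contra hcon
      rw [not_nonempty_iff_eq_empty, eq_empty_iff_forall_notMem] at hcon
      have : gapSz 0 D ≤ 1 / 2 := by
        refine Gap.gapSz_le (fun γ hγ h0 => ?_) (by norm_num)
        rw [mem_low_zero] at h0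
        have : ¬ ‖γ‖ ≤ 2 := fun h => hcon γ ⟨⟨hγ, hlb γ hγ h0⟩, by simpa using h⟩
        rw [tl_zero]
        linarith
      linarith) continuous_norm.continuousOn
    have hv1 : 1 ≤ ‖v‖ := hv.1.2
    have hle : gapSz 0 D ≤ ‖v‖⁻¹ := by
      refine Gap.gapSz_le (fun γ hγ h0 => ?_) (by positivity)
      rw [mem_low_zero] at h0
      rw [tl_zero, ← div_eq_inv_mul, le_div_iff₀ (by linarith), one_mul]
      rcases le_or_gt ‖γ‖ 2 with h | h
      · exact hmin ⟨⟨hγ, hlb γ hγ h0⟩, by simpa using h⟩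
      · have : ‖v‖ ≤ 2 := by simpa using hv.2
        linarith
    rw [h1] at hle
    have : ‖v‖ = 1 := by
      refine le_antisymm ?_ hv1
      rw [le_inv_comm₀ one_pos (by linarith), inv_one] at hle
      exact hle
    have hv0 : v ≠ 0 := by
      rintro rfl
      simp at this
    refine ⟨⟨v, hv.1.1, hv0, this.symm⟩, ?_⟩
    rintro _ ⟨γ, hγ, h0, rfl⟩
    exact hlb γ hγ h0

/-- The two descriptions of the link of the trivial subgroup. -/
def ZeroLink.toLk (x : ZeroLink k) : Lk k 0 0 := ⟨x.1, isLeast_iff_isSlice.1 x.2⟩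

theorem ZeroLink.continuous_toLk : Continuous (ZeroLink.toLk (k := k)) :=
  continuous_subtype_val.subtype_mk _

instance : CompactSpace (ZeroLink k) := by
  have : IsCompact {D : ChabautyR k | IsSlice 0 0 1 1 D ∧ sz 0 0 D = 1} :=
    isCompact_iff_compactSpace.2 (inferInstanceAs (CompactSpace (Lk k 0 0)))
  refine isCompact_iff_compactSpace (s := {D : ChabautyR k |
    IsLeast {r : ℝ | ∃ v ∈ D.toSubgroup, v ≠ 0 ∧ r = ‖v‖} 1}).1 ?_
  simpa only [isLeast_iff_isSlice] using this

end ZeroLinks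

/-! ### The join of two links as a space of pairs of subgroups -/

section Joins

variable {p k : ℕ}

instance {X Y : Type u} [TopologicalSpace X] [TopologicalSpace Y] [CompactSpace X]
    [CompactSpace Y] : CompactSpace (TopJoin X Y) :=
  inferInstanceAs (CompactSpace (Quot (JoinRel X Y)))

theorem TopJoin.cases {X Y : Type u} (z : TopJoin X Y) :
    (∃ x, z = Quot.mk _ (Sum.inl (Sum.inl x))) ∨ (∃ y, z = Quot.mk _ (Sum.inl (Sum.inr y))) ∨
      ∃ x y, ∃ m : unitInterval, 0 < m ∧ m < 1 ∧ z = Quot.mk _ (Sum.inr (x, y, m)) := by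
  obtain ⟨(x | y) | ⟨x, y, m⟩, rfl⟩ := Quot.exists_rep z
  · exact .inl ⟨x, rfl⟩
  · exact .inr (.inl ⟨y, rfl⟩)
  · rcases eq_or_ne m 1 with rfl | h₁
    · exact .inl ⟨x, Quot.sound (.left x y)⟩
    · rcases eq_or_ne m 0 with rfl | h₀
      · exact .inr (.inl ⟨y, Quot.sound (.right x y)⟩)
      · exact .inr (.inr ⟨x, y, m, unitInterval.pos_iff_ne_zero.2 h₀,
          unitInterval.lt_one_iff_ne_one.2 h₁, rfl⟩)

/-- The subgroup of size `t` on the ray through the point `x` of the link. -/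
noncomputable def ray (x : ZeroLink k) (t : unitInterval) : ChabautyR k :=
  coneFun k 0 0 2 (OpenCone.mk x.toLk ⟨t / 2, by
    have := t.2.1
    have := t.2.2
    constructor <;> linarith⟩)

theorem continuous_ray : Continuous fun xt : ZeroLink k × unitInterval => ray xt.1 xt.2 := by
  have h : Continuous fun xt : ZeroLink k × unitInterval =>
      ((xt.1.toLk, ⟨xt.2 / 2, by
        have := xt.2.2.1
        have := xt.2.2.2
        constructor <;> linarith⟩) : Lk k 0 0 × Ico (0 : ℝ) 1) :=
    (ZeroLink.continuous_toLk.comp continuous_fst).prodMk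
      (((continuous_subtype_val.comp continuous_snd).div_const 2).subtype_mk _)
  exact (continuous_coneFun two_pos).comp (OpenCone.continuous_mk.comp h)

@[simp] theorem ray_zero (x : ZeroLink k) : ray x 0 = Std k 0 0 := by
  rw [ray, OpenCone.mk_eq_apex _ (by simp), coneFun_apex]

theorem ray_of_ne {x : ZeroLink k} {t : unitInterval} (h : (t : ℝ) ≠ 0) :
    ray x t = dil k 0 0 (ru t) • x.1 := by
  rw [ray, coneFun_mk _ _ (by simpa using h)]
  simp only
  rw [mul_div_cancel₀ _ two_ne_zero]
  rfl

@[simp] theorem ray_one (x : ZeroLink k) : ray x 1 = x.1 := by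
  rw [ray_of_ne (by simp)]
  simp

theorem ray_spec (x : ZeroLink k) (t : unitInterval) :
    Gap 0 1 (ray x t) ∧ sz 0 0 (ray x t) = t := by
  have h := coneFun_mk_spec two_pos x.toLk ⟨t / 2, by
    have := t.2.1
    have := t.2.2
    constructor <;> linarith⟩
  simp only [mul_div_cancel₀ _ (two_ne_zero (α := ℝ))] at h
  exact ⟨h.1.gap.mono t.2.2, h.2⟩

theorem nz_ray {x : ZeroLink k} {t : unitInterval} (h : (t : ℝ) ≠ 0) : nz 0 0 (ray x t) = x.1 := by
  have hx := isLeast_iff_isSlice.1 x.2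
  rw [ray_of_ne h, hx.1.nz_dil zero_le_one (ru_pos (lt_of_le_of_ne t.2.1 h.symm))
    (by rw [hx.2]; norm_num), nz_eq_self hx.2]

theorem sz_Std_zero : sz 0 0 (Std k 0 0) = 0 :=
  ((isSlice_zero_iff.2 rfl).sz_eq_zero_iff le_rfl).2 rfl

theorem gap_Std_zero {b : ℝ} (hb : 0 ≤ b) : Gap 0 b (Std k 0 0) :=
  (isSlice_Std hb hb : IsSlice 0 0 b b (Std k 0 0)).gap

/-- Pairs of discrete subgroups whose sizes add up to one. -/
abbrev JoinPair (p k : ℕ) : Type := {D : ChabautyR p × ChabautyR k //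
  (Gap 0 1 D.1 ∧ Gap 0 1 D.2) ∧ sz 0 0 D.1 + sz 0 0 D.2 = 1}

/-- The pair of subgroups that corresponds to a point of the join. -/
noncomputable def joinFun : TopJoin (ZeroLink p) (ZeroLink k) → JoinPair p k :=
  Quot.lift (Sum.elim
    (Sum.elim (fun x => ⟨(x.1, Std k 0 0), by
        have hx := isLeast_iff_isSlice.1 x.2
        exact ⟨⟨hx.1.gap, gap_Std_zero zero_le_one⟩, by simp [hx.2, sz_Std_zero]⟩⟩)
      (fun y => ⟨(Std p 0 0, y.1), by
        have hy := isLeast_iff_isSlice.1 y.2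
        exact ⟨⟨gap_Std_zero zero_le_one, hy.1.gap⟩, by simp [hy.2, sz_Std_zero]⟩⟩))
    (fun z => ⟨(ray z.1 z.2.2, ray z.2.1 (unitInterval.symm z.2.2)),
      ⟨(ray_spec _ _).1, (ray_spec _ _).1⟩, by simp [(ray_spec _ _).2]⟩)) (by
    rintro _ _ (⟨x, y⟩ | ⟨x, y⟩) <;> simp)

theorem continuous_joinFun : Continuous (joinFun (p := p) (k := k)) := by
  refine continuous_quot_lift _ (continuous_sumElim.2 ⟨continuous_sumElim.2 ⟨?_, ?_⟩, ?_⟩)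
  · exact (continuous_subtype_val.prodMk continuous_const).subtype_mk _
  · exact (continuous_const.prodMk continuous_subtype_val).subtype_mk _
  · refine Continuous.subtype_mk (.prodMk ?_ ?_) _
    · exact continuous_ray.comp (continuous_fst.prodMk (continuous_snd.comp continuous_snd))
    · exact continuous_ray.comp ((continuous_fst.comp continuous_snd).prodMk
        (unitInterval.continuous_symm.comp (continuous_snd.comp continuous_snd)))

theorem Gap.eq_Std_zero {b : ℝ} {D : ChabautyR k} (h : Gap 0 b D) (hb : 0 ≤ b)
    (h0 : sz 0 0 D = 0) : D = Std k 0 0 :=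
  ((h.isSlice hb).sz_eq_zero_iff hb).1 h0

theorem Gap.isLeast_nz {b : ℝ} {D : ChabautyR k} (h : Gap 0 b D) (hb : 0 ≤ b)
    (h0 : sz 0 0 D ≠ 0) :
    IsLeast {r : ℝ | ∃ v ∈ (nz 0 0 D).toSubgroup, v ≠ 0 ∧ r = ‖v‖} 1 :=
  isLeast_iff_isSlice.2 ((h.isSlice hb).nz_isSlice hb h0)

theorem joinFun_bijective : Function.Bijective (joinFun (p := p) (k := k)) := by
  constructor
  · intro z z' h
    have h₁ := congrArg (fun D : JoinPair p k => D.1.1) h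
    have h₂ := congrArg (fun D : JoinPair p k => D.1.2) h
    have s₁ := congrArg (sz 0 0) h₁
    have s₂ := congrArg (sz 0 0) h₂
    have hsz : ∀ {k} (x : ZeroLink k), sz 0 0 x.1 = 1 := fun x => (isLeast_iff_isSlice.1 x.2).2
    rcases TopJoin.cases z with ⟨x, rfl⟩ | ⟨y, rfl⟩ | ⟨x, y, m, hm, hm', rfl⟩ <;>
    rcases TopJoin.cases z' with ⟨x', rfl⟩ | ⟨y', rfl⟩ | ⟨x', y', m', hn, hn', rfl⟩ <;>
    simp only [joinFun, Sum.elim_inl, Sum.elim_inr] at h₁ h₂ s₁ s₂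
    · rw [Subtype.ext h₁]
    · simp [hsz, sz_Std_zero] at s₁
    · rw [hsz, (ray_spec _ _).2] at s₁
      exact absurd (Subtype.ext s₁.symm) hn'.ne
    · simp [hsz, sz_Std_zero] at s₁
    · rw [Subtype.ext h₂]
    · rw [sz_Std_zero, (ray_spec _ _).2] at s₁
      exact absurd (Subtype.ext s₁.symm) hn.ne'
    · rw [hsz, (ray_spec _ _).2] at s₁
      exact absurd (Subtype.ext s₁) hm'.ne
    · rw [sz_Std_zero, (ray_spec _ _).2] at s₁
      exact absurd (Subtype.ext s₁) hm.ne'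
    · rw [(ray_spec _ _).2, (ray_spec _ _).2] at s₁
      obtain rfl : m = m' := Subtype.ext s₁
      have h0 : (m : ℝ) ≠ 0 := (show (0 : ℝ) < m from hm).ne'
      have h0' : ((unitInterval.symm m : unitInterval) : ℝ) ≠ 0 :=
        (show (0 : ℝ) < 1 - m from sub_pos.2 hm').ne'
      have e₁ : x = x' := Subtype.ext (by rw [← nz_ray (x := x) h0, h₁, nz_ray h0])
      have e₂ : y = y' := Subtype.ext (by rw [← nz_ray (x := y) h0', h₂, nz_ray h0'])
      rw [e₁, e₂]
  · rintro ⟨⟨D, E⟩, ⟨hD, hE⟩, hs⟩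
    dsimp only at hD hE hs
    by_cases hE0 : sz 0 0 E = 0
    · have := hE.eq_Std_zero zero_le_one hE0
      subst this
      rw [hE0, add_zero] at hs
      exact ⟨Quot.mk _ (Sum.inl (Sum.inl ⟨D, isLeast_iff_isSlice.2
        ⟨hD.isSlice zero_le_one, hs⟩⟩)), rfl⟩
    by_cases hD0 : sz 0 0 D = 0
    · have := hD.eq_Std_zero zero_le_one hD0
      subst this
      rw [hD0, zero_add] at hs
      exact ⟨Quot.mk _ (Sum.inl (Sum.inr ⟨E, isLeast_iff_isSlice.2
        ⟨hE.isSlice zero_le_one, hs⟩⟩)), rfl⟩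
    have hE1 := sz_nonneg (p := 0) (q := 0) (Γ := E)
    refine ⟨Quot.mk _ (Sum.inr (⟨nz 0 0 D, hD.isLeast_nz zero_le_one hD0⟩,
      ⟨nz 0 0 E, hE.isLeast_nz zero_le_one hE0⟩, ⟨sz 0 0 D, sz_nonneg, by linarith⟩)), ?_⟩
    refine Subtype.ext (Prod.ext ?_ ?_)
    · refine (ray_of_ne (by simpa using hD0)).trans ?_
      exact dil_smul_nz hD0
    · have hval : ((unitInterval.symm ⟨sz 0 0 D, sz_nonneg, by linarith⟩ : unitInterval) : ℝ) =
          sz 0 0 E := by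
        simp only [unitInterval.coe_symm_eq]
        linarith
      refine (ray_of_ne (by rw [hval]; exact hE0)).trans ?_
      rw [hval]
      exact dil_smul_nz hE0

/-- The join of two links is the space of pairs of discrete subgroups with sizes adding up to
one. -/
noncomputable def joinHomeo : TopJoin (ZeroLink p) (ZeroLink k) ≃ₜ JoinPair p k :=
  Continuous.homeoOfEquivCompactToT2 (f := Equiv.ofBijective _ joinFun_bijective) continuous_joinFun

theorem ZeroLink.exists_stratum (x : ZeroLink k) : ∃ i, x ∈ zeroLinkStrata k i := by
  have hx := isLeast_iff_isSlice.1 x.2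
  obtain ⟨m, hm, β, hβ⟩ := hx.1.gap.exists_eq_smul_Std zero_le_one
  have ht : x.1 ∈ typeStratum k 0 m := hβ ▸ smul_mem_typeStratum β (Std_mem_typeStratum (by omega))
  rcases Nat.eq_zero_or_pos m with rfl | h
  · have := hx.1.eq_Std zero_le_one (Nat.zero_le _) ht
    have h0 := hx.2
    rw [this, sz_Std_zero] at h0
    exact absurd h0 zero_ne_one
  · refine ⟨⟨m - 1, by omega⟩, ?_⟩
    change x.1 ∈ typeStratum k 0 (m - 1 + 1)
    rwa [Nat.sub_add_cancel h]

theorem joinFun_mem_typeStratum {z : TopJoin (ZeroLink p) (ZeroLink k)} {i : JoinIndex p k}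
    (h : z ∈ joinStrata (zeroLinkStrata p) (zeroLinkStrata k) i) :
    (joinFun z).1.1 ∈ typeStratum p 0 i.fstRank ∧
      (joinFun z).1.2 ∈ typeStratum k 0 i.sndRank := by
  rcases i with i | i | ⟨i, i'⟩
  · obtain ⟨x, hx, rfl⟩ := h
    exact ⟨hx, Std_mem_typeStratum (Nat.zero_le _)⟩
  · obtain ⟨y, hy, rfl⟩ := h
    exact ⟨Std_mem_typeStratum (Nat.zero_le _), hy⟩
  · obtain ⟨x, hx, y, hy, m, hm, hm', rfl⟩ := h
    have h0 : (m : ℝ) ≠ 0 := (show (0 : ℝ) < m from hm).ne'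
    have h0' : ((unitInterval.symm m : unitInterval) : ℝ) ≠ 0 :=
      (show (0 : ℝ) < 1 - m from sub_pos.2 hm').ne'
    change ray x m ∈ typeStratum p 0 _ ∧ ray y (unitInterval.symm m) ∈ typeStratum k 0 _
    rw [ray_of_ne h0, ray_of_ne h0']
    exact ⟨smul_mem_typeStratum _ hx, smul_mem_typeStratum _ hy⟩

theorem mem_joinStrata_iff {z : TopJoin (ZeroLink p) (ZeroLink k)} {i : JoinIndex p k} :
    z ∈ joinStrata (zeroLinkStrata p) (zeroLinkStrata k) i ↔
    (joinFun z).1.1 ∈ typeStratum p 0 i.fstRank ∧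
      (joinFun z).1.2 ∈ typeStratum k 0 i.sndRank := by
  refine ⟨joinFun_mem_typeStratum, fun h => ?_⟩
  obtain ⟨i', hi'⟩ : ∃ i', z ∈ joinStrata (zeroLinkStrata p) (zeroLinkStrata k) i' := by
    rcases TopJoin.cases z with ⟨x, rfl⟩ | ⟨y, rfl⟩ | ⟨x, y, m, hm, hm', rfl⟩
    · obtain ⟨i, hi⟩ := x.exists_stratum
      exact ⟨Sum.inl i, x, hi, rfl⟩
    · obtain ⟨i, hi⟩ := y.exists_stratum
      exact ⟨Sum.inr (Sum.inl i), y, hi, rfl⟩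
    · obtain ⟨i, hi⟩ := x.exists_stratum
      obtain ⟨i', hi'⟩ := y.exists_stratum
      exact ⟨Sum.inr (Sum.inr (i, i')), x, hi, y, hi', m, hm, hm', rfl⟩
  have h' := joinFun_mem_typeStratum hi'
  rwa [JoinIndex.ext_rank (type_unique h.1 h'.1).2 (type_unique h.2 h'.2).2]

end Joins

/-! ### The projection of a link onto a join -/

section LinkProjection

variable {n p q k j m : ℕ} {a b c : ℝ} {Γ : ChabautyR n}

/-- The dual of the trace of a subgroup on the first `p` coordinates. -/
noncomputable def dfst (p : ℕ) (Γ : ChabautyR n) : ChabautyR p := (fstPart p Γ).dual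

theorem IsSlice.gap_dfst (h : IsSlice p q a b Γ) (hp : p ≤ n) : Gap 0 (2 * a) (dfst p Γ) :=
  (h.cov.fstPart hp).gap_dual

theorem star_dil (t : ℝˣ) : (star (dil p p 0 t))⁻¹ = dil p 0 0 t := by
  rw [inv_eq_iff_eq_inv, ← dil_inv]
  refine Units.ext (clm_ext_bv fun b => ?_)
  refine ext_inner_left ℝ fun v => ?_
  change inner ℝ v (ContinuousLinearMap.adjoint (dil p p 0 t).val (bv b)) = _
  rw [ContinuousLinearMap.adjoint_inner_right, inner_eq_sum, inner_eq_sum]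
  refine Finset.sum_congr rfl fun a _ => ?_
  rw [dil_apply, dil_apply, if_pos a.2]
  simp
  ring

theorem dfst_dil (t : ℝˣ) (Γ : ChabautyR n) :
    dfst p (dil n p q t • Γ) = dil p 0 0 t • dfst p Γ := by
  rw [dfst, fstPart_dil, dual_smul, star_dil, dfst]

theorem dfst_blk (hn : p + q + k = n) (α : GLn p) (β : GLn k) (Γ : ChabautyR n) :
    dfst p (blk hn α β • Γ) = (star α)⁻¹ • dfst p Γ := by
  rw [dfst, fstPart_blk, dual_smul, dfst]

/-- The sum of the sizes of the two components of a subgroup. -/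
noncomputable def tsz (p q k : ℕ) (Γ : ChabautyR n) : ℝ :=
  sz 0 0 (dfst p Γ) + sz 0 0 (sndPart (p + q) k Γ)

theorem tsz_nonneg : 0 ≤ tsz p q k Γ := add_nonneg sz_nonneg sz_nonneg

theorem IsSlice.tsz_dil (h : IsSlice p q a b Γ) (hb : 0 ≤ b) (hn : p + q + k = n) {t : ℝˣ}
    (ht : 0 < (t : ℝ)) : tsz p q k (dil n p q t • Γ) = t * tsz p q k Γ := by
  have ha := h.cov.nonneg
  rw [tsz, tsz, dfst_dil, h.sndPart_dil hb hn,
    ((h.gap_dfst (by omega)).isSlice le_rfl).sz_dil (by positivity) ht,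
    ((h.gap_sndPart hb hn).isSlice le_rfl).sz_dil hb ht, mul_add]

/-- A subgroup rescaled to total size one. -/
noncomputable def tn (p q k : ℕ) (Γ : ChabautyR n) : ChabautyR n :=
  dil n p q (ru (tsz p q k Γ)⁻¹) • Γ

theorem tn_eq_self (h : tsz p q k Γ = 1) : tn p q k Γ = Γ := by simp [tn, h]

theorem IsSlice.tsz_tn (h : IsSlice p q a b Γ) (hb : 0 ≤ b) (hn : p + q + k = n)
    (h0 : tsz p q k Γ ≠ 0) : tsz p q k (tn p q k Γ) = 1 := by
  have hpos : 0 < (tsz p q k Γ)⁻¹ := inv_pos.2 (lt_of_le_of_ne tsz_nonneg h0.symm)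
  rw [tn, h.tsz_dil hb hn (ru_pos hpos), ru_val hpos.ne', inv_mul_cancel₀ h0]

theorem IsSlice.tn_dil (h : IsSlice p q a b Γ) (hb : 0 ≤ b) (hn : p + q + k = n) {t : ℝˣ}
    (ht : 0 < (t : ℝ)) (h0 : tsz p q k Γ ≠ 0) : tn p q k (dil n p q t • Γ) = tn p q k Γ := by
  rw [tn, h.tsz_dil hb hn ht, mul_inv, ru_mul (inv_ne_zero ht.ne') (inv_ne_zero h0),
    ru_inv ht.ne', ru_val_self, ← mul_smul, ← dil_mul, mul_right_comm, inv_mul_cancel, one_mul, tn]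

theorem IsSlice.tsz_ne_zero (h : IsSlice p q a b Γ) (hb : 0 ≤ b) (hn : p + q + k = n)
    (h0 : Γ ≠ Std n p q) : tsz p q k Γ ≠ 0 := by
  intro hz
  have ha := h.cov.nonneg
  obtain ⟨j, hj, m, hm, ⟨u, hu, hΓ⟩, h₁, h₂⟩ := h.exists_normal hb hn
  have hz' := (add_eq_zero_iff_of_nonneg sz_nonneg sz_nonneg).1 hz
  have e₁ := (h.gap_dfst (by omega)).eq_Std_zero (by positivity) hz'.1
  have e₂ := (h.gap_sndPart hb hn).eq_Std_zero hb hz'.2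
  have h₁' := dual_mem_typeStratum hj h₁
  rw [dfst] at e₁
  rw [e₁] at h₁'
  rw [e₂] at h₂
  obtain rfl : 0 = j := (type_unique (Std_mem_typeStratum (Nat.zero_le _)) h₁').2
  obtain rfl : 0 = m := (type_unique (Std_mem_typeStratum (Nat.zero_le _)) h₂).2
  exact h0 (hΓ.trans (Qgrp_smul_Std hu))

theorem continuousOn_dfst (hp : p ≤ n) :
    ContinuousOn (dfst (n := n) p) {Γ | IsSlice p q a b Γ} := by
  rw [continuousOn_iff_continuous_domRestrict, continuous_iff_ultrafilter]
  intro Γ w hw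
  have h : Tendsto (Subtype.val : {Γ : ChabautyR n | IsSlice p q a b Γ} → _) w (𝓝 Γ.1) :=
    (continuous_subtype_val.tendsto Γ).mono_left hw
  exact (Γ.2.cov.fstPart hp).tendsto_dual (tendsto_fstPart hp (.of_forall fun i => i.2) h)

theorem continuousOn_sndPart (hb : 0 ≤ b) (hn : p + q + k = n) :
    ContinuousOn (sndPart (n := n) (p + q) k) {Γ | IsSlice p q a b Γ} := by
  rw [continuousOn_iff_continuous_domRestrict, continuous_iff_ultrafilter]
  intro Γ w hw
  have h : Tendsto (Subtype.val : {Γ : ChabautyR n | IsSlice p q a b Γ} → _) w (𝓝 Γ.1) :=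
    (continuous_subtype_val.tendsto Γ).mono_left hw
  exact tendsto_sndPart hb hn (.of_forall fun i => i.2) h

theorem continuousOn_tsz (hb : 0 ≤ b) (hn : p + q + k = n) :
    ContinuousOn (tsz (n := n) p q k) {Γ | IsSlice p q a b Γ} := by
  rcases lt_or_ge a 0 with ha | ha
  · exact (continuousOn_empty _).mono fun Γ h => absurd h.cov.nonneg ha.not_ge
  refine ContinuousOn.add ?_ ?_
  · exact (continuousOn_sz (a := 0) (b := 2 * a) (by positivity)).comp (continuousOn_dfst (by omega))
      fun Γ h => (h.gap_dfst (by omega)).isSlice le_rfl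
  · exact (continuousOn_sz (a := 0) hb).comp (continuousOn_sndPart hb hn)
      fun Γ h => (h.gap_sndPart hb hn).isSlice le_rfl

theorem Lk.tsz_ne_zero (hn : p + q + k = n) (l : Lk n p q) : tsz p q k l.1 ≠ 0 :=
  l.2.1.tsz_ne_zero zero_le_one hn l.ne_Std

theorem Lk.tsz_pos (hn : p + q + k = n) (l : Lk n p q) : 0 < tsz p q k l.1 :=
  lt_of_le_of_ne tsz_nonneg (l.tsz_ne_zero hn).symm

theorem Lk.continuous_dil_tsz (hn : p + q + k = n) (N P Q : ℕ) :
    Continuous fun l : Lk n p q => dil N P Q (ru (tsz p q k l.1)⁻¹) := by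
  have h₁ : Continuous fun l : Lk n p q => tsz p q k l.1 :=
    (continuousOn_tsz zero_le_one hn).comp_continuous continuous_subtype_val fun l => l.2.1
  exact continuous_dil.comp (continuousOn_ru.comp_continuous (h₁.inv₀ (Lk.tsz_ne_zero hn))
    fun l => inv_ne_zero (l.tsz_ne_zero hn))

theorem Lk.continuous_tn (hn : p + q + k = n) : Continuous fun l : Lk n p q => tn p q k l.1 :=
  (Lk.continuous_dil_tsz hn n p q).smul continuous_subtype_val

theorem Lk.isSlice_tn (hn : p + q + k = n) (l : Lk n p q) :
    IsSlice p q (tsz p q k l.1)⁻¹ (tsz p q k l.1)⁻¹ (tn p q k l.1) := by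
  have hpos := inv_pos.2 (l.tsz_pos hn)
  have := l.2.1.dilate (ru_pos hpos)
  rwa [ru_val hpos.ne', mul_one] at this

theorem Lk.nz_tn (hn : p + q + k = n) (l : Lk n p q) : nz p q (tn p q k l.1) = l.1 := by
  have hpos := inv_pos.2 (l.tsz_pos hn)
  rw [tn, l.2.1.nz_dil zero_le_one (ru_pos hpos) (by rw [l.2.2]; norm_num), nz_eq_self l.2.2]

theorem IsSlice.gap_of_tsz (h : IsSlice p q a b Γ) (hb : 0 ≤ b) (hn : p + q + k = n)
    (h1 : tsz p q k Γ = 1) : Gap 0 1 (dfst p Γ) ∧ Gap 0 1 (sndPart (p + q) k Γ) := by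
  have ha := h.cov.nonneg
  have e₁ := (h.gap_dfst (by omega)).isSlice_sz (by positivity)
  have e₂ := (h.gap_sndPart hb hn).isSlice_sz hb
  have s₁ := sz_nonneg (p := 0) (q := 0) (Γ := dfst p Γ)
  have s₂ := sz_nonneg (p := 0) (q := 0) (Γ := sndPart (p + q) k Γ)
  rw [tsz] at h1
  exact ⟨e₁.gap.mono (by linarith), e₂.gap.mono (by linarith)⟩

/-- The pair of discrete subgroups attached to a point of the link. -/
noncomputable def lkPair (hn : p + q + k = n) (l : Lk n p q) : JoinPair p k :=
  ⟨(dfst p (tn p q k l.1), sndPart (p + q) k (tn p q k l.1)),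
    (l.isSlice_tn hn).gap_of_tsz (inv_nonneg.2 tsz_nonneg) hn
      (l.2.1.tsz_tn zero_le_one hn (l.tsz_ne_zero hn)),
    l.2.1.tsz_tn zero_le_one hn (l.tsz_ne_zero hn)⟩

theorem lkPair_fst (hn : p + q + k = n) (l : Lk n p q) :
    (lkPair hn l).1.1 = dil p 0 0 (ru (tsz p q k l.1)⁻¹) • dfst p l.1 := dfst_dil _ _

theorem lkPair_snd (hn : p + q + k = n) (l : Lk n p q) :
    (lkPair hn l).1.2 = dil k 0 0 (ru (tsz p q k l.1)⁻¹) • sndPart (p + q) k l.1 :=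
  l.2.1.sndPart_dil zero_le_one hn _

theorem continuous_lkPair (hn : p + q + k = n) :
    Continuous (lkPair (n := n) (p := p) (q := q) (k := k) hn) := by
  have h₁ : Continuous fun l : Lk n p q => dfst p l.1 :=
    (continuousOn_dfst (by omega)).comp_continuous continuous_subtype_val fun l => l.2.1
  have h₂ : Continuous fun l : Lk n p q => sndPart (p + q) k l.1 :=
    (continuousOn_sndPart zero_le_one hn).comp_continuous continuous_subtype_val fun l => l.2.1
  refine Continuous.subtype_mk (.prodMk ?_ ?_) _
  · refine Continuous.congr ?_ fun l => (lkPair_fst hn l).symm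
    exact (Lk.continuous_dil_tsz hn p 0 0).smul h₁
  · refine Continuous.congr ?_ fun l => (lkPair_snd hn l).symm
    exact (Lk.continuous_dil_tsz hn k 0 0).smul h₂

/-- The projection of the link onto the join. -/
noncomputable def lkProj (hn : p + q + k = n) (l : Lk n p q) : TopJoin (ZeroLink p) (ZeroLink k) :=
  joinHomeo.symm (lkPair hn l)

theorem continuous_lkProj (hn : p + q + k = n) :
    Continuous (lkProj (n := n) (p := p) (q := q) (k := k) hn) :=
  joinHomeo.symm.continuous.comp (continuous_lkPair hn)

theorem joinFun_lkProj (hn : p + q + k = n) (l : Lk n p q) :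
    joinFun (lkProj hn l) = lkPair hn l := joinHomeo.apply_symm_apply _

theorem lkProj_mem_joinStrata_iff (hn : p + q + k = n) (l : Lk n p q) (i : JoinIndex p k) :
    lkProj hn l ∈ joinStrata (zeroLinkStrata p) (zeroLinkStrata k) i ↔
      l.1 ∈ typeStratum n (p - i.fstRank) (q + i.fstRank + i.sndRank) := by
  rw [mem_joinStrata_iff, joinFun_lkProj, lkPair_fst, lkPair_snd, smul_mem_typeStratum_iff,
    smul_mem_typeStratum_iff]
  obtain ⟨j, hj, m, hm, ⟨u, hu, hl⟩, h₁, h₂⟩ := l.2.1.exists_normal zero_le_one hn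
  have h₁' : dfst p l.1 ∈ typeStratum p 0 j := dual_mem_typeStratum hj h₁
  have hl' : l.1 ∈ typeStratum n (p - j) (q + j + m) :=
    hl ▸ smul_mem_typeStratum u (Std_mem_typeStratum (by omega))
  constructor
  · rintro ⟨e₁, e₂⟩
    rw [← (type_unique h₁' e₁).2, ← (type_unique h₂ e₂).2]
    exact hl'
  · intro e
    have := type_unique e hl'
    have := i.fstRank_le
    obtain rfl : i.fstRank = j := by omega
    obtain rfl : i.sndRank = m := by omega
    exact ⟨h₁', h₂⟩

end LinkProjection

/-! ### The fibres of the projection -/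

section Fibres

variable {n p q k j m : ℕ} {a b c : ℝ} {Γ : ChabautyR n}

/-- The subgroups of the slice whose two components are standard. -/
structure IsFib (p q k j m : ℕ) (Γ : ChabautyR n) : Prop where
  slice : IsSlice p q p 1 Γ
  fst : fstPart p Γ = Std p (p - j) j
  snd : sndPart (p + q) k Γ = Std k 0 m

theorem IsSlice.isFib (h : IsSlice p q a b Γ) (hn : p + q + k = n) (hj : j ≤ p)
    (h₁ : fstPart p Γ = Std p (p - j) j) (h₂ : sndPart (p + q) k Γ = Std k 0 m) :
    IsFib p q k j m Γ := by
  refine ⟨⟨?_, h.lift, h.int, ?_⟩, h₁, h₂⟩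
  · refine Cov.of_fstPart (by omega) ?_
    rw [h₁]
    have := (isSlice_Std (n := p) (p := p - j) (q := j) le_rfl le_rfl).of_le (p := p) (q := 0)
      (by omega) (by omega)
    simpa using this.cov
  · refine Gap.of_sndPart hn ?_
    rw [h₂]
    have := (isSlice_Std (n := k) (p := 0) (q := m) le_rfl le_rfl).of_le (p := 0) (q := 0)
      le_rfl (by omega)
    simpa using this.gap

theorem isFib_Std (hn : p + q + k = n) (hj : j ≤ p) (hm : m ≤ k) :
    IsFib p q k j m (Std n (p - j) (q + j + m)) := by
  have hs := (isSlice_Std (n := n) (p := p - j) (q := q + j + m) le_rfl le_rfl).of_le (p := p)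
    (q := q) (by omega) (by omega)
  refine hs.isFib hn hj ?_ ?_
  · ext x
    rw [mem_fstPart, mem_Std, mem_Std]
    constructor
    · rintro ⟨h₁, -⟩
      refine ⟨fun a ha => ?_, by rw [low_eq_top (by omega)]; trivial⟩
      have := h₁ ⟨a, by omega⟩ ha
      rwa [sh_zero_apply x (a := (⟨a, by omega⟩ : Fin n)) a.2] at this
    · rintro ⟨h₁, -⟩
      refine ⟨fun a ha => ?_, low_mono (by omega) (sh_mem_low x)⟩
      by_cases h : (a : ℕ) < p
      · rw [sh_zero_apply x h]
        exact h₁ _ ha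
      · exact ⟨0, by rw [sh_zero_apply' x (by omega)]; simp⟩
  · ext x
    rw [hs.mem_sndPart (by simp) hn, mem_Std, mem_low]
    constructor
    · rintro ⟨γ, hγ, rfl⟩
      rw [mem_Std, mem_low] at hγ
      refine ⟨fun a _ => ?_, fun a ha => ?_⟩ <;> rw [sh_apply, dif_pos (by omega)]
      · exact hγ.1 _ (by simp only; omega)
      · exact hγ.2 _ (by simp only; omega)
    · rintro ⟨h₁, h₂⟩
      refine ⟨WithLp.toLp 2 fun a => if h : p + q ≤ (a : ℕ) then x ⟨a - (p + q), by omega⟩ else 0,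
        mem_Std.2 ⟨fun a ha => ?_, mem_low.2 fun a ha => ?_⟩, ?_⟩
      · by_cases h : p + q ≤ (a : ℕ)
        · simpa [h] using h₁ _ (Nat.zero_le _)
        · exact ⟨0, by simp [h]⟩
      · by_cases h : p + q ≤ (a : ℕ)
        · simpa [h] using h₂ ⟨a - (p + q), by omega⟩ (by simp only; omega)
        · simp [h]
      · ext a
        rw [sh_apply, dif_pos (by omega)]
        simp

/-- A linear map whose contragredient has, up to the order of the coordinates, the effect of
`β`. -/
noncomputable def coGL (β : GLn p) : GLn p := star (revGL p * β⁻¹)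

theorem coGL_dual (hj : j ≤ p) (β : GLn p) :
    (star (coGL β))⁻¹ • (Std p (p - j) j).dual = β • Std p 0 j := by
  rw [coGL, star_star, dual_Std hj, mul_inv_rev, inv_inv, mul_smul, inv_smul_smul]

theorem continuous_coGL : Continuous (coGL (p := p)) :=
  continuous_iff_continuousAt.2 fun β =>
    GLn.tendsto_star (tendsto_const_nhds.mul (continuous_inv.tendsto β))

theorem IsFib.dfst_blk (h : IsFib p q k j m Γ) (hn : p + q + k = n) (hj : j ≤ p) (β : GLn p)
    (β' : GLn k) : dfst p (blk hn (coGL β) β' • Γ) = β • Std p 0 j := by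
  rw [_root_.dfst_blk, dfst, h.fst, coGL_dual hj]

theorem IsFib.sndPart_blk (h : IsFib p q k j m Γ) (hn : p + q + k = n) (α : GLn p)
    (β' : GLn k) : sndPart (p + q) k (blk hn α β' • Γ) = β' • Std k 0 m := by
  rw [h.slice.sndPart_blk zero_le_one hn, h.snd]

theorem tsz_Std (hn : p + q + k = n) : tsz p q k (Std n p q) = 0 := by
  have h := isFib_Std (q := q) (j := 0) (m := 0) hn (Nat.zero_le _) (Nat.zero_le _)
  simp only [Nat.sub_zero, add_zero] at h
  have h₁ := h.fst
  have h₂ := dual_Std (p := p) (Nat.zero_le _)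
  rw [Nat.sub_zero] at h₁ h₂
  rw [tsz, dfst, h₁, h.snd, h₂, Qgrp_smul_Std (q := 0), sz_Std_zero, sz_Std_zero, add_zero]
  intro x hx
  rw [mem_low_zero.1 hx]
  simp

theorem IsSlice.sz_ne_zero_of_tsz (h : IsSlice p q a b Γ) (hb : 0 ≤ b) (hn : p + q + k = n)
    (h1 : tsz p q k Γ = 1) : sz p q Γ ≠ 0 := by
  intro h0
  rw [(h.sz_eq_zero_iff hb).1 h0, tsz_Std hn] at h1
  exact zero_ne_one h1

theorem IsSlice.tn_nz (h : IsSlice p q a b Γ) (hb : 0 ≤ b) (hn : p + q + k = n)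
    (h1 : tsz p q k Γ = 1) : tn p q k (nz p q Γ) = Γ := by
  have h0 := h.sz_ne_zero_of_tsz hb hn h1
  rw [nz, h.tn_dil hb hn (ru_pos (inv_pos.2 (lt_of_le_of_ne sz_nonneg h0.symm))) (by simp [h1]),
    tn_eq_self h1]

/-- A subgroup of the slice with prescribed components gives a point of the link. -/
theorem IsSlice.joinFun_lkProj_nz (h : IsSlice p q a b Γ) (hb : 0 ≤ b) (hn : p + q + k = n)
    (h1 : tsz p q k Γ = 1) :
    (joinFun (lkProj hn ⟨nz p q Γ, h.nz_isSlice hb (h.sz_ne_zero_of_tsz hb hn h1)⟩)).1 =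
      (dfst p Γ, sndPart (p + q) k Γ) := by
  rw [joinFun_lkProj]
  simp only [lkPair, h.tn_nz hb hn h1]

theorem lkProj_surjective (hn : p + q + k = n) : Function.Surjective (lkProj (q := q) hn) := by
  intro z
  obtain ⟨⟨h₁, h₂⟩, hs⟩ := (joinFun z).2
  obtain ⟨j, hj, β, hβ⟩ := h₁.exists_eq_smul_Std zero_le_one
  obtain ⟨m, hm, β', hβ'⟩ := h₂.exists_eq_smul_Std zero_le_one
  have hF := isFib_Std (q := q) hn hj hm
  have hS := hF.slice.smul (blk_mem_Qgrp hn (coGL β) β') zero_le_one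
  have e₁ := hF.dfst_blk hn hj β β'
  have e₂ := hF.sndPart_blk hn (coGL β) β'
  have h1 : tsz p q k (blk hn (coGL β) β' • Std n (p - j) (q + j + m)) = 1 := by
    rw [tsz, e₁, e₂, ← hβ, ← hβ']
    exact hs
  refine ⟨_, joinFun_bijective.1 (Subtype.ext ((hS.joinFun_lkProj_nz (by positivity) hn h1).trans ?_))⟩
  rw [e₁, e₂, ← hβ, ← hβ']

end Fibres

/-! ### The bundle over a stratum of the join -/

section Bundles

theorem exists_trivialization {E B F : Type*} [TopologicalSpace E] [TopologicalSpace B]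
    [TopologicalSpace F] {proj : E → B} (hproj : Continuous proj) {U : Set B} (hU : IsOpen U)
    {f : E → F} {g : B × F → E} (hf : ContinuousOn f (proj ⁻¹' U))
    (hg : ContinuousOn g (U ×ˢ univ)) (hpg : ∀ x ∈ U, ∀ y, proj (g (x, y)) = x)
    (hfg : ∀ x ∈ U, ∀ y, f (g (x, y)) = y) (hgf : ∀ e, proj e ∈ U → g (proj e, f e) = e) :
    ∃ e : Bundle.Trivialization F proj, e.baseSet = U :=
  ⟨{  toFun := fun e => (proj e, f e)
      invFun := g
      source := proj ⁻¹' U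
      target := U ×ˢ univ
      map_source' := fun e he => ⟨he, mem_univ _⟩
      map_target' := fun x hx => by
        rw [mem_preimage, hpg _ hx.1]
        exact hx.1
      left_inv' := fun e he => hgf e he
      right_inv' := fun x hx => Prod.ext (hpg _ hx.1 _) (hfg _ hx.1 _)
      open_source := hU.preimage hproj
      open_target := hU.prod isOpen_univ
      continuousOn_toFun := hproj.continuousOn.prodMk hf
      continuousOn_invFun := hg
      baseSet := U
      open_baseSet := hU
      source_eq := rfl
      target_eq := rfl
      proj_toFun := fun _ _ => rfl }, rfl⟩

variable {n p q k j m : ℕ} {a b c : ℝ} {Γ : ChabautyR n}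

theorem IsFib.tsz_blk (h : IsFib p q k j m Γ) (hn : p + q + k = n) (hj : j ≤ p) {β : GLn p}
    {β' : GLn k} {D : JoinPair p k} (h₁ : β • Std p 0 j = D.1.1) (h₂ : β' • Std k 0 m = D.1.2) :
    tsz p q k (blk hn (coGL β) β' • Γ) = 1 := by
  rw [tsz, h.dfst_blk hn hj, h.sndPart_blk hn, h₁, h₂]
  exact D.2.2

/-- A point of the link over a point with standard components up to `blk` yields an element of the
fibre. -/
theorem Lk.isFib (hn : p + q + k = n) (hj : j ≤ p) (l : Lk n p q) {β : GLn p} {β' : GLn k}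
    (h₁ : β • Std p 0 j = (lkPair hn l).1.1) (h₂ : β' • Std k 0 m = (lkPair hn l).1.2) :
    IsFib p q k j m ((blk hn (coGL β) β')⁻¹ • tn p q k l.1) := by
  have hs := l.isSlice_tn hn
  have hb : 0 ≤ (tsz p q k l.1)⁻¹ := inv_nonneg.2 tsz_nonneg
  refine (hs.smul (inv_mem (blk_mem_Qgrp hn (coGL β) β')) hb).isFib hn hj ?_ ?_
  · have h : dfst p ((blk hn (coGL β) β')⁻¹ • tn p q k l.1) = (Std p (p - j) j).dual := by
      rw [blk_inv, dfst_blk, star_inv, inv_inv, smul_eq_iff_eq_inv_smul, coGL_dual hj, h₁]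
      rfl
    rw [← dual_dual (fstPart p _), ← dual_dual (Std p (p - j) j)]
    exact congrArg _ h
  · rw [blk_inv, hs.sndPart_blk hb hn, inv_smul_eq_iff, h₂]
    rfl

theorem isLocallyTrivialBundle_lkProj (hn : p + q + k = n) (i : JoinIndex p k) :
    IsLocallyTrivialBundle {Γ : ChabautyR n // IsFib p q k i.fstRank i.sndRank Γ}
      ((joinStrata (zeroLinkStrata p) (zeroLinkStrata k) i).restrictPreimage
        (lkProj (q := q) hn)) := by
  set S := joinStrata (zeroLinkStrata p) (zeroLinkStrata k) i
  set j := i.fstRank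
  set m := i.sndRank
  intro z₀
  have hj : j ≤ p := i.fstRank_le
  have hm : m ≤ k := i.sndRank_le
  have hS : ∀ z : S, (joinFun z.1).1.1 ∈ typeStratum p 0 j ∧
      (joinFun z.1).1.2 ∈ typeStratum k 0 m := fun z => mem_joinStrata_iff.1 z.2
  obtain ⟨O, hO, hOo, σ, hσ, hσS⟩ := exists_local_section (by omega) (hS z₀).1
  obtain ⟨O', hO', hOo', σ', hσ', hσS'⟩ := exists_local_section (by omega) (hS z₀).2
  have hc₁ : Continuous fun z : S => (joinFun z.1).1.1 :=
    continuous_fst.comp (continuous_subtype_val.comp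
      (continuous_joinFun.comp continuous_subtype_val))
  have hc₂ : Continuous fun z : S => (joinFun z.1).1.2 :=
    continuous_snd.comp (continuous_subtype_val.comp
      (continuous_joinFun.comp continuous_subtype_val))
  set U : Set S := {z | (joinFun z.1).1.1 ∈ O ∧ (joinFun z.1).1.2 ∈ O'} with hUdef
  have hU : IsOpen U := (hOo.preimage hc₁).inter (hOo'.preimage hc₂)
  set G : S → GLn n := fun z => blk hn (coGL (σ (joinFun z.1).1.1)) (σ' (joinFun z.1).1.2) with hG
  have hGc : ContinuousOn G U := by
    intro z hz
    refine tendsto_blk hn ((continuous_coGL.tendsto _).comp ?_) ?_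
    · exact (hσ.comp hc₁.continuousOn fun z hz => ⟨hz.1, (hS z).1⟩) z hz
    · exact (hσ'.comp hc₂.continuousOn fun z hz => ⟨hz.2, (hS z).2⟩) z hz
  have h₁ : ∀ z ∈ U, σ (joinFun z.1).1.1 • Std p 0 j = (joinFun z.1).1.1 :=
    fun z hz => hσS _ ⟨hz.1, (hS z).1⟩
  have h₂ : ∀ z ∈ U, σ' (joinFun z.1).1.2 • Std k 0 m = (joinFun z.1).1.2 :=
    fun z hz => hσS' _ ⟨hz.2, (hS z).2⟩
  have hsl : ∀ (z : S) {Γ : ChabautyR n}, IsFib p q k j m Γ →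
      IsSlice p q (‖(G z).val‖ * p) (‖(↑(G z)⁻¹ : Euc n →L[ℝ] Euc n)‖ * 1) (G z • Γ) :=
    fun z Γ h => h.slice.smul (blk_mem_Qgrp hn _ _) zero_le_one
  have ht : ∀ z ∈ U, ∀ {Γ : ChabautyR n}, IsFib p q k j m Γ → tsz p q k (G z • Γ) = 1 :=
    fun z hz Γ h => h.tsz_blk hn hj (h₁ z hz) (h₂ z hz)
  have hf : ∀ e : lkProj (q := q) hn ⁻¹' S, ∃ Γ : {Γ : ChabautyR n // IsFib p q k j m Γ},
      S.restrictPreimage (lkProj (q := q) hn) e ∈ U →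
        Γ.1 = (G (S.restrictPreimage (lkProj (q := q) hn) e))⁻¹ • tn p q k e.1.1 := by
    intro e
    by_cases he : S.restrictPreimage (lkProj (q := q) hn) e ∈ U
    · have e₁ := h₁ _ he
      have e₂ := h₂ _ he
      refine ⟨⟨_, e.1.isFib hn hj (e₁.trans ?_) (e₂.trans ?_)⟩, fun _ => rfl⟩ <;>
      exact congrArg _ (congrArg Subtype.val (joinFun_lkProj hn e.1))
    · exact ⟨⟨_, isFib_Std hn hj hm⟩, fun h => absurd h he⟩
  choose f hf using hf
  have hg : ∀ x : S × {Γ : ChabautyR n // IsFib p q k j m Γ}, ∃ e : lkProj (q := q) hn ⁻¹' S,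
      x.1 ∈ U → S.restrictPreimage (lkProj (q := q) hn) e = x.1 ∧
        e.1.1 = nz p q (G x.1 • x.2.1) := by
    intro x
    by_cases hx : x.1 ∈ U
    · have key := (hsl x.1 x.2.2).joinFun_lkProj_nz (by positivity) hn (ht x.1 hx x.2.2)
      set l : Lk n p q := ⟨nz p q (G x.1 • x.2.1), (hsl x.1 x.2.2).nz_isSlice (by positivity)
        ((hsl x.1 x.2.2).sz_ne_zero_of_tsz (by positivity) hn (ht x.1 hx x.2.2))⟩
      have hl : lkProj hn l = x.1.1 := by
        refine joinFun_bijective.1 (Subtype.ext (key.trans (Prod.ext ?_ ?_)))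
        · exact (x.2.2.dfst_blk hn hj _ _).trans (h₁ _ hx)
        · exact (x.2.2.sndPart_blk hn _ _).trans (h₂ _ hx)
      exact ⟨⟨l, by rw [mem_preimage, hl]; exact x.1.2⟩, fun _ => ⟨Subtype.ext hl, rfl⟩⟩
    · obtain ⟨l, hl⟩ := lkProj_surjective (q := q) hn x.1.1
      exact ⟨⟨l, by rw [mem_preimage, hl]; exact x.1.2⟩, fun h => absurd h hx⟩
  choose g hg using hg
  have hproj : Continuous (S.restrictPreimage (lkProj (q := q) hn)) :=
    (continuous_lkProj hn).restrictPreimage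
  have hfg : ∀ x ∈ U, ∀ y, f (g (x, y)) = y := by
    intro x hx y
    obtain ⟨e₁, e₂⟩ := hg (x, y) hx
    refine Subtype.ext ?_
    rw [hf _ (by rw [e₁]; exact hx), e₁, e₂, (hsl x y.2).tn_nz (by positivity) hn (ht x hx y.2),
      inv_smul_smul]
  have hgf : ∀ e, S.restrictPreimage (lkProj (q := q) hn) e ∈ U →
      g (S.restrictPreimage (lkProj (q := q) hn) e, f e) = e := by
    intro e he
    refine Subtype.ext (Subtype.ext ?_)
    rw [(hg _ he).2, hf e he, smul_inv_smul, e.1.nz_tn hn]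
  have hfc : ContinuousOn f (S.restrictPreimage (lkProj (q := q) hn) ⁻¹' U) := by
    refine IsEmbedding.subtypeVal.isInducing.continuousOn_iff.2 ?_
    refine ContinuousOn.congr ?_ fun e he => hf e he
    have hc : Continuous fun e : lkProj (q := q) hn ⁻¹' S => tn p q k e.1.1 :=
      (Lk.continuous_tn hn).comp continuous_subtype_val
    exact (continuous_inv.comp_continuousOn (hGc.comp hproj.continuousOn fun e he => he)).smul
      hc.continuousOn
  have hgc : ContinuousOn g (U ×ˢ univ) := by
    have hi : IsInducing fun e : lkProj (q := q) hn ⁻¹' S => e.1.1 :=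
      (IsEmbedding.subtypeVal.comp IsEmbedding.subtypeVal).isInducing
    refine hi.continuousOn_iff.2 ?_
    have hgn : EqOn (fun x => (g x).1.1) (fun x => nz p q (G x.1 • x.2.1)) (U ×ˢ univ) :=
      fun x hx => (hg x hx.1).2
    change ContinuousOn (fun x => (g x).1.1) _
    refine ContinuousOn.congr ?_ hgn
    rintro ⟨z, Γ⟩ ⟨hz, -⟩
    have hGz : Tendsto (fun x : S × {Γ : ChabautyR n // IsFib p q k j m Γ} => G x.1)
        (𝓝[U ×ˢ univ] (z, Γ)) (𝓝 (G z)) :=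
      (hGc.comp continuous_fst.continuousOn fun x hx => hx.1) (z, Γ) ⟨hz, mem_univ _⟩
    have hψ : Tendsto (fun x : S × {Γ : ChabautyR n // IsFib p q k j m Γ} => G x.1 • x.2.1)
        (𝓝[U ×ˢ univ] (z, Γ)) (𝓝 (G z • Γ.1)) :=
      GLn.tendsto_smul hGz ((continuous_subtype_val.comp continuous_snd).continuousWithinAt)
    set C := max ((‖(G z).val‖ + 1) * p) ((‖(↑(G z)⁻¹ : Euc n →L[ℝ] Euc n)‖ + 1) * 1) with hC
    have hev : ∀ᶠ x : S × {Γ : ChabautyR n // IsFib p q k j m Γ} in 𝓝[U ×ˢ univ] (z, Γ),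
        IsSlice p q C C (G x.1 • x.2.1) ∧ sz p q (G x.1 • x.2.1) ≠ 0 := by
      have n₁ := (GLn.tendsto_iff.1 hGz).norm.eventually (gt_mem_nhds (lt_add_one _))
      have n₂ := (GLn.tendsto_iff.1 hGz.inv).norm.eventually (gt_mem_nhds (lt_add_one _))
      filter_upwards [n₁, n₂, self_mem_nhdsWithin] with x x₁ x₂ hx
      refine ⟨(hsl x.1 x.2.2).mono (le_trans ?_ (le_max_left _ _)) (le_trans ?_ (le_max_right _ _)),
        (hsl x.1 x.2.2).sz_ne_zero_of_tsz (by positivity) hn (ht x.1 hx.1 x.2.2)⟩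
      · exact mul_le_mul_of_nonneg_right x₁.le (Nat.cast_nonneg _)
      · exact mul_le_mul_of_nonneg_right x₂.le zero_le_one
    have hz' := hev.self_of_nhdsWithin ⟨hz, mem_univ _⟩
    exact ((continuousOn_nz (a := C) (hz'.1.cov.nonneg)) _ hz').tendsto.comp
      (tendsto_nhdsWithin_iff.2 ⟨hψ, hev⟩)
  obtain ⟨e, he⟩ := exists_trivialization hproj hU hfc hgc (fun x hx y => (hg (x, y) hx).1) hfg hgf
  exact ⟨e, he ▸ ⟨mem_of_mem_nhds hO, mem_of_mem_nhds hO'⟩⟩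

end Bundles

/-! ### The fibres as torus bundles over tori -/

section Shears

theorem exists_torus_section {d : ℕ} (t₀ : Torus d) : ∃ V : Set (Torus d), IsOpen V ∧ t₀ ∈ V ∧
    ∃ s : Torus d → Fin d → ℝ, ContinuousOn s V ∧
      ∀ t ∈ V, ∀ i, (s t i : UnitAddCircle) = t i := by
  have ha : ∀ i, ∃ a : ℝ, t₀ i ≠ (a : UnitAddCircle) := by
    intro i
    obtain ⟨x, hx⟩ := QuotientAddGroup.mk_surjective (t₀ i)
    refine ⟨x + 1 / 2, fun h => ?_⟩
    rw [← hx, AddCircle.coe_add] at h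
    have h' : (((1 / 2 : ℝ)) : UnitAddCircle) = 0 := by simpa using h
    obtain ⟨z, hz⟩ := AddCircle.coe_eq_zero_iff (1 : ℝ) |>.1 h'
    simp only [zsmul_eq_mul, mul_one] at hz
    have : ((2 * z : ℤ) : ℝ) = ((1 : ℤ) : ℝ) := by push_cast; linarith
    have := Int.cast_injective this
    omega
  choose a ha using ha
  have : Fact ((0 : ℝ) < 1) := ⟨one_pos⟩
  refine ⟨{t | ∀ i, t i ≠ (a i : UnitAddCircle)}, ?_, ha,
    fun t i => AddCircle.equivIco 1 (a i) (t i), ?_, fun t _ i => AddCircle.coe_equivIco⟩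
  · simp only [ofPred_forall]
    exact isOpen_iInter_of_finite fun i => isOpen_ne.preimage (continuous_apply i)
  · refine continuousOn_pi.2 fun i t ht => ContinuousAt.continuousWithinAt ?_
    have h₁ : ContinuousAt (fun t : Torus d => t i) t := (continuous_apply i).continuousAt
    exact continuous_subtype_val.continuousAt.comp
      (ContinuousAt.comp (f := fun t : Torus d => t i)
        (AddCircle.continuousAt_equivIco 1 (a i) (ht i)) h₁)

theorem coe_unitAddCircle_eq_iff {x y : ℝ} :
    (x : UnitAddCircle) = y ↔ ∃ z : ℤ, x - y = z := by
  rw [← sub_eq_zero, ← AddCircle.coe_sub, AddCircle.coe_eq_zero_iff]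
  simp [eq_comm]

variable {n M d w : ℕ}

/-- The rows of the block `[M - d, M) × [M, M + w)`. -/
def rowIx (hd : d ≤ M) (hw : M + w ≤ n) (t : Fin (w * d)) : Fin n :=
  ⟨M - d + (finProdFinEquiv.symm t).2, by have := (finProdFinEquiv.symm t).2.2; omega⟩

/-- The columns of the block `[M - d, M) × [M, M + w)`. -/
def colIx (hw : M + w ≤ n) (t : Fin (w * d)) : Fin n :=
  ⟨M + (finProdFinEquiv.symm t).1, by have := (finProdFinEquiv.symm t).1.2; omega⟩

theorem ix_injective (hd : d ≤ M) (hw : M + w ≤ n) {t t' : Fin (w * d)}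
    (h : rowIx hd hw t = rowIx hd hw t') (h' : colIx hw t = colIx hw t') : t = t' := by
  simp only [rowIx, colIx, Fin.mk.injEq] at h h'
  refine finProdFinEquiv.symm.injective (Prod.ext (Fin.ext ?_) (Fin.ext ?_)) <;> omega

theorem exists_ix (hd : d ≤ M) (hw : M + w ≤ n) {i i' : Fin n} (h₁ : M - d ≤ (i : ℕ))
    (h₂ : (i : ℕ) < M) (h₃ : M ≤ (i' : ℕ)) (h₄ : (i' : ℕ) < M + w) :
    ∃ t : Fin (w * d), rowIx hd hw t = i ∧ colIx hw t = i' := by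
  refine ⟨finProdFinEquiv (⟨i' - M, by omega⟩, ⟨i - (M - d), by omega⟩), ?_, ?_⟩ <;>
  · refine Fin.ext ?_
    simp only [rowIx, colIx, Equiv.symm_apply_apply]
    omega

/-- The nilpotent matrix with entries `θ` in the block `[M - d, M) × [M, M + w)`. -/
noncomputable def shearN (hd : d ≤ M) (hw : M + w ≤ n) (θ : Fin (w * d) → ℝ) :
    Euc n →L[ℝ] Euc n :=
  ∑ t, θ t • (EuclideanSpace.proj (colIx hw t) : Euc n →L[ℝ] ℝ).smulRight (bv (rowIx hd hw t))

theorem shearN_apply (hd : d ≤ M) (hw : M + w ≤ n) (θ : Fin (w * d) → ℝ) (x : Euc n) :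
    shearN hd hw θ x = ∑ t, (θ t * x (colIx hw t)) • bv (rowIx hd hw t) := by
  simp [shearN, smul_smul]

theorem shearN_mem_low (hd : d ≤ M) (hw : M + w ≤ n) (θ : Fin (w * d) → ℝ) (x : Euc n) :
    shearN hd hw θ x ∈ low n M := by
  rw [shearN_apply]
  refine sum_mem fun t _ => Submodule.smul_mem _ _ (bv_mem_low ?_)
  have := (finProdFinEquiv.symm t).2.2
  simp only [rowIx]
  omega

theorem shearN_of_mem_low (hd : d ≤ M) (hw : M + w ≤ n) (θ : Fin (w * d) → ℝ) {x : Euc n}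
    (hx : x ∈ low n M) : shearN hd hw θ x = 0 := by
  rw [shearN_apply]
  refine Finset.sum_eq_zero fun t _ => ?_
  rw [mem_low.1 hx _ (by simp [colIx]), mul_zero, zero_smul]

theorem shearN_bv (hd : d ≤ M) (hw : M + w ≤ n) (θ : Fin (w * d) → ℝ) (t : Fin (w * d)) :
    shearN hd hw θ (bv (colIx hw t)) (rowIx hd hw t) = θ t := by
  rw [shearN_apply, WithLp.ofLp_sum, Finset.sum_apply, Finset.sum_eq_single t]
  · simp
  · intro t' _ hne
    rw [PiLp.smul_apply, bv_apply, bv_apply]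
    by_cases h : rowIx hd hw t = rowIx hd hw t'
    · rw [if_neg fun h' => hne (ix_injective hd hw h h'.symm).symm]
      simp
    · simp [h]
  · simp

/-- The unipotent matrix with entries `θ` in the block `[M - d, M) × [M, M + w)`. -/
noncomputable def shear (hd : d ≤ M) (hw : M + w ≤ n) (θ : Fin (w * d) → ℝ) : GLn n where
  val := 1 + shearN hd hw θ
  inv := 1 - shearN hd hw θ
  val_inv := by
    ext x : 1
    simp [shearN_of_mem_low hd hw θ (shearN_mem_low hd hw θ x)]
  inv_val := by
    ext x : 1
    simp [shearN_of_mem_low hd hw θ (shearN_mem_low hd hw θ x)]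

theorem shear_apply (hd : d ≤ M) (hw : M + w ≤ n) (θ : Fin (w * d) → ℝ) (x : Euc n) :
    (shear hd hw θ).val x = x + shearN hd hw θ x := rfl

theorem continuous_shear (hd : d ≤ M) (hw : M + w ≤ n) : Continuous (shear hd hw) := by
  refine GLn.continuous_iff.2 (continuous_const.add ?_)
  exact continuous_finsetSum _ fun t _ => (continuous_apply t).smul continuous_const

/-- The subgroup `Γ` has bounded lifts of the basis vectors with indices in `[M, M + w)`, and the
coordinates from `M - d` on of the elements of `Γ` in the span of the first `M` basis vectors are
integral. -/
structure HasLifts (M d w : ℕ) (R : ℝ) (Γ : ChabautyR n) : Prop where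
  lift : ∀ i : Fin n, M ≤ (i : ℕ) → (i : ℕ) < M + w → ∃ γ ∈ Γ, γ - bv i ∈ low n M ∧ ‖γ‖ ≤ R
  int : ∀ γ ∈ Γ, γ ∈ low n M → ∀ i : Fin n, M - d ≤ (i : ℕ) → ∃ z : ℤ, γ i = z

open Classical in
/-- The classes modulo the integers of the coordinates in `[M - d, M)` of the lifts. -/
noncomputable def liftClass (hd : d ≤ M) (hw : M + w ≤ n) (Γ : ChabautyR n) : Torus (w * d) :=
  fun t => if h : ∃ γ ∈ Γ, γ - bv (colIx hw t) ∈ low n M then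
    ((h.choose (rowIx hd hw t) : ℝ) : UnitAddCircle) else 0

variable {R : ℝ} {Γ : ChabautyR n}

theorem HasLifts.liftClass_eq (h : HasLifts M d w R Γ) (hd : d ≤ M) (hw : M + w ≤ n) {γ : Euc n}
    {t : Fin (w * d)} (hγ : γ ∈ Γ) (hγ' : γ - bv (colIx hw t) ∈ low n M) :
    liftClass hd hw Γ t = ((γ (rowIx hd hw t) : ℝ) : UnitAddCircle) := by
  have hex : ∃ γ ∈ Γ, γ - bv (colIx hw t) ∈ low n M := ⟨γ, hγ, hγ'⟩
  rw [liftClass, dif_pos hex, coe_unitAddCircle_eq_iff]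
  obtain ⟨h₁, h₂⟩ := hex.choose_spec
  have := h.int _ (sub_mem h₁ hγ) (by
    have := sub_mem h₂ hγ'
    rwa [sub_sub_sub_cancel_right] at this) (rowIx hd hw t) (by simp [rowIx])
  simpa using this

theorem HasLifts.exists_lift (h : HasLifts M d w R Γ) (hw : M + w ≤ n) (t : Fin (w * d)) :
    ∃ γ ∈ Γ, γ - bv (colIx hw t) ∈ low n M ∧ ‖γ‖ ≤ R :=
  h.lift _ (by simp [colIx]) (by have := (finProdFinEquiv.symm t).1.2; simp only [colIx]; omega)

theorem continuousOn_liftClass (hd : d ≤ M) (hw : M + w ≤ n) :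
    ContinuousOn (liftClass (n := n) hd hw) {Γ | HasLifts M d w R Γ} := by
  refine continuousOn_pi.2 fun t => ?_
  rw [continuousOn_iff_continuous_domRestrict, continuous_iff_ultrafilter]
  intro Γ u hu
  have h : Tendsto (Subtype.val : {Γ : ChabautyR n | HasLifts M d w R Γ} → _) u (𝓝 Γ.1) :=
    (continuous_subtype_val.tendsto Γ).mono_left hu
  choose γ hγ hγ' hR using fun Δ : {Γ : ChabautyR n | HasLifts M d w R Γ} => Δ.2.exists_lift hw t
  obtain ⟨γ₀, hγ₀⟩ := exists_tendsto_of_norm_le (u := u) (.of_forall hR)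
  have h₁ := Chabauty.mem_of_tendsto h (.of_forall hγ) hγ₀
  have h₂ : γ₀ - bv (colIx hw t) ∈ low n M :=
    isClosed_low.mem_of_tendsto (hγ₀.sub_const _) (.of_forall hγ')
  change Tendsto (fun Δ : {Γ : ChabautyR n | HasLifts M d w R Γ} => liftClass hd hw Δ.1 t) u
    (𝓝 (liftClass hd hw Γ.1 t))
  rw [Γ.2.liftClass_eq hd hw h₁ h₂]
  simp only [fun Δ : {Γ : ChabautyR n | HasLifts M d w R Γ} =>
    Δ.2.liftClass_eq hd hw (hγ Δ) (hγ' Δ)]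
  exact ((AddCircle.continuous_mk' 1).tendsto _).comp (tendsto_coord hγ₀ _)

theorem HasLifts.liftClass_shear (h : HasLifts M d w R Γ) (hd : d ≤ M) (hw : M + w ≤ n)
    (θ : Fin (w * d) → ℝ) (h' : HasLifts M d w R (shear hd hw θ • Γ)) :
    liftClass hd hw (shear hd hw θ • Γ) =
      liftClass hd hw Γ + fun t => ((θ t : ℝ) : UnitAddCircle) := by
  ext t
  obtain ⟨γ, hγ, hγ', -⟩ := h.exists_lift hw t
  have hN : shearN hd hw θ γ = shearN hd hw θ (bv (colIx hw t)) := by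
    have := shearN_of_mem_low hd hw θ hγ'
    rwa [map_sub, sub_eq_zero] at this
  rw [Pi.add_apply, h.liftClass_eq hd hw hγ hγ', h'.liftClass_eq hd hw
    (GLn.apply_mem_smul.2 hγ), shear_apply, hN, PiLp.add_apply, shearN_bv, AddCircle.coe_add]
  rw [shear_apply, add_sub_right_comm]
  exact add_mem hγ' (shearN_mem_low _ _ _ _)

end Shears

section FibreBundles

variable {n p q k j m : ℕ} {Γ : ChabautyR n}

theorem IsFib.smul (h : IsFib p q k j m Γ) (hn : p + q + k = n) (hj : j ≤ p) {T : GLn n}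
    (hT : T ∈ Qgrp n p q) (hT₁ : ∀ x ∈ low n p, T.val x = x)
    (hT₂ : ∀ x, T.val x - x ∈ low n (p + q)) : IsFib p q k j m (T • Γ) := by
  refine (h.slice.smul hT zero_le_one).isFib hn hj ?_ ?_
  · rw [fstPart_smul (α := 1) fun x => by rw [hT₁ _ (sh_mem_low x)]; rfl, one_smul, h.fst]
  · rw [h.slice.sndPart_smul zero_le_one hn hT (β := 1) fun x =>
      sh_eq_of_sub_mem hn (hT₂ x), one_smul, h.snd]

theorem IsFib.shear_smul {M d w : ℕ} (h : IsFib p q k j m Γ) (hn : p + q + k = n) (hj : j ≤ p)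
    (hd : d ≤ M) (hw : M + w ≤ n) (hM : M = p ∨ M = p + q) (θ : Fin (w * d) → ℝ) :
    IsFib p q k j m (shear hd hw θ • Γ) := by
  refine h.smul hn hj (mem_Qgrp.2 fun x hx => ?_) (fun x hx => ?_) fun x => ?_
  · rw [shear_apply, add_sub_cancel_left]
    rcases hM with rfl | rfl
    · exact shearN_mem_low _ _ _ _
    · rw [shearN_of_mem_low hd hw θ hx]
      exact zero_mem _
  · rw [shear_apply, shearN_of_mem_low hd hw θ (low_mono (by omega) hx), add_zero]
  · rw [shear_apply, add_sub_cancel_left]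
    exact low_mono (by omega) (shearN_mem_low hd hw θ x)

theorem isClosed_isFib (hn : p + q + k = n) :
    IsClosed {Γ : ChabautyR n | IsFib p q k j m Γ} := by
  have h₁ := (continuousOn_dfst (q := q) (a := p) (b := 1) (by omega)).preimage_isClosed_of_isClosed
    (isClosed_isSlice (n := n)) (isClosed_singleton (x := (Std p (p - j) j).dual))
  have h₂ := (continuousOn_sndPart (a := p) zero_le_one hn).preimage_isClosed_of_isClosed
    (isClosed_isSlice (n := n)) (isClosed_singleton (x := Std k 0 m))
  convert h₁.inter h₂ using 1
  ext Γ
  constructor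
  · rintro ⟨e₁, e₂, e₃⟩
    exact ⟨⟨e₁, congrArg _ e₂⟩, e₁, e₃⟩
  · rintro ⟨⟨e₁, e₂⟩, -, e₃⟩
    refine ⟨e₁, ?_, e₃⟩
    rw [← dual_dual (fstPart p Γ), ← dual_dual (Std p (p - j) j)]
    exact congrArg _ e₂

theorem IsFib.mem_of_mem_low (h : IsFib p q k j m Γ) (hn : p + q + k = n) (hj : j ≤ p) {x : Euc n}
    (hx : x ∈ low n p) : x ∈ Γ ↔ ∀ i : Fin n, p - j ≤ (i : ℕ) → ∃ z : ℤ, x i = z := by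
  have : x ∈ Γ ↔ sh 0 p n x ∈ fstPart p Γ := by rw [mem_fstPart, sh_sh_of_mem_low hx]
  rw [this, h.fst, mem_Std]
  constructor
  · rintro ⟨e, -⟩ i hi
    by_cases hip : (i : ℕ) < p
    · have := e ⟨i, hip⟩ hi
      rwa [sh_zero_apply x (a := (⟨i, hip⟩ : Fin p)) i.2] at this
    · exact ⟨0, by rw [mem_low.1 hx i (by omega)]; simp⟩
  · intro e
    refine ⟨fun i hi => ?_, by rw [low_eq_top (by omega)]; trivial⟩
    rw [sh_zero_apply x (by omega)]
    exact e _ hi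

theorem IsFib.hasLifts_fst (h : IsFib p q k j m Γ) (hn : p + q + k = n) (hj : j ≤ p) :
    HasLifts p j q (p + 1) Γ := by
  refine ⟨fun i hi hi' => ?_, fun γ hγ hγ' => (h.mem_of_mem_low hn hj hγ').1 hγ⟩
  obtain ⟨γ, hγ, hγ'⟩ := h.slice.lift i hi hi'
  obtain ⟨δ, hδ, hδ', hle⟩ := h.slice.cov.exists_reduce hγ
  refine ⟨δ, hδ, ?_, hle.trans ?_⟩
  · have := sub_mem hγ' hδ'
    rwa [sub_sub_sub_cancel_left] at this
  · rw [tl_eq_of_sub_mem hγ']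
    have := norm_tl_le p (bv i)
    rw [norm_bv] at this
    linarith

theorem IsFib.liftClass_eq_zero_iff (h : IsFib p q k j m Γ) (hn : p + q + k = n) (hj : j ≤ p)
    (hw : p + q ≤ n) : liftClass hj hw Γ = 0 ↔
      ∀ i : Fin n, p ≤ (i : ℕ) → (i : ℕ) < p + q → bv i ∈ Γ := by
  have hL := h.hasLifts_fst hn hj
  constructor
  · intro h0 i hi hi'
    obtain ⟨γ, hγ, hγ', -⟩ := hL.lift i hi hi'
    have hmem : γ - bv i ∈ Γ := by
      rw [h.mem_of_mem_low hn hj hγ']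
      intro i' hi''
      by_cases hlt : (i' : ℕ) < p
      · obtain ⟨t, rfl, rfl⟩ := exists_ix hj hw hi'' hlt hi hi'
        have := hL.liftClass_eq hj hw hγ hγ'
        rw [h0, Pi.zero_apply, eq_comm, ← AddCircle.coe_zero, coe_unitAddCircle_eq_iff,
          sub_zero] at this
        obtain ⟨z, hz⟩ := this
        refine ⟨z, ?_⟩
        rw [PiLp.sub_apply, hz, bv_ne, sub_zero]
        rw [Ne, Fin.ext_iff]
        omega
      · exact ⟨0, by rw [mem_low.1 hγ' i' (by omega)]; simp⟩
    have := sub_mem hγ hmem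
    rwa [sub_sub_cancel] at this
  · intro hbv
    ext t
    have hc : p ≤ (colIx hw t : ℕ) ∧ (colIx hw t : ℕ) < p + q := by
      have := (finProdFinEquiv.symm t).1.2
      simp only [colIx]
      omega
    have hr : (rowIx hj hw t : ℕ) < p := by
      have := (finProdFinEquiv.symm t).2.2
      simp only [rowIx]
      omega
    rw [hL.liftClass_eq hj hw (hbv _ hc.1 hc.2) (by rw [sub_self]; exact zero_mem _), bv_ne]
    · simp
    · rw [Ne, Fin.ext_iff]
      omega

theorem IsFib.mem_of_mem_low_add (h : IsFib p q k j m Γ) (hn : p + q + k = n) (hj : j ≤ p)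
    (hbv : ∀ i : Fin n, p ≤ (i : ℕ) → (i : ℕ) < p + q → bv i ∈ Γ) {x : Euc n}
    (hx : x ∈ low n (p + q)) : x ∈ Γ ↔ ∀ i : Fin n, p - j ≤ (i : ℕ) → ∃ z : ℤ, x i = z := by
  have key : ∀ z : Fin n → ℤ, (∀ i : Fin n, p ≤ (i : ℕ) → x i = z i) → (x ∈ Γ ↔
      ∀ i : Fin n, p - j ≤ (i : ℕ) → ∃ z : ℤ, x i = z) := by
    intro z hz
    obtain ⟨v, hv, hvz⟩ := Chabauty.exists_int_comb hbv z
    have hlow : x - v ∈ low n p := by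
      refine mem_low.2 fun i hi => ?_
      rw [PiLp.sub_apply, hvz i]
      split_ifs with hc
      · rw [hz i hi, sub_self]
      · rw [mem_low.1 hx i (by omega), sub_zero]
    have h₁ : x ∈ Γ ↔ x - v ∈ Γ :=
      ⟨fun h => sub_mem h hv, fun h => by simpa using add_mem h hv⟩
    rw [h₁, h.mem_of_mem_low hn hj hlow]
    refine forall_congr' fun i => forall_congr' fun hi => ?_
    rw [PiLp.sub_apply, hvz i]
    split_ifs with hc
    · rw [hz i hc.1, sub_self]
      exact ⟨fun _ => ⟨_, rfl⟩, fun _ => ⟨0, by simp⟩⟩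
    · rw [sub_zero]
  constructor
  · intro hmem
    choose z hz using fun i : {i : Fin n // p ≤ (i : ℕ)} => h.slice.int x hmem hx i.1 i.2
    exact (key (fun i => if hi : p ≤ (i : ℕ) then z ⟨i, hi⟩ else 0) fun i hi => by
      rw [dif_pos hi, hz ⟨i, hi⟩]).1 hmem
  · intro hint
    choose z hz using fun i : {i : Fin n // p - j ≤ (i : ℕ)} => hint i.1 i.2
    exact (key (fun i => if hi : p - j ≤ (i : ℕ) then z ⟨i, hi⟩ else 0) fun i hi => by
      rw [dif_pos (by omega), hz ⟨i, by omega⟩]).2 hint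

theorem IsFib.hasLifts_snd (h : IsFib p q k j m Γ) (hn : p + q + k = n) (hj : j ≤ p)
    (hbv : ∀ i : Fin n, p ≤ (i : ℕ) → (i : ℕ) < p + q → bv i ∈ Γ) :
    HasLifts (p + q) (q + j) m (p + n + 1) Γ := by
  refine ⟨fun i hi hi' => ?_, fun γ hγ hγ' i hi =>
    (h.mem_of_mem_low_add hn hj hbv hγ').1 hγ i (by omega)⟩
  have hmem : sh (p + q) k n (bv i) ∈ sndPart (p + q) k Γ := by
    rw [h.snd]
    refine mem_Std.2 ⟨fun a _ => ?_, mem_low.2 fun a ha => ?_⟩ <;>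
      rw [sh_apply, dif_pos (by omega), bv_apply]
    · split_ifs
      · exact ⟨1, by simp⟩
      · exact ⟨0, by simp⟩
    · rw [if_neg]
      rw [Fin.ext_iff]
      simp only
      omega
  obtain ⟨γ, hγ, hsh⟩ := (h.slice.mem_sndPart zero_le_one hn).1 hmem
  have hγ' : γ - bv i ∈ low n (p + q) := by
    rw [← sh_eq_zero_iff hn, map_sub, hsh, sub_self]
  obtain ⟨δ, hδ, hδ', hle⟩ := h.slice.exists_reduce hγ
  refine ⟨δ, hδ, ?_, hle.trans ?_⟩
  · have := sub_mem hγ' hδ'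
    rwa [sub_sub_sub_cancel_left] at this
  · rw [tl_eq_of_sub_mem hγ']
    have := norm_tl_le (p + q) (bv i)
    rw [norm_bv] at this
    linarith

/-- The elements of the fibre that contain the middle basis vectors. -/
abbrev SubFib (n p q k j m : ℕ) : Type := {Γ : ChabautyR n // IsFib p q k j m Γ ∧
  ∀ i : Fin n, p ≤ (i : ℕ) → (i : ℕ) < p + q → bv i ∈ Γ}

theorem continuous_liftClass_fst (hn : p + q + k = n) (hj : j ≤ p) (hw : p + q ≤ n) :
    Continuous fun Γ : {Γ : ChabautyR n // IsFib p q k j m Γ} => liftClass hj hw Γ.1 :=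
  (continuousOn_liftClass hj hw).comp_continuous continuous_subtype_val
    fun Γ => Γ.2.hasLifts_fst hn hj

theorem continuous_liftClass_snd (hn : p + q + k = n) (hj : j ≤ p)
    (hd : q + j ≤ p + q) (hw : p + q + m ≤ n) :
    Continuous fun Γ : SubFib n p q k j m => liftClass hd hw Γ.1 :=
  (continuousOn_liftClass hd hw).comp_continuous continuous_subtype_val
    fun Γ => Γ.2.1.hasLifts_snd hn hj Γ.2.2

theorem compactSpace_subFib (hn : p + q + k = n) (hj : j ≤ p) :
    CompactSpace (SubFib n p q k j m) := by
  have hK : CompactSpace {Γ : ChabautyR n // IsFib p q k j m Γ} :=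
    isCompact_iff_compactSpace.1 (isClosed_isFib hn).isCompact
  have hc := (isClosed_singleton (x := (0 : Torus (q * j)))).preimage
    (continuous_liftClass_fst (m := m) hn hj (by omega))
  refine isCompact_iff_compactSpace (s := {Γ : ChabautyR n | IsFib p q k j m Γ ∧
    ∀ i : Fin n, p ≤ (i : ℕ) → (i : ℕ) < p + q → bv i ∈ Γ}).1 ?_
  convert hc.isCompact.image continuous_subtype_val
  ext Γ
  constructor
  · rintro ⟨h, h'⟩
    exact ⟨⟨Γ, h⟩, (h.liftClass_eq_zero_iff hn hj (by omega)).2 h', rfl⟩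
  · rintro ⟨Γ, h', rfl⟩
    exact ⟨Γ.2, (Γ.2.liftClass_eq_zero_iff hn hj (by omega)).1 h'⟩

theorem bijective_liftClass_snd (hn : p + q + k = n) (hj : j ≤ p) (hm : m ≤ k)
    (hd : q + j ≤ p + q) (hw : p + q + m ≤ n) :
    Function.Bijective fun Γ : SubFib n p q k j m => liftClass hd hw Γ.1 := by
  constructor
  · rintro ⟨Γ, h, hbv⟩ ⟨Γ', h', hbv'⟩ heq
    have hL := h.hasLifts_snd hn hj hbv
    have hL' := h'.hasLifts_snd hn hj hbv'
    have hmid : ∀ i : Fin n, ∃ v : Euc n, v - bv i ∈ low n (p + q) ∧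
        ((i : ℕ) < p + q → v = bv i) ∧
        (p + q ≤ (i : ℕ) → (i : ℕ) < p + q + m → v ∈ Γ ∧ v ∈ Γ') := by
      intro i
      by_cases hi : p + q ≤ (i : ℕ) ∧ (i : ℕ) < p + q + m
      · obtain ⟨γ, hγ, hγl, -⟩ := hL.lift i hi.1 hi.2
        obtain ⟨γ', hγ', hγl', -⟩ := hL'.lift i hi.1 hi.2
        refine ⟨γ, hγl, fun h => absurd hi.1 (by omega), fun _ _ => ⟨hγ, ?_⟩⟩
        have hlow : γ - γ' ∈ low n (p + q) := by
          have := sub_mem hγl hγl'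
          rwa [sub_sub_sub_cancel_right] at this
        have hmem : γ - γ' ∈ Γ' := by
          rw [h'.mem_of_mem_low_add hn hj hbv' hlow]
          intro i' hi'
          by_cases hlt : (i' : ℕ) < p + q
          · obtain ⟨t, rfl, rfl⟩ := exists_ix hd hw (i := i') (by omega) hlt hi.1 hi.2
            have := congrFun heq t
            simp only at this
            rwa [hL.liftClass_eq hd hw hγ hγl, hL'.liftClass_eq hd hw hγ' hγl',
              coe_unitAddCircle_eq_iff] at this
          · exact ⟨0, by rw [mem_low.1 hlow i' (by omega)]; simp⟩
        simpa using add_mem hmem hγ'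
      · exact ⟨bv i, by rw [sub_self]; exact zero_mem _, fun _ => rfl,
          fun h₁ h₂ => absurd ⟨h₁, h₂⟩ hi⟩
    choose v hv₁ hv₂ hv₃ using hmid
    obtain ⟨T, hT, hT₁, hT₂, hTv⟩ := exists_unipotent (p := p) (q := q) (v := v)
      (fun i hi => hv₂ i (by omega))
      (fun i _ hi => by rw [hv₂ i hi, sub_self]; exact zero_mem _) (fun i _ => hv₁ i)
    have e := h.slice.eq_smul_Std_of_parts zero_le_one hn hj h.fst h.snd hT hT₁ hT₂
      (fun i hi hi' => by
        rw [hTv]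
        by_cases hlt : (i : ℕ) < p + q
        · rw [hv₂ i hlt]
          exact hbv i hi hlt
        · exact (hv₃ i (by omega) hi').1)
    have e' := h'.slice.eq_smul_Std_of_parts zero_le_one hn hj h'.fst h'.snd hT hT₁ hT₂
      (fun i hi hi' => by
        rw [hTv]
        by_cases hlt : (i : ℕ) < p + q
        · rw [hv₂ i hlt]
          exact hbv' i hi hlt
        · exact (hv₃ i (by omega) hi').2)
    exact Subtype.ext (e.trans e'.symm)
  · intro t
    choose θ hθ using fun i => QuotientAddGroup.mk_surjective (t i)
    have hstd : ∀ i : Fin n, (i : ℕ) < p + q + m →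
        bv i ∈ Std n (p - j) (q + j + m) := fun i hi => by
      refine mem_Std.2 ⟨fun a _ => ?_, bv_mem_low (by omega)⟩
      rw [bv_apply]
      split_ifs
      · exact ⟨1, by simp⟩
      · exact ⟨0, by simp⟩
    have hF := isFib_Std (q := q) hn hj hm
    have hF' := hF.shear_smul hn hj hd hw (.inr rfl) θ
    have hbv : ∀ i : Fin n, p ≤ (i : ℕ) → (i : ℕ) < p + q →
        bv i ∈ shear hd hw θ • Std n (p - j) (q + j + m) := fun i hi hi' => by
      have := GLn.apply_mem_smul (g := shear hd hw θ) |>.2 (hstd i (by omega))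
      rwa [shear_apply, shearN_of_mem_low hd hw θ (bv_mem_low hi'), add_zero] at this
    have hL := hF.hasLifts_snd hn hj fun i _ hi' => hstd i (by omega)
    refine ⟨⟨_, hF', hbv⟩, ?_⟩
    simp only
    rw [hL.liftClass_shear hd hw θ (hF'.hasLifts_snd hn hj hbv)]
    ext i
    have hc : p + q ≤ (colIx hw i : ℕ) ∧ (colIx hw i : ℕ) < p + q + m := by
      have := (finProdFinEquiv.symm i).1.2
      simp only [colIx]
      omega
    have hr : (rowIx hd hw i : ℕ) < p + q := by
      have := (finProdFinEquiv.symm i).2.2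
      simp only [rowIx]
      omega
    rw [Pi.add_apply, hL.liftClass_eq hd hw (hstd _ hc.2) (by rw [sub_self]; exact zero_mem _), bv_ne]
    · simpa using hθ i
    · rw [Ne, Fin.ext_iff]
      omega

theorem isTorusBundleOverTorus_isFib (hn : p + q + k = n) (hj : j ≤ p) (hm : m ≤ k) :
    IsTorusBundleOverTorus {Γ : ChabautyR n // IsFib p q k j m Γ} (q * j) (m * (q + j)) := by
  have hw : p + q ≤ n := by omega
  have hd : q + j ≤ p + q := by omega
  have hw' : p + q + m ≤ n := by omega
  have hK := compactSpace_subFib (q := q) (m := m) hn hj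
  let e : SubFib n p q k j m ≃ₜ Torus (m * (q + j)) :=
    Continuous.homeoOfEquivCompactToT2 (f := Equiv.ofBijective _ (bijective_liftClass_snd hn hj hm
      hd hw')) (continuous_liftClass_snd hn hj hd hw')
  have hρ := continuous_liftClass_fst (q := q) (m := m) hn hj hw
  refine ⟨fun Γ => liftClass hj hw Γ.1, fun t₀ => ?_⟩
  obtain ⟨V, hV, ht₀, s, hs, hst⟩ := exists_torus_section t₀
  have hlift : ∀ (Γ : ChabautyR n), IsFib p q k j m Γ → ∀ θ,
      liftClass hj hw (shear hj hw θ • Γ) = liftClass hj hw Γ + fun t => ((θ t : ℝ) : UnitAddCircle) :=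
    fun Γ h θ => (h.hasLifts_fst hn hj).liftClass_shear hj hw θ
      ((h.shear_smul hn hj hj hw (.inl rfl) θ).hasLifts_fst hn hj)
  have hsub : ∀ Γ : {Γ : ChabautyR n // IsFib p q k j m Γ}, ∃ Δ : SubFib n p q k j m,
      liftClass hj hw Γ.1 ∈ V → Δ.1 = (shear hj hw (s (liftClass hj hw Γ.1)))⁻¹ • Γ.1 := by
    intro Γ
    by_cases hΓ : liftClass hj hw Γ.1 ∈ V
    · set θ := s (liftClass hj hw Γ.1)
      have hinv : (shear hj hw θ)⁻¹ = shear hj hw (-θ) := by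
        refine Units.ext (ContinuousLinearMap.ext fun x => ?_)
        change x - shearN hj hw θ x = x + shearN hj hw (-θ) x
        rw [shearN_apply, shearN_apply, sub_eq_add_neg, ← Finset.sum_neg_distrib]
        simp only [Pi.neg_apply, neg_mul, neg_smul]
      have hF : IsFib p q k j m ((shear hj hw θ)⁻¹ • Γ.1) := by
        rw [hinv]
        exact Γ.2.shear_smul hn hj hj hw (.inl rfl) _
      refine ⟨⟨_, hF, (hF.liftClass_eq_zero_iff hn hj hw).1 ?_⟩, fun _ => rfl⟩
      have := hlift _ hF θ
      rw [smul_inv_smul] at this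
      ext t
      have := congrFun this t
      rw [Pi.add_apply, hst _ hΓ t] at this
      simpa using this
    · exact ⟨e.symm 0, fun h => absurd h hΓ⟩
  choose r hr using hsub
  have hgF : ∀ x : Torus (q * j) × Torus (m * (q + j)),
      IsFib p q k j m (shear hj hw (s x.1) • (e.symm x.2).1) :=
    fun x => (e.symm x.2).2.1.shear_smul hn hj hj hw (.inl rfl) _
  have hpg : ∀ x ∈ V, ∀ y, liftClass hj hw (shear hj hw (s x) • (e.symm y).1) = x := by
    intro x hx y
    rw [hlift _ (e.symm y).2.1,
      ((e.symm y).2.1.liftClass_eq_zero_iff hn hj hw).2 (e.symm y).2.2, zero_add]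
    exact funext fun t => hst x hx t
  obtain ⟨T, hT⟩ := exists_trivialization (proj := fun Γ : {Γ : ChabautyR n // IsFib p q k j m Γ} =>
    liftClass hj hw Γ.1) hρ hV (f := fun Γ => e (r Γ)) (g := fun x => ⟨_, hgF x⟩)
    (e.continuous.comp_continuousOn (IsEmbedding.subtypeVal.isInducing.continuousOn_iff.2 (by
      refine ContinuousOn.congr ?_ fun Γ hΓ => hr Γ hΓ
      have h₁ : ContinuousOn (fun Γ : {Γ : ChabautyR n // IsFib p q k j m Γ} =>
          (shear hj hw (s (liftClass hj hw Γ.1)))⁻¹) ((fun Γ => liftClass hj hw Γ.1) ⁻¹' V) :=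
        continuous_inv.comp_continuousOn ((continuous_shear hj hw).comp_continuousOn
          (hs.comp hρ.continuousOn fun Γ h => h))
      exact h₁.smul continuous_subtype_val.continuousOn)))
    (IsEmbedding.subtypeVal.isInducing.continuousOn_iff.2 (by
      have h₁ : ContinuousOn (fun x : Torus (q * j) × Torus (m * (q + j)) =>
          shear hj hw (s x.1)) (V ×ˢ univ) :=
        (continuous_shear hj hw).comp_continuousOn
          (hs.comp continuous_fst.continuousOn fun x h => h.1)
      exact h₁.smul (continuous_subtype_val.comp
        (e.symm.continuous.comp continuous_snd)).continuousOn))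
    (fun x hx y => hpg x hx y)
    (fun x hx y => by
      refine (e.symm_apply_eq.1 (Subtype.ext ?_)).symm
      rw [hr _ (by rw [hpg x hx y]; exact hx), hpg x hx y, inv_smul_smul])
    (fun Γ hΓ => by
      refine Subtype.ext ?_
      simp only [e.symm_apply_apply]
      rw [hr Γ hΓ, smul_inv_smul])
  exact ⟨T, hT ▸ ht₀⟩

end FibreBundles

/-! ### Density, codimension, and the main theorem -/

section MainTheorem

variable {n : ℕ}

theorem dense_typeStratum (n : ℕ) : Dense (typeStratum n 0 n) := by
  intro Γ
  obtain ⟨p, q, hn, hΓ⟩ := exists_type Γ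
  by_cases h : p = 0 ∧ q = n
  · obtain ⟨rfl, rfl⟩ := h
    exact subset_closure hΓ
  obtain ⟨k, hk₁, hk₂⟩ := JoinIndex.exists_rank (a := p) (b := n - (p + q)) le_rfl le_rfl
    (by omega)
  obtain ⟨f, hf, hf0, -, hfk⟩ := exists_cone_chart hn hΓ rfl
  obtain ⟨l, hl⟩ := lkStrata_nonempty hn k
  have hmem : ∀ t : Ico (0 : ℝ) 1, 0 < t.1 → f (0, OpenCone.mk l t) ∈ typeStratum n 0 n := by
    intro t ht
    have : ((0, OpenCone.mk l t) : Euc _ × OpenCone (Lk n p q)) ∈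
        f ⁻¹' typeStratum n (p - k.fstRank) (q + k.fstRank + k.sndRank) := by
      rw [hfk k]
      exact ⟨mem_univ _, l, hl, t, ht, rfl⟩
    rwa [mem_preimage, show p - k.fstRank = 0 by omega,
      show q + k.fstRank + k.sndRank = n by omega] at this
  have hc : Continuous fun t : Ico (0 : ℝ) 1 => f (0, OpenCone.mk l t) :=
    hf.continuous.comp (continuous_const.prodMk
      (OpenCone.continuous_mk.comp (continuous_const.prodMk continuous_id)))
  have hu : ∀ i : ℕ, (1 : ℝ) / ((i : ℝ) + 2) ∈ Ico (0 : ℝ) 1 := fun i =>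
    ⟨by positivity, by rw [div_lt_one (by positivity)]; linarith [Nat.cast_nonneg (α := ℝ) i]⟩
  have hlim : Tendsto (fun i : ℕ => (⟨1 / ((i : ℝ) + 2), hu i⟩ : Ico (0 : ℝ) 1)) atTop
      (𝓝 ⟨0, by norm_num⟩) := by
    rw [tendsto_subtype_rng]
    refine Tendsto.div_atTop tendsto_const_nhds ?_
    exact tendsto_atTop_add_const_right _ _ tendsto_natCast_atTop_atTop
  have h0 : f (0, OpenCone.mk l ⟨0, by norm_num⟩) = Γ := by
    rw [OpenCone.mk_eq_apex l rfl, hf0]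
  rw [← h0]
  exact mem_closure_of_tendsto ((hc.tendsto _).comp hlim)
    (.of_forall fun i => hmem _ (by simp only; positivity))

theorem typeDim_le (t : TypeIndex n) : typeDim n t ≤ n * n :=
  Nat.mul_le_mul t.2 (Nat.sub_le _ _)

theorem typeDim_le_of_ne {t : TypeIndex n} (h : t.1 ≠ (0, n)) : typeDim n t ≤ n * (n - 1) := by
  obtain ⟨⟨p, q⟩, ht⟩ := t
  simp only [ne_eq, Prod.mk.injEq] at ht h
  rw [typeDim]
  rcases Nat.eq_zero_or_pos p with rfl | hp
  · rw [mul_comm]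
    exact Nat.mul_le_mul (by omega) (by simp only; omega)
  · exact Nat.mul_le_mul ht (by simp only; omega)

theorem hasSingularCodim_typeDim (hn : 1 ≤ n) : HasSingularCodim (typeDim n) n := by
  have hlt : n * (n - 1) < n * n := Nat.mul_lt_mul_of_pos_left (by omega) (by omega)
  refine ⟨n * n, n * (n - 1), ⟨⟨⟨(0, n), by simp⟩, by simp [typeDim]⟩, ?_⟩,
    ⟨⟨⟨⟨(0, n - 1), by simp only; omega⟩, by simp [typeDim, mul_comm]⟩, hlt⟩, ?_⟩, ?_⟩
  · rintro _ ⟨t, rfl⟩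
    exact typeDim_le t
  · rintro _ ⟨⟨t, rfl⟩, ht⟩
    refine typeDim_le_of_ne fun h => ht.ne ?_
    simp [typeDim, h]
  · rw [← Nat.mul_succ, Nat.succ_eq_add_one, Nat.sub_add_cancel hn]

theorem HasSingularCodim.unique {ι : Type*} {dim : ι → ℕ} {c c' : ℕ} (h : HasSingularCodim dim c)
    (h' : HasSingularCodim dim c') : c = c' := by
  obtain ⟨d, e, hd, he, rfl⟩ := h
  obtain ⟨d', e', hd', he', h'⟩ := h'
  rw [hd.unique hd'] at he
  have := he.unique he'
  have := hd.unique hd'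
  omega

theorem isPseudoManifold_typeStrata (hn : 2 ≤ n) : IsPseudoManifold (typeStrata n) (typeDim n) where
  gm := isGoreskyMacPherson_typeStrata n
  dense := (dense_typeStratum n).mono fun Γ hΓ => by
    refine mem_biUnion (x := (⟨(0, n), by simp⟩ : TypeIndex n)) (fun t => ?_) hΓ
    refine (typeDim_le t).trans_eq ?_
    simp [typeDim]
  codim := fun c hc => by
    rw [hc.unique (hasSingularCodim_typeDim (by omega))]
    exact hn

end MainTheorem

theorem theoremB (n : ℕ) :
    -- the partition by type is a Goresky–MacPherson stratification,
    -- with strata of dimension `(p + q)(n - p)`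
    IsGoreskyMacPherson (typeStrata n) (typeDim n) ∧
    -- the strata are the orbits of the general linear group
    (∀ t : TypeIndex n, ∀ Γ ∈ typeStrata n t, ∀ Γ' : ChabautyR n,
      Γ' ∈ typeStrata n t ↔
        ∃ g : EuclideanSpace ℝ (Fin n) ≃ₗ[ℝ] EuclideanSpace ℝ (Fin n),
          (Γ'.toSubgroup : Set (EuclideanSpace ℝ (Fin n))) = g '' Γ.toSubgroup) ∧
    -- each subgroup of type `(p, q)` has a conical neighbourhood `ℝ^((n-p)(p+q)) × cL`
    (∀ p q : ℕ, p + q ≤ n → ∀ Γ ∈ typeStratum n p q,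
      ∃ (L : Type) (_ : TopologicalSpace L)
        (π : L → TopJoin (ZeroLink p) (ZeroLink (n - (p + q)))),
        CompactSpace L ∧ Continuous π ∧ Function.Surjective π ∧
        -- `L`, stratified by the preimages of the strata of the join, is Goresky–MacPherson
        (∃ dimL : JoinIndex p (n - (p + q)) → ℕ,
          IsGoreskyMacPherson (fun k => π ⁻¹' joinStrata (zeroLinkStrata p)
            (zeroLinkStrata (n - (p + q))) k) dimL) ∧
        -- over each stratum of the join `π` is a bundle whose fibre is a torus bundle over a torus
        (∀ k : JoinIndex p (n - (p + q)), ∃ (F : Type) (_ : TopologicalSpace F),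
          IsTorusBundleOverTorus F (q * k.fstRank) (k.sndRank * (q + k.fstRank)) ∧
          IsLocallyTrivialBundle F
            ((joinStrata (zeroLinkStrata p) (zeroLinkStrata (n - (p + q))) k).restrictPreimage π)) ∧
        -- `ℝ^((n-p)(p+q)) × cL` is isomorphic to an open neighbourhood of `Γ`
        ∃ f : EuclideanSpace ℝ (Fin ((n - p) * (p + q))) × OpenCone L → ChabautyR n,
          IsOpenEmbedding f ∧ f (0, OpenCone.apex) = Γ ∧
          f ⁻¹' typeStratum n p q = Set.univ ×ˢ {OpenCone.apex} ∧
          ∀ k : JoinIndex p (n - (p + q)),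
            f ⁻¹' typeStratum n (p - k.fstRank) (q + k.fstRank + k.sndRank) =
              Set.univ ×ˢ coneStrata (fun k => π ⁻¹' joinStrata (zeroLinkStrata p)
                (zeroLinkStrata (n - (p + q))) k) (some k)) ∧
    -- singular codimension and pseudo-manifold
    (1 ≤ n → HasSingularCodim (typeDim n) n) ∧
    (2 ≤ n → IsPseudoManifold (typeStrata n) (typeDim n)) := by
  refine ⟨isGoreskyMacPherson_typeStrata n, fun t Γ hΓ Γ' => mem_typeStratum_iff_image t.2 hΓ,
    fun p q hn Γ hΓ => ?_, hasSingularCodim_typeDim, isPseudoManifold_typeStrata⟩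
  have hk : p + q + (n - (p + q)) = n := by omega
  have hstr : (fun k => lkProj (q := q) hk ⁻¹' joinStrata (zeroLinkStrata p)
      (zeroLinkStrata (n - (p + q))) k) = lkStrata n p q :=
    funext fun k => Set.ext fun l => lkProj_mem_joinStrata_iff hk l k
  refine ⟨Lk n p q, inferInstance, lkProj hk, inferInstance, continuous_lkProj hk,
    lkProj_surjective hk, ⟨lkDim n p q, ?_⟩, fun k => ⟨{Γ : ChabautyR n //
      IsFib p q (n - (p + q)) k.fstRank k.sndRank Γ}, inferInstance,
      isTorusBundleOverTorus_isFib hk k.fstRank_le k.sndRank_le,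
      isLocallyTrivialBundle_lkProj hk k⟩, ?_⟩
  · rw [hstr]
    exact isGoreskyMacPherson_lkStrata n p q hn
  · rw [hstr]
    exact exists_cone_chart hn hΓ rfl
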